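/- **Setting.** Let $\mathbb F$ be a field, let $A_{\alpha\beta}\in\mathbb F^{2\times2}$ and $d_{\alpha\beta}\in\mathbb Z$ for $\alpha\in[\mu]$, $\beta\in[\nu]$, and let $A(t)=(A_{\alpha\beta}\,x_{\alpha\beta}\,t^{d_{\alpha\beta}})_{\alpha,\beta}$, where $t$ and the $x_{\alpha\beta}$ are distinct variables. $\delta_k(A(t))$ is the maximum degree in $t$ of a minor of $A(t)$ of order $k$ ($-\infty$ if all of them vanish or there are none). Put $E=\{\alpha\beta: A_{\alpha\beta}\ne O\}$, a bipartite graph on $[\mu]\sqcup[\nu]$; an edge is *rank-$i$* if $\operatorname{rank}A_{\alpha\beta}=i$. $\mathcal M_\alpha$ and $\mathcal M_\beta$ are the sets of lines ($1$-dimensional subspaces) of $U_\alpha=\mathbb F^2$ and $V_\beta=\mathbb F^2$, and $A_{\alpha\beta}(u,v)=u^\top A_{\alpha\beta}v$. $X^{\perp_{\alpha\beta}}$ is the orthogonal space of $X\subseteq U_\alpha$ or $X\subseteq V_\beta$ with respect to $A_{\alpha\beta}$. $\sigma$ denotes a sign, $\bar\sigma$ the opposite one. **Matching-pairs.** A *labeling*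 $\mathcal V$ assigns to each $\alpha$ two distinct lines $U_\alpha^+,U_\alpha^-\in\mathcal M_\alpha$ and to each $\beta$ two distinct lines $V_\beta^+,V_\beta^-\in\mathcal M_\beta$. Let $M\subseteq E$ have all degrees at most $2$ and a proper $2$-edge-coloring by $+$ and $-$. $\mathcal V$ is *valid* for $M$ if for each $\alpha\beta\in M$ we have $A_{\alpha\beta}(U_\alpha^+,V_\beta^-)=A_{\alpha\beta}(U_\alpha^-,V_\beta^+)=\{0\}$ and, if $\alpha\beta$ is a rank-1 $\sigma$-edge, the left and right kernels of $A_{\alpha\beta}$ are $U_\alpha^\sigma$ and $V_\beta^\sigma$. $M$ is a *pseudo-matching* if all degrees are at most $2$, every cycle component of $M$ has a rank-1 edge, and $M$ admits a 2-edge-coloring with a valid labeling. A *matching-pair* $(M,I)$ is a pseudo-matching $M$ with a set $I\subseteq M$ of rank-2 edges that are isolated in $M$. Its size is $|M|+|I|$ and its weight is $w(M,I)=\sum_{M}d_{\alpha\beta}+\sum_{I}d_{\alpha\beta}$. $U_\alpha^\sigma$ (resp. $V_\beta^\sigma$) is *matched* if $\alpha$ (resp. $\beta$) is incident to a $\bar\sigma$-edge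 of $M$ or to a $\sigma$-edge of $I$. **Potentials.** A *$c$-potential* ($c\in\mathbb R$) is a function $p\ge0$ on the disjoint union of all $\mathcal M_\alpha$, $\mathcal M_\beta$ such that $p(X)+p(Y)+c\ge d_{\alpha\beta}$ whenever $X\in\mathcal M_\alpha$, $Y\in\mathcal M_\beta$, $A_{\alpha\beta}(X,Y)\neq\{0\}$. It is *$(M,I,\mathcal V)$-compatible* if (Reg) $p(X)=\max\{p(U_\alpha^+),p(U_\alpha^-)\}$ for all other lines $X\in\mathcal M_\alpha$, and likewise for each $\beta$; and (Tight) $d_{\alpha\beta}=p(U_\alpha^{\bar\sigma})+p(V_\beta^{\bar\sigma})+c$ for each $\sigma$-edge $\alpha\beta\in M$, and also $d_{\alpha\beta}=p(U_\alpha^{\sigma})+p(V_\beta^{\sigma})+c$ if $\alpha\beta\in I$. It is *optimal* if $w(M,I)=p(\mathcal V)+(|M|+|I|)c$, where $p(\mathcal V)$ is the sum of $p$ over all $U_\alpha^\pm,V_\beta^\pm$. **Auxiliary graph.** $\mathcal G(\mathcal V,p)$ has the vertices $\alpha^\pm,\beta^\pm$ and the edges $\alpha^\sigma\beta^{\sigma'}$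 with $A_{\alpha\beta}(U_\alpha^\sigma,V_\beta^{\sigma'})\ne\{0\}$ and $p(U_\alpha^\sigma)+p(V_\beta^{\sigma'})+c=d_{\alpha\beta}$; $\mathcal G(\mathcal V,p)|_M$ keeps only the edges with $\alpha\beta\in M$. The *source set* $\mathcal S$ (resp. *target set* $\mathcal T$) consists of the vertices of the components of $\mathcal G(\mathcal V,p)|_M$ that contain some $\beta^\sigma$ with $V_\beta^\sigma$ unmatched (resp. some $\alpha^\sigma$ with $U_\alpha^\sigma$ unmatched). $\alpha\beta\in M$ is *double-tight* if $\alpha^+\beta^+$ and $\alpha^-\beta^-$ are edges of $\mathcal G(\mathcal V,p)$. A component $C$ of $M\setminus I$ is *rearrangeable* if it is a path of odd length whose end edges are $\sigma$-edges and all its $\sigma$-edges are double-tight; the *rearrangement* deletes the $\bar\sigma$-edges of $C$ from $M$ and adds the $\sigma$-edges of $C$ to $I$. **Augmenting paths.** An *outer path* is a path $\beta_0^{\sigma_0},\alpha_1^{\sigma_1},\beta_1^{\sigma_1},\alpha_2^{\sigma_2},\dots,\beta_l^{\sigma_l},\alpha_{l+1}^{\sigma_{l+1}}$ ($l\ge0$)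 in $\mathcal G(\mathcal V,p)$ with $\beta_i\alpha_{i+1}\in E\setminus M$ for $0\le i\le l$, and $\alpha_{i+1}\beta_{i+1}\in I$ and $A_{\alpha_{i+1}\beta_i}(U_{\alpha_{i+1}}^{\overline{\sigma_{i+1}}},V_{\beta_i}^{\sigma_i})=\{0\}$ for $0\le i<l$. An *inner path* is a path $\alpha_0^\sigma,\beta_1^\sigma,\alpha_1^\sigma,\dots,\alpha_l^\sigma,\beta_{l+1}^\sigma$ ($l\ge0$) in $\mathcal G(\mathcal V,p)$ over edges of $M\setminus I$, where the $\alpha_i\beta_{i+1}$ are $\bar\sigma$-edges and the $\beta_i\alpha_i$ are $\sigma$-edges. An *augmenting path* for $(M,I,\mathcal V,p)$ is a path from $\mathcal S$ to $\mathcal T$ in $\mathcal G(\mathcal V,p)$ that is a concatenation $\mathcal P_0\circ\mathcal Q_1\circ\mathcal P_1\circ\dots\circ\mathcal Q_m\circ\mathcal P_m$ ($m\ge0$) of outer paths $\mathcal P_i$ and inner paths $\mathcal Q_i$. **Procedure.** The input is a matching-pair $(M,I)$ of size $k<\min\{2\mu,2\nu\}$ with a 2-edge-coloring of $M$, a valid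 labeling $\mathcal V$ for $M$ and an optimal $(M,I,\mathcal V)$-compatible $c$-potential $p$, without a rearrangeable component. A forest $\mathcal F$ is maintained; initially its vertex set is $\mathcal S$ and it has no edges. Repeat the following; choices may be made arbitrarily. *Primal update*, if $\mathcal G(\mathcal V,p)$ has an edge $\beta^\sigma\alpha^{\sigma'}$ with $\beta^\sigma\in\mathcal F\not\ni\alpha^{\sigma'}$: add such an edge to $\mathcal F$. - (P1) If $\alpha^{\sigma'}\in\mathcal T$, output $(M,I,\mathcal V,p)$ and the path $\mathcal R$ in $\mathcal F$ from $\mathcal S$ to $\alpha^{\sigma'}$; stop. - (P2) If $\alpha^{\sigma'}\notin\mathcal T$ and $\alpha\beta'\in I$ for some $\beta'$, set $U_\alpha^{\overline{\sigma'}}\leftarrow(V_\beta^\sigma)^{\perp_{\alpha\beta}}$, then $V_{\beta'}^{\sigma'}\leftarrow(U_\alpha^{\overline{\sigma'}})^{\perp_{\alpha\beta'}}$, and add the edge $\alpha^{\sigma'}\beta'^{\sigma'}$ to $\mathcal F$. - (P3) If $\alpha^{\sigma'}\notin\mathcal T$ and $\alpha$ is incident to an edge of $M\setminus I$, add to $\mathcal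 F$ the longest inner path that starts at $\alpha^{\sigma'}$ and avoids the previous vertices of $\mathcal F$. *Dual update*, if there is no such edge: let $\epsilon\in\mathbb R\cup\{+\infty\}$ be the infimum of $p(U_\alpha^{\sigma'})+p(V_\beta^\sigma)+c-d_{\alpha\beta}$ over all $\beta^\sigma\in\mathcal F$, $\alpha^{\sigma'}\notin\mathcal F$ with $A_{\alpha\beta}(U_\alpha^{\sigma'},V_\beta^\sigma)\ne\{0\}$. - (D1) If $\epsilon=+\infty$, output "$\delta_{k+1}(A(t))=-\infty$"; stop. - (D2) Otherwise increase $p(V_\beta^\sigma)$ by $\epsilon$ for $\beta^\sigma\notin\mathcal F$ and $p(U_\alpha^\sigma)$ by $\epsilon$ for $\alpha^\sigma\in\mathcal F$, decrease $c$ by $\epsilon$, and redefine $p$ on the other lines by (Reg). - (D2-1) If there is now a rearrangeable component, apply the rearrangement to $(M,I)$, output $(M,I,\mathcal V,p)$; stop. - (D2-2) Otherwise, if $\mathcal T$ has become larger, output $(M,I,\mathcal V,p)$ and an inclusion-minimal path $\mathcal R$ in $\mathcal F$ from a vertex of $\mathcal S$ to a vertex of $\mathcal F\cap\mathcal T$;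 stop. - (D2-3) Otherwise $\mathcal F\leftarrow\mathcal F\cup\mathcal S$. **Theorem.** For every input as above: 1. If the procedure stops at (P1) or (D2-2), then in its output $(M,I)$ is a matching-pair of size $k$, $\mathcal V$ is a valid labeling for $M$, $p$ is an optimal $(M,I,\mathcal V)$-compatible $c$-potential (for the current $c$), and $\mathcal R$ is an augmenting path for $(M,I,\mathcal V,p)$. 2. If it stops at (D1), then $\delta_{k+1}(A(t))=-\infty$. 3. If it stops at (D2-1), then in its output $(M,I)$ is a matching-pair of size $k+1$, $\mathcal V$ is a valid labeling for $M$, and $p$ is an optimal $(M,I,\mathcal V)$-compatible $c$-potential. 4. The running time is $O(\mu\nu\min\{\mu,\nu\})$. Precisely: whatever choices are made, the procedure never gets stuck and stops after $O(\min\{\mu,\nu\})$ updates; and there is a program for a random access machine, in which memory accesses, operations on indices, arithmetic operations and comparisons in $\mathbb F$ and in $\mathbb R$ take unit time, that carries out a complete execution of the procedure on each input in time $O(\mu\nu\min\{\mu,\nu\})$. The program and the constants are absolute: they do not depend on $\mathbb F$, $\mu$, $\nu$ or the input. -/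

import Mathlib

universe u

namespace GPM

/-! ## Partitioned polynomial matrices, matching-pairs, potentials -/

/-- The data of a `(2 × 2)`-type generic partitioned polynomial matrix: its `(a, b)` block is
`A a b * x_{ab} * t ^ d a b`. -/
structure PartMatrix (F : Type u) [Field F] (μ ν : ℕ) where
  A : Fin μ → Fin ν → Matrix (Fin 2) (Fin 2) F
  d : Fin μ → Fin ν → ℤ

/-- The 1-dimensional subspaces of `F ^ 2`. -/
abbrev Line (F : Type u) [Field F] : Type u :=
  {X : Submodule F (Fin 2 → F) // Module.finrank F X = 1}

/-- Signs are Booleans: `true` is `+`, `false` is `-`; the opposite sign of `s` is `!s`. -/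
structure Labeling (F : Type u) [Field F] (μ ν : ℕ) where
  U : Fin μ → Bool → Line F
  V : Fin ν → Bool → Line F
  U_ne : ∀ a, U a true ≠ U a false
  V_ne : ∀ b, V b true ≠ V b false

/-- A real function on the disjoint union, over all row- and column-blocks, of the sets of
1-dimensional subspaces. -/
structure Potential (F : Type u) [Field F] (μ ν : ℕ) where
  row : Fin μ → Line F → ℝ
  col : Fin ν → Line F → ℝ

/-- The objects the search works with: two edge sets, an edge coloring (only its values on `M`
matter), a labeling, a function `p` and a real number `c`. -/
structure Conf (F : Type u) [Field F] (μ ν : ℕ) where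
  M : Finset (Fin μ × Fin ν)
  I : Finset (Fin μ × Fin ν)
  sgn : Fin μ → Fin ν → Bool
  L : Labeling F μ ν
  p : Potential F μ ν
  c : ℝ

/-- The vertices `α^σ` and `β^σ` of the auxiliary graph. -/
inductive Vertex (μ ν : ℕ) where
  | row (a : Fin μ) (s : Bool)
  | col (b : Fin ν) (s : Bool)

/-- The bipartite graph on the blocks with edge set `M`. -/
def edgeGraph {μ ν : ℕ} (M : Finset (Fin μ × Fin ν)) : SimpleGraph (Fin μ ⊕ Fin ν) :=
  SimpleGraph.fromEdgeSet {z | ∃ e ∈ M, z = s(Sum.inl e.1, Sum.inr e.2)}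

def rowDeg {μ ν : ℕ} (M : Finset (Fin μ × Fin ν)) (a : Fin μ) : ℕ :=
  (M.filter fun e => e.1 = a).card

def colDeg {μ ν : ℕ} (M : Finset (Fin μ × Fin ν)) (b : Fin ν) : ℕ :=
  (M.filter fun e => e.2 = b).card

/-- A 2-edge-coloring of `M`: incident edges have different signs. -/
def IsColoring {μ ν : ℕ} (M : Finset (Fin μ × Fin ν)) (sgn : Fin μ → Fin ν → Bool) : Prop :=
  ∀ e ∈ M, ∀ e' ∈ M, e ≠ e' → (e.1 = e'.1 ∨ e.2 = e'.2) → sgn e.1 e.2 ≠ sgn e'.1 e'.2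

section

variable {F : Type u} [Field F] {μ ν : ℕ}

/-- The bilinear form `(u, v) ↦ uᵀ B v`. -/
def bil (B : Matrix (Fin 2) (Fin 2) F) (u v : Fin 2 → F) : F :=
  dotProduct u (B.mulVec v)

/-- `B(X, Y) = {0}`. -/
def Orth (B : Matrix (Fin 2) (Fin 2) F) (X Y : Submodule F (Fin 2 → F)) : Prop :=
  ∀ u ∈ X, ∀ v ∈ Y, bil B u v = 0

def kerL (B : Matrix (Fin 2) (Fin 2) F) : Submodule F (Fin 2 → F) :=
  LinearMap.ker B.vecMulLinear

def kerR (B : Matrix (Fin 2) (Fin 2) F) : Submodule F (Fin 2 → F) :=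
  LinearMap.ker B.mulVecLin

/-- The matrix `A(t)`, over the Laurent polynomials in `t` with coefficients in the polynomial
ring over `F` in the variables `x_{ab}`. -/
noncomputable def PartMatrix.toMatrix (P : PartMatrix F μ ν) :
    Matrix (Fin μ × Fin 2) (Fin ν × Fin 2)
      (LaurentPolynomial (MvPolynomial (Fin μ × Fin ν) F)) :=
  fun r s =>
    LaurentPolynomial.C (MvPolynomial.C (P.A r.1 s.1 r.2 s.2) * MvPolynomial.X (r.1, s.1)) *
      LaurentPolynomial.T (P.d r.1 s.1)

/-- `δ_k(A(t))`: the maximum degree in `t` of a minor of order `k`; `⊥` is `-∞`. Rows and columns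
are chosen by injections, that is, together with an ordering, which does not affect degrees. -/
noncomputable def PartMatrix.delta (P : PartMatrix F μ ν) (k : ℕ) : WithBot ℤ :=
  Finset.univ.sup fun rs : (Fin k ↪ Fin μ × Fin 2) × (Fin k ↪ Fin ν × Fin 2) =>
    (P.toMatrix.submatrix rs.1 rs.2).det.degree

/-- `L` is valid for `M` (with the coloring `sgn`). -/
def IsValid (P : PartMatrix F μ ν) (M : Finset (Fin μ × Fin ν)) (sgn : Fin μ → Fin ν → Bool)
    (L : Labeling F μ ν) : Prop :=
  ∀ a b, (a, b) ∈ M →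
    Orth (P.A a b) (L.U a true) (L.V b false) ∧
    Orth (P.A a b) (L.U a false) (L.V b true) ∧
    ((P.A a b).rank = 1 →
      kerL (P.A a b) = L.U a (sgn a b) ∧ kerR (P.A a b) = L.V b (sgn a b))

/-- Pseudo-matchings. When all degrees are at most 2, the cycles of `M` are exactly its cycle
components. -/
structure IsPseudoMatching (P : PartMatrix F μ ν) (M : Finset (Fin μ × Fin ν)) : Prop where
  subset : ∀ e ∈ M, P.A e.1 e.2 ≠ 0
  deg_row : ∀ a, rowDeg M a ≤ 2
  deg_col : ∀ b, colDeg M b ≤ 2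
  cycle : ∀ (v : Fin μ ⊕ Fin ν) (w : (edgeGraph M).Walk v v), w.IsCycle →
    ∃ e ∈ M, s(Sum.inl e.1, Sum.inr e.2) ∈ w.edges ∧ (P.A e.1 e.2).rank = 1
  vl : ∃ sgn, IsColoring M sgn ∧ ∃ L, IsValid P M sgn L

/-- `(M, I)` is a matching-pair: `I` consists of isolated rank-2 edges of `M`. -/
structure IsMatchingPair (P : PartMatrix F μ ν) (M I : Finset (Fin μ × Fin ν)) : Prop where
  pseudo : IsPseudoMatching P M
  subset : I ⊆ M
  isolated : ∀ e ∈ I, rowDeg M e.1 = 1 ∧ colDeg M e.2 = 1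
  rank_two : ∀ e ∈ I, (P.A e.1 e.2).rank = 2

def weight (P : PartMatrix F μ ν) (M I : Finset (Fin μ × Fin ν)) : ℤ :=
  ∑ e ∈ M, P.d e.1 e.2 + ∑ e ∈ I, P.d e.1 e.2

/-- `p` is a `c`-potential. (The hypothesis of `bound` forces `A a b ≠ 0`.) -/
structure IsPotential (P : PartMatrix F μ ν) (c : ℝ) (p : Potential F μ ν) : Prop where
  row_nonneg : ∀ a X, 0 ≤ p.row a X
  col_nonneg : ∀ b Y, 0 ≤ p.col b Y
  bound : ∀ a b (X Y : Line F), ¬ Orth (P.A a b) X Y → (P.d a b : ℝ) ≤ p.row a X + p.col b Y + c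

/-- `p(𝒱)`. -/
def Potential.total (p : Potential F μ ν) (L : Labeling F μ ν) : ℝ :=
  ∑ a, (p.row a (L.U a true) + p.row a (L.U a false)) +
    ∑ b, (p.col b (L.V b true) + p.col b (L.V b false))

/-- (Reg) -/
structure IsReg (L : Labeling F μ ν) (p : Potential F μ ν) : Prop where
  row : ∀ a X, X ≠ L.U a true → X ≠ L.U a false →
    p.row a X = max (p.row a (L.U a true)) (p.row a (L.U a false))
  col : ∀ b Y, Y ≠ L.V b true → Y ≠ L.V b false →
    p.col b Y = max (p.col b (L.V b true)) (p.col b (L.V b false))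

/-- (Tight) -/
structure IsTight (P : PartMatrix F μ ν) (x : Conf F μ ν) : Prop where
  on_M : ∀ a b, (a, b) ∈ x.M →
    (P.d a b : ℝ) = x.p.row a (x.L.U a (!x.sgn a b)) + x.p.col b (x.L.V b (!x.sgn a b)) + x.c
  on_I : ∀ a b, (a, b) ∈ x.I →
    (P.d a b : ℝ) = x.p.row a (x.L.U a (x.sgn a b)) + x.p.col b (x.L.V b (x.sgn a b)) + x.c

/-- `(M, I)` is a matching-pair of size `k`, edge-colored by `sgn`, `𝒱 = L` is a valid labeling for
`M`, and `p` is an optimal `(M, I, 𝒱)`-compatible `c`-potential. -/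
structure IsOptimal (P : PartMatrix F μ ν) (k : ℕ) (x : Conf F μ ν) : Prop where
  pair : IsMatchingPair P x.M x.I
  size : x.M.card + x.I.card = k
  coloring : IsColoring x.M x.sgn
  valid : IsValid P x.M x.sgn x.L
  potential : IsPotential P x.c x.p
  reg : IsReg x.L x.p
  tight : IsTight P x
  optimal : (weight P x.M x.I : ℝ) = x.p.total x.L + k * x.c

/-! ## The auxiliary graph, rearrangeable components, augmenting paths -/

/-- `α^s β^s'` is an edge of the auxiliary graph. -/
def TightEdge (P : PartMatrix F μ ν) (x : Conf F μ ν) (a : Fin μ) (s : Bool) (b : Fin ν)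
    (s' : Bool) : Prop :=
  ¬ Orth (P.A a b) (x.L.U a s) (x.L.V b s') ∧
    x.p.row a (x.L.U a s) + x.p.col b (x.L.V b s') + x.c = P.d a b

/-- The subgraph of the auxiliary graph formed by the edges that lie over edges of `M`. -/
def graphM (P : PartMatrix F μ ν) (x : Conf F μ ν) : SimpleGraph (Vertex μ ν) :=
  SimpleGraph.fromEdgeSet
    {z | ∃ a s b s', (a, b) ∈ x.M ∧ TightEdge P x a s b s' ∧ z = s(Vertex.row a s, Vertex.col b s')}

/-- `U_a^s` (or `V_b^s`) is matched by `(M, I)`. -/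
def Matched (x : Conf F μ ν) : Vertex μ ν → Prop
  | .row a s => (∃ b, (a, b) ∈ x.M ∧ x.sgn a b = !s) ∨ (∃ b, (a, b) ∈ x.I ∧ x.sgn a b = s)
  | .col b s => (∃ a, (a, b) ∈ x.M ∧ x.sgn a b = !s) ∨ (∃ a, (a, b) ∈ x.I ∧ x.sgn a b = s)

def source (P : PartMatrix F μ ν) (x : Conf F μ ν) : Set (Vertex μ ν) :=
  {z | ∃ b s, ¬ Matched x (.col b s) ∧ (graphM P x).Reachable (.col b s) z}

def target (P : PartMatrix F μ ν) (x : Conf F μ ν) : Set (Vertex μ ν) :=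
  {z | ∃ a s, ¬ Matched x (.row a s) ∧ (graphM P x).Reachable (.row a s) z}

def DoubleTight (P : PartMatrix F μ ν) (x : Conf F μ ν) (a : Fin μ) (b : Fin ν) : Prop :=
  TightEdge P x a true b true ∧ TightEdge P x a false b false

/-- `C` is the edge set of a connected component of `M \ I` that is a path of odd length whose end
edges are `σ`-edges, and every `σ`-edge of `C` is double-tight. (A path of odd length has one end
among the row-blocks, `a`, and one among the column-blocks, `b`.) -/
def IsRearrangeable (P : PartMatrix F μ ν) (x : Conf F μ ν) (C : Finset (Fin μ × Fin ν))
    (σ : Bool) : Prop :=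
  ∃ (a : Fin μ) (b : Fin ν) (w : (edgeGraph (x.M \ x.I)).Walk (Sum.inl a) (Sum.inr b)),
    w.IsPath ∧ Odd w.length ∧
    (∀ e, e ∈ C ↔ s(Sum.inl e.1, Sum.inr e.2) ∈ w.edges) ∧
    (∀ e ∈ x.M \ x.I, (Sum.inl e.1 ∈ w.support ∨ Sum.inr e.2 ∈ w.support) → e ∈ C) ∧
    (∀ e ∈ C, (e.1 = a ∨ e.2 = b) → x.sgn e.1 e.2 = σ) ∧
    (∀ e ∈ C, x.sgn e.1 e.2 = σ → DoubleTight P x e.1 e.2)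

/-- The rearrangement with respect to `C`. -/
def rearrange (x : Conf F μ ν) (C : Finset (Fin μ × Fin ν)) (σ : Bool) : Conf F μ ν :=
  { x with
    M := x.M \ C.filter (fun e => x.sgn e.1 e.2 = !σ)
    I := x.I ∪ C.filter (fun e => x.sgn e.1 e.2 = σ) }

/-- The vertex sequences of the form required of an outer path (whose vertices have, in addition,
to be distinct). -/
inductive OuterSeq (P : PartMatrix F μ ν) (x : Conf F μ ν) : List (Vertex μ ν) → Prop
  | last (b : Fin ν) (s : Bool) (a : Fin μ) (s' : Bool)
      (h_tight : TightEdge P x a s' b s) (h_M : (a, b) ∉ x.M) :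
      OuterSeq P x [.col b s, .row a s']
  | cons (b : Fin ν) (s : Bool) (a : Fin μ) (s' : Bool) (b' : Fin ν) (R : List (Vertex μ ν))
      (h_tight : TightEdge P x a s' b s) (h_M : (a, b) ∉ x.M)
      (h_I : (a, b') ∈ x.I) (h_tight' : TightEdge P x a s' b' s')
      (h_orth : Orth (P.A a b) (x.L.U a (!s')) (x.L.V b s))
      (h_rest : OuterSeq P x (.col b' s' :: R)) :
      OuterSeq P x (.col b s :: .row a s' :: .col b' s' :: R)

/-- The vertex sequences of the form required of an inner path with sign `s`. Consecutive edges
are edges of `M \ I`, so they lie in one connected component of `M \ I`. -/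
inductive InnerSeq (P : PartMatrix F μ ν) (x : Conf F μ ν) (s : Bool) : List (Vertex μ ν) → Prop
  | last (a : Fin μ) (b : Fin ν) (h_edge : (a, b) ∈ x.M \ x.I) (h_sgn : x.sgn a b = !s)
      (h_tight : TightEdge P x a s b s) : InnerSeq P x s [.row a s, .col b s]
  | cons (a : Fin μ) (b : Fin ν) (a' : Fin μ) (R : List (Vertex μ ν))
      (h_edge : (a, b) ∈ x.M \ x.I) (h_sgn : x.sgn a b = !s) (h_tight : TightEdge P x a s b s)
      (h_edge' : (a', b) ∈ x.M \ x.I) (h_sgn' : x.sgn a' b = s)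
      (h_tight' : TightEdge P x a' s b s)
      (h_rest : InnerSeq P x s (.row a' s :: R)) :
      InnerSeq P x s (.row a s :: .col b s :: .row a' s :: R)

def IsOuterPath (P : PartMatrix F μ ν) (x : Conf F μ ν) (R : List (Vertex μ ν)) : Prop :=
  OuterSeq P x R ∧ R.Nodup

def IsInnerPath (P : PartMatrix F μ ν) (x : Conf F μ ν) (s : Bool) (R : List (Vertex μ ν)) : Prop :=
  InnerSeq P x s R ∧ R.Nodup

/-- Concatenations `𝒫₀ ∘ 𝒬₁ ∘ 𝒫₁ ∘ ⋯ ∘ 𝒬ₘ ∘ 𝒫ₘ` of outer and inner paths, the last vertex of each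
path being the first vertex of the next one. -/
inductive AltConcat (P : PartMatrix F μ ν) (x : Conf F μ ν) : List (Vertex μ ν) → Prop
  | outer (R : List (Vertex μ ν)) (h : IsOuterPath P x R) : AltConcat P x R
  | cons (R₀ Q R : List (Vertex μ ν)) (s : Bool)
      (h_outer : IsOuterPath P x R₀) (h_inner : IsInnerPath P x s Q)
      (h_join : R₀.getLast? = Q.head?) (h_join' : Q.getLast? = R.head?)
      (h_rest : AltConcat P x R) : AltConcat P x (R₀ ++ Q.tail ++ R.tail)

structure IsAugmentingPath (P : PartMatrix F μ ν) (x : Conf F μ ν) (R : List (Vertex μ ν)) :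
    Prop where
  alternating : AltConcat P x R
  nodup : R.Nodup
  first : ∃ z ∈ source P x, R.head? = some z
  last : ∃ z ∈ target P x, R.getLast? = some z

/-! ## The search procedure -/

/-- The current configuration together with the forest, given by its vertices and its edges. -/
structure State (F : Type u) [Field F] (μ ν : ℕ) where
  x : Conf F μ ν
  nodes : Set (Vertex μ ν)
  edges : Set (Sym2 (Vertex μ ν))

/-- What the procedure outputs, by stopping case. -/
inductive Outcome (F : Type u) [Field F] (μ ν : ℕ) where
  | P1 (x : Conf F μ ν) (R : List (Vertex μ ν))
  | D1
  | D21 (x : Conf F μ ν)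
  | D22 (x : Conf F μ ν) (R : List (Vertex μ ν))

/-- `R` is a path with edges in `T`, from a vertex in `X` to a vertex in `Y`. -/
structure IsPathFromTo (T : Set (Sym2 (Vertex μ ν))) (X Y : Set (Vertex μ ν))
    (R : List (Vertex μ ν)) : Prop where
  chain : R.IsChain fun v w => s(v, w) ∈ T
  nodup : R.Nodup
  first : ∃ z ∈ X, R.head? = some z
  last : ∃ z ∈ Y, R.getLast? = some z

/-- The set of edges of a path given by its vertices. -/
def pathEdges (R : List (Vertex μ ν)) : Set (Sym2 (Vertex μ ν)) :=
  {z | ∃ v w, [v, w] <:+: R ∧ z = s(v, w)}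

def initState (P : PartMatrix F μ ν) (x : Conf F μ ν) : State F μ ν := ⟨x, source P x, ∅⟩

/-- The edge `β^s α^s'` of the auxiliary graph leaves the forest. -/
def Leaves (P : PartMatrix F μ ν) (S : State F μ ν) (b : Fin ν) (s : Bool) (a : Fin μ)
    (s' : Bool) : Prop :=
  TightEdge P S.x a s' b s ∧ .col b s ∈ S.nodes ∧ .row a s' ∉ S.nodes

/-- The relabeling `U_a^{!s'} ← (V_b^s)^⊥`, `V_b'^{s'} ← (U_a^{!s'})^⊥`, the orthogonal spaces being
taken with respect to `A a b` and to `A a b'`, and with the new `U_a^{!s'}`. -/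
structure IsRelabeling (P : PartMatrix F μ ν) (L L' : Labeling F μ ν) (b : Fin ν) (s : Bool)
    (a : Fin μ) (s' : Bool) (b' : Fin ν) : Prop where
  row_new : ∀ u, u ∈ (L'.U a (!s')).1 ↔ ∀ v ∈ (L.V b s).1, bil (P.A a b) u v = 0
  col_new : ∀ v, v ∈ (L'.V b' s').1 ↔ ∀ u ∈ (L'.U a (!s')).1, bil (P.A a b') u v = 0
  row_old : ∀ a₁ s₁, (a₁, s₁) ≠ (a, !s') → L'.U a₁ s₁ = L.U a₁ s₁
  col_old : ∀ b₁ s₁, (b₁, s₁) ≠ (b', s') → L'.V b₁ s₁ = L.V b₁ s₁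

/-- The quantities whose minimum is the step length `ε` of a dual update. -/
def slacks (P : PartMatrix F μ ν) (S : State F μ ν) : Set ℝ :=
  {r | ∃ b s a s', Vertex.col b s ∈ S.nodes ∧ Vertex.row a s' ∉ S.nodes ∧
    ¬ Orth (P.A a b) (S.x.L.U a s') (S.x.L.V b s) ∧
    r = S.x.p.row a (S.x.L.U a s') + S.x.p.col b (S.x.L.V b s) + S.x.c - P.d a b}

open Classical in
/-- The potential after a dual update: shifted by `ε` on the spaces of the labeling, then adjusted
on all other lines so that (Reg) holds. -/
noncomputable def dualPotential (S : State F μ ν) (ε : ℝ) : Potential F μ ν where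
  row a X :=
    let r : Bool → ℝ := fun s =>
      S.x.p.row a (S.x.L.U a s) + if Vertex.row a s ∈ S.nodes then ε else 0
    if X = S.x.L.U a true then r true else if X = S.x.L.U a false then r false
    else max (r true) (r false)
  col b Y :=
    let r : Bool → ℝ := fun s =>
      S.x.p.col b (S.x.L.V b s) + if Vertex.col b s ∈ S.nodes then 0 else ε
    if Y = S.x.L.V b true then r true else if Y = S.x.L.V b false then r false
    else max (r true) (r false)

noncomputable def dualConf (S : State F μ ν) (ε : ℝ) : Conf F μ ν :=
  { S.x with p := dualPotential S ε, c := S.x.c - ε }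

/-- A dual update of finite step length `ε` is performed. -/
def DualStep (P : PartMatrix F μ ν) (S : State F μ ν) (ε : ℝ) : Prop :=
  (∀ b s a s', ¬ Leaves P S b s a s') ∧ IsLeast (slacks P S) ε

/-- The updates after which the procedure goes on. Choices left open by the procedure are left
open here. -/
inductive Step (P : PartMatrix F μ ν) (S : State F μ ν) : State F μ ν → Prop
  | P2 (b : Fin ν) (s : Bool) (a : Fin μ) (s' : Bool) (b' : Fin ν) (L' : Labeling F μ ν)
      (h_leaves : Leaves P S b s a s') (h_target : .row a s' ∉ target P S.x)
      (h_I : (a, b') ∈ S.x.I) (h_label : IsRelabeling P S.x.L L' b s a s' b') :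
      Step P S
        { x := { S.x with L := L' }
          nodes := S.nodes ∪ {.row a s', .col b' s'}
          edges := S.edges ∪ {s(.col b s, .row a s'), s(.row a s', .col b' s')} }
  | P3 (b : Fin ν) (s : Bool) (a : Fin μ) (s' : Bool) (Q : List (Vertex μ ν))
      (h_leaves : Leaves P S b s a s') (h_target : .row a s' ∉ target P S.x)
      (h_comp : ∃ b', (a, b') ∈ S.x.M \ S.x.I)
      (h_inner : IsInnerPath P S.x s' Q) (h_start : Q.head? = some (.row a s'))
      (h_avoid : ∀ z ∈ Q, z ∉ S.nodes)
      (h_longest : ∀ Q', IsInnerPath P S.x s' Q' → Q'.head? = some (.row a s') →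
        (∀ z ∈ Q', z ∉ S.nodes) → Q'.length ≤ Q.length) :
      Step P S
        { x := S.x
          nodes := S.nodes ∪ {z | z ∈ Q}
          edges := S.edges ∪ {s(.col b s, .row a s')} ∪ pathEdges Q }
  | D23 (ε : ℝ) (h_dual : DualStep P S ε)
      (h_rearr : ∀ C σ, ¬ IsRearrangeable P (dualConf S ε) C σ)
      (h_target : ¬ target P S.x ⊂ target P (dualConf S ε)) :
      -- if the source set has not grown, this union changes nothing
      Step P S
        { x := dualConf S ε
          nodes := S.nodes ∪ source P (dualConf S ε)
          edges := S.edges }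

/-- The updates with which the procedure stops. -/
inductive Stops (P : PartMatrix F μ ν) (S : State F μ ν) : Outcome F μ ν → Prop
  | P1 (b : Fin ν) (s : Bool) (a : Fin μ) (s' : Bool) (R : List (Vertex μ ν))
      (h_leaves : Leaves P S b s a s') (h_target : .row a s' ∈ target P S.x)
      (h_path : IsPathFromTo (S.edges ∪ {s(.col b s, .row a s')}) (source P S.x) {.row a s'} R) :
      Stops P S (.P1 S.x R)
  | D1 (h_none : ∀ b s a s', ¬ Leaves P S b s a s') (h_infinite : slacks P S = ∅) :
      Stops P S .D1
  | D21 (ε : ℝ) (h_dual : DualStep P S ε) (C : Finset (Fin μ × Fin ν)) (σ : Bool)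
      (h_rearr : IsRearrangeable P (dualConf S ε) C σ) :
      Stops P S (.D21 (rearrange (dualConf S ε) C σ))
  | D22 (ε : ℝ) (h_dual : DualStep P S ε)
      (h_rearr : ∀ C σ, ¬ IsRearrangeable P (dualConf S ε) C σ)
      (h_target : target P S.x ⊂ target P (dualConf S ε)) (R : List (Vertex μ ν))
      (h_path : IsPathFromTo S.edges (source P (dualConf S ε))
        (S.nodes ∩ target P (dualConf S ε)) R)
      (h_minimal : ∀ R', IsPathFromTo S.edges (source P (dualConf S ε))
        (S.nodes ∩ target P (dualConf S ε)) R' → R' ⊆ R → R ⊆ R') :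
      Stops P S (.D22 (dualConf S ε) R)

/-- `n` updates after which the procedure goes on lead from `S` to `S'`. -/
inductive Run (P : PartMatrix F μ ν) (S : State F μ ν) : ℕ → State F μ ν → Prop
  | zero : Run P S 0 S
  | succ (n : ℕ) (S' S'' : State F μ ν) (h : Run P S n S') (h' : Step P S' S'') :
      Run P S (n + 1) S''

/-- Some execution of the procedure on the input `x` stops with the outcome `o`. -/
def Outputs (P : PartMatrix F μ ν) (x : Conf F μ ν) (o : Outcome F μ ν) : Prop :=
  ∃ n S, Run P (initState P x) n S ∧ Stops P S o

/-- The inputs of the procedure. -/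
structure IsInput (P : PartMatrix F μ ν) (k : ℕ) (x : Conf F μ ν) : Prop where
  optimal : IsOptimal P k x
  size_lt : k < min (2 * μ) (2 * ν)
  not_rearrangeable : ∀ C σ, ¬ IsRearrangeable P x C σ

end

/-! ## A random access machine with step count

The memory consists of two-dimensional arrays of natural numbers (for indices), of elements of `F`
and of real numbers. Every access to a memory cell, every operation on index numbers, every
arithmetic operation in `F` or in `ℝ`, every comparison, every instruction and every iteration of a
loop costs one unit of time. Programs are finite texts that contain no constants other than natural
numbers and the `0` and `1` of `F` and `ℝ`, so they do not depend on `F` or on the input. A loop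
runs over a range that is fixed when it is entered, so that every program halts; the main loop of
the procedure, which repeats the updates until the procedure stops, is added at the end. -/

structure Mem (F : Type u) where
  nat : ℕ → ℕ → ℕ → ℕ
  fld : ℕ → ℕ → ℕ → F
  real : ℕ → ℕ → ℕ → ℝ

/-- The array cell `(x, i, j)` of `f` is set to `y`. -/
def setCell {T : Type u} (f : ℕ → ℕ → ℕ → T) (x i j : ℕ) (y : T) : ℕ → ℕ → ℕ → T :=
  fun x' i' j' => if x' = x ∧ i' = i ∧ j' = j then y else f x' i' j'

/-- Expressions for natural numbers; `get x i j` is the entry `(i, j)` of the array `x`. -/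
inductive NExp where
  | const (k : ℕ)
  | get (x : ℕ) (i j : NExp)
  | add (e f : NExp)
  | sub (e f : NExp)

inductive FExp where
  | zero
  | one
  | get (x : ℕ) (i j : NExp)
  | add (e f : FExp)
  | sub (e f : FExp)
  | mul (e f : FExp)
  | inv (e : FExp)

inductive RExp where
  | zero
  | one
  | get (x : ℕ) (i j : NExp)
  | add (e f : RExp)
  | sub (e f : RExp)

inductive Test where
  | natLt (e f : NExp)
  | natEq (e f : NExp)
  | fldEq (e f : FExp)
  | realLe (e f : RExp)
  | and (p q : Test)
  | not (p : Test)

inductive Cmd where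
  | skip
  | setNat (x : ℕ) (i j : NExp) (e : NExp)
  | setFld (x : ℕ) (i j : NExp) (e : FExp)
  | setReal (x : ℕ) (i j : NExp) (e : RExp)
  | seq (p q : Cmd)
  | ite (b : Test) (p q : Cmd)
  /-- `loop x e p`: for the values `0, 1, …, e - 1` of the cell `(x, 0, 0)`, do `p`. -/
  | loop (x : ℕ) (e : NExp) (p : Cmd)

def NExp.cost : NExp → ℕ
  | .const _ => 1
  | .get _ i j => i.cost + j.cost + 1
  | .add e f => e.cost + f.cost + 1
  | .sub e f => e.cost + f.cost + 1

def FExp.cost : FExp → ℕ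
  | .zero => 1
  | .one => 1
  | .get _ i j => i.cost + j.cost + 1
  | .add e f => e.cost + f.cost + 1
  | .sub e f => e.cost + f.cost + 1
  | .mul e f => e.cost + f.cost + 1
  | .inv e => e.cost + 1

def RExp.cost : RExp → ℕ
  | .zero => 1
  | .one => 1
  | .get _ i j => i.cost + j.cost + 1
  | .add e f => e.cost + f.cost + 1
  | .sub e f => e.cost + f.cost + 1

def Test.cost : Test → ℕ
  | .natLt e f => e.cost + f.cost + 1
  | .natEq e f => e.cost + f.cost + 1
  | .fldEq e f => e.cost + f.cost + 1
  | .realLe e f => e.cost + f.cost + 1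
  | .and p q => p.cost + q.cost + 1
  | .not p => p.cost + 1

section

variable {F : Type u} [Field F]

def NExp.eval (m : Mem F) : NExp → ℕ
  | .const k => k
  | .get x i j => m.nat x (i.eval m) (j.eval m)
  | .add e f => e.eval m + f.eval m
  | .sub e f => e.eval m - f.eval m

def FExp.eval (m : Mem F) : FExp → F
  | .zero => 0
  | .one => 1
  | .get x i j => m.fld x (i.eval m) (j.eval m)
  | .add e f => e.eval m + f.eval m
  | .sub e f => e.eval m - f.eval m
  | .mul e f => e.eval m * f.eval m
  | .inv e => (e.eval m)⁻¹

noncomputable def RExp.eval (m : Mem F) : RExp → ℝ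
  | .zero => 0
  | .one => 1
  | .get x i j => m.real x (i.eval m) (j.eval m)
  | .add e f => e.eval m + f.eval m
  | .sub e f => e.eval m - f.eval m

def Test.Holds (m : Mem F) : Test → Prop
  | .natLt e f => e.eval m < f.eval m
  | .natEq e f => e.eval m = f.eval m
  | .fldEq e f => e.eval m = f.eval m
  | .realLe e f => e.eval m ≤ f.eval m
  | .and p q => p.Holds m ∧ q.Holds m
  | .not p => ¬ p.Holds m

open Classical in
/-- The memory after the execution of a program, and the time that the execution takes. -/
noncomputable def Cmd.run : Cmd → Mem F → Mem F × ℕ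
  | .skip, m => (m, 1)
  | .setNat x i j e, m =>
      ({ m with nat := setCell m.nat x (i.eval m) (j.eval m) (e.eval m) },
        i.cost + j.cost + e.cost + 1)
  | .setFld x i j e, m =>
      ({ m with fld := setCell m.fld x (i.eval m) (j.eval m) (e.eval m) },
        i.cost + j.cost + e.cost + 1)
  | .setReal x i j e, m =>
      ({ m with real := setCell m.real x (i.eval m) (j.eval m) (e.eval m) },
        i.cost + j.cost + e.cost + 1)
  | .seq p q, m =>
      ((q.run (p.run m).1).1, (p.run m).2 + (q.run (p.run m).1).2)
  | .ite b p q, m =>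
      if b.Holds m then ((p.run m).1, b.cost + (p.run m).2 + 1)
      else ((q.run m).1, b.cost + (q.run m).2 + 1)
  | .loop x e p, m =>
      (List.range (e.eval m)).foldl
        (fun mt i =>
          let r := p.run { mt.1 with nat := setCell mt.1.nat x 0 0 i }
          (r.1, mt.2 + r.2 + 1))
        (m, e.cost + 1)

variable {μ ν : ℕ}

/-- The memory holds `μ`, `ν`, the blocks `A a b` and the exponents `d a b`. -/
structure StoresMatrix (m : Mem F) (P : PartMatrix F μ ν) : Prop where
  rows : m.nat 0 0 0 = μ
  cols : m.nat 0 0 1 = ν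
  block : ∀ (a : Fin μ) (b : Fin ν),
    P.A a b = !![m.fld 0 a b, m.fld 1 a b; m.fld 2 a b, m.fld 3 a b]
  exponent : ∀ (a : Fin μ) (b : Fin ν), m.real 0 a b = P.d a b

/-- The memory holds `M`, `I` and the signs of the edges of `M`, a spanning vector of each space of
the labeling, the values of `p` on these spaces (which, under (Reg), determine `p`), and `c`. -/
structure StoresConf (m : Mem F) (x : Conf F μ ν) : Prop where
  edge : ∀ (a : Fin μ) (b : Fin ν),
    m.nat 1 a b = if (a, b) ∈ x.I then 2 else if (a, b) ∈ x.M then 1 else 0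
  sign : ∀ (a : Fin μ) (b : Fin ν), (a, b) ∈ x.M → m.nat 2 a b = (x.sgn a b).toNat
  row_space : ∀ (a : Fin μ) (s : Bool),
    (x.L.U a s).1 = Submodule.span F {![m.fld 4 a s.toNat, m.fld 5 a s.toNat]}
  col_space : ∀ (b : Fin ν) (s : Bool),
    (x.L.V b s).1 = Submodule.span F {![m.fld 6 b s.toNat, m.fld 7 b s.toNat]}
  row_value : ∀ (a : Fin μ) (s : Bool), m.real 1 a s.toNat = x.p.row a (x.L.U a s)
  col_value : ∀ (b : Fin ν) (s : Bool), m.real 2 b s.toNat = x.p.col b (x.L.V b s)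
  shift : m.real 3 0 0 = x.c

/-- The codes of a vertex: its side, its index and its sign. -/
def Vertex.code : Vertex μ ν → ℕ × ℕ × ℕ
  | .row a s => (0, a, s.toNat)
  | .col b s => (1, b, s.toNat)

/-- The memory holds the sequence `R` of vertices. -/
structure StoresPath (m : Mem F) (R : List (Vertex μ ν)) : Prop where
  length : m.nat 3 0 1 = R.length
  vertex : ∀ (i : ℕ) (z : Vertex μ ν), R[i]? = some z →
    (m.nat 4 i 0, m.nat 4 i 1, m.nat 4 i 2) = z.code

/-- The memory holds the outcome, the stopping case being coded by the cell `(3, 0, 0)`. -/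
def StoresOutcome (m : Mem F) : Outcome F μ ν → Prop
  | .P1 x R => m.nat 3 0 0 = 1 ∧ StoresConf m x ∧ StoresPath m R
  | .D1 => m.nat 3 0 0 = 2
  | .D21 x => m.nat 3 0 0 = 3 ∧ StoresConf m x
  | .D22 x R => m.nat 3 0 0 = 4 ∧ StoresConf m x ∧ StoresPath m R

/-- The memory holds the current state: the configuration, the vertices of the forest and, for all
signs, the adjacency matrix of the edges of the forest; the cell `(3, 0, 0)` is `0`. -/
structure StoresState (m : Mem F) (S : State F μ ν) : Prop where
  running : m.nat 3 0 0 = 0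
  conf : StoresConf m S.x
  row_node : ∀ (a : Fin μ) (s : Bool), m.nat 5 a s.toNat = 1 ↔ Vertex.row a s ∈ S.nodes
  col_node : ∀ (b : Fin ν) (s : Bool), m.nat 6 b s.toNat = 1 ↔ Vertex.col b s ∈ S.nodes
  edge : ∀ (a : Fin μ) (s : Bool) (b : Fin ν) (s' : Bool),
    m.nat (7 + 2 * s.toNat + s'.toNat) a b = 1 ↔ s(Vertex.row a s, Vertex.col b s') ∈ S.edges

/-- The memory after `init` and `i` executions of `upd`. -/
noncomputable def memAfter (init upd : Cmd) (m : Mem F) : ℕ → Mem F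
  | 0 => (init.run m).1
  | i + 1 => (upd.run (memAfter init upd m i)).1

/-- The time for `init` and `i` executions of `upd`, each followed by a test whether to stop. -/
noncomputable def timeAfter (init upd : Cmd) (m : Mem F) : ℕ → ℕ
  | 0 => (init.run m).2
  | i + 1 => timeAfter init upd m i + (upd.run (memAfter init upd m i)).2 + 1

/-- Started on the memory `m`, the program "do `init`, then repeat `upd` until the cell `(3, 0, 0)`
is not `0`" carries out, update by update, a complete execution of the procedure on the input `x`,
and this takes time `t`. -/
def CarriesOut (init upd : Cmd) (P : PartMatrix F μ ν) (x : Conf F μ ν) (m : Mem F) (t : ℕ) :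
    Prop :=
  ∃ (n : ℕ) (S : ℕ → State F μ ν) (o : Outcome F μ ν),
    S 0 = initState P x ∧ (∀ i < n, Step P (S i) (S (i + 1))) ∧ Stops P (S n) o ∧
    (∀ i ≤ n, StoresState (memAfter init upd m i) (S i)) ∧
    StoresOutcome (memAfter init upd m (n + 1)) o ∧
    t = timeAfter init upd m (n + 1)

end

end GPM

open GPM

/-!
Fix the signs. Call a row vertex `a^s` and a column vertex `b^s` *mates* if the corresponding spaces
are matched with each other (`Mate`), and *linked* if they are adjacent over a double-tight `s`-edge
of `M \ I` (`Link`). Every vertex has at most one mate and at most one link, hence the auxiliary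
graph over `M`, with links directed from rows to columns and mates from columns to rows (`TStep`),
is a disjoint union of directed chains and cycles. Its chains that end in an unmatched column vertex
form the source set, and those that start at an unmatched row vertex form the target set
(`IsOptimal.mem_source`, `IsOptimal.mem_target`). A chain of both kinds is the same as a
rearrangeable component (`IsOptimal.not_rearrangeable_iff`). Moreover, given tightness, the potential
is optimal exactly if it vanishes on all unmatched spaces (`optimal_iff`).

The search keeps the following invariant (`SearchInv`): the configuration is optimal, the forest
contains the source set, avoids the target set and is closed under mates (`Searching`), and each of
its row vertices outside the source set has a parent, to which it is adjacent either over an edge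
outside `M` with the orthogonality that outer paths require, or by a link, while the parent of a
column vertex is its mate (`Forest`). An update of the procedure preserves the invariant
(`SearchInv.step`):
* In (P2) the space `U_a^{-t}` is replaced by the orthogonal space of `V_b^s`. If it changes at all,
  then `V_b^s` is orthogonal to neither of the two spaces at `a`, so that the inequality for the
  potential together with the tightness of `b^s a^t` gives `p(U_a^{-t}) ≥ p(U_a^t)`, and the new
  space has the potential `p(U_a^{-t})` by regularity. The same argument applies to the space
  `V_{b'}^t` at the other end of the edge `a b'` of `I`. Hence the configuration remains optimal
  (`Searching.relabel_opt`).
* In a dual update the edges of the forest and those between mates remain tight, since their ends lie on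
  the same side of the cut, and unmatched spaces keep the value `0`, since unmatched column vertices are in
  the forest and unmatched row vertices are not (`Searching.dual_opt`).

The outputs follow from the invariant.
* A path of the forest that starts in the source set descends along parents. Cut at the edges by
  which it enters or leaves `M \ I`, it becomes an alternating concatenation of outer and inner
  paths (`altConcat_of_descending`). Only the last edge needs care: it has to lie outside `M`. In
  (P1) a link would carry the target set into the forest, and in (D2-2) it would contradict the
  minimality of the path (`SearchInv.output_P1`, `SearchInv.output_D22`).
* If no dual update is possible, all blocks vanish between the column vertices of the forest and the
  row vertices outside. As mates lie on the same side, at most `k` vertices are row vertices of the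
  forest or column vertices outside (`Searching.card_le`), and hence every `k + 1` columns of the
  matrix are linearly dependent (`Searching.delta_eq_bot`).
* Rearranging a path of odd length drops its edges of one sign and counts those of the other sign
  twice, which increases the size by `1`. The double-tight edges provide the new tightness conditions
  (`IsOptimal.rearrange`).

Every primal update adds a row vertex and a column vertex to the forest. A dual update either adds
vertices of the source set, again of both kinds, or is followed by a primal update. So there are at
most `5 * min μ ν` updates (`IsInput.run_le`).

The program recomputes mates, links and the two sets in every update, in time `O(μ ν)`. A chain is
followed link by link, for as many rounds as there are columns (or rows) at most, so that all chains
together take time `O(μ ν)` as well. The time is bounded by a syntactic degree of programs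
(`Cmd.deg`, `Cmd.run_le`), and `update_spec` states that one run of `update` performs a step of the
procedure or reaches one of its ends. As every state is stored in some memory (`exists_stores`), this
also shows that the procedure is never stuck.
-/

namespace GPM

/-! ### Bilinear forms on lines -/

section

variable {F : Type u} [Field F]

lemma bil_eq (B : Matrix (Fin 2) (Fin 2) F) (u v : Fin 2 → F) :
    bil B u v = u 0 * (B 0 0 * v 0 + B 0 1 * v 1) + u 1 * (B 1 0 * v 0 + B 1 1 * v 1) := by
  simp [bil, dotProduct, Matrix.mulVec, Fin.sum_univ_two]

lemma Line.exists_span (X : Line F) : ∃ u : Fin 2 → F, u ≠ 0 ∧ X.1 = Submodule.span F {u} := by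
  obtain ⟨u, hu, h⟩ := finrank_eq_one_iff'.1 X.2
  refine ⟨u.1, fun h0 => hu (Subtype.ext h0), le_antisymm (fun w hw => ?_) ?_⟩
  · obtain ⟨c, hc⟩ := h ⟨w, hw⟩
    exact Submodule.mem_span_singleton.2 ⟨c, congrArg Subtype.val hc⟩
  · rw [Submodule.span_singleton_le_iff_mem]; exact u.2

/-- The line spanned by a nonzero vector. -/
def lineOf (u : Fin 2 → F) (hu : u ≠ 0) : Line F :=
  ⟨Submodule.span F {u}, finrank_span_singleton hu⟩

lemma Line.eq_of_le {X Y : Line F} (h : X.1 ≤ Y.1) : X = Y :=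
  Subtype.ext (Submodule.eq_of_le_of_finrank_eq h (X.2.trans Y.2.symm))

lemma Line.sup_eq_top {X Y : Line F} (h : X ≠ Y) : X.1 ⊔ Y.1 = ⊤ := by
  apply Submodule.eq_top_of_finrank_eq
  have h1 : X.1 < X.1 ⊔ Y.1 := lt_of_le_of_ne le_sup_left fun he =>
    h (Line.eq_of_le (X := Y) (Y := X) (he ▸ le_sup_right)).symm
  have h2 := Submodule.finrank_lt_finrank_of_lt h1
  have h3 := Submodule.finrank_le (X.1 ⊔ Y.1)
  have h4 := X.2
  simp only [Module.finrank_fin_fun] at *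
  omega

lemma Orth.mono {B : Matrix (Fin 2) (Fin 2) F} {X X' Y Y' : Submodule F (Fin 2 → F)}
    (h : Orth B X' Y') (hX : X ≤ X') (hY : Y ≤ Y') : Orth B X Y :=
  fun u hu v hv => h u (hX hu) v (hY hv)

lemma Orth.sup_left {B : Matrix (Fin 2) (Fin 2) F} {X X' Y : Submodule F (Fin 2 → F)}
    (h : Orth B X Y) (h' : Orth B X' Y) : Orth B (X ⊔ X') Y := by
  intro u hu v hv
  obtain ⟨a, ha, b, hb, rfl⟩ := Submodule.mem_sup.1 hu
  have := h a ha v hv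
  have := h' b hb v hv
  simp_all [bil, add_dotProduct]

lemma Orth.sup_right {B : Matrix (Fin 2) (Fin 2) F} {X Y Y' : Submodule F (Fin 2 → F)}
    (h : Orth B X Y) (h' : Orth B X Y') : Orth B X (Y ⊔ Y') := by
  intro u hu v hv
  obtain ⟨a, ha, b, hb, rfl⟩ := Submodule.mem_sup.1 hv
  have h1 := h u hu a ha
  have h2 := h' u hu b hb
  simp only [bil_eq] at *
  simp only [Pi.add_apply]
  linear_combination h1 + h2

lemma Orth.of_left {B : Matrix (Fin 2) (Fin 2) F} {X X' : Line F} {Y : Submodule F (Fin 2 → F)}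
    (hne : X ≠ X') (h : Orth B X Y) (h' : Orth B X' Y) (Z : Submodule F (Fin 2 → F)) :
    Orth B Z Y :=
  (h.sup_left h').mono (by rw [Line.sup_eq_top hne]; exact le_top) le_rfl

lemma Orth.of_right {B : Matrix (Fin 2) (Fin 2) F} {Y Y' : Line F} {X : Submodule F (Fin 2 → F)}
    (hne : Y ≠ Y') (h : Orth B X Y) (h' : Orth B X Y') (Z : Submodule F (Fin 2 → F)) :
    Orth B X Z :=
  (h.sup_right h').mono le_rfl (by rw [Line.sup_eq_top hne]; exact le_top)

lemma orth_span_iff {B : Matrix (Fin 2) (Fin 2) F} {u v : Fin 2 → F} :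
    Orth B (Submodule.span F {u}) (Submodule.span F {v}) ↔ bil B u v = 0 := by
  constructor
  · intro h
    exact h u (Submodule.mem_span_singleton_self u) v (Submodule.mem_span_singleton_self v)
  · intro h x hx y hy
    obtain ⟨c, rfl⟩ := Submodule.mem_span_singleton.1 hx
    obtain ⟨d, rfl⟩ := Submodule.mem_span_singleton.1 hy
    simp only [bil_eq] at *
    simp only [Pi.smul_apply, smul_eq_mul]
    linear_combination c * d * h

/-- In the plane, the vectors annihilated by a nonzero linear form `w` are spanned by
`(w₁, -w₀)`. -/
lemma mem_span_rot {w u : Fin 2 → F} (hw : w ≠ 0) :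
    u ∈ Submodule.span F {![w 1, 0 - w 0]} ↔ u 0 * w 0 + u 1 * w 1 = 0 := by
  rw [Submodule.mem_span_singleton]
  constructor
  · rintro ⟨c, rfl⟩
    simp; ring
  · intro h
    by_cases h1 : w 1 = 0
    · have h0 : w 0 ≠ 0 := by
        intro h0; apply hw; ext i; fin_cases i <;> simp [h0, h1]
      have hu : u 0 = 0 := by simpa [h1, h0] using h
      refine ⟨-(u 1 / w 0), ?_⟩
      ext i; fin_cases i
      · simp [h1, hu]
      · simp; field_simp
    · refine ⟨u 0 / w 1, ?_⟩
      ext i; fin_cases i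
      · simp; field_simp
      · simp; field_simp; linear_combination -h

lemma rot_ne_zero {w : Fin 2 → F} (hw : w ≠ 0) : ![w 1, 0 - w 0] ≠ 0 := by
  intro h
  apply hw
  have h0 := congrFun h 0
  have h1 := congrFun h 1
  ext i; fin_cases i
  · simpa using h1
  · simpa using h0

/-- If `v` spans `Y` and `B v ≠ 0`, the orthogonal space of `Y` is spanned by `B v`, turned by a
right angle. -/
lemma mem_perp_left {B : Matrix (Fin 2) (Fin 2) F} {v : Fin 2 → F} (hv : B.mulVec v ≠ 0)
    (u : Fin 2 → F) :
    u ∈ Submodule.span F {![B.mulVec v 1, 0 - B.mulVec v 0]} ↔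
      ∀ y ∈ Submodule.span F {v}, bil B u y = 0 := by
  rw [mem_span_rot hv]
  have : u 0 * B.mulVec v 0 + u 1 * B.mulVec v 1 = bil B u v := by
    rw [bil, dotProduct, Fin.sum_univ_two]
  rw [this]
  constructor
  · intro h y hy
    obtain ⟨c, rfl⟩ := Submodule.mem_span_singleton.1 hy
    simp only [bil_eq] at *
    simp only [Pi.smul_apply, smul_eq_mul]
    linear_combination c * h
  · intro h; exact h v (Submodule.mem_span_singleton_self v)

lemma mem_perp_right {B : Matrix (Fin 2) (Fin 2) F} {u : Fin 2 → F} (hu : B.vecMul u ≠ 0)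
    (v : Fin 2 → F) :
    v ∈ Submodule.span F {![B.vecMul u 1, 0 - B.vecMul u 0]} ↔
      ∀ y ∈ Submodule.span F {u}, bil B y v = 0 := by
  rw [mem_span_rot hu]
  have : v 0 * B.vecMul u 0 + v 1 * B.vecMul u 1 = bil B u v := by
    simp only [bil_eq, Matrix.vecMul, dotProduct, Fin.sum_univ_two]; ring
  rw [this]
  constructor
  · intro h y hy
    obtain ⟨c, rfl⟩ := Submodule.mem_span_singleton.1 hy
    simp only [bil_eq] at *
    simp only [Pi.smul_apply, smul_eq_mul]
    linear_combination c * h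
  · intro h; exact h u (Submodule.mem_span_singleton_self u)

lemma mulVec_ne_zero_of_bil {B : Matrix (Fin 2) (Fin 2) F} {u v : Fin 2 → F} (h : bil B u v ≠ 0) :
    B.mulVec v ≠ 0 := by
  intro h0; apply h; simp [bil, h0]

lemma vecMul_ne_zero_of_bil {B : Matrix (Fin 2) (Fin 2) F} {u v : Fin 2 → F} (h : bil B u v ≠ 0) :
    B.vecMul u ≠ 0 := by
  intro h0; apply h; rw [bil, Matrix.dotProduct_mulVec, h0]; simp

/-- Orthogonal spaces of a line that are lines exist as soon as the form does not vanish on it. -/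
lemma exists_perp_left {B : Matrix (Fin 2) (Fin 2) F} {X Y : Line F} (h : ¬ Orth B X Y) :
    ∃ Z : Line F, ∀ u, u ∈ Z.1 ↔ ∀ v ∈ Y.1, bil B u v = 0 := by
  obtain ⟨u, -, hu⟩ := X.exists_span
  obtain ⟨v, -, hv⟩ := Y.exists_span
  rw [hu, hv, orth_span_iff] at h
  have h1 := mulVec_ne_zero_of_bil h
  exact ⟨lineOf _ (rot_ne_zero h1), fun z => by rw [hv]; exact mem_perp_left h1 z⟩

lemma exists_perp_right {B : Matrix (Fin 2) (Fin 2) F} {X Y : Line F} (h : ¬ Orth B X Y) :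
    ∃ Z : Line F, ∀ v, v ∈ Z.1 ↔ ∀ u ∈ X.1, bil B u v = 0 := by
  obtain ⟨u, -, hu⟩ := X.exists_span
  obtain ⟨v, -, hv⟩ := Y.exists_span
  rw [hu, hv, orth_span_iff] at h
  have h1 := vecMul_ne_zero_of_bil h
  exact ⟨lineOf _ (rot_ne_zero h1), fun z => by rw [hu]; exact mem_perp_right h1 z⟩

lemma kerL_eq_bot_of_rank {B : Matrix (Fin 2) (Fin 2) F} (h : B.rank = 2) : kerL B = ⊥ := by
  rw [← Matrix.rank_transpose] at h
  have h1 : Module.finrank F (LinearMap.range (Matrix.transpose B).mulVecLin) = 2 := h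
  have h2 := LinearMap.finrank_range_add_finrank_ker (Matrix.transpose B).mulVecLin
  have h3 : Module.finrank F (LinearMap.ker (Matrix.transpose B).mulVecLin) = 0 := by
    rw [h1] at h2; simpa using h2
  have h4 := Submodule.finrank_eq_zero.1 h3
  rw [Matrix.mulVecLin_transpose] at h4
  exact h4

lemma kerR_eq_bot_of_rank {B : Matrix (Fin 2) (Fin 2) F} (h : B.rank = 2) : kerR B = ⊥ := by
  have h1 : Module.finrank F (LinearMap.range B.mulVecLin) = 2 := h
  have h2 := LinearMap.finrank_range_add_finrank_ker B.mulVecLin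
  have h3 : Module.finrank F (LinearMap.ker B.mulVecLin) = 0 := by
    rw [h1] at h2; simpa using h2
  exact Submodule.finrank_eq_zero.1 h3

lemma le_kerL_iff {B : Matrix (Fin 2) (Fin 2) F} {X : Submodule F (Fin 2 → F)} :
    X ≤ kerL B ↔ Orth B X ⊤ := by
  constructor
  · intro h u hu v _
    have := h hu
    simp [kerL] at this
    rw [bil, Matrix.dotProduct_mulVec, this]; simp
  · intro h u hu
    simp only [kerL, LinearMap.mem_ker, Matrix.vecMulLinear_apply]
    ext i
    have := h u hu (Pi.single i 1) trivial
    rw [bil, Matrix.dotProduct_mulVec] at this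
    simpa using this

lemma le_kerR_iff {B : Matrix (Fin 2) (Fin 2) F} {Y : Submodule F (Fin 2 → F)} :
    Y ≤ kerR B ↔ Orth B ⊤ Y := by
  constructor
  · intro h u _ v hv
    have := h hv
    simp [kerR] at this
    simp [bil, this]
  · intro h v hv
    simp only [kerR, LinearMap.mem_ker, Matrix.mulVecLin_apply]
    ext i
    have := h (Pi.single i 1) trivial v hv
    simpa [bil] using this

lemma rank_eq_one_or_two {B : Matrix (Fin 2) (Fin 2) F} (h : B ≠ 0) : B.rank = 1 ∨ B.rank = 2 := by
  have h1 : B.rank ≤ 2 := by simpa using B.rank_le_card_width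
  have h2 : B.rank ≠ 0 := fun h0 => h (by
    have h3 : LinearMap.range B.mulVecLin = ⊥ := Submodule.finrank_eq_zero.1 h0
    have h4 := LinearMap.range_eq_bot.1 h3
    exact Matrix.toLin'.map_eq_zero_iff.1 (by rw [Matrix.toLin'_apply']; exact h4))
  omega

lemma Line.ne_bot (X : Line F) : X.1 ≠ ⊥ := by
  intro h
  have := X.2
  rw [h] at this
  simp at this

/-- A line that is not in the left kernel is not orthogonal to one of two distinct lines. -/
lemma not_orth_of_rank_two {B : Matrix (Fin 2) (Fin 2) F} (h : B.rank = 2) {X Y Y' : Line F}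
    (hne : Y ≠ Y') (h' : Orth B X Y') : ¬ Orth B X Y := by
  intro h1
  have := le_kerL_iff.2 (h1.of_right hne h' ⊤)
  rw [kerL_eq_bot_of_rank h] at this
  exact X.ne_bot (le_bot_iff.1 this)

lemma not_orth_of_rank_two' {B : Matrix (Fin 2) (Fin 2) F} (h : B.rank = 2) {X X' Y : Line F}
    (hne : X ≠ X') (h' : Orth B X' Y) : ¬ Orth B X Y := by
  intro h1
  have := le_kerR_iff.2 (h1.of_left hne h' ⊤)
  rw [kerR_eq_bot_of_rank h] at this
  exact Y.ne_bot (le_bot_iff.1 this)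

end

section

variable {F : Type u} [Field F] {μ ν : ℕ}

lemma Labeling.U_ne' (L : Labeling F μ ν) (a : Fin μ) (s : Bool) : L.U a s ≠ L.U a (!s) := by
  cases s
  · exact (L.U_ne a).symm
  · exact L.U_ne a

lemma Labeling.V_ne' (L : Labeling F μ ν) (b : Fin ν) (s : Bool) : L.V b s ≠ L.V b (!s) := by
  cases s
  · exact (L.V_ne b).symm
  · exact L.V_ne b

lemma Bool.eq_or_eq_not' (s t : Bool) : t = s ∨ t = !s := by cases s <;> cases t <;> simp

lemma IsValid.orth {P : PartMatrix F μ ν} {M : Finset (Fin μ × Fin ν)} {sgn : Fin μ → Fin ν → Bool}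
    {L : Labeling F μ ν} (h : IsValid P M sgn L) {a : Fin μ} {b : Fin ν} (hab : (a, b) ∈ M)
    (s : Bool) : Orth (P.A a b) (L.U a s) (L.V b (!s)) := by
  cases s
  · exact (h a b hab).2.1
  · exact (h a b hab).1

/-- An edge of `M` with sign `s` does not vanish on the spaces with the opposite sign. -/
lemma IsValid.not_orth {P : PartMatrix F μ ν} {M : Finset (Fin μ × Fin ν)}
    {sgn : Fin μ → Fin ν → Bool} {L : Labeling F μ ν} (h : IsValid P M sgn L) {a : Fin μ}
    {b : Fin ν} (hab : (a, b) ∈ M) (h0 : P.A a b ≠ 0) :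
    ¬ Orth (P.A a b) (L.U a (!sgn a b)) (L.V b (!sgn a b)) := by
  have h1 : Orth (P.A a b) (L.U a (!sgn a b)) (L.V b (sgn a b)) := by
    simpa using h.orth hab (!sgn a b)
  rcases rank_eq_one_or_two h0 with hr | hr
  · intro h2
    have h3 := le_kerL_iff.2 (h1.of_right (L.V_ne' b _) h2 ⊤)
    rw [((h a b hab).2.2 hr).1] at h3
    exact L.U_ne' a _ (Line.eq_of_le h3).symm
  · exact not_orth_of_rank_two hr (L.V_ne' b _).symm h1

end

/-! ### Mates, links and alternating components -/

section

variable {F : Type u} [Field F] {μ ν : ℕ}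

/-- `a^s` and `b^s` are matched with each other: `ab` is an edge of `M` with sign opposite to `s`,
or an edge of `I`. -/
def Mate (x : Conf F μ ν) (a : Fin μ) (b : Fin ν) (s : Bool) : Prop :=
  (a, b) ∈ x.M ∧ (x.sgn a b = !s ∨ (a, b) ∈ x.I)

/-- `ab` is a double-tight `s`-edge of `M \ I`, so that `a^s` and `b^s` are adjacent over `M`
without being matched with each other. -/
def Link (P : PartMatrix F μ ν) (x : Conf F μ ν) (a : Fin μ) (b : Fin ν) (s : Bool) : Prop :=
  (a, b) ∈ x.M ∧ (a, b) ∉ x.I ∧ x.sgn a b = s ∧ TightEdge P x a s b s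

/-- The edges of `graphM`, directed: links from rows to columns, matched pairs from columns to
rows. -/
inductive TStep (P : PartMatrix F μ ν) (x : Conf F μ ν) : Vertex μ ν → Vertex μ ν → Prop
  | link {a : Fin μ} {b : Fin ν} {s : Bool} (h : Link P x a b s) :
      TStep P x (.row a s) (.col b s)
  | mate {a : Fin μ} {b : Fin ν} {s : Bool} (h : Mate x a b s) :
      TStep P x (.col b s) (.row a s)

variable {P : PartMatrix F μ ν} {k : ℕ} {x : Conf F μ ν}

lemma IsOptimal.ne_zero (h : IsOptimal P k x) {a : Fin μ} {b : Fin ν} (hab : (a, b) ∈ x.M) :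
    P.A a b ≠ 0 := h.pair.pseudo.subset _ hab

lemma IsOptimal.isolated_row (h : IsOptimal P k x) {a : Fin μ} {b b' : Fin ν}
    (hI : (a, b) ∈ x.I) (hM : (a, b') ∈ x.M) : b' = b := by
  have h1 := Finset.card_le_one.1 (h.pair.isolated _ hI).1.le (a, b')
    (by simp [hM]) (a, b) (by simp [h.pair.subset hI])
  exact congrArg Prod.snd h1

lemma IsOptimal.isolated_col (h : IsOptimal P k x) {a a' : Fin μ} {b : Fin ν}
    (hI : (a, b) ∈ x.I) (hM : (a', b) ∈ x.M) : a' = a := by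
  have h1 := Finset.card_le_one.1 (h.pair.isolated _ hI).2.le (a', b)
    (by simp [hM]) (a, b) (by simp [h.pair.subset hI])
  exact congrArg Prod.fst h1

lemma IsOptimal.sgn_row (h : IsOptimal P k x) {a : Fin μ} {b b' : Fin ν}
    (hM : (a, b) ∈ x.M) (hM' : (a, b') ∈ x.M) (hs : x.sgn a b = x.sgn a b') : b = b' := by
  by_contra hne
  exact h.coloring _ hM _ hM' (by simp [hne]) (Or.inl rfl) hs

lemma IsOptimal.sgn_col (h : IsOptimal P k x) {a a' : Fin μ} {b : Fin ν}
    (hM : (a, b) ∈ x.M) (hM' : (a', b) ∈ x.M) (hs : x.sgn a b = x.sgn a' b) : a = a' := by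
  by_contra hne
  exact h.coloring _ hM _ hM' (by simp [hne]) (Or.inr rfl) hs

lemma IsOptimal.mate_row (h : IsOptimal P k x) {a : Fin μ} {b b' : Fin ν} {s : Bool}
    (h1 : Mate x a b s) (h2 : Mate x a b' s) : b = b' := by
  rcases h1.2 with h1' | h1'
  · rcases h2.2 with h2' | h2'
    · exact h.sgn_row h1.1 h2.1 (h1'.trans h2'.symm)
    · exact h.isolated_row h2' h1.1
  · exact (h.isolated_row h1' h2.1).symm

lemma IsOptimal.mate_col (h : IsOptimal P k x) {a a' : Fin μ} {b : Fin ν} {s : Bool}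
    (h1 : Mate x a b s) (h2 : Mate x a' b s) : a = a' := by
  rcases h1.2 with h1' | h1'
  · rcases h2.2 with h2' | h2'
    · exact h.sgn_col h1.1 h2.1 (h1'.trans h2'.symm)
    · exact h.isolated_col h2' h1.1
  · exact (h.isolated_col h1' h2.1).symm

lemma IsOptimal.link_row (h : IsOptimal P k x) {a : Fin μ} {b b' : Fin ν} {s : Bool}
    (h1 : Link P x a b s) (h2 : Link P x a b' s) : b = b' :=
  h.sgn_row h1.1 h2.1 (h1.2.2.1.trans h2.2.2.1.symm)

lemma IsOptimal.link_col (h : IsOptimal P k x) {a a' : Fin μ} {b : Fin ν} {s : Bool}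
    (h1 : Link P x a b s) (h2 : Link P x a' b s) : a = a' :=
  h.sgn_col h1.1 h2.1 (h1.2.2.1.trans h2.2.2.1.symm)

lemma Link.not_mate {a : Fin μ} {b : Fin ν} {s : Bool} (h : Link P x a b s) : ¬ Mate x a b s := by
  rintro ⟨-, h2 | h2⟩
  · rw [h.2.2.1] at h2; cases s <;> simp at h2
  · exact h.2.1 h2

lemma matched_row_iff (h : x.I ⊆ x.M) {a : Fin μ} {s : Bool} :
    Matched x (.row a s) ↔ ∃ b, Mate x a b s := by
  constructor
  · rintro (⟨b, h1, h2⟩ | ⟨b, h1, h2⟩)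
    · exact ⟨b, h1, Or.inl h2⟩
    · exact ⟨b, h h1, Or.inr h1⟩
  · rintro ⟨b, h1, h2⟩
    by_cases hs : x.sgn a b = !s
    · exact Or.inl ⟨b, h1, hs⟩
    · exact Or.inr ⟨b, h2.resolve_left hs, by cases s <;> simp_all⟩

lemma matched_col_iff (h : x.I ⊆ x.M) {b : Fin ν} {s : Bool} :
    Matched x (.col b s) ↔ ∃ a, Mate x a b s := by
  constructor
  · rintro (⟨b, h1, h2⟩ | ⟨b, h1, h2⟩)
    · exact ⟨b, h1, Or.inl h2⟩
    · exact ⟨b, h h1, Or.inr h1⟩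
  · rintro ⟨a, h1, h2⟩
    by_cases hs : x.sgn a b = !s
    · exact Or.inl ⟨a, h1, hs⟩
    · exact Or.inr ⟨a, h2.resolve_left hs, by cases s <;> simp_all⟩

/-- Over an edge of `M`, only vertices of equal sign are adjacent. -/
lemma IsOptimal.sign_eq (h : IsOptimal P k x) {a : Fin μ} {b : Fin ν} {s t : Bool}
    (hab : (a, b) ∈ x.M) (ht : TightEdge P x a s b t) : s = t := by
  by_contra hne
  have : t = !s := by cases s <;> cases t <;> simp_all
  subst this
  exact ht.1 (h.valid.orth hab s)

lemma IsOptimal.not_orth_I (h : IsOptimal P k x) {a : Fin μ} {b : Fin ν}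
    (hab : (a, b) ∈ x.I) (s : Bool) : ¬ Orth (P.A a b) (x.L.U a s) (x.L.V b s) :=
  not_orth_of_rank_two (h.pair.rank_two _ hab) (x.L.V_ne' b s)
    (h.valid.orth (h.pair.subset hab) s)

lemma IsOptimal.mate_tight (h : IsOptimal P k x) {a : Fin μ} {b : Fin ν} {s : Bool}
    (hm : Mate x a b s) : TightEdge P x a s b s := by
  by_cases hs : x.sgn a b = !s
  · have h1 := h.valid.not_orth hm.1 (h.ne_zero hm.1)
    have h2 := h.tight.on_M _ _ hm.1
    simp only [hs, Bool.not_not] at h1 h2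
    exact ⟨h1, h2.symm⟩
  · have hI := hm.2.resolve_left hs
    have hs' : x.sgn a b = s := by cases s <;> simp_all
    have h2 := h.tight.on_I _ _ hI
    rw [hs'] at h2
    exact ⟨h.not_orth_I hI s, h2.symm⟩

lemma IsOptimal.mate_or_link (h : IsOptimal P k x) {a : Fin μ} {b : Fin ν} {s t : Bool}
    (hab : (a, b) ∈ x.M) (ht : TightEdge P x a s b t) :
    s = t ∧ (Mate x a b s ∨ Link P x a b s) := by
  obtain rfl := h.sign_eq hab ht
  refine ⟨rfl, ?_⟩
  by_cases hI : (a, b) ∈ x.I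
  · exact Or.inl ⟨hab, Or.inr hI⟩
  · by_cases hs : x.sgn a b = !s
    · exact Or.inl ⟨hab, Or.inl hs⟩
    · exact Or.inr ⟨hab, hI, by cases s <;> simp_all, ht⟩

lemma IsOptimal.graphM_adj (h : IsOptimal P k x) {z z' : Vertex μ ν} :
    (graphM P x).Adj z z' ↔ TStep P x z z' ∨ TStep P x z' z := by
  have aux : ∀ a s b t, ((∃ a' s' b' t', (a', b') ∈ x.M ∧ TightEdge P x a' s' b' t' ∧
      s(Vertex.row a s, Vertex.col b t) = s(Vertex.row a' s', Vertex.col b' t')) ↔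
      (s = t ∧ (Mate x a b s ∨ Link P x a b s))) := by
    intro a s b t
    constructor
    · rintro ⟨a', s', b', t', hM, ht, he⟩
      simp at he
      obtain ⟨⟨rfl, rfl⟩, rfl, rfl⟩ := he
      exact h.mate_or_link hM ht
    · rintro ⟨rfl, hm | hl⟩
      · exact ⟨a, s, b, s, hm.1, h.mate_tight hm, rfl⟩
      · exact ⟨a, s, b, s, hl.1, hl.2.2.2, rfl⟩
  rw [graphM, SimpleGraph.fromEdgeSet_adj, Set.mem_ofPred_eq]
  rcases z with ⟨a, s⟩ | ⟨b, t⟩ <;> rcases z' with ⟨a', s'⟩ | ⟨b', t'⟩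
  · constructor
    · rintro ⟨⟨a', s', b', t', hM, ht, he⟩, -⟩; simp at he
    · rintro (h | h) <;> cases h
  · rw [aux]
    constructor
    · rintro ⟨⟨rfl, hm | hl⟩, -⟩
      · exact Or.inr (.mate hm)
      · exact Or.inl (.link hl)
    · rintro (h | h)
      · cases h with | link h => exact ⟨⟨rfl, Or.inr h⟩, by simp⟩
      · cases h with | mate h => exact ⟨⟨rfl, Or.inl h⟩, by simp⟩
  · rw [Sym2.eq_swap, aux]
    constructor
    · rintro ⟨⟨rfl, hm | hl⟩, -⟩
      · exact Or.inl (.mate hm)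
      · exact Or.inr (.link hl)
    · rintro (h | h)
      · cases h with | mate h => exact ⟨⟨rfl, Or.inl h⟩, by simp⟩
      · cases h with | link h => exact ⟨⟨rfl, Or.inr h⟩, by simp⟩
  · constructor
    · rintro ⟨⟨a', s', b', t', hM, ht, he⟩, -⟩; simp at he
    · rintro (h | h) <;> cases h

lemma IsOptimal.tstep_right_unique (h : IsOptimal P k x) {z y y' : Vertex μ ν}
    (h1 : TStep P x z y) (h2 : TStep P x z y') : y = y' := by
  cases h1 with
  | link h1 => cases h2 with | link h2 => rw [h.link_row h1 h2]
  | mate h1 => cases h2 with | mate h2 => rw [h.mate_col h1 h2]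

lemma IsOptimal.tstep_left_unique (h : IsOptimal P k x) {z y y' : Vertex μ ν}
    (h1 : TStep P x y z) (h2 : TStep P x y' z) : y = y' := by
  cases h1 with
  | link h1 => cases h2 with | link h2 => rw [h.link_col h1 h2]
  | mate h1 => cases h2 with | mate h2 => rw [h.mate_row h1 h2]

/-- The source set consists of the vertices from which some unmatched column vertex is reached
along directed edges: nothing leaves an unmatched column vertex, and every vertex has at most one
edge leaving it. -/
lemma IsOptimal.mem_source (h : IsOptimal P k x) {z : Vertex μ ν} :
    z ∈ source P x ↔ ∃ b s, (∀ a, ¬ Mate x a b s) ∧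
      Relation.ReflTransGen (TStep P x) z (.col b s) := by
  have hm : ∀ b s, ¬ Matched x (.col b s) ↔ ∀ a, ¬ Mate x a b s := fun b s => by
    rw [matched_col_iff h.pair.subset, not_exists]
  constructor
  · rintro ⟨b, s, hu, hr⟩
    rw [hm] at hu
    refine ⟨b, s, hu, ?_⟩
    rw [SimpleGraph.reachable_iff_reflTransGen] at hr
    induction hr with
    | refl => exact .refl
    | tail _ hadj ih =>
      rcases h.graphM_adj.1 hadj with hs | hs
      · rcases Relation.ReflTransGen.cases_head ih with rfl | ⟨y, hy, hy'⟩
        · cases hs with | mate hs => exact absurd hs (hu _)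
        · rwa [h.tstep_right_unique hs hy]
      · exact .head hs ih
  · rintro ⟨b, s, hu, hr⟩
    refine ⟨b, s, (hm b s).2 hu, ?_⟩
    apply SimpleGraph.Reachable.symm
    rw [SimpleGraph.reachable_iff_reflTransGen]
    exact Relation.ReflTransGen.lift id (fun u v huv => h.graphM_adj.2 (Or.inl huv)) _ _ hr

lemma IsOptimal.mem_target (h : IsOptimal P k x) {z : Vertex μ ν} :
    z ∈ target P x ↔ ∃ a s, (∀ b, ¬ Mate x a b s) ∧
      Relation.ReflTransGen (TStep P x) (.row a s) z := by
  have hm : ∀ a s, ¬ Matched x (.row a s) ↔ ∀ b, ¬ Mate x a b s := fun b s => by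
    rw [matched_row_iff h.pair.subset, not_exists]
  constructor
  · rintro ⟨b, s, hu, hr⟩
    rw [hm] at hu
    refine ⟨b, s, hu, ?_⟩
    rw [SimpleGraph.reachable_iff_reflTransGen] at hr
    induction hr with
    | refl => exact .refl
    | tail _ hadj ih =>
      rcases h.graphM_adj.1 hadj with hs | hs
      · exact .tail ih hs
      · rcases Relation.ReflTransGen.cases_tail ih with rfl | ⟨y, hy, hy'⟩
        · cases hs with | mate hs => exact absurd hs (hu _)
        · rwa [h.tstep_left_unique hs hy']
  · rintro ⟨b, s, hu, hr⟩
    refine ⟨b, s, (hm b s).2 hu, ?_⟩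
    rw [SimpleGraph.reachable_iff_reflTransGen]
    exact Relation.ReflTransGen.lift id (fun u v huv => h.graphM_adj.2 (Or.inl huv)) _ _ hr

lemma mem_source_adj {z z' : Vertex μ ν} (hz : z ∈ source P x) (h : (graphM P x).Adj z z') :
    z' ∈ source P x := by
  obtain ⟨b, s, hu, hr⟩ := hz
  exact ⟨b, s, hu, hr.trans h.reachable⟩

lemma mem_target_adj {z z' : Vertex μ ν} (hz : z ∈ target P x) (h : (graphM P x).Adj z z') :
    z' ∈ target P x := by
  obtain ⟨b, s, hu, hr⟩ := hz
  exact ⟨b, s, hu, hr.trans h.reachable⟩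

lemma IsOptimal.source_tstep (h : IsOptimal P k x) {z z' : Vertex μ ν}
    (ht : TStep P x z z') : z ∈ source P x ↔ z' ∈ source P x :=
  ⟨fun hz => mem_source_adj hz (h.graphM_adj.2 (.inl ht)),
    fun hz => mem_source_adj hz (h.graphM_adj.2 (.inr ht))⟩

lemma IsOptimal.target_tstep (h : IsOptimal P k x) {z z' : Vertex μ ν}
    (ht : TStep P x z z') : z ∈ target P x ↔ z' ∈ target P x :=
  ⟨fun hz => mem_target_adj hz (h.graphM_adj.2 (.inl ht)),
    fun hz => mem_target_adj hz (h.graphM_adj.2 (.inr ht))⟩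

lemma IsOptimal.unmatched_mem_source (h : IsOptimal P k x) {b : Fin ν} {s : Bool}
    (hu : ∀ a, ¬ Mate x a b s) : .col b s ∈ source P x :=
  h.mem_source.2 ⟨b, s, hu, .refl⟩

lemma IsOptimal.unmatched_mem_target (h : IsOptimal P k x) {a : Fin μ} {s : Bool}
    (hu : ∀ b, ¬ Mate x a b s) : .row a s ∈ target P x :=
  h.mem_target.2 ⟨a, s, hu, .refl⟩

/-- The source set is unchanged, and so is the target set, if `M`, `I` and the colors are and the
links are. -/
lemma source_target_congr {k' : ℕ} {x' : Conf F μ ν} (h : IsOptimal P k x)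
    (h' : IsOptimal P k' x') (ht : TStep P x = TStep P x') :
    source P x = source P x' ∧ target P x = target P x' := by
  have hm : ∀ a b s, Mate x a b s ↔ Mate x' a b s := fun a b s => by
    constructor
    · intro hm
      have : TStep P x' (.col b s) (.row a s) := ht ▸ TStep.mate hm
      cases this; assumption
    · intro hm
      have : TStep P x (.col b s) (.row a s) := ht ▸ TStep.mate hm
      cases this; assumption
  constructor
  · ext z; simp only [h.mem_source, h'.mem_source, hm, ht]
  · ext z; simp only [h.mem_target, h'.mem_target, hm, ht]

end

/-! ### Rearrangeable components -/

section

variable {F : Type u} [Field F] {μ ν : ℕ}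

/-- The block edge `e` as an edge of the bipartite graph on the blocks. -/
def blockEdge (e : Fin μ × Fin ν) : Sym2 (Fin μ ⊕ Fin ν) := s(Sum.inl e.1, Sum.inr e.2)

/-- The block edge `e` is incident to the block `v`. -/
def Incident (e : Fin μ × Fin ν) (v : Fin μ ⊕ Fin ν) : Prop := Sum.inl e.1 = v ∨ Sum.inr e.2 = v

lemma incident_iff {e : Fin μ × Fin ν} {v : Fin μ ⊕ Fin ν} : Incident e v ↔ v ∈ blockEdge e := by
  simp [Incident, blockEdge, eq_comm]

lemma blockEdge_injective : Function.Injective (blockEdge (μ := μ) (ν := ν)) := by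
  rintro ⟨a, b⟩ ⟨a', b'⟩ h
  simpa [blockEdge] using h

lemma edgeGraph_adj {N : Finset (Fin μ × Fin ν)} {v v' : Fin μ ⊕ Fin ν} :
    (edgeGraph N).Adj v v' ↔ ∃ e ∈ N, s(v, v') = blockEdge e := by
  rw [edgeGraph, SimpleGraph.fromEdgeSet_adj]
  constructor
  · rintro ⟨⟨e, he, h⟩, -⟩; exact ⟨e, he, h⟩
  · rintro ⟨e, he, h⟩
    refine ⟨⟨e, he, h⟩, ?_⟩
    rintro rfl
    simp only [blockEdge, Sym2.eq_iff] at h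
    rcases h with ⟨h1, h2⟩ | ⟨h1, h2⟩ <;> (rw [h1] at h2; cases h2)

lemma mem_of_blockEdge_mem {N : Finset (Fin μ × Fin ν)} {u v : Fin μ ⊕ Fin ν}
    {w : (edgeGraph N).Walk u v} {e : Fin μ × Fin ν} (h : blockEdge e ∈ w.edges) : e ∈ N := by
  have h1 := w.edges_subset_edgeSet h
  rw [blockEdge, SimpleGraph.mem_edgeSet, edgeGraph_adj] at h1
  obtain ⟨e', he', h2⟩ := h1
  rwa [blockEdge_injective (a₁ := e) h2]

/-- A path `w` that follows its component in `N` from an end: all edges at the blocks passed are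
edges of `w`, and at the last block it is exactly the edges of sign `τ` that are. -/
structure IsFollowing (N : Finset (Fin μ × Fin ν)) (sgn : Fin μ → Fin ν → Bool)
    {u v : Fin μ ⊕ Fin ν} (w : (edgeGraph N).Walk u v) (τ : Bool) : Prop where
  path : w.IsPath
  old : ∀ v' ∈ w.support, v' ≠ v → ∀ e ∈ N, Incident e v' → blockEdge e ∈ w.edges
  cur : ∀ e ∈ N, Incident e v → (blockEdge e ∈ w.edges ↔ sgn e.1 e.2 = τ)

/-- A path that follows its component can be continued by the edge of sign `!τ`, if there is one. -/
lemma IsFollowing.concat {N : Finset (Fin μ × Fin ν)} {sgn : Fin μ → Fin ν → Bool}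
    (hc : IsColoring N sgn) {u v v' : Fin μ ⊕ Fin ν} {w : (edgeGraph N).Walk u v} {τ : Bool}
    (h : IsFollowing N sgn w τ) {e : Fin μ × Fin ν} (he : e ∈ N) (hvv : s(v, v') = blockEdge e)
    (hs : sgn e.1 e.2 = !τ) :
    IsFollowing N sgn (w.concat (edgeGraph_adj.2 ⟨e, he, hvv⟩)) (!τ) := by
  have hadj : (edgeGraph N).Adj v v' := edgeGraph_adj.2 ⟨e, he, hvv⟩
  have hev : Incident e v := incident_iff.2 (hvv ▸ Sym2.mem_mk_left v v')
  have hev' : Incident e v' := incident_iff.2 (hvv ▸ Sym2.mem_mk_right v v')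
  have huniq : ∀ e' ∈ N, ∀ z, Incident e z → Incident e' z → sgn e'.1 e'.2 = !τ → e' = e := by
    intro e' he' z hz hz' hs'
    by_contra hne
    refine hc e' he' e he hne ?_ (hs'.trans hs.symm)
    rcases hz with rfl | rfl <;> rcases hz' with h1 | h1 <;> simp_all
  have hnew : v' ∉ w.support := by
    intro hmem
    have h1 := h.old v' hmem hadj.ne' e he hev'
    rw [h.cur e he hev, hs] at h1
    simp at h1
  have hnot : ∀ e', Incident e' v' → blockEdge e' ∉ w.edges := by
    intro e' he' hmem
    exact hnew (SimpleGraph.Walk.mem_support_of_mem_edges hmem (incident_iff.1 he'))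
  refine ⟨h.path.concat hnew hadj, ?_, ?_⟩
  · intro z hz hzv e' he' hinc
    rw [SimpleGraph.Walk.support_concat, List.mem_append, List.mem_singleton] at hz
    rw [SimpleGraph.Walk.edges_concat, List.concat_eq_append, List.mem_append, List.mem_singleton]
    rcases hz with hz | hz
    · by_cases hzv' : z = v
      · subst hzv'
        by_cases hs' : sgn e'.1 e'.2 = τ
        · exact Or.inl ((h.cur e' he' hinc).2 hs')
        · have : sgn e'.1 e'.2 = !τ := by cases τ <;> simp_all
          rw [huniq e' he' z hev hinc this]
          exact Or.inr hvv.symm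
      · exact Or.inl (h.old z hz hzv' e' he' hinc)
    · exact absurd hz hzv
  · intro e' he' hinc
    rw [SimpleGraph.Walk.edges_concat, List.concat_eq_append, List.mem_append, List.mem_singleton]
    constructor
    · rintro (h1 | h1)
      · exact absurd h1 (hnot e' hinc)
      · rw [hvv] at h1
        rw [blockEdge_injective h1, hs]
    · intro hs'
      rw [huniq e' he' v' hev' hinc hs']
      exact Or.inr hvv.symm

/-- The block of a vertex. -/
def Vertex.block : Vertex μ ν → Fin μ ⊕ Fin ν
  | .row a _ => Sum.inl a
  | .col b _ => Sum.inr b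

/-- The vertex of sign `s` over a block. -/
def vertexOver (s : Bool) : Fin μ ⊕ Fin ν → Vertex μ ν
  | .inl a => .row a s
  | .inr b => .col b s

variable {P : PartMatrix F μ ν} {k : ℕ} {x : Conf F μ ν}

lemma IsOptimal.coloring_diff (h : IsOptimal P k x) : IsColoring (x.M \ x.I) x.sgn :=
  fun e he e' he' => h.coloring e (Finset.sdiff_subset he) e' (Finset.sdiff_subset he')

lemma IsOptimal.doubleTight_of_link (h : IsOptimal P k x) {a : Fin μ} {b : Fin ν} {s : Bool}
    (hl : Link P x a b s) : DoubleTight P x a b := by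
  have h1 := h.mate_tight (s := !s) ⟨hl.1, Or.inl (by simp [hl.2.2.1])⟩
  have h2 := hl.2.2.2
  cases s
  · exact ⟨h1, h2⟩
  · exact ⟨h2, h1⟩

lemma TStep.sign_eq {z : Vertex μ ν} {s : Bool} {v : Fin μ ⊕ Fin ν}
    (h : TStep P x (vertexOver s v) z) : ∃ v', z = vertexOver s v' := by
  rcases v with a | b
  · cases h with | @link _ b' _ h => exact ⟨.inr b', rfl⟩
  · cases h with | @mate a' _ _ h => exact ⟨.inl a', rfl⟩

/-- The component of an unmatched row vertex, up to some vertex, as a path over `M \ I`. -/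
lemma IsOptimal.exists_following (h : IsOptimal P k x) {a : Fin μ} {s : Bool}
    (hu : ∀ b, ¬ Mate x a b s) {z : Vertex μ ν}
    (hz : Relation.ReflTransGen (TStep P x) (.row a s) z) :
    ∃ (v : Fin μ ⊕ Fin ν) (w : (edgeGraph (x.M \ x.I)).Walk (Sum.inl a) v) (τ : Bool),
      z = vertexOver s v ∧ IsFollowing (x.M \ x.I) x.sgn w τ ∧
      (τ = s ↔ v.isRight) ∧ (Odd w.length ↔ v.isRight) ∧
      (∀ a' b', blockEdge (a', b') ∈ w.edges → x.sgn a' b' = s → Link P x a' b' s) ∧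
      (∀ v' ∈ w.support, Relation.ReflTransGen (TStep P x) (.row a s) (vertexOver s v')) ∧
      (∀ b, v = .inr b → ∃ a', (a', b) ∈ x.M \ x.I) := by
  induction hz with
  | refl =>
    refine ⟨.inl a, .nil, !s, rfl, ⟨.nil, ?_, ?_⟩, by simp, by simp, by simp, ?_, by simp⟩
    · intro v' hv' hne; simp at hv'; exact absurd hv' hne
    · intro e he hinc
      simp only [SimpleGraph.Walk.edges_nil, List.not_mem_nil, false_iff]
      intro hs
      rcases hinc with h1 | h1
      · obtain ⟨e1, e2⟩ := e
        simp only [Sum.inl.injEq] at h1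
        subst h1
        exact hu e2 ⟨(Finset.mem_sdiff.1 he).1, Or.inl hs⟩
      · cases h1
    · intro v' hv'; simp at hv'; subst hv'; exact .refl
  | @tail y z hy hyz ih =>
    obtain ⟨v, w, τ, rfl, hf, hτ, hodd, hlink, hsupp, hN⟩ := ih
    obtain ⟨v', rfl⟩ := hyz.sign_eq
    -- the edge that leads from `v` to `v'`
    have key : ∃ e ∈ x.M \ x.I, s(v, v') = blockEdge e ∧ x.sgn e.1 e.2 = !τ ∧
        (v.isRight ↔ ¬ v'.isRight) ∧ (x.sgn e.1 e.2 = s → Link P x e.1 e.2 s) ∧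
        (∀ b, v' = .inr b → ∃ a', (a', b) ∈ x.M \ x.I) := by
      rcases v with a1 | b1 <;> rcases v' with a2 | b2
      · cases hyz
      · cases hyz with
        | link hl =>
          have hmem : (a1, b2) ∈ x.M \ x.I := Finset.mem_sdiff.2 ⟨hl.1, hl.2.1⟩
          refine ⟨(a1, b2), hmem, rfl, ?_, by simp, fun _ => hl, ?_⟩
          · have : τ ≠ s := by simpa using hτ
            rw [hl.2.2.1]; cases s <;> cases τ <;> simp_all
          · rintro b hb; cases hb; exact ⟨a1, hmem⟩
      · cases hyz with
        | mate hm =>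
          have hI : (a2, b1) ∉ x.I := by
            intro hI
            obtain ⟨a', ha'⟩ := hN b1 rfl
            rw [Finset.mem_sdiff] at ha'
            have := h.isolated_col hI ha'.1
            subst this
            exact ha'.2 hI
          have hs := hm.2.resolve_right hI
          refine ⟨(a2, b1), Finset.mem_sdiff.2 ⟨hm.1, hI⟩, Sym2.eq_swap, ?_, by simp, ?_, by simp⟩
          · have : τ = s := by simpa using hτ
            rw [hs, this]
          · intro hs'; simp only at hs'; rw [hs] at hs'; cases s <;> simp at hs'
      · cases hyz
    obtain ⟨e, he, hvv, hs, hlr, hl, hN'⟩ := key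
    refine ⟨v', _, !τ, rfl, hf.concat h.coloring_diff he hvv hs, ?_, ?_, ?_, ?_, hN'⟩
    · have : (!τ) = s ↔ ¬ τ = s := by cases s <;> cases τ <;> simp
      rw [this, hτ, hlr, not_not]
    · rw [SimpleGraph.Walk.length_concat, Nat.odd_add_one, hodd, hlr, not_not]
    · intro a' b' hmem hs'
      rw [SimpleGraph.Walk.edges_concat, List.concat_eq_append, List.mem_append, List.mem_singleton] at hmem
      rcases hmem with hmem | hmem
      · exact hlink a' b' hmem hs'
      · have := blockEdge_injective (hmem.trans hvv)
        subst this
        exact hl hs'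
    · intro v'' hv''
      rw [SimpleGraph.Walk.support_concat, List.mem_append, List.mem_singleton] at hv''
      rcases hv'' with hv'' | rfl
      · exact hsupp _ hv''
      · exact hy.tail hyz

/-- The edges of `M \ I` at the rows of the component of `a^s`. -/
def IsComponentOf (P : PartMatrix F μ ν) (x : Conf F μ ν) (a : Fin μ) (s : Bool)
    (C : Finset (Fin μ × Fin ν)) : Prop :=
  ∀ a' b', (a', b') ∈ C ↔
    (a', b') ∈ x.M \ x.I ∧ Relation.ReflTransGen (TStep P x) (.row a s) (.row a' s)

/-- An unmatched row vertex in the source set gives rise to a rearrangeable component. -/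
lemma IsOptimal.isRearrangeable (h : IsOptimal P k x) {a : Fin μ} {s : Bool}
    (hu : ∀ b, ¬ Mate x a b s) (hS : .row a s ∈ source P x) {C : Finset (Fin μ × Fin ν)}
    (hC : IsComponentOf P x a s C) : IsRearrangeable P x C s := by
  obtain ⟨b, t, hub, hr⟩ := h.mem_source.1 hS
  obtain ⟨v, w, τ, hv, hf, hτ, hodd, hlink, hsupp, hN⟩ := h.exists_following hu hr
  rcases v with a1 | b1
  · cases hv
  cases hv
  have hτ' : τ = s := by simpa using hτ
  subst hτ'
  -- at both ends there are only edges of sign `s`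
  have hend : ∀ e ∈ x.M \ x.I, (e.1 = a ∨ e.2 = b) → x.sgn e.1 e.2 = τ := by
    rintro ⟨e1, e2⟩ he h1
    by_contra hne
    have hs : x.sgn e1 e2 = !τ := by cases τ <;> simp_all
    rcases h1 with rfl | rfl
    · exact hu e2 ⟨(Finset.mem_sdiff.1 he).1, Or.inl hs⟩
    · exact hub e1 ⟨(Finset.mem_sdiff.1 he).1, Or.inl hs⟩
  have hall : ∀ v' ∈ w.support, ∀ e ∈ x.M \ x.I, Incident e v' → blockEdge e ∈ w.edges := by
    intro v' hv' e he hinc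
    by_cases hvb : v' = Sum.inr b
    · subst hvb
      refine (hf.cur e he hinc).2 (hend e he (Or.inr ?_))
      rcases hinc with h1 | h1
      · cases h1
      · simpa using h1
    · exact hf.old v' hv' hvb e he hinc
  have hrows : ∀ a', Relation.ReflTransGen (TStep P x) (.row a τ) (.row a' τ) →
      Sum.inl a' ∈ w.support := by
    intro a' ha'
    have : ∀ z, Relation.ReflTransGen (TStep P x) (.row a τ) z → z.block ∈ w.support := by
      intro z hz
      induction hz with
      | refl => exact w.start_mem_support
      | @tail y z hy hyz ih =>
        obtain ⟨v1, w1, τ1, hy1, -, -, -, -, -, hN1⟩ := h.exists_following hu hy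
        cases hyz with
        | @link a1 b1 _ hl =>
          have := hall _ ih (a1, b1) (Finset.mem_sdiff.2 ⟨hl.1, hl.2.1⟩) (Or.inl rfl)
          exact SimpleGraph.Walk.mem_support_of_mem_edges this (by simp [blockEdge, Vertex.block])
        | @mate a1 b1 _ hm =>
          have hI : (a1, b1) ∉ x.I := by
            intro hI
            rcases v1 with a2 | b2
            · simp [vertexOver] at hy1
            · simp only [vertexOver, Vertex.col.injEq] at hy1
              obtain ⟨a', ha'⟩ := hN1 b2 rfl
              rw [← hy1.1, Finset.mem_sdiff] at ha'
              have := h.isolated_col hI ha'.1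
              subst this
              exact ha'.2 hI
          have := hall _ ih (a1, b1) (Finset.mem_sdiff.2 ⟨hm.1, hI⟩) (Or.inr rfl)
          exact SimpleGraph.Walk.mem_support_of_mem_edges this (by simp [blockEdge, Vertex.block])
    exact this _ ha'
  have hCw : ∀ e, e ∈ C ↔ blockEdge e ∈ w.edges := by
    rintro ⟨e1, e2⟩
    rw [hC]
    constructor
    · rintro ⟨he, hre⟩
      exact hall _ (hrows _ hre) _ he (Or.inl rfl)
    · intro hmem
      exact ⟨mem_of_blockEdge_mem hmem,
        hsupp (.inl e1) (SimpleGraph.Walk.mem_support_of_mem_edges hmem (by simp [blockEdge]))⟩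
  refine ⟨a, b, w, hf.path, hodd.2 rfl, hCw, ?_, ?_, ?_⟩
  · rintro e he (h1 | h1)
    · exact (hCw e).2 (hall _ h1 e he (Or.inl rfl))
    · exact (hCw e).2 (hall _ h1 e he (Or.inr rfl))
  · intro e he h1
    exact hend e (mem_of_blockEdge_mem ((hCw e).1 he)) h1
  · rintro ⟨e1, e2⟩ he hs
    exact h.doubleTight_of_link (hlink _ _ ((hCw _).1 he) hs)

lemma IsOptimal.reachable_of_walk (h : IsOptimal P k x) {σ : Bool} {u v : Fin μ ⊕ Fin ν}
    (w : (edgeGraph (x.M \ x.I)).Walk u v)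
    (hw : ∀ e, blockEdge e ∈ w.edges → x.sgn e.1 e.2 = σ → DoubleTight P x e.1 e.2) :
    (graphM P x).Reachable (vertexOver σ u) (vertexOver σ v) := by
  induction w with
  | nil => exact .refl _
  | @cons u v' v hadj w ih =>
    refine SimpleGraph.Reachable.trans ?_ (ih fun e he => hw e (by simp [he]))
    obtain ⟨⟨a, b⟩, he, hvv⟩ := edgeGraph_adj.1 hadj
    rw [Finset.mem_sdiff] at he
    have ht : TightEdge P x a σ b σ := by
      by_cases hs : x.sgn a b = σ
      · have := hw (a, b) (by simp [hvv]) hs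
        cases σ
        · exact this.2
        · exact this.1
      · exact h.mate_tight ⟨he.1, Or.inl (by cases σ <;> simp_all)⟩
    apply SimpleGraph.Adj.reachable
    rw [h.graphM_adj]
    have hml := (h.mate_or_link he.1 ht).2
    simp only [blockEdge, Sym2.eq_iff] at hvv
    rcases hvv with ⟨rfl, rfl⟩ | ⟨rfl, rfl⟩
    · exact hml.elim (fun hm => Or.inr (.mate hm)) fun hl => Or.inl (.link hl)
    · exact hml.elim (fun hm => Or.inl (.mate hm)) fun hl => Or.inr (.link hl)

lemma exists_edge_of_walk {N : Finset (Fin μ × Fin ν)} {u v : Fin μ ⊕ Fin ν}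
    (w : (edgeGraph N).Walk u v) (hne : u ≠ v) : ∃ e ∈ N, Incident e u := by
  cases w with
  | nil => exact absurd rfl hne
  | cons hadj w =>
    obtain ⟨e, he, h⟩ := edgeGraph_adj.1 hadj
    exact ⟨e, he, incident_iff.2 (h ▸ Sym2.mem_mk_left _ _)⟩

/-- Conversely, a rearrangeable component has an unmatched row vertex in the source set. -/
lemma IsOptimal.exists_of_isRearrangeable (h : IsOptimal P k x) {C : Finset (Fin μ × Fin ν)}
    {σ : Bool} (hr : IsRearrangeable P x C σ) :
    ∃ a, (∀ b, ¬ Mate x a b σ) ∧ .row a σ ∈ source P x := by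
  obtain ⟨a, b, w, hp, hodd, hC, hcomp, hend, hdt⟩ := hr
  have hu : ∀ b', ¬ Mate x a b' σ := by
    rintro b' ⟨hM, hs⟩
    by_cases hI : (a, b') ∈ x.I
    · obtain ⟨⟨e1, e2⟩, he, hinc⟩ := exists_edge_of_walk w (by simp)
      rcases hinc with h1 | h1
      · simp only [Sum.inl.injEq] at h1
        subst h1
        rw [Finset.mem_sdiff] at he
        have := h.isolated_row hI he.1
        subst this
        exact he.2 hI
      · cases h1
    · have h1 := hend _ (hcomp (a, b') (Finset.mem_sdiff.2 ⟨hM, hI⟩) (Or.inl w.start_mem_support))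
        (Or.inl rfl)
      simp only at h1
      rw [h1] at hs
      cases σ <;> simp [hI] at hs
  have hub : ∀ a', ¬ Mate x a' b σ := by
    rintro a' ⟨hM, hs⟩
    by_cases hI : (a', b) ∈ x.I
    · obtain ⟨⟨e1, e2⟩, he, hinc⟩ := exists_edge_of_walk w.reverse (by simp)
      rcases hinc with h1 | h1
      · cases h1
      · simp only [Sum.inr.injEq] at h1
        subst h1
        rw [Finset.mem_sdiff] at he
        have := h.isolated_col hI he.1
        subst this
        exact he.2 hI
    · have h1 := hend _ (hcomp (a', b) (Finset.mem_sdiff.2 ⟨hM, hI⟩) (Or.inr w.end_mem_support))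
        (Or.inr rfl)
      simp only at h1
      rw [h1] at hs
      cases σ <;> simp [hI] at hs
  refine ⟨a, hu, b, σ, ?_, ?_⟩
  · rw [matched_col_iff h.pair.subset]; simpa using hub
  · exact (h.reachable_of_walk w fun e he hs => hdt e ((hC e).2 he) hs).symm

lemma exists_isComponentOf (P : PartMatrix F μ ν) (x : Conf F μ ν) (a : Fin μ) (s : Bool) :
    ∃ C, IsComponentOf P x a s C := by
  classical
  exact ⟨(x.M \ x.I).filter fun e => Relation.ReflTransGen (TStep P x) (.row a s) (.row e.1 s),
    fun a' b' => by simp⟩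

lemma IsOptimal.not_rearrangeable_iff (h : IsOptimal P k x) :
    (∀ C σ, ¬ IsRearrangeable P x C σ) ↔ Disjoint (source P x) (target P x) := by
  constructor
  · intro hr
    rw [Set.disjoint_left]
    intro z hz hz'
    obtain ⟨a, s, hu, hz''⟩ := h.mem_target.1 hz'
    have hS : .row a s ∈ source P x := by
      clear hz'
      induction hz'' with
      | refl => exact hz
      | tail _ hst ih => exact ih ((h.source_tstep hst).2 hz)
    obtain ⟨C, hC⟩ := exists_isComponentOf P x a s
    exact hr C s (h.isRearrangeable hu hS hC)
  · intro hd C σ hr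
    obtain ⟨a, hu, hS⟩ := h.exists_of_isRearrangeable hr
    exact Set.disjoint_left.1 hd hS (h.unmatched_mem_target hu)

lemma IsOptimal.not_rearrangeable_iff' (h : IsOptimal P k x) :
    (∀ C σ, ¬ IsRearrangeable P x C σ) ↔
      ∀ a s, (∀ b, ¬ Mate x a b s) → .row a s ∉ source P x := by
  constructor
  · intro hr a s hu hS
    exact Set.disjoint_left.1 (h.not_rearrangeable_iff.1 hr) hS (h.unmatched_mem_target hu)
  · intro hd C σ hr
    obtain ⟨a, hu, hS⟩ := h.exists_of_isRearrangeable hr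
    exact hd a σ hu hS

end

/-! ### Optimality and the values on unmatched spaces -/

section

variable {F : Type u} [Field F] {μ ν : ℕ} {P : PartMatrix F μ ν} {x : Conf F μ ν}

lemma sum_add_sum_eq_sum_filter {ι E R : Type*} [Fintype ι] [AddCommMonoid R] {M I : Finset E}
    (φ ψ : E → ι) (f : ι → R) (hφ : Set.InjOn φ M) (hψ : Set.InjOn ψ I)
    (hd : ∀ e ∈ M, ∀ e' ∈ I, φ e ≠ ψ e') (p : ι → Prop) [DecidablePred p]
    (hp : ∀ i, p i ↔ (∃ e ∈ M, φ e = i) ∨ ∃ e ∈ I, ψ e = i) :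
    ∑ e ∈ M, f (φ e) + ∑ e ∈ I, f (ψ e) = ∑ i with p i, f i := by
  classical
  rw [← Finset.sum_image hφ, ← Finset.sum_image hψ, ← Finset.sum_union]
  · congr 1
    ext i
    simp [hp]
  · rw [Finset.disjoint_left]
    intro i hi hi'
    obtain ⟨e, he, rfl⟩ := Finset.mem_image.1 hi
    obtain ⟨e', he', h⟩ := Finset.mem_image.1 hi'
    exact hd e he e' he' h.symm

open Classical in
/-- Every matched row vertex is counted by exactly one edge of `M` or `I`. -/
lemma sum_matched_row {R : Type*} [AddCommMonoid R] (hp : IsMatchingPair P x.M x.I)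
    (hc : IsColoring x.M x.sgn) (f : Fin μ × Bool → R) :
    ∑ e ∈ x.M, f (e.1, !x.sgn e.1 e.2) + ∑ e ∈ x.I, f (e.1, x.sgn e.1 e.2) =
      ∑ i with ∃ b, Mate x i.1 b i.2, f i := by
  refine sum_add_sum_eq_sum_filter (fun e : Fin μ × Fin ν => (e.1, !x.sgn e.1 e.2))
    (fun e : Fin μ × Fin ν => (e.1, x.sgn e.1 e.2))
    f ?_ ?_ ?_ _ ?_
  · intro e he e' he' h
    by_contra hne
    simp only [Prod.mk.injEq, Bool.not_inj_iff] at h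
    exact hc e he e' he' hne (Or.inl h.1) h.2
  · intro e he e' he' h
    by_contra hne
    simp only [Prod.mk.injEq] at h
    exact hc e (hp.subset he) e' (hp.subset he') hne (Or.inl h.1) h.2
  · intro e he e' he' h
    simp only [Prod.mk.injEq] at h
    have h1 := Finset.card_le_one.1 (hp.isolated _ he').1.le e (by simp [he, h.1]) e'
      (by simp [hp.subset he'])
    subst h1
    simp at h
  · rintro ⟨a, s⟩
    rw [← matched_row_iff hp.subset]
    constructor
    · rintro (⟨b, h1, h2⟩ | ⟨b, h1, h2⟩)
      · exact Or.inl ⟨(a, b), h1, by simp [h2]⟩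
      · exact Or.inr ⟨(a, b), h1, by simp [h2]⟩
    · rintro (⟨⟨a', b⟩, h1, h2⟩ | ⟨⟨a', b⟩, h1, h2⟩)
      · simp only [Prod.mk.injEq] at h2; obtain ⟨rfl, rfl⟩ := h2
        exact Or.inl ⟨b, h1, by simp⟩
      · simp only [Prod.mk.injEq] at h2; obtain ⟨rfl, rfl⟩ := h2
        exact Or.inr ⟨b, h1, rfl⟩

open Classical in
lemma sum_matched_col {R : Type*} [AddCommMonoid R] (hp : IsMatchingPair P x.M x.I)
    (hc : IsColoring x.M x.sgn) (f : Fin ν × Bool → R) :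
    ∑ e ∈ x.M, f (e.2, !x.sgn e.1 e.2) + ∑ e ∈ x.I, f (e.2, x.sgn e.1 e.2) =
      ∑ i with ∃ a, Mate x a i.1 i.2, f i := by
  refine sum_add_sum_eq_sum_filter (fun e : Fin μ × Fin ν => (e.2, !x.sgn e.1 e.2))
    (fun e : Fin μ × Fin ν => (e.2, x.sgn e.1 e.2))
    f ?_ ?_ ?_ _ ?_
  · intro e he e' he' h
    by_contra hne
    simp only [Prod.mk.injEq, Bool.not_inj_iff] at h
    exact hc e he e' he' hne (Or.inr h.1) h.2
  · intro e he e' he' h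
    by_contra hne
    simp only [Prod.mk.injEq] at h
    exact hc e (hp.subset he) e' (hp.subset he') hne (Or.inr h.1) h.2
  · intro e he e' he' h
    simp only [Prod.mk.injEq] at h
    have h1 := Finset.card_le_one.1 (hp.isolated _ he').2.le e (by simp [he, h.1]) e'
      (by simp [hp.subset he'])
    subst h1
    simp at h
  · rintro ⟨b, s⟩
    rw [← matched_col_iff hp.subset]
    constructor
    · rintro (⟨a, h1, h2⟩ | ⟨a, h1, h2⟩)
      · exact Or.inl ⟨(a, b), h1, by simp [h2]⟩
      · exact Or.inr ⟨(a, b), h1, by simp [h2]⟩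
    · rintro (⟨⟨a, b'⟩, h1, h2⟩ | ⟨⟨a, b'⟩, h1, h2⟩)
      · simp only [Prod.mk.injEq] at h2; obtain ⟨rfl, rfl⟩ := h2
        exact Or.inl ⟨a, h1, by simp⟩
      · simp only [Prod.mk.injEq] at h2; obtain ⟨rfl, rfl⟩ := h2
        exact Or.inr ⟨a, h1, rfl⟩

/-- By tightness, `w(M, I)` is `(|M| + |I|) c` plus the sum of `p` over the matched spaces, so
optimality means that `p` vanishes on the unmatched ones. -/
lemma optimal_iff (hp : IsMatchingPair P x.M x.I) (hc : IsColoring x.M x.sgn) (ht : IsTight P x)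
    (hpot : IsPotential P x.c x.p) {k : ℕ} (hk : x.M.card + x.I.card = k) :
    ((weight P x.M x.I : ℝ) = x.p.total x.L + k * x.c) ↔
      (∀ a s, (∀ b, ¬ Mate x a b s) → x.p.row a (x.L.U a s) = 0) ∧
        ∀ b s, (∀ a, ¬ Mate x a b s) → x.p.col b (x.L.V b s) = 0 := by
  classical
  have h1 := sum_matched_row hp hc fun i : Fin μ × Bool => x.p.row i.1 (x.L.U i.1 i.2)
  have h2 := sum_matched_col hp hc fun i : Fin ν × Bool => x.p.col i.1 (x.L.V i.1 i.2)
  have h3 : (weight P x.M x.I : ℝ) =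
      ∑ i : Fin μ × Bool with ∃ b, Mate x i.1 b i.2, x.p.row i.1 (x.L.U i.1 i.2) +
      ∑ i : Fin ν × Bool with ∃ a, Mate x a i.1 i.2, x.p.col i.1 (x.L.V i.1 i.2) + k * x.c := by
    rw [← h1, ← h2, weight, ← hk]
    push_cast
    have e1 := Finset.sum_congr rfl fun e (he : e ∈ x.M) => ht.on_M e.1 e.2 he
    have e2 := Finset.sum_congr rfl fun e (he : e ∈ x.I) => ht.on_I e.1 e.2 he
    rw [e1, e2]
    simp only [Finset.sum_add_distrib, Finset.sum_const, nsmul_eq_mul]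
    ring
  have h4 : x.p.total x.L = ∑ i : Fin μ × Bool, x.p.row i.1 (x.L.U i.1 i.2) +
      ∑ i : Fin ν × Bool, x.p.col i.1 (x.L.V i.1 i.2) := by
    simp [Potential.total, Fintype.sum_prod_type]
  have h5 := Finset.sum_filter_add_sum_filter_not Finset.univ
    (fun i : Fin μ × Bool => ∃ b, Mate x i.1 b i.2) fun i => x.p.row i.1 (x.L.U i.1 i.2)
  have h6 := Finset.sum_filter_add_sum_filter_not Finset.univ
    (fun i : Fin ν × Bool => ∃ a, Mate x a i.1 i.2) fun i => x.p.col i.1 (x.L.V i.1 i.2)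
  have n1 : ∀ i ∈ Finset.univ.filter (fun i : Fin μ × Bool => ¬ ∃ b, Mate x i.1 b i.2),
    0 ≤ x.p.row i.1 (x.L.U i.1 i.2) := fun i _ => hpot.row_nonneg _ _
  have n2 : ∀ i ∈ Finset.univ.filter (fun i : Fin ν × Bool => ¬ ∃ a, Mate x a i.1 i.2),
    0 ≤ x.p.col i.1 (x.L.V i.1 i.2) := fun i _ => hpot.col_nonneg _ _
  have s1 := Finset.sum_nonneg n1
  have s2 := Finset.sum_nonneg n2
  rw [h3, h4]
  constructor
  · intro h
    have z1 := (Finset.sum_eq_zero_iff_of_nonneg n1).1 (by linarith)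
    have z2 := (Finset.sum_eq_zero_iff_of_nonneg n2).1 (by linarith)
    exact ⟨fun a s hu => z1 (a, s) (by simpa using hu), fun b s hu => z2 (b, s) (by simpa using hu)⟩
  · rintro ⟨hr, hcl⟩
    have z1 := (Finset.sum_eq_zero_iff_of_nonneg n1).2
      (fun i hi => hr i.1 i.2 (by simpa using hi))
    have z2 := (Finset.sum_eq_zero_iff_of_nonneg n2).2
      (fun i hi => hcl i.1 i.2 (by simpa using hi))
    linarith

/-! ### Rearrangement -/

lemma edgeGraph_mono {M M' : Finset (Fin μ × Fin ν)} (h : M ⊆ M') : edgeGraph M ≤ edgeGraph M' := by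
  intro u v huv
  obtain ⟨e, he, h1⟩ := edgeGraph_adj.1 huv
  exact edgeGraph_adj.2 ⟨e, h he, h1⟩

lemma IsPseudoMatching.mono {M M' : Finset (Fin μ × Fin ν)} (h : IsPseudoMatching P M)
    (hs : M' ⊆ M) : IsPseudoMatching P M' where
  subset e he := h.subset e (hs he)
  deg_row a := (Finset.card_le_card (Finset.filter_subset_filter _ hs)).trans (h.deg_row a)
  deg_col b := (Finset.card_le_card (Finset.filter_subset_filter _ hs)).trans (h.deg_col b)
  cycle v w hw := by
    obtain ⟨e, he, h1, h2⟩ := h.cycle v (w.mapLe (edgeGraph_mono hs)) (hw.mapLe _)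
    rw [SimpleGraph.Walk.edges_mapLe_eq_edges] at h1
    exact ⟨e, mem_of_blockEdge_mem h1, h1, h2⟩
  vl := by
    obtain ⟨sgn, hc, L, hv⟩ := h.vl
    exact ⟨sgn, fun e he e' he' => hc e (hs he) e' (hs he'), L, fun a b hab => hv a b (hs hab)⟩

/-- On a path whose first edge has sign `σ`, the edges of sign `σ` outnumber those of the other sign by
`1` if the length is odd, and are equally many if it is even. -/
lemma card_path_edges {N : Finset (Fin μ × Fin ν)} {sgn : Fin μ → Fin ν → Bool}
    (hcol : IsColoring N sgn) {u v : Fin μ ⊕ Fin ν} (w : (edgeGraph N).Walk u v)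
    (hp : w.IsPath) (σ : Bool) (hu : ∀ e ∈ N, blockEdge e ∈ w.edges → Incident e u →
      sgn e.1 e.2 = σ) (C : Finset (Fin μ × Fin ν)) (hC : ∀ e, e ∈ C ↔ blockEdge e ∈ w.edges) :
    (C.filter fun e => sgn e.1 e.2 = σ).card =
      (C.filter fun e => sgn e.1 e.2 = !σ).card + w.length % 2 := by
  classical
  induction w generalizing σ C with
  | nil =>
    have : C = ∅ := by ext e; simp [hC]
    simp [this]
  | @cons u v' v hadj w ih =>
    obtain ⟨e, he, hvv⟩ := edgeGraph_adj.1 hadj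
    rw [SimpleGraph.Walk.cons_isPath_iff] at hp
    have hev : Incident e u := incident_iff.2 (hvv ▸ Sym2.mem_mk_left _ _)
    have hev' : Incident e v' := incident_iff.2 (hvv ▸ Sym2.mem_mk_right _ _)
    have hes : sgn e.1 e.2 = σ := hu e he (by simp [hvv]) hev
    have henot : blockEdge e ∉ w.edges := fun hmem =>
      hp.2 (SimpleGraph.Walk.mem_support_of_mem_edges hmem (incident_iff.1 hev))
    have heC : e ∈ C := (hC e).2 (by simp [hvv])
    have hC' : ∀ e', e' ∈ C.erase e ↔ blockEdge e' ∈ w.edges := by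
      intro e'
      rw [Finset.mem_erase, hC, SimpleGraph.Walk.edges_cons, List.mem_cons, hvv,
        blockEdge_injective.eq_iff]
      constructor
      · rintro ⟨h1, h2⟩; exact h2.resolve_left h1
      · intro h1; exact ⟨fun h2 => henot (h2 ▸ h1), Or.inr h1⟩
    have h1 := ih hp.1 (!σ) (by
      intro e' he' hmem hinc
      by_contra hne
      have hs' : sgn e'.1 e'.2 = σ := by cases σ <;> simp_all
      have hne' : e' ≠ e := fun h2 => henot (h2 ▸ hmem)
      refine hcol e' he' e he hne' ?_ (hs'.trans hes.symm)
      rcases hinc with rfl | rfl <;> rcases hev' with h3 | h3 <;> simp_all) (C.erase e) hC'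
    rw [Bool.not_not] at h1
    have h2 : (C.filter fun e => sgn e.1 e.2 = σ) =
        insert e ((C.erase e).filter fun e => sgn e.1 e.2 = σ) := by
      rw [← Finset.insert_erase heC, Finset.filter_insert, if_pos hes]
      simp
    have h3 : (C.filter fun e => sgn e.1 e.2 = !σ) =
        ((C.erase e).filter fun e => sgn e.1 e.2 = !σ) := by
      conv_lhs => rw [← Finset.insert_erase heC]
      rw [Finset.filter_insert, if_neg (by rw [hes]; cases σ <;> simp)]
    rw [h2, h3, Finset.card_insert_of_notMem (by simp), SimpleGraph.Walk.length_cons, h1]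
    omega

/-- Every block inside a path is incident to two edges of the path. -/
lemma exists_other_edge {N : Finset (Fin μ × Fin ν)} {u u' v : Fin μ ⊕ Fin ν}
    (w : (edgeGraph N).Walk u u') (hp : w.IsPath) (hv : v ∈ w.support) (hvu : v ≠ u)
    (hvu' : v ≠ u') (e : Fin μ × Fin ν) :
    ∃ e', blockEdge e' ∈ w.edges ∧ e' ≠ e ∧ Incident e' v := by
  obtain ⟨w1, w2, rfl⟩ := SimpleGraph.Walk.mem_support_iff_exists_append.1 hv
  obtain ⟨y1, hy1, w1', hw1⟩ := SimpleGraph.Walk.exists_eq_cons_of_ne hvu w1.reverse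
  obtain ⟨y2, hy2, w2', hw2⟩ := SimpleGraph.Walk.exists_eq_cons_of_ne hvu' w2
  obtain ⟨e1, -, he1⟩ := edgeGraph_adj.1 hy1
  obtain ⟨e2, -, he2⟩ := edgeGraph_adj.1 hy2
  have m1 : blockEdge e1 ∈ w1.edges := by
    rw [← List.mem_reverse, ← SimpleGraph.Walk.edges_reverse, hw1]; simp [he1]
  have m2 : blockEdge e2 ∈ w2.edges := by rw [hw2]; simp [he2]
  have hnd := hp.isTrail.edges_nodup
  rw [SimpleGraph.Walk.edges_append] at hnd ⊢
  have hne : e1 ≠ e2 := by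
    rintro rfl
    exact (List.nodup_append.1 hnd).2.2 _ m1 _ m2 rfl
  have i1 : Incident e1 v := incident_iff.2 (he1 ▸ Sym2.mem_mk_left _ _)
  have i2 : Incident e2 v := incident_iff.2 (he2 ▸ Sym2.mem_mk_left _ _)
  by_cases h1 : e1 = e
  · exact ⟨e2, by simp [m2], fun h2 => hne (h1.trans h2.symm), i2⟩
  · exact ⟨e1, by simp [m1], h1, i1⟩

/-- The end of a component path with end edges of sign `σ`: blocks at edges of the other sign are
inner blocks, so they also have an edge of sign `σ`. -/
lemma exists_edge_of_other_sign {N : Finset (Fin μ × Fin ν)} {sgn : Fin μ → Fin ν → Bool}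
    (hcol : IsColoring N sgn) {a : Fin μ} {b : Fin ν} {σ : Bool}
    (w : (edgeGraph N).Walk (Sum.inl a) (Sum.inr b)) (hp : w.IsPath)
    (hend : ∀ e, blockEdge e ∈ w.edges → (e.1 = a ∨ e.2 = b) → sgn e.1 e.2 = σ)
    {e : Fin μ × Fin ν} (he : blockEdge e ∈ w.edges) (hs : sgn e.1 e.2 = !σ) :
    (∃ b', blockEdge (e.1, b') ∈ w.edges ∧ sgn e.1 b' = σ) ∧
      ∃ a', blockEdge (a', e.2) ∈ w.edges ∧ sgn a' e.2 = σ := by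
  have hs1 : Sum.inl e.1 ∈ w.support :=
    SimpleGraph.Walk.mem_support_of_mem_edges he (by simp [blockEdge])
  have hs2 : Sum.inr e.2 ∈ w.support :=
    SimpleGraph.Walk.mem_support_of_mem_edges he (by simp [blockEdge])
  have hea : e.1 ≠ a := fun h1 => by
    have := hend e he (Or.inl h1); rw [hs] at this; cases σ <;> simp at this
  have heb : e.2 ≠ b := fun h1 => by
    have := hend e he (Or.inr h1); rw [hs] at this; cases σ <;> simp at this
  constructor
  · obtain ⟨⟨a', b'⟩, he', hne, hinc⟩ :=
      exists_other_edge w hp hs1 (by simpa using hea) (by simp) e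
    have h1 : a' = e.1 := by
      rcases hinc with h1 | h1
      · simpa using h1
      · cases h1
    subst h1
    have := hcol _ (mem_of_blockEdge_mem he') e (mem_of_blockEdge_mem he) hne (Or.inl rfl)
    refine ⟨b', he', ?_⟩
    simp only [hs] at this
    cases σ <;> simpa using this
  · obtain ⟨⟨a', b'⟩, he', hne, hinc⟩ :=
      exists_other_edge w hp hs2 (by simp) (by simpa using heb) e
    have h1 : b' = e.2 := by
      rcases hinc with h1 | h1
      · cases h1
      · simpa using h1
    subst h1
    have := hcol _ (mem_of_blockEdge_mem he') e (mem_of_blockEdge_mem he) hne (Or.inr rfl)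
    refine ⟨a', he', ?_⟩
    simp only [hs] at this
    cases σ <;> simpa using this

lemma IsOptimal.rank_two_of_link {k : ℕ} (h : IsOptimal P k x) {a : Fin μ} {b : Fin ν} {s : Bool}
    (hl : Link P x a b s) : (P.A a b).rank = 2 := by
  refine (rank_eq_one_or_two (h.ne_zero hl.1)).resolve_left fun hr => ?_
  have h1 := ((h.valid a b hl.1).2.2 hr).1
  rw [hl.2.2.1] at h1
  exact hl.2.2.2.1 ((le_kerL_iff.1 h1.ge).mono le_rfl le_top)

/-- The rearrangement of an optimal configuration is optimal, with size increased by one. -/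
lemma IsOptimal.rearrange {k : ℕ} (h : IsOptimal P k x) {C : Finset (Fin μ × Fin ν)} {σ : Bool}
    (hr : IsRearrangeable P x C σ) : IsOptimal P (k + 1) (rearrange x C σ) := by
  obtain ⟨a, b, w, hp, hodd, hC, hcomp, hend, hdt⟩ := hr
  have hC' : ∀ e, e ∈ C ↔ blockEdge e ∈ w.edges := hC
  have hCN : ∀ e ∈ C, e ∈ x.M ∧ e ∉ x.I := fun e he =>
    Finset.mem_sdiff.1 (mem_of_blockEdge_mem ((hC' e).1 he))
  have hlink : ∀ e ∈ C, x.sgn e.1 e.2 = σ → Link P x e.1 e.2 σ := fun e he hs =>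
    ⟨(hCN e he).1, (hCN e he).2, hs, by
      have := hdt e he hs
      cases σ
      · exact this.2
      · exact this.1⟩
  -- edges of `M \ I` that touch an edge of `C` belong to `C`
  have hclosed : ∀ e ∈ C, ∀ e' ∈ x.M, e' ∉ x.I → (e'.1 = e.1 ∨ e'.2 = e.2) → e' ∈ C := by
    intro e he e' he' hI' h1
    refine hcomp e' (Finset.mem_sdiff.2 ⟨he', hI'⟩) ?_
    have hs1 : Sum.inl e.1 ∈ w.support :=
      SimpleGraph.Walk.mem_support_of_mem_edges ((hC' e).1 he) (by simp [blockEdge])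
    have hs2 : Sum.inr e.2 ∈ w.support :=
      SimpleGraph.Walk.mem_support_of_mem_edges ((hC' e).1 he) (by simp [blockEdge])
    rcases h1 with h1 | h1
    · exact Or.inl (h1 ▸ hs1)
    · exact Or.inr (h1 ▸ hs2)
  have hM : (GPM.rearrange x C σ).M = x.M \ C.filter (fun e => x.sgn e.1 e.2 = !σ) := rfl
  have hI : (GPM.rearrange x C σ).I = x.I ∪ C.filter (fun e => x.sgn e.1 e.2 = σ) := rfl
  have hsub : (GPM.rearrange x C σ).M ⊆ x.M := Finset.sdiff_subset
  have hIM : (GPM.rearrange x C σ).I ⊆ (GPM.rearrange x C σ).M := by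
    intro e he
    rw [hM, Finset.mem_sdiff, Finset.mem_filter]
    rw [hI, Finset.mem_union, Finset.mem_filter] at he
    rcases he with he | ⟨he, hs⟩
    · exact ⟨h.pair.subset he, fun h1 => (hCN e h1.1).2 he⟩
    · exact ⟨(hCN e he).1, fun h1 => by rw [hs] at h1; cases σ <;> simp at h1⟩
  have hisol : ∀ e ∈ (GPM.rearrange x C σ).I, ∀ e' ∈ (GPM.rearrange x C σ).M,
      (e'.1 = e.1 ∨ e'.2 = e.2) → e' = e := by
    intro e he e' he' h1
    rw [hI, Finset.mem_union, Finset.mem_filter] at he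
    rw [hM, Finset.mem_sdiff, Finset.mem_filter] at he'
    rcases he with he | ⟨he, hs⟩
    · rcases h1 with h1 | h1
      · have := h.isolated_row (a := e.1) (b := e.2) (b' := e'.2) he (h1 ▸ he'.1)
        exact Prod.ext h1 this
      · have := h.isolated_col (a := e.1) (b := e.2) (a' := e'.1) he (h1 ▸ he'.1)
        exact Prod.ext this h1
    · by_contra hne
      have hcne := h.coloring e' he'.1 e (hCN e he).1 hne h1
      have hI' : e' ∉ x.I := by
        intro hI'
        rcases h1 with h1 | h1
        · have := h.isolated_row (a := e'.1) (b := e'.2) (b' := e.2) hI' (h1 ▸ (hCN e he).1)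
          exact hne (Prod.ext h1 this.symm)
        · have := h.isolated_col (a := e'.1) (b := e'.2) (a' := e.1) hI' (h1 ▸ (hCN e he).1)
          exact hne (Prod.ext this.symm h1)
      exact he'.2 ⟨hclosed e he e' he'.1 hI' h1, by
        rw [hs] at hcne; cases σ <;> simp_all⟩
  have hpair : IsMatchingPair P (GPM.rearrange x C σ).M (GPM.rearrange x C σ).I := by
    refine ⟨h.pair.pseudo.mono hsub, hIM, ?_, ?_⟩
    · intro e he
      constructor
      · exact Finset.card_eq_one.2 ⟨e, by
          ext e'
          simp only [Finset.mem_filter, Finset.mem_singleton]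
          exact ⟨fun h1 => hisol e he e' h1.1 (Or.inl h1.2), fun h1 => by
            subst h1; exact ⟨hIM he, rfl⟩⟩⟩
      · exact Finset.card_eq_one.2 ⟨e, by
          ext e'
          simp only [Finset.mem_filter, Finset.mem_singleton]
          exact ⟨fun h1 => hisol e he e' h1.1 (Or.inr h1.2), fun h1 => by
            subst h1; exact ⟨hIM he, rfl⟩⟩⟩
    · intro e he
      rw [hI, Finset.mem_union, Finset.mem_filter] at he
      rcases he with he | ⟨he, hs⟩
      · exact h.pair.rank_two e he
      · exact h.rank_two_of_link (hlink e he hs)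
  have hcol : IsColoring (GPM.rearrange x C σ).M (GPM.rearrange x C σ).sgn :=
    fun e he e' he' => h.coloring e (hsub he) e' (hsub he')
  have htight : IsTight P (GPM.rearrange x C σ) := by
    refine ⟨fun a b hab => h.tight.on_M a b (hsub hab), fun a b hab => ?_⟩
    rw [hI, Finset.mem_union, Finset.mem_filter] at hab
    rcases hab with hab | ⟨hab, hs⟩
    · exact h.tight.on_I a b hab
    · have := (hlink _ hab hs).2.2.2.2
      simp only at hs
      have h2 : (GPM.rearrange x C σ).sgn a b = σ := hs
      rw [h2]
      exact this.symm
  have hsize : (GPM.rearrange x C σ).M.card + (GPM.rearrange x C σ).I.card = k + 1 := by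
    have h1 := card_path_edges h.coloring_diff w hp σ (fun e _ hmem hinc =>
      hend e ((hC' e).2 hmem) (Or.inl (by
        rcases hinc with h1 | h1
        · simpa using h1
        · cases h1))) C hC'
    rw [Nat.odd_iff.1 hodd] at h1
    have h2 : (C.filter fun e => x.sgn e.1 e.2 = !σ) ⊆ x.M := fun e he =>
      (hCN e (Finset.mem_filter.1 he).1).1
    have h3 := Finset.card_le_card h2
    rw [hM, hI, Finset.card_sdiff_of_subset h2, Finset.card_union_of_disjoint, ← h.size]
    · omega
    · rw [Finset.disjoint_left]
      intro e he he'
      exact (hCN e (Finset.mem_filter.1 he').1).2 he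
  refine ⟨hpair, hsize, hcol, fun a b hab => h.valid a b (hsub hab), h.potential, h.reg, htight, ?_⟩
  rw [optimal_iff hpair hcol htight h.potential hsize]
  obtain ⟨hz1, hz2⟩ := (optimal_iff h.pair h.coloring h.tight h.potential h.size).1 h.optimal
  -- what was matched remains matched: along `C`, by the edges added to `I`
  have hkeep : ∀ e ∈ C, x.sgn e.1 e.2 = !σ →
      (∃ b', (e.1, b') ∈ C ∧ x.sgn e.1 b' = σ) ∧ ∃ a', (a', e.2) ∈ C ∧ x.sgn a' e.2 = σ := by
    intro e he hs
    have := exists_edge_of_other_sign h.coloring_diff w hp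
      (fun e he => hend e ((hC' e).2 he)) ((hC' e).1 he) hs
    simpa only [hC'] using this
  have hIC : ∀ e ∈ C, x.sgn e.1 e.2 = σ → e ∈ (GPM.rearrange x C σ).I := fun e he hs => by
    rw [hI]; simp [he, hs]
  have hmate : ∀ a' b' s, Mate x a' b' s → (∃ b'', Mate (GPM.rearrange x C σ) a' b'' s) ∧
      ∃ a'', Mate (GPM.rearrange x C σ) a'' b' s := by
    intro a' b' s hm
    by_cases hd : (a', b') ∈ C ∧ x.sgn a' b' = !σ
    · obtain ⟨⟨b'', h1, h2⟩, a'', h3, h4⟩ := hkeep _ hd.1 hd.2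
      exact ⟨⟨b'', hIM (hIC _ h1 h2), Or.inr (hIC _ h1 h2)⟩,
        ⟨a'', hIM (hIC _ h3 h4), Or.inr (hIC _ h3 h4)⟩⟩
    · have h1 : (a', b') ∈ (GPM.rearrange x C σ).M := by
        rw [hM, Finset.mem_sdiff, Finset.mem_filter]; exact ⟨hm.1, hd⟩
      have h2 : Mate (GPM.rearrange x C σ) a' b' s := ⟨h1, hm.2.imp id fun h2 => by
        rw [hI]; exact Finset.mem_union_left _ h2⟩
      exact ⟨⟨_, h2⟩, ⟨_, h2⟩⟩
  constructor
  · intro a' s hu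
    refine hz1 a' s fun b' hm => ?_
    obtain ⟨b'', hb''⟩ := (hmate _ _ _ hm).1
    exact hu b'' hb''
  · intro b' s hu
    refine hz2 b' s fun a' hm => ?_
    obtain ⟨a'', ha''⟩ := (hmate _ _ _ hm).2
    exact hu a'' ha''

end

/-! ### Dual updates -/

section

variable {F : Type u} [Field F] {μ ν : ℕ}

/-- The part of the invariant of the search that does not refer to the edges of the forest. -/
structure Searching (P : PartMatrix F μ ν) (k : ℕ) (S : State F μ ν) : Prop where
  opt : IsOptimal P k S.x
  disj : Disjoint (source P S.x) (target P S.x)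
  source_sub : source P S.x ⊆ S.nodes
  target_disj : Disjoint S.nodes (target P S.x)
  mate : ∀ {a b s}, Mate S.x a b s → (.row a s ∈ S.nodes ↔ .col b s ∈ S.nodes)

variable {P : PartMatrix F μ ν} {k : ℕ} {S : State F μ ν} {ε : ℝ}

open Classical in
lemma dualPotential_row (S : State F μ ν) (ε : ℝ) (a : Fin μ) (s : Bool) :
    (dualPotential S ε).row a (S.x.L.U a s) =
      S.x.p.row a (S.x.L.U a s) + if .row a s ∈ S.nodes then ε else 0 := by
  cases s
  · simp [dualPotential, (S.x.L.U_ne a).symm]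
  · simp [dualPotential]

open Classical in
lemma dualPotential_col (S : State F μ ν) (ε : ℝ) (b : Fin ν) (s : Bool) :
    (dualPotential S ε).col b (S.x.L.V b s) =
      S.x.p.col b (S.x.L.V b s) + if .col b s ∈ S.nodes then 0 else ε := by
  cases s
  · simp [dualPotential, (S.x.L.V_ne b).symm]
  · simp [dualPotential]

lemma dualPotential_reg (S : State F μ ν) (ε : ℝ) : IsReg S.x.L (dualPotential S ε) := by
  constructor
  · intro a X h1 h2
    rw [dualPotential_row, dualPotential_row]
    simp [dualPotential, h1, h2]
  · intro a X h1 h2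
    rw [dualPotential_col, dualPotential_col]
    simp [dualPotential, h1, h2]

lemma IsReg.exists_row {L : Labeling F μ ν} {p : Potential F μ ν} (h : IsReg L p)
    {B : Matrix (Fin 2) (Fin 2) F} {a : Fin μ} {X Y : Line F} (ho : ¬ Orth B X Y) :
    ∃ s, ¬ Orth B (L.U a s) Y ∧ p.row a (L.U a s) ≤ p.row a X := by
  by_cases h1 : X = L.U a true
  · exact ⟨true, h1 ▸ ho, h1 ▸ le_rfl⟩
  by_cases h2 : X = L.U a false
  · exact ⟨false, h2 ▸ ho, h2 ▸ le_rfl⟩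
  rw [h.row a X h1 h2]
  by_contra hcon
  push Not at hcon
  refine ho (Orth.of_left (L.U_ne a) ?_ ?_ _)
  · by_contra ho'
    exact absurd (hcon true ho') (not_lt.2 (le_max_left _ _))
  · by_contra ho'
    exact absurd (hcon false ho') (not_lt.2 (le_max_right _ _))

lemma IsReg.exists_col {L : Labeling F μ ν} {p : Potential F μ ν} (h : IsReg L p)
    {B : Matrix (Fin 2) (Fin 2) F} {b : Fin ν} {X : Submodule F (Fin 2 → F)} {Y : Line F}
    (ho : ¬ Orth B X Y) :
    ∃ s, ¬ Orth B X (L.V b s) ∧ p.col b (L.V b s) ≤ p.col b Y := by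
  by_cases h1 : Y = L.V b true
  · exact ⟨true, h1 ▸ ho, h1 ▸ le_rfl⟩
  by_cases h2 : Y = L.V b false
  · exact ⟨false, h2 ▸ ho, h2 ▸ le_rfl⟩
  rw [h.col b Y h1 h2]
  by_contra hcon
  push Not at hcon
  refine ho (Orth.of_right (L.V_ne b) ?_ ?_ _)
  · by_contra ho'
    exact absurd (hcon true ho') (not_lt.2 (le_max_left _ _))
  · by_contra ho'
    exact absurd (hcon false ho') (not_lt.2 (le_max_right _ _))

lemma DualStep.pos (h : Searching P k S) (hd : DualStep P S ε) : 0 < ε := by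
  obtain ⟨b, s, a, s', hb, ha, ho, rfl⟩ := hd.2.1
  have h1 := h.opt.potential.bound a b _ _ ho
  rcases h1.lt_or_eq with h2 | h2
  · linarith
  · exact absurd ⟨⟨ho, h2.symm⟩, hb, ha⟩ (hd.1 b s a s')

/-- Tightness of an edge whose ends are both in the forest, or both outside, is not affected. -/
lemma tightEdge_dual_iff {a : Fin μ} {b : Fin ν} {s t : Bool}
    (h : .row a s ∈ S.nodes ↔ .col b t ∈ S.nodes) :
    TightEdge P (dualConf S ε) a s b t ↔ TightEdge P S.x a s b t := by
  have h1 := dualPotential_row S ε a s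
  have h2 := dualPotential_col S ε b t
  unfold TightEdge
  simp only [dualConf]
  rw [h1, h2]
  by_cases hr : .row a s ∈ S.nodes
  · rw [if_pos hr, if_pos (h.1 hr)]
    refine and_congr_right fun _ => ?_
    ring_nf
  · rw [if_neg hr, if_neg fun hc => hr (h.2 hc)]
    refine and_congr_right fun _ => ?_
    ring_nf

lemma not_tightEdge_dual (h : IsPotential P S.x.c S.x.p) (hε : 0 < ε) {a : Fin μ} {b : Fin ν}
    {s t : Bool} (hr : .row a s ∈ S.nodes) (hc : .col b t ∉ S.nodes) :
    ¬ TightEdge P (dualConf S ε) a s b t := by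
  rintro ⟨ho, ht⟩
  have h1 := dualPotential_row S ε a s
  have h2 := dualPotential_col S ε b t
  rw [if_pos hr] at h1
  rw [if_neg hc] at h2
  simp only [dualConf] at ho ht
  rw [h1, h2] at ht
  have := h.bound a b _ _ ho
  linarith

lemma dual_bound (h : Searching P k S) (hd : DualStep P S ε) {a : Fin μ} {b : Fin ν}
    {s t : Bool} (ho : ¬ Orth (P.A a b) (S.x.L.U a s) (S.x.L.V b t)) :
    (P.d a b : ℝ) ≤ (dualPotential S ε).row a (S.x.L.U a s) +
      (dualPotential S ε).col b (S.x.L.V b t) + (S.x.c - ε) := by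
  rw [dualPotential_row, dualPotential_col]
  have h1 := h.opt.potential.bound a b _ _ ho
  have hε := hd.pos h
  by_cases hr : .row a s ∈ S.nodes
  · rw [if_pos hr]
    split_ifs <;> linarith
  · rw [if_neg hr]
    split_ifs with hc
    · have := hd.2.2 ⟨b, t, a, s, hc, hr, ho, rfl⟩
      linarith
    · linarith

lemma mate_dual_iff {a : Fin μ} {b : Fin ν} {s : Bool} :
    Mate (dualConf S ε) a b s ↔ Mate S.x a b s := Iff.rfl

/-- A dual update preserves optimality. -/
lemma Searching.dual_opt (h : Searching P k S) (hd : DualStep P S ε) :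
    IsOptimal P k (dualConf S ε) := by
  have hε := hd.pos h
  have hpot : IsPotential P (dualConf S ε).c (dualConf S ε).p := by
    refine ⟨fun a X => ?_, fun b Y => ?_, fun a b X Y ho => ?_⟩
    · have h1 : ∀ s, 0 ≤ (dualPotential S ε).row a (S.x.L.U a s) := fun s => by
        rw [dualPotential_row]
        have := h.opt.potential.row_nonneg a (S.x.L.U a s)
        split_ifs <;> linarith
      by_cases hX : X = S.x.L.U a true
      · exact hX ▸ h1 true
      by_cases hX' : X = S.x.L.U a false
      · exact hX' ▸ h1 false
      · exact ((dualPotential_reg S ε).row a X hX hX').symm ▸ le_max_of_le_left (h1 true)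
    · have h1 : ∀ s, 0 ≤ (dualPotential S ε).col b (S.x.L.V b s) := fun s => by
        rw [dualPotential_col]
        have := h.opt.potential.col_nonneg b (S.x.L.V b s)
        split_ifs <;> linarith
      by_cases hX : Y = S.x.L.V b true
      · exact hX ▸ h1 true
      by_cases hX' : Y = S.x.L.V b false
      · exact hX' ▸ h1 false
      · exact ((dualPotential_reg S ε).col b Y hX hX').symm ▸ le_max_of_le_left (h1 true)
    · obtain ⟨s, ho1, hs⟩ := (dualPotential_reg S ε).exists_row (a := a) ho
      obtain ⟨t, ho2, ht⟩ := (dualPotential_reg S ε).exists_col (b := b) ho1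
      have := dual_bound h hd ho2
      simp only [dualConf]
      linarith
  have hm : ∀ a b s, Mate S.x a b s → (P.d a b : ℝ) =
      (dualConf S ε).p.row a (S.x.L.U a s) + (dualConf S ε).p.col b (S.x.L.V b s) +
      (dualConf S ε).c := fun a b s hm =>
    ((tightEdge_dual_iff (h.mate hm)).2 (h.opt.mate_tight hm)).2.symm
  have htight : IsTight P (dualConf S ε) :=
    ⟨fun a b hab => hm a b _ ⟨hab, Or.inl (by simp [dualConf])⟩,
      fun a b hab => hm a b _ ⟨h.opt.pair.subset hab, Or.inr hab⟩⟩
  refine ⟨h.opt.pair, h.opt.size, h.opt.coloring, h.opt.valid, hpot, dualPotential_reg S ε, htight,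
    ?_⟩
  rw [optimal_iff (x := dualConf S ε) h.opt.pair h.opt.coloring htight hpot h.opt.size]
  obtain ⟨h1, h2⟩ := (optimal_iff h.opt.pair h.opt.coloring h.opt.tight h.opt.potential
    h.opt.size).1 h.opt.optimal
  constructor
  · intro a s hu
    have h3 := dualPotential_row S ε a s
    rw [if_neg fun hr => Set.disjoint_left.1 h.target_disj hr (h.opt.unmatched_mem_target hu),
      h1 a s hu, add_zero] at h3
    exact h3
  · intro b s hu
    have h3 := dualPotential_col S ε b s
    rw [if_pos (h.source_sub (h.opt.unmatched_mem_source hu)), h2 b s hu, add_zero] at h3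
    exact h3

/-- Links between two vertices of the forest, or two other vertices, are kept. -/
lemma tstep_dual_iff {z z' : Vertex μ ν} (hz : z ∈ S.nodes ↔ z' ∈ S.nodes) :
    TStep P (dualConf S ε) z z' ↔ TStep P S.x z z' := by
  constructor
  · intro ht
    cases ht with
    | link hl => exact .link ⟨hl.1, hl.2.1, hl.2.2.1, (tightEdge_dual_iff hz).1 hl.2.2.2⟩
    | mate hm => exact .mate hm
  · intro ht
    cases ht with
    | link hl => exact .link ⟨hl.1, hl.2.1, hl.2.2.1, (tightEdge_dual_iff hz).2 hl.2.2.2⟩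
    | mate hm => exact .mate hm

lemma Searching.source_dual_sup (h : Searching P k S) (hd : DualStep P S ε) :
    source P S.x ⊆ source P (dualConf S ε) := by
  intro z hz
  obtain ⟨b, s, hu, hr⟩ := h.opt.mem_source.1 hz
  refine (h.dual_opt hd).mem_source.2 ⟨b, s, hu, ?_⟩
  induction hr using Relation.ReflTransGen.head_induction_on with
  | refl => exact .refl
  | head hst _ ih =>
    have hz' := (h.opt.source_tstep hst).1 hz
    exact .head ((tstep_dual_iff (by simp [h.source_sub hz, h.source_sub hz'])).2 hst) (ih hz')

/-- Vertices of the forest do not enter the source set. -/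
lemma Searching.source_dual_inter (h : Searching P k S) (hd : DualStep P S ε) {z : Vertex μ ν}
    (hz : z ∈ source P (dualConf S ε)) (hF : z ∈ S.nodes) : z ∈ source P S.x := by
  obtain ⟨b, s, hu, hr⟩ := (h.dual_opt hd).mem_source.1 hz
  have : z ∈ source P S.x ∨ z ∉ S.nodes := by
    clear hF hz
    induction hr using Relation.ReflTransGen.head_induction_on with
    | refl => exact Or.inl (h.opt.unmatched_mem_source hu)
    | @head z z' hst _ ih =>
      by_cases hz : z ∈ S.nodes
      · left
        have hz' : z' ∈ S.nodes := by
          cases hst with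
          | link hl =>
            by_contra hc
            exact not_tightEdge_dual h.opt.potential (hd.pos h) hz hc hl.2.2.2
          | mate hm => exact (h.mate hm).2 hz
        exact (h.opt.source_tstep ((tstep_dual_iff (by simp [hz, hz'])).1 hst)).2
          (ih.resolve_right (not_not.2 hz'))
      · exact Or.inr hz
  exact this.resolve_right (not_not.2 hF)

lemma Searching.target_dual_sup (h : Searching P k S) (hd : DualStep P S ε) :
    target P S.x ⊆ target P (dualConf S ε) := by
  intro z hz
  obtain ⟨b, s, hu, hr⟩ := h.opt.mem_target.1 hz
  refine (h.dual_opt hd).mem_target.2 ⟨b, s, hu, ?_⟩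
  induction hr with
  | refl => exact .refl
  | tail _ hst ih =>
    have hz' := (h.opt.target_tstep hst).2 hz
    have n1 := Set.disjoint_right.1 h.target_disj hz
    have n2 := Set.disjoint_right.1 h.target_disj hz'
    exact .tail (ih hz') ((tstep_dual_iff (by simp [n1, n2])).2 hst)

/-- If the target set grows, it meets the forest. -/
lemma Searching.target_dual_sub (h : Searching P k S) (hd : DualStep P S ε)
    (hF : Disjoint S.nodes (target P (dualConf S ε))) :
    target P (dualConf S ε) ⊆ target P S.x := by
  intro z hz
  obtain ⟨b, s, hu, hr⟩ := (h.dual_opt hd).mem_target.1 hz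
  refine h.opt.mem_target.2 ⟨b, s, hu, ?_⟩
  induction hr with
  | refl => exact .refl
  | tail _ hst ih =>
    have hz' := ((h.dual_opt hd).target_tstep hst).2 hz
    have n1 := Set.disjoint_right.1 hF hz
    have n2 := Set.disjoint_right.1 hF hz'
    exact .tail (ih hz') ((tstep_dual_iff (by simp [n1, n2])).1 hst)

lemma Searching.target_grows_iff (h : Searching P k S) (hd : DualStep P S ε) :
    target P S.x ⊂ target P (dualConf S ε) ↔ ¬ Disjoint S.nodes (target P (dualConf S ε)) := by
  constructor
  · intro hs hF
    exact hs.2 (h.target_dual_sub hd hF)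
  · intro hF
    refine ⟨h.target_dual_sup hd, fun hs => hF (h.target_disj.mono_right hs)⟩

lemma Searching.exists_row_target (h : Searching P k S) (hd : DualStep P S ε)
    (hdis : Disjoint (source P (dualConf S ε)) (target P (dualConf S ε)))
    (hF : ¬ Disjoint S.nodes (target P (dualConf S ε))) :
    ∃ a s, .row a s ∈ S.nodes ∧ .row a s ∈ target P (dualConf S ε) := by
  obtain ⟨z, hz, hz'⟩ := Set.not_disjoint_iff.1 hF
  rcases z with ⟨a, s⟩ | ⟨b, s⟩
  · exact ⟨a, s, hz, hz'⟩
  · have : ∃ a, Mate S.x a b s := by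
      by_contra hu
      push Not at hu
      exact Set.disjoint_left.1 hdis ((h.dual_opt hd).unmatched_mem_source hu) hz'
    obtain ⟨a, hm⟩ := this
    exact ⟨a, s, (h.mate hm).2 hz, ((h.dual_opt hd).target_tstep (.mate hm)).1 hz'⟩

/-- The state after a dual update with which the search goes on. -/
lemma Searching.dual (h : Searching P k S) (hd : DualStep P S ε)
    (hdis : Disjoint (source P (dualConf S ε)) (target P (dualConf S ε)))
    (ht : ¬ target P S.x ⊂ target P (dualConf S ε)) (E : Set (Sym2 (Vertex μ ν))) :
    Searching P k ⟨dualConf S ε, S.nodes ∪ source P (dualConf S ε), E⟩ := by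
  rw [h.target_grows_iff hd, not_not] at ht
  refine ⟨h.dual_opt hd, hdis, Set.subset_union_right, Set.disjoint_union_left.2 ⟨ht, hdis⟩, ?_⟩
  intro a b s hm
  have h1 := h.mate hm
  have h2 := (h.dual_opt hd).source_tstep (TStep.mate (P := P) (mate_dual_iff.2 hm))
  simp only [Set.mem_union, h1, h2]

/-- After a dual update, the forest can grow, or it has already gained a row vertex and a column
vertex. -/
lemma Searching.dual_progress (h : Searching P k S) (hd : DualStep P S ε)
    (hdis : Disjoint (source P (dualConf S ε)) (target P (dualConf S ε)))
    (E : Set (Sym2 (Vertex μ ν))) :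
    (∃ b s a s', Leaves P ⟨dualConf S ε, S.nodes ∪ source P (dualConf S ε), E⟩ b s a s') ∨
      (∃ a s, .row a s ∉ S.nodes ∧ .row a s ∈ source P (dualConf S ε)) ∧
        ∃ b s, .col b s ∉ S.nodes ∧ .col b s ∈ source P (dualConf S ε) := by
  obtain ⟨b, s, a, s', hb, ha, ho, hε⟩ := hd.2.1
  by_cases hs : .row a s' ∈ source P (dualConf S ε)
  · right
    refine ⟨⟨a, s', ha, hs⟩, ?_⟩
    have : ∃ b', Mate S.x a b' s' := by
      by_contra hu
      push Not at hu
      exact Set.disjoint_left.1 hdis hs ((h.dual_opt hd).unmatched_mem_target hu)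
    obtain ⟨b', hm⟩ := this
    exact ⟨b', s', fun hc => ha ((h.mate hm).2 hc),
      ((h.dual_opt hd).source_tstep (TStep.mate (P := P) (mate_dual_iff.2 hm))).2 hs⟩
  · left
    refine ⟨b, s, a, s', ⟨ho, ?_⟩, Or.inl hb, fun hc => hc.elim ha hs⟩
    have h1 := dualPotential_row S ε a s'
    have h2 := dualPotential_col S ε b s
    rw [if_neg ha] at h1
    rw [if_pos hb] at h2
    simp only [dualConf]
    rw [h1, h2]
    linarith

end

/-! ### Paths in the forest -/

section

/-- A chain without repetitions that starts at a vertex without parent goes from parents to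
children, provided that adjacent vertices are parent and child in one order or the other and that
parents are unique. -/
lemma isChain_parent {V : Type*} {Par : V → V → Prop}
    (huniq : ∀ {v w w'}, Par v w → Par v w' → w = w') :
    ∀ {l : List V} {v : V}, (v :: l).IsChain (fun v w => Par w v ∨ Par v w) → (v :: l).Nodup →
      (∀ w ∈ l, ¬ Par v w) → (v :: l).IsChain (fun v w => Par w v)
  | [], _, _, _, _ => by simp
  | w :: l, v, hc, hn, hv => by
    rw [List.isChain_cons_cons] at hc ⊢
    have h1 : Par w v := hc.1.resolve_right (hv w (by simp))
    refine ⟨h1, isChain_parent (Par := Par) huniq hc.2 (List.nodup_cons.1 hn).2 fun z hz hwz => ?_⟩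
    have := huniq h1 hwz
    subst this
    exact (List.nodup_cons.1 hn).1 (List.mem_cons_of_mem _ hz)

variable {F : Type u} [Field F] {μ ν : ℕ}

/-- `pr` assigns parents to the row vertices in `G`: the parent of `a^s` is adjacent to it either
over an edge outside `M`, subject to the condition that outer paths require, or by a link. -/
structure IsParents (P : PartMatrix F μ ν) (x : Conf F μ ν) (G : Fin μ → Bool → Prop)
    (pr : Fin μ → Bool → Fin ν × Bool) : Prop where
  not_source : ∀ {a s}, G a s → .row a s ∉ source P x
  tight : ∀ {a s}, G a s → TightEdge P x a s (pr a s).1 (pr a s).2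
  kind : ∀ {a s}, G a s →
    ((a, (pr a s).1) ∉ x.M ∧ ∀ b', (a, b') ∈ x.I →
      Orth (P.A a (pr a s).1) (x.L.U a (!s)) (x.L.V (pr a s).1 (pr a s).2)) ∨
    (Link P x a (pr a s).1 s ∧ (pr a s).2 = s)

/-- The parent relation of the forest: the parent of a column vertex is its mate. -/
inductive IsParent (x : Conf F μ ν) (G : Fin μ → Bool → Prop)
    (pr : Fin μ → Bool → Fin ν × Bool) : Vertex μ ν → Vertex μ ν → Prop
  | row {a : Fin μ} {s : Bool} (h : G a s) :
      IsParent x G pr (.row a s) (.col (pr a s).1 (pr a s).2)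
  | col {a : Fin μ} {b : Fin ν} {s : Bool} (h : G a s) (hm : Mate x a b s) :
      IsParent x G pr (.col b s) (.row a s)

variable {P : PartMatrix F μ ν} {k : ℕ} {x : Conf F μ ν} {G : Fin μ → Bool → Prop}
  {pr : Fin μ → Bool → Fin ν × Bool}

lemma IsOptimal.isParent_unique (h : IsOptimal P k x) {v w w' : Vertex μ ν}
    (h1 : IsParent x G pr v w) (h2 : IsParent x G pr v w') : w = w' := by
  cases h1 with
  | row h1 => cases h2 with | row h2 => rfl
  | col h1 hm => cases h2 with | col h2 hm' => rw [h.mate_col hm hm']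

lemma IsParents.not_isParent (hG : IsParents P x G pr) (h : IsOptimal P k x) {v w : Vertex μ ν}
    (hv : v ∈ source P x) : ¬ IsParent x G pr v w := by
  intro h1
  cases h1 with
  | row h1 => exact hG.not_source h1 hv
  | col h1 hm => exact hG.not_source h1 ((h.source_tstep (.mate hm)).1 hv)

/-- An outer path that begins with an edge into an `I`-edge is extended by these two edges. -/
lemma AltConcat.cons_outer {b : Fin ν} {s : Bool} {a : Fin μ} {s' : Bool} {b' : Fin ν}
    {R : List (Vertex μ ν)} (h_tight : TightEdge P x a s' b s) (h_M : (a, b) ∉ x.M)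
    (h_I : (a, b') ∈ x.I) (h_tight' : TightEdge P x a s' b' s')
    (h_orth : Orth (P.A a b) (x.L.U a (!s')) (x.L.V b s))
    (h : AltConcat P x (.col b' s' :: R))
    (hn : (Vertex.col b s :: .row a s' :: .col b' s' :: R).Nodup) :
    AltConcat P x (.col b s :: .row a s' :: .col b' s' :: R) := by
  generalize hR : Vertex.col b' s' :: R = R' at h hn ⊢
  cases h with
  | outer _ h =>
    subst hR
    exact .outer _ ⟨.cons b s a s' b' R h_tight h_M h_I h_tight' h_orth h.1, hn⟩
  | cons R₀ Q R₁ t h_outer h_inner h_join h_join' h_rest =>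
    obtain ⟨R₀', rfl⟩ : ∃ R₀', R₀ = .col b' s' :: R₀' := by
      rcases R₀ with _ | ⟨z, R₀'⟩
      · cases h_outer.1
      · simp only [List.cons_append, List.cons.injEq] at hR
        exact ⟨R₀', by rw [hR.1]⟩
    have hn' : (Vertex.col b s :: .row a s' :: .col b' s' :: R₀').Nodup := by
      refine hn.sublist ?_
      simp only [List.cons_append, List.append_assoc]
      exact (((List.sublist_append_left _ _).cons_cons _).cons_cons _).cons_cons _
    have := AltConcat.cons (.col b s :: .row a s' :: .col b' s' :: R₀') Q R₁ t
      ⟨.cons b s a s' b' R₀' h_tight h_M h_I h_tight' h_orth h_outer.1, hn'⟩ h_inner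
      (by simpa using h_join) h_join' h_rest
    simpa using this

/-- A list of vertices ends with a row vertex that is reached from outside `M`. -/
def EndsOuter (x : Conf F μ ν) (pr : Fin μ → Bool → Fin ν × Bool) (R : List (Vertex μ ν)) : Prop :=
  ∃ a s, R.getLast? = some (.row a s) ∧ (a, (pr a s).1) ∉ x.M

lemma EndsOuter.tail {z z' : Vertex μ ν} {R : List (Vertex μ ν)}
    (h : EndsOuter x pr (z :: z' :: R)) : EndsOuter x pr (z' :: R) := by
  obtain ⟨a, s, h1, h2⟩ := h
  exact ⟨a, s, by rwa [List.getLast?_cons_cons] at h1, h2⟩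

/-- A descending path of the forest alternates between outer and inner paths. The two statements are
about a rest of the path that starts with an edge outside `M`, and about one that starts within an
inner path, with the edge between a row vertex and its mate. -/
lemma altConcat_of_descending (h : IsOptimal P k x) (hG : IsParents P x G pr) :
    ∀ n : ℕ, (∀ (a : Fin μ) (s : Bool) (tl : List (Vertex μ ν)), tl.length < n →
      (Vertex.col (pr a s).1 (pr a s).2 :: .row a s :: tl).IsChain
        (fun v w => IsParent x G pr w v) →
      (Vertex.col (pr a s).1 (pr a s).2 :: .row a s :: tl).Nodup →
      EndsOuter x pr (.row a s :: tl) → (a, (pr a s).1) ∉ x.M →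
      AltConcat P x (.col (pr a s).1 (pr a s).2 :: .row a s :: tl)) ∧
    (∀ (a : Fin μ) (b : Fin ν) (s : Bool) (tl : List (Vertex μ ν)), tl.length < n →
      (Vertex.row a s :: .col b s :: tl).IsChain (fun v w => IsParent x G pr w v) →
      (Vertex.row a s :: .col b s :: tl).Nodup →
      EndsOuter x pr (.col b s :: tl) → (a, b) ∉ x.I → Mate x a b s →
      ∃ Q R, IsInnerPath P x s Q ∧ Q.head? = some (.row a s) ∧ Q.getLast? = R.head? ∧
        AltConcat P x R ∧ .row a s :: .col b s :: tl = Q ++ R.tail) := by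
  intro n
  induction n with
  | zero => exact ⟨fun _ _ _ hn => absurd hn (by omega), fun _ _ _ _ hn => absurd hn (by omega)⟩
  | succ n ih =>
    obtain ⟨ih1, ih2⟩ := ih
    constructor
    · intro a s tl hlen hc hn he hM
      rw [List.isChain_cons_cons] at hc
      have hGa : G a s := by
        have := hc.1
        generalize hp : Vertex.col (pr a s).1 (pr a s).2 = z at this
        cases this
        assumption
      rcases tl with _ | ⟨z, tl⟩
      · exact .outer _ ⟨.last _ _ _ _ (hG.tight hGa) hM, hn⟩
      have hc2 := hc.2
      rw [List.isChain_cons_cons] at hc2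
      have hz := hc2.1
      cases hz with
      | @col _ b' _ _ hm =>
      have he' := he.tail
      have hnl := (List.nodup_cons.1 hn).2
      by_cases hI : (a, b') ∈ x.I
      · have horth := ((hG.kind hGa).resolve_right (fun hl =>
          hl.1.2.1 (h.isolated_row hI hl.1.1 ▸ hI))).2 b' hI
        refine AltConcat.cons_outer (hG.tight hGa) hM hI (h.mate_tight hm) horth ?_ hn
        rcases tl with _ | ⟨z, tl⟩
        · obtain ⟨a1, s1, h1, -⟩ := he'
          simp at h1
        have hz := hc2.2
        rw [List.isChain_cons_cons] at hz
        generalize hp : Vertex.col b' s = y at hz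
        obtain ⟨hz1, hz2⟩ := hz
        cases hz1 with
        | @col a1 b1 s1 hGa2 hm2 => cases hp
        | @row a2 s2 hGa2 =>
        simp only [Vertex.col.injEq] at hp
        obtain ⟨hp1, hp2⟩ := hp
        have hM2 : (a2, (pr a2 s2).1) ∉ x.M := by
          rcases hG.kind hGa2 with hk | hk
          · exact hk.1
          · rw [← hp1] at hk
            have := h.isolated_col hI hk.1.1
            subst this
            exact absurd hI hk.1.2.1
        refine ih1 a2 s2 tl (by simp at hlen; omega) ?_ ?_ he'.tail hM2
        · rw [← hp1, ← hp2]; exact hc2.2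
        · rw [← hp1, ← hp2]; exact (List.nodup_cons.1 hnl).2
      · obtain ⟨Q, R, hQ, hQ1, hQ2, hR, heq⟩ := ih2 a b' s tl (by simp at hlen; omega) hc.2 hnl he'
          hI hm
        have := AltConcat.cons [.col (pr a s).1 (pr a s).2, .row a s] Q R s
          ⟨.last _ _ _ _ (hG.tight hGa) hM, hn.sublist (by simp)⟩ hQ (by simp [hQ1]) hQ2 hR
        obtain ⟨Q', rfl⟩ : ∃ Q', Q = .row a s :: Q' := by
          rcases Q with _ | ⟨z, Q'⟩
          · simp at hQ1
          · simp at hQ1; exact ⟨Q', by rw [hQ1]⟩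
        rw [heq]
        simpa using this
    · intro a b s tl hlen hc hn he hI hm
      have hs : x.sgn a b = !s := hm.2.resolve_right hI
      rw [List.isChain_cons_cons] at hc
      have hGa : G a s := by
        have := hc.1
        cases this
        assumption
      rcases tl with _ | ⟨z, tl⟩
      · obtain ⟨a1, s1, h1, -⟩ := he
        simp at h1
      have hz := hc.2
      rw [List.isChain_cons_cons] at hz
      obtain ⟨hz1, hz2⟩ := hz
      generalize hp : Vertex.col b s = y at hz1
      cases hz1 with
      | @col a1 b1 s1 hGa2 hm2 => cases hp
      | @row a2 s2 hGa2 =>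
      simp only [Vertex.col.injEq] at hp
      obtain ⟨hp1, hp2⟩ := hp
      have hnl := (List.nodup_cons.1 hn).2
      rcases hG.kind hGa2 with hk | hk
      · refine ⟨[.row a s, .col b s], .col b s :: .row a2 s2 :: tl, ⟨.last a b
          (Finset.mem_sdiff.2 ⟨hm.1, hI⟩) hs (h.mate_tight hm), by simp⟩, by simp, by simp, ?_,
          by simp [hp1, ← hp2]⟩
        rw [hp1, hp2]
        refine ih1 a2 s2 tl (by simp at hlen; omega) ?_ ?_ he.tail hk.1
        · rw [← hp1, ← hp2]; exact hc.2
        · rw [← hp1, ← hp2]; exact hnl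
      · obtain ⟨hl, hs2⟩ := hk
        rw [← hp2] at hs2
        subst hs2
        rw [← hp1] at hl
        rcases tl with _ | ⟨z, tl⟩
        · obtain ⟨a1, s1, h1, h2⟩ := he
          simp at h1
          obtain ⟨rfl, rfl⟩ := h1
          exact absurd (hp1 ▸ hl.1) h2
        rw [List.isChain_cons_cons] at hz2
        have hz3 := hz2.1
        cases hz3 with
        | @col _ b3 _ _ hm3 =>
        have hI3 : (a2, b3) ∉ x.I := by
          intro hI3
          have := h.isolated_row hI3 hl.1
          subst this
          exact hl.2.1 hI3
        obtain ⟨Q, R, hQ, hQ1, hQ2, hR, heq⟩ := ih2 a2 b3 s tl (by simp at hlen; omega)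
          (by rw [List.isChain_cons_cons]; exact hz2) (List.nodup_cons.1 hnl).2 he.tail.tail hI3 hm3
        obtain ⟨Q', rfl⟩ : ∃ Q', Q = .row a2 s :: Q' := by
          rcases Q with _ | ⟨z, Q'⟩
          · simp at hQ1
          · simp at hQ1; exact ⟨Q', by rw [hQ1]⟩
        refine ⟨.row a s :: .col b s :: .row a2 s :: Q', R, ⟨.cons a b a2 Q'
          (Finset.mem_sdiff.2 ⟨hm.1, hI⟩) hs (h.mate_tight hm)
          (Finset.mem_sdiff.2 ⟨hl.1, hl.2.1⟩) hl.2.2.1 hl.2.2.2 hQ.1, ?_⟩, by simp,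
          by simpa using hQ2, hR, by simp [heq, hp1, ← hp2]⟩
        refine hn.sublist ?_
        rw [heq]
        exact (List.sublist_append_left _ _).cons_cons _ |>.cons_cons _

/-- Paths of the forest from the source set to the target set are augmenting if their last vertex
is a row vertex reached from outside `M`. -/
lemma IsParents.isAugmentingPath (hG : IsParents P x G pr) (h : IsOptimal P k x)
    (hdis : Disjoint (source P x) (target P x)) {R : List (Vertex μ ν)}
    (hc : R.IsChain fun v w => IsParent x G pr w v ∨ IsParent x G pr v w) (hn : R.Nodup)
    (hf : ∃ z ∈ source P x, R.head? = some z) (hl : ∃ z ∈ target P x, R.getLast? = some z)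
    (ho : EndsOuter x pr R) :
    IsAugmentingPath P x R := by
  refine ⟨?_, hn, hf, hl⟩
  obtain ⟨z, hz, hz'⟩ := hf
  rcases R with _ | ⟨z1, R⟩
  · simp at hz'
  simp only [List.head?_cons, Option.some.injEq] at hz'
  subst hz'
  have hc' := isChain_parent (Par := IsParent x G pr) h.isParent_unique hc hn (fun w _ => hG.not_isParent h hz)
  rcases R with _ | ⟨z2, R⟩
  · obtain ⟨y, hy, hy'⟩ := hl
    simp at hy'
    subst hy'
    exact absurd hy (Set.disjoint_left.1 hdis hz)
  have h1 := hc'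
  rw [List.isChain_cons_cons] at h1
  have h2 := h1.1
  cases h2 with
  | @col a b s hGa hm => exact absurd hz (hG.not_source hGa)
  | @row a s hGa =>
    refine (altConcat_of_descending h hG (R.length + 1)).1 a s R (by omega) hc' hn ho.tail ?_
    rcases hG.kind hGa with hk | hk
    · exact hk.1
    · rw [hk.2] at hz
      exact absurd ((h.source_tstep (.link hk.1)).2 hz) (hG.not_source hGa)

end

/-! ### The forest -/

section

variable {F : Type u} [Field F] {μ ν : ℕ}

/-- The row vertex `a^s` has been added to the forest with a parent. -/
def Planted (P : PartMatrix F μ ν) (S : State F μ ν) (a : Fin μ) (s : Bool) : Prop :=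
  .row a s ∈ S.nodes ∧ .row a s ∉ source P S.x

/-- The number of row vertices in the forest. -/
noncomputable def rowCount (S : State F μ ν) : ℕ :=
  {i : Fin μ × Bool | Vertex.row i.1 i.2 ∈ S.nodes}.ncard

/-- The number of column vertices in the forest. -/
noncomputable def colCount (S : State F μ ν) : ℕ :=
  {i : Fin ν × Bool | Vertex.col i.1 i.2 ∈ S.nodes}.ncard

/-- The edges of `S` join every row vertex that is not a root to its parent, given by `pr`, and
every column vertex that is not a root to its mate. The numbers `dep` decrease on the way to a
root. -/
structure Forest (P : PartMatrix F μ ν) (S : State F μ ν) (pr : Fin μ → Bool → Fin ν × Bool)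
    (dep : Fin μ → Bool → ℕ) : Prop where
  edge : ∀ {a s b t}, s(Vertex.row a s, Vertex.col b t) ∈ S.edges ↔
    Planted P S a s ∧ (pr a s = (b, t) ∨ s = t ∧ Mate S.x a b s)
  bip : ∀ z ∈ S.edges, ∃ a s b t, z = s(Vertex.row a s, Vertex.col b t)
  parents : IsParents P S.x (Planted P S) pr
  mem : ∀ {a s}, Planted P S a s → .col (pr a s).1 (pr a s).2 ∈ S.nodes
  dep_lt : ∀ {a s a'}, Planted P S a s → Planted P S a' (pr a s).2 →
    Mate S.x a' (pr a s).1 (pr a s).2 → dep a' (pr a s).2 < dep a s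
  dep_le : ∀ {a s}, Planted P S a s → dep a s ≤ rowCount S

variable {P : PartMatrix F μ ν} {k : ℕ} {S : State F μ ν} {pr : Fin μ → Bool → Fin ν × Bool}
  {dep : Fin μ → Bool → ℕ} {ε : ℝ}

lemma rowCount_le_two_mul (S : State F μ ν) : rowCount S ≤ 2 * μ := by
  have := Set.ncard_le_ncard (Set.subset_univ {i : Fin μ × Bool | Vertex.row i.1 i.2 ∈ S.nodes})
  rw [Set.ncard_univ, Nat.card_eq_fintype_card] at this
  simp at this
  unfold rowCount
  omega

lemma colCount_le_two_mul (S : State F μ ν) : colCount S ≤ 2 * ν := by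
  have := Set.ncard_le_ncard (Set.subset_univ {i : Fin ν × Bool | Vertex.col i.1 i.2 ∈ S.nodes})
  rw [Set.ncard_univ, Nat.card_eq_fintype_card] at this
  simp at this
  unfold colCount
  omega

lemma rowCount_mono {S' : State F μ ν} (h : S.nodes ⊆ S'.nodes) : rowCount S ≤ rowCount S' :=
  Set.ncard_le_ncard fun _ hi => h hi

lemma rowCount_lt {S' : State F μ ν} (h : S.nodes ⊆ S'.nodes) {a : Fin μ} {s : Bool}
    (h1 : .row a s ∉ S.nodes) (h2 : .row a s ∈ S'.nodes) : rowCount S < rowCount S' :=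
  Set.ncard_lt_ncard ⟨fun _ hi => h hi, fun hs => h1 (hs (a := (a, s)) h2)⟩

lemma colCount_mono {S' : State F μ ν} (h : S.nodes ⊆ S'.nodes) : colCount S ≤ colCount S' :=
  Set.ncard_le_ncard fun _ hi => h hi

lemma colCount_lt {S' : State F μ ν} (h : S.nodes ⊆ S'.nodes) {b : Fin ν} {s : Bool}
    (h1 : .col b s ∉ S.nodes) (h2 : .col b s ∈ S'.nodes) : colCount S < colCount S' :=
  Set.ncard_lt_ncard ⟨fun _ hi => h hi, fun hs => h1 (hs (a := (b, s)) h2)⟩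

lemma Searching.init (h : IsOptimal P k S.x) (hr : ∀ C σ, ¬ IsRearrangeable P S.x C σ) :
    Searching P k (initState P S.x) where
  opt := h
  disj := h.not_rearrangeable_iff.1 hr
  source_sub := subset_rfl
  target_disj := h.not_rearrangeable_iff.1 hr
  mate hm := ((h.source_tstep (.mate hm)).symm)

lemma not_planted_init (x : Conf F μ ν) (a : Fin μ) (s : Bool) :
    ¬ Planted P (initState P x) a s := fun h => h.2 h.1

lemma Forest.init (x : Conf F μ ν) (pr : Fin μ → Bool → Fin ν × Bool) :
    Forest P (initState P x) pr (fun _ _ => 0) where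
  edge := by simp [initState, Planted]
  bip := by simp [initState]
  parents := ⟨fun h => h.2, fun h => absurd h (not_planted_init _ _ _),
    fun h => absurd h (not_planted_init _ _ _)⟩
  mem h := absurd h (not_planted_init _ _ _)
  dep_lt h := absurd h (not_planted_init _ _ _)
  dep_le _ := Nat.zero_le _

/-- The state after the row vertex `a^t`, with parent `b^s`, and its mate `b'^t` are added. -/
def grown (S : State F μ ν) (b : Fin ν) (s : Bool) (a : Fin μ) (t : Bool) (b' : Fin ν) :
    State F μ ν where
  x := S.x
  nodes := S.nodes ∪ {.row a t, .col b' t}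
  edges := S.edges ∪ {s(.col b s, .row a t), s(.row a t, .col b' t)}

/-- What makes `b^s` an admissible parent of `a^t`. -/
def Admissible (P : PartMatrix F μ ν) (x : Conf F μ ν) (b : Fin ν) (s : Bool) (a : Fin μ)
    (t : Bool) : Prop :=
  ((a, b) ∉ x.M ∧ ∀ b', (a, b') ∈ x.I → Orth (P.A a b) (x.L.U a (!t)) (x.L.V b s)) ∨
    (Link P x a b t ∧ s = t)

lemma Searching.grow (h : Searching P k S) {b : Fin ν} {s : Bool} {a : Fin μ} {t : Bool}
    {b' : Fin ν} (hT : .row a t ∉ target P S.x) (hm : Mate S.x a b' t) :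
    Searching P k (grown S b s a t b') where
  opt := h.opt
  disj := h.disj
  source_sub := h.source_sub.trans Set.subset_union_left
  target_disj := by
    refine Set.disjoint_union_left.2 ⟨h.target_disj, ?_⟩
    rw [Set.disjoint_left]
    rintro z (rfl | rfl) hz
    · exact hT hz
    · exact hT ((h.opt.target_tstep (.mate hm)).1 hz)
  mate := by
    intro a1 b1 s1 hm1
    have h1 := h.mate hm1
    simp only [grown, Set.mem_union, Set.mem_insert_iff, Set.mem_singleton_iff, h1,
      Vertex.row.injEq, Vertex.col.injEq, reduceCtorEq, or_false, false_or]
    refine or_congr_right ⟨?_, ?_⟩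
    · rintro ⟨rfl, rfl⟩; exact ⟨h.opt.mate_row hm1 hm, rfl⟩
    · rintro ⟨rfl, rfl⟩; exact ⟨h.opt.mate_col hm1 hm, rfl⟩

lemma planted_grown_iff (h : Searching P k S) {b : Fin ν} {s : Bool} {a : Fin μ} {t : Bool}
    {b' : Fin ν} (hF : .row a t ∉ S.nodes) {a1 : Fin μ} {s1 : Bool} :
    Planted P (grown S b s a t b') a1 s1 ↔ Planted P S a1 s1 ∨ (a1 = a ∧ s1 = t) := by
  simp only [Planted, grown, Set.mem_union, Set.mem_insert_iff, Set.mem_singleton_iff,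
    Vertex.row.injEq, reduceCtorEq, or_false]
  constructor
  · rintro ⟨h1 | h1, h2⟩
    · exact Or.inl ⟨h1, h2⟩
    · exact Or.inr h1
  · rintro (h1 | ⟨rfl, rfl⟩)
    · exact ⟨Or.inl h1.1, h1.2⟩
    · exact ⟨Or.inr ⟨rfl, rfl⟩, fun h1 => hF (h.source_sub h1)⟩

/-- A row vertex with an admissible parent can be added together with its mate. The number of row
vertices serves as its depth. -/
lemma Forest.grow (hf : Forest P S pr dep) (h : Searching P k S) {b : Fin ν} {s : Bool} {a : Fin μ}
    {t : Bool} {b' : Fin ν} (hF : .row a t ∉ S.nodes) (hb : .col b s ∈ S.nodes)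
    (ht : TightEdge P S.x a t b s) (hadm : Admissible P S.x b s a t) (hm : Mate S.x a b' t) :
    Forest P (grown S b s a t b') (fun a1 s1 => if a1 = a ∧ s1 = t then (b, s) else pr a1 s1)
      (fun a1 s1 => if a1 = a ∧ s1 = t then rowCount S + 1 else dep a1 s1) := by
  have hpl := fun {a1 s1} => planted_grown_iff (b := b) (s := s) (b' := b') h hF
    (a1 := a1) (s1 := s1)
  have hne : ∀ {a1 s1}, Planted P S a1 s1 → ¬ (a1 = a ∧ s1 = t) := by
    rintro a1 s1 hp ⟨rfl, rfl⟩; exact hF hp.1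
  have hx : (grown S b s a t b').x = S.x := rfl
  refine ⟨?_, ?_, ⟨?_, ?_, ?_⟩, ?_, ?_, ?_⟩
  · intro a1 s1 b1 t1
    rw [hpl, hx]
    simp only [grown, Set.mem_union, hf.edge, Set.mem_insert_iff, Set.mem_singleton_iff,
      Sym2.eq_iff, Vertex.row.injEq, Vertex.col.injEq, reduceCtorEq, and_false,
      false_or, or_false]
    by_cases he : a1 = a ∧ s1 = t
    · obtain ⟨rfl, rfl⟩ := he
      have h1 : ¬ Planted P S a1 s1 := fun hp => hF hp.1
      simp only [h1, and_self, if_true, Prod.mk.injEq, true_and, false_and, false_or]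
      constructor
      · rintro (⟨rfl, rfl⟩ | ⟨rfl, rfl⟩)
        · exact Or.inl ⟨rfl, rfl⟩
        · exact Or.inr ⟨rfl, hm⟩
      · rintro (⟨rfl, rfl⟩ | ⟨rfl, hm1⟩)
        · exact Or.inl ⟨rfl, rfl⟩
        · exact Or.inr ⟨h.opt.mate_row hm1 hm, rfl⟩
    · simp only [he, if_false, or_false, false_and, or_self]
  · rintro z (hz | rfl | rfl)
    · exact hf.bip z hz
    · exact ⟨a, t, b, s, Sym2.eq_swap⟩
    · exact ⟨a, t, b', t, rfl⟩
  · intro a1 s1 hp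
    exact hp.2
  · intro a1 s1 hp
    rcases hpl.1 hp with hp | ⟨rfl, rfl⟩
    · simp only [if_neg (hne hp)]; exact hf.parents.tight hp
    · simp only [and_self, if_true]; exact ht
  · intro a1 s1 hp
    rcases hpl.1 hp with hp | ⟨rfl, rfl⟩
    · simp only [if_neg (hne hp)]; exact hf.parents.kind hp
    · simp only [and_self, if_true]; exact hadm
  · intro a1 s1 hp
    rcases hpl.1 hp with hp | ⟨rfl, rfl⟩
    · simp only [if_neg (hne hp)]; exact Or.inl (hf.mem hp)
    · simp only [and_self, if_true]; exact Or.inl hb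
  · intro a1 s1 a2 hp hp2 hm2
    rw [hx] at hm2
    -- the vertex `a^t` is not the mate of a vertex of the forest
    have hc : Vertex.col (μ := μ) (if a1 = a ∧ s1 = t then (b, s) else pr a1 s1).1
        (if a1 = a ∧ s1 = t then (b, s) else pr a1 s1).2 ∈ S.nodes := by
      split_ifs with he
      · exact hb
      · exact hf.mem ((hpl.1 hp).resolve_right he)
    have h2 := (h.mate hm2).2 hc
    have hp2' := (hpl.1 hp2).resolve_right (fun he => by
      rw [he.1, he.2] at h2; exact hF h2)
    rw [if_neg (hne hp2')]
    by_cases he : a1 = a ∧ s1 = t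
    · simp only [if_pos he]
      have := hf.dep_le hp2'
      rw [if_pos he] at this
      exact Nat.lt_succ_of_le this
    · simp only [if_neg he] at *
      exact hf.dep_lt ((hpl.1 hp).resolve_right he) hp2' hm2
  · intro a1 s1 hp
    have h1 : rowCount S < rowCount (grown S b s a t b') :=
      rowCount_lt (Set.subset_union_left) hF (Or.inr (Or.inl rfl))
    rcases hpl.1 hp with hp | ⟨rfl, rfl⟩
    · simp only [if_neg (hne hp)]; exact (hf.dep_le hp).trans h1.le
    · simp only [and_self, if_true]; exact h1

/-- A vertex over an edge of `I` is not in the target set. -/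
lemma IsOptimal.not_mem_target_of_I {x : Conf F μ ν} (h : IsOptimal P k x) {a : Fin μ} {b : Fin ν}
    (hI : (a, b) ∈ x.I) (t : Bool) : .row a t ∉ target P x := by
  intro hT
  obtain ⟨a', s, hu, hr⟩ := h.mem_target.1 hT
  have hm : Mate x a b t := ⟨h.pair.subset hI, Or.inr hI⟩
  rcases Relation.ReflTransGen.cases_tail hr with he | ⟨y, hy, hst⟩
  · cases he; exact hu b hm
  · cases hst with
    | mate hm' =>
      have := h.mate_row hm' hm
      subst this
      rcases Relation.ReflTransGen.cases_tail hy with he | ⟨y, hy, hst⟩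
      · cases he
      · cases hst with
        | link hl =>
          have := h.isolated_col hI hl.1
          subst this
          exact hl.2.1 hI

/-- A tight edge that leaves the forest over `M` is a link. -/
lemma Leaves.link_of_mem (h : Searching P k S) {b : Fin ν} {s : Bool} {a : Fin μ} {t : Bool}
    (hl : Leaves P S b s a t) (hM : (a, b) ∈ S.x.M) : Link P S.x a b t ∧ s = t := by
  obtain ⟨ht, hb, ha⟩ := hl
  obtain ⟨rfl, hm | hl⟩ := h.opt.mate_or_link hM ht
  · exact absurd ((h.mate hm).2 hb) ha
  · exact ⟨hl, rfl⟩

lemma Leaves.admissible (h : Searching P k S) {b : Fin ν} {s : Bool} {a : Fin μ} {t : Bool}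
    (hl : Leaves P S b s a t) (hI : ∀ b', (a, b') ∉ S.x.I) : Admissible P S.x b s a t := by
  by_cases hM : (a, b) ∈ S.x.M
  · exact Or.inr (hl.link_of_mem h hM)
  · exact Or.inl ⟨hM, fun b' hb' => absurd hb' (hI b')⟩

/-! ### Relabelings -/

section Relabeling

variable {L' : Labeling F μ ν} {b : Fin ν} {s : Bool} {a : Fin μ} {t : Bool} {b' : Fin ν}

/-- The configuration with the labeling replaced. -/
def relabeled (x : Conf F μ ν) (L' : Labeling F μ ν) : Conf F μ ν := { x with L := L' }

lemma IsRelabeling.orth_row {L : Labeling F μ ν} (h : IsRelabeling P L L' b s a t b') :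
    Orth (P.A a b) (L'.U a (!t)) (L.V b s) := fun u hu v hv => (h.row_new u).1 hu v hv

lemma IsRelabeling.orth_col {L : Labeling F μ ν} (h : IsRelabeling P L L' b s a t b') :
    Orth (P.A a b') (L'.U a (!t)) (L'.V b' t) := fun u hu v hv => (h.col_new v).1 hv u hu

lemma IsRelabeling.U_eq {L : Labeling F μ ν} (h : IsRelabeling P L L' b s a t b') :
    L'.U a t = L.U a t := h.row_old a t (by simp)

lemma IsRelabeling.V_eq {L : Labeling F μ ν} (h : IsRelabeling P L L' b s a t b') :
    L'.V b' (!t) = L.V b' (!t) := h.col_old b' (!t) (by simp)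

/-- If the relabeling changes `U_a^{!t}`, then `p` is at least as large there as on `U_a^t`. -/
lemma Searching.relabel_le (h : Searching P k S) (hl : Leaves P S b s a t)
    (hr : IsRelabeling P S.x.L L' b s a t b') (hne : L'.U a (!t) ≠ S.x.L.U a (!t)) :
    S.x.p.row a (S.x.L.U a t) ≤ S.x.p.row a (S.x.L.U a (!t)) := by
  have ho : ¬ Orth (P.A a b) (S.x.L.U a (!t)) (S.x.L.V b s) := by
    intro ho
    exact hne (Line.eq_of_le (X := S.x.L.U a (!t)) (Y := L'.U a (!t))
      fun u hu => (hr.row_new u).2 fun v hv => ho u hu v hv).symm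
  have h1 := h.opt.potential.bound a b _ _ ho
  have h2 := hl.1.2
  linarith

lemma Searching.relabel_le' (h : Searching P k S) (hl : Leaves P S b s a t) (hI : (a, b') ∈ S.x.I)
    (hr : IsRelabeling P S.x.L L' b s a t b') (hne : L'.V b' t ≠ S.x.L.V b' t) :
    S.x.p.col b' (S.x.L.V b' (!t)) ≤ S.x.p.col b' (S.x.L.V b' t) := by
  have hne' : L'.U a (!t) ≠ S.x.L.U a (!t) := by
    intro he
    have ho := h.opt.valid.orth (h.opt.pair.subset hI) (!t)
    rw [Bool.not_not] at ho
    exact hne (Line.eq_of_le (X := S.x.L.V b' t) (Y := L'.V b' t)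
      fun v hv => (hr.col_new v).2 fun u hu => ho u (he ▸ hu) v hv).symm
  have h1 := h.relabel_le hl hr hne'
  have hm : ∀ s, Mate S.x a b' s := fun s => ⟨h.opt.pair.subset hI, Or.inr hI⟩
  have h2 := (h.opt.mate_tight (hm t)).2
  have h3 := (h.opt.mate_tight (hm (!t))).2
  linarith

lemma IsReg.row_eq {L : Labeling F μ ν} {p : Potential F μ ν} (h : IsReg L p) {a : Fin μ}
    {X : Line F} {t : Bool} (h1 : X ≠ L.U a t) (h2 : X ≠ L.U a (!t))
    (hle : p.row a (L.U a t) ≤ p.row a (L.U a (!t))) : p.row a X = p.row a (L.U a (!t)) := by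
  cases t
  · rw [h.row a X h2 h1]; exact max_eq_left hle
  · rw [h.row a X h1 h2]; exact max_eq_right hle

lemma IsReg.col_eq {L : Labeling F μ ν} {p : Potential F μ ν} (h : IsReg L p) {b : Fin ν}
    {X : Line F} {t : Bool} (h1 : X ≠ L.V b t) (h2 : X ≠ L.V b (!t))
    (hle : p.col b (L.V b (!t)) ≤ p.col b (L.V b t)) : p.col b X = p.col b (L.V b t) := by
  cases t
  · rw [h.col b X h2 h1]; exact max_eq_right hle
  · rw [h.col b X h1 h2]; exact max_eq_left hle

/-- The values of `p` on the spaces of the labeling do not change. -/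
lemma Searching.relabel_row (h : Searching P k S) (hl : Leaves P S b s a t)
    (hr : IsRelabeling P S.x.L L' b s a t b') (a1 : Fin μ) (s1 : Bool) :
    S.x.p.row a1 (L'.U a1 s1) = S.x.p.row a1 (S.x.L.U a1 s1) := by
  by_cases he : (a1, s1) = (a, !t)
  · simp only [Prod.mk.injEq] at he
    obtain ⟨rfl, rfl⟩ := he
    by_cases hne : L'.U a1 (!t) = S.x.L.U a1 (!t)
    · rw [hne]
    · refine h.opt.reg.row_eq ?_ hne (h.relabel_le hl hr hne)
      intro he
      exact hl.1.1 (he ▸ hr.orth_row)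
  · rw [hr.row_old a1 s1 he]

lemma Searching.relabel_col_ne (h : Searching P k S) (hl : Leaves P S b s a t)
    (hI : (a, b') ∈ S.x.I) (hr : IsRelabeling P S.x.L L' b s a t b') :
    L'.V b' t ≠ S.x.L.V b' (!t) := by
  intro he
  have h1 := hr.orth_col
  rw [he] at h1
  have h2 := h.opt.valid.orth (h.opt.pair.subset hI) t
  have h3 : L'.U a (!t) ≠ S.x.L.U a t := fun he => hl.1.1 (he ▸ hr.orth_row)
  exact not_orth_of_rank_two' (h.opt.pair.rank_two _ hI) h3 h2 h1

lemma Searching.relabel_col (h : Searching P k S) (hl : Leaves P S b s a t) (hI : (a, b') ∈ S.x.I)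
    (hr : IsRelabeling P S.x.L L' b s a t b') (b1 : Fin ν) (s1 : Bool) :
    S.x.p.col b1 (L'.V b1 s1) = S.x.p.col b1 (S.x.L.V b1 s1) := by
  by_cases he : (b1, s1) = (b', t)
  · simp only [Prod.mk.injEq] at he
    obtain ⟨rfl, rfl⟩ := he
    by_cases hne : L'.V b1 s1 = S.x.L.V b1 s1
    · rw [hne]
    · exact h.opt.reg.col_eq hne (h.relabel_col_ne hl hI hr) (h.relabel_le' hl hI hr hne)
  · rw [hr.col_old b1 s1 he]

/-- The new spaces have the same potential as the ones that they replace, and they are orthogonal to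
the same spaces as far as validity requires it. -/
lemma Searching.relabel_opt (h : Searching P k S) (hl : Leaves P S b s a t) (hI : (a, b') ∈ S.x.I)
    (hr : IsRelabeling P S.x.L L' b s a t b') : IsOptimal P k (relabeled S.x L') := by
  have hrow := h.relabel_row hl hr
  have hcol := h.relabel_col hl hI hr
  refine ⟨h.opt.pair, h.opt.size, h.opt.coloring, ?_, h.opt.potential, ⟨?_, ?_⟩, ⟨?_, ?_⟩, ?_⟩
  · intro a1 b1 hab
    by_cases he : a1 = a
    · subst he
      have := h.opt.isolated_row hI hab
      subst this
      have h1 : Orth (P.A a1 b1) (L'.U a1 t) (L'.V b1 (!t)) := by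
        rw [hr.U_eq, hr.V_eq]; exact h.opt.valid.orth hab t
      have h2 := hr.orth_col
      refine ⟨?_, ?_, fun h3 => ?_⟩
      · cases t
        · exact h2
        · exact h1
      · cases t
        · exact h1
        · exact h2
      · rw [h.opt.pair.rank_two _ hI] at h3; omega
    · have hb : b1 ≠ b' := by
        rintro rfl
        exact he (h.opt.isolated_col hI hab)
      have hU : ∀ s1, L'.U a1 s1 = S.x.L.U a1 s1 := fun s1 => hr.row_old a1 s1 (by simp [he])
      have hV : ∀ s1, L'.V b1 s1 = S.x.L.V b1 s1 := fun s1 => hr.col_old b1 s1 (by simp [hb])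
      have := h.opt.valid a1 b1 hab
      simpa only [relabeled, hU, hV] using this
  · intro a1 X h1 h2
    simp only [relabeled] at *
    rw [hrow, hrow]
    by_cases he : ∃ s1, X = S.x.L.U a1 s1
    · obtain ⟨s1, rfl⟩ := he
      have hs : (a1, s1) = (a, !t) := by
        by_contra hne
        have := hr.row_old a1 s1 hne
        cases s1
        · exact h2 this.symm
        · exact h1 this.symm
      simp only [Prod.mk.injEq] at hs
      obtain ⟨rfl, rfl⟩ := hs
      have hle := h.relabel_le hl hr (fun he => by
        cases t
        · exact h1 he.symm
        · exact h2 he.symm)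
      cases t
      · exact (max_eq_left hle).symm
      · exact (max_eq_right hle).symm
    · push Not at he
      exact h.opt.reg.row a1 X (he true) (he false)
  · intro b1 X h1 h2
    simp only [relabeled] at *
    rw [hcol, hcol]
    by_cases he : ∃ s1, X = S.x.L.V b1 s1
    · obtain ⟨s1, rfl⟩ := he
      have hs : (b1, s1) = (b', t) := by
        by_contra hne
        have := hr.col_old b1 s1 hne
        cases s1
        · exact h2 this.symm
        · exact h1 this.symm
      simp only [Prod.mk.injEq] at hs
      obtain ⟨rfl, rfl⟩ := hs
      have hle := h.relabel_le' hl hI hr (fun he => by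
        cases s1
        · exact h2 he.symm
        · exact h1 he.symm)
      cases s1
      · exact (max_eq_right hle).symm
      · exact (max_eq_left hle).symm
    · push Not at he
      exact h.opt.reg.col b1 X (he true) (he false)
  · intro a1 b1 hab
    simp only [relabeled, hrow, hcol]
    exact h.opt.tight.on_M a1 b1 hab
  · intro a1 b1 hab
    simp only [relabeled, hrow, hcol]
    exact h.opt.tight.on_I a1 b1 hab
  · have : S.x.p.total L' = S.x.p.total S.x.L := by simp [Potential.total, hrow, hcol]
    simp only [relabeled, this]
    exact h.opt.optimal

lemma IsRelabeling.tight_iff (hr : IsRelabeling P S.x.L L' b s a t b') {a1 : Fin μ} {s1 : Bool}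
    {b1 : Fin ν} {t1 : Bool} (h1 : (a1, s1) ≠ (a, !t)) (h2 : (b1, t1) ≠ (b', t)) :
    TightEdge P (relabeled S.x L') a1 s1 b1 t1 ↔ TightEdge P S.x a1 s1 b1 t1 := by
  simp only [TightEdge, relabeled, hr.row_old a1 s1 h1, hr.col_old b1 t1 h2]

lemma Searching.relabel_link_iff (h : Searching P k S) (hl : Leaves P S b s a t)
    (hI : (a, b') ∈ S.x.I) (hr : IsRelabeling P S.x.L L' b s a t b') {a1 : Fin μ} {b1 : Fin ν}
    {s1 : Bool} : Link P (relabeled S.x L') a1 b1 s1 ↔ Link P S.x a1 b1 s1 := by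
  unfold Link
  refine and_congr_right fun hM => and_congr_right fun hI' => and_congr_right fun _ =>
    hr.tight_iff ?_ ?_
  · intro he
    simp only [Prod.mk.injEq] at he
    obtain ⟨rfl, -⟩ := he
    exact hI' (h.opt.isolated_row hI hM ▸ hI)
  · intro he
    simp only [Prod.mk.injEq] at he
    obtain ⟨rfl, -⟩ := he
    exact hI' (h.opt.isolated_col hI hM ▸ hI)

lemma Searching.relabel_tstep (h : Searching P k S) (hl : Leaves P S b s a t)
    (hI : (a, b') ∈ S.x.I) (hr : IsRelabeling P S.x.L L' b s a t b') :
    TStep P S.x = TStep P (relabeled S.x L') := by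
  ext z z'
  constructor
  · intro hst
    cases hst with
    | link hl' => exact .link ((h.relabel_link_iff hl hI hr).2 hl')
    | mate hm => exact .mate hm
  · intro hst
    cases hst with
    | link hl' => exact .link ((h.relabel_link_iff hl hI hr).1 hl')
    | mate hm => exact .mate hm

/-- The state with the labeling replaced. -/
def State.relabel (S : State F μ ν) (L' : Labeling F μ ν) : State F μ ν :=
  ⟨relabeled S.x L', S.nodes, S.edges⟩

lemma Searching.relabel_source (h : Searching P k S) (hl : Leaves P S b s a t)
    (hI : (a, b') ∈ S.x.I) (hr : IsRelabeling P S.x.L L' b s a t b') :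
    source P (relabeled S.x L') = source P S.x ∧ target P (relabeled S.x L') = target P S.x := by
  have := source_target_congr h.opt (h.relabel_opt hl hI hr) (h.relabel_tstep hl hI hr)
  exact ⟨this.1.symm, this.2.symm⟩

lemma Searching.relabel (h : Searching P k S) (hl : Leaves P S b s a t) (hI : (a, b') ∈ S.x.I)
    (hr : IsRelabeling P S.x.L L' b s a t b') : Searching P k (S.relabel L') := by
  obtain ⟨h1, h2⟩ := h.relabel_source hl hI hr
  refine ⟨h.relabel_opt hl hI hr, ?_, ?_, ?_, h.mate⟩
  · simp only [State.relabel]; rw [h1, h2]; exact h.disj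
  · simp only [State.relabel]; rw [h1]; exact h.source_sub
  · simp only [State.relabel]; rw [h2]; exact h.target_disj

lemma Searching.planted_relabel (h : Searching P k S) (hl : Leaves P S b s a t)
    (hI : (a, b') ∈ S.x.I) (hr : IsRelabeling P S.x.L L' b s a t b') :
    Planted P (S.relabel L') = Planted P S := by
  ext a1 s1
  simp only [Planted, State.relabel]
  rw [(h.relabel_source hl hI hr).1]

lemma Leaves.col_ne (h : Searching P k S) (hl : Leaves P S b s a t) (hI : (a, b') ∈ S.x.I)
    {b1 : Fin ν} {t1 : Bool} (hc : .col b1 t1 ∈ S.nodes) : (b1, t1) ≠ (b', t) := by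
  intro he
  simp only [Prod.mk.injEq] at he
  obtain ⟨rfl, rfl⟩ := he
  exact hl.2.2 ((h.mate ⟨h.opt.pair.subset hI, Or.inr hI⟩).2 hc)

/-- The relabeling does not damage the forest. The space `U_a^{!t}` may change although `a^{!t}`
is in the forest; but then its parent is orthogonal to `U_a^t` and hence not to the new
`U_a^{!t}`. -/
lemma Forest.relabel (hf : Forest P S pr dep) (h : Searching P k S) (hl : Leaves P S b s a t)
    (hI : (a, b') ∈ S.x.I) (hr : IsRelabeling P S.x.L L' b s a t b') :
    Forest P (S.relabel L') pr dep := by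
  have hpl := h.planted_relabel hl hI hr
  refine ⟨?_, hf.bip, ⟨?_, ?_, ?_⟩, ?_, ?_, ?_⟩
  · rw [hpl]; exact hf.edge
  · intro a1 s1 hp
    exact hp.2
  · rw [hpl]
    intro a1 s1 hp
    have hne := hl.col_ne h hI (hf.mem hp)
    by_cases he : (a1, s1) = (a, !t)
    · simp only [Prod.mk.injEq] at he
      obtain ⟨rfl, rfl⟩ := he
      have h1 := hf.parents.tight hp
      refine ⟨?_, ?_⟩
      · simp only [State.relabel, relabeled]
        rw [hr.col_old _ _ hne]
        rcases hf.parents.kind hp with hk | hk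
        · have h2 := hk.2 b' hI
          rw [Bool.not_not] at h2
          intro h3
          refine h1.1 (Orth.of_left ?_ h2 h3 _)
          intro he
          exact hl.1.1 (he ▸ hr.orth_row)
        · exact absurd (h.opt.isolated_row hI hk.1.1 ▸ hI) hk.1.2.1
      · simp only [State.relabel, relabeled]
        rw [h.relabel_row hl hr, h.relabel_col hl hI hr]
        exact h1.2
    · exact (hr.tight_iff he hne).2 (hf.parents.tight hp)
  · rw [hpl]
    intro a1 s1 hp
    have hne := hl.col_ne h hI (hf.mem hp)
    rcases hf.parents.kind hp with hk | hk
    · refine Or.inl ⟨hk.1, fun b1 hb1 => ?_⟩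
      have h2 := hk.2 b1 hb1
      simp only [State.relabel, relabeled]
      rw [hr.col_old _ _ hne, hr.row_old]
      · exact h2
      · intro he
        simp only [Prod.mk.injEq, Bool.not_inj_iff] at he
        obtain ⟨rfl, rfl⟩ := he
        exact hl.2.2 hp.1
    · exact Or.inr ⟨(h.relabel_link_iff hl hI hr).2 hk.1, hk.2⟩
  · rw [hpl]; exact hf.mem
  · rw [hpl]; exact hf.dep_lt
  · rw [hpl]; exact hf.dep_le

lemma Leaves.relabel_tight (h : Searching P k S) (hl : Leaves P S b s a t) (hI : (a, b') ∈ S.x.I)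
    (hr : IsRelabeling P S.x.L L' b s a t b') : TightEdge P (relabeled S.x L') a t b s :=
  (hr.tight_iff (by simp) (hl.col_ne h hI hl.2.1)).2 hl.1

lemma Leaves.relabel_admissible (h : Searching P k S) (hl : Leaves P S b s a t)
    (hI : (a, b') ∈ S.x.I) (hr : IsRelabeling P S.x.L L' b s a t b') :
    Admissible P (relabeled S.x L') b s a t := by
  refine Or.inl ⟨fun hM => ?_, fun _ _ => ?_⟩
  · obtain ⟨hlk, -⟩ := hl.link_of_mem h hM
    exact hlk.2.1 (h.opt.isolated_row hI hM ▸ hI)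
  · simp only [relabeled]
    rw [hr.col_old _ _ (hl.col_ne h hI hl.2.1)]
    exact hr.orth_row

/-- A relabeling exists. -/
lemma Leaves.exists_relabeling (h : Searching P k S) (hl : Leaves P S b s a t)
    (hI : (a, b') ∈ S.x.I) : ∃ L', IsRelabeling P S.x.L L' b s a t b' := by
  classical
  obtain ⟨U', hU'⟩ := exists_perp_left hl.1.1
  have hUo : Orth (P.A a b) U' (S.x.L.V b s) := fun u hu v hv => (hU' u).1 hu v hv
  have hne : U' ≠ S.x.L.U a t := fun he => hl.1.1 (he ▸ hUo)
  have hr2 := h.opt.pair.rank_two _ hI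
  have hno : ¬ Orth (P.A a b') U' (S.x.L.V b' (!t)) :=
    not_orth_of_rank_two' hr2 hne (h.opt.valid.orth (h.opt.pair.subset hI) t)
  obtain ⟨V', hV'⟩ := exists_perp_right hno
  have hVo : Orth (P.A a b') U' V' := fun u hu v hv => (hV' v).1 hv u hu
  have hne' : V' ≠ S.x.L.V b' (!t) := fun he => hno (he ▸ hVo)
  let nU : Fin μ → Bool → Line F := fun a1 s1 => if (a1, s1) = (a, !t) then U' else S.x.L.U a1 s1
  let nV : Fin ν → Bool → Line F := fun b1 s1 => if (b1, s1) = (b', t) then V' else S.x.L.V b1 s1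
  refine ⟨⟨nU, nV, fun a1 => ?_, fun b1 => ?_⟩, ?_, ?_, ?_, ?_⟩
  · have hL := S.x.L.U_ne a1
    by_cases ha : a1 = a
    · subst ha
      cases t
      · simpa [nU] using hne
      · simpa [nU] using hne.symm
    · simpa [nU, ha] using hL
  · have hL := S.x.L.V_ne b1
    by_cases hb : b1 = b'
    · subst hb
      cases t
      · simpa [nV] using hne'.symm
      · simpa [nV] using hne'
    · simpa [nV, hb] using hL
  · intro u
    simp only [nU, if_true]
    exact hU' u
  · intro v
    simp only [nU, nV, if_true]
    exact hV' v
  · intro a1 s1 h1; exact if_neg h1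
  · intro b1 s1 h1; exact if_neg h1

end Relabeling

end

/-! ### Updates -/

section

variable {F : Type u} [Field F] {μ ν : ℕ} {P : PartMatrix F μ ν} {k : ℕ} {S : State F μ ν}
  {pr : Fin μ → Bool → Fin ν × Bool} {dep : Fin μ → Bool → ℕ} {ε : ℝ}

lemma pathEdges_cons_cons (v w : Vertex μ ν) (R : List (Vertex μ ν)) :
    pathEdges (v :: w :: R) = {s(v, w)} ∪ pathEdges (w :: R) := by
  ext z
  simp only [pathEdges, Set.mem_union, Set.mem_singleton_iff, Set.mem_ofPred_eq,
    List.infix_cons_iff (a := v), List.cons_prefix_cons, List.nil_prefix, and_true]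
  constructor
  · rintro ⟨v', w', ⟨rfl, rfl⟩ | h, rfl⟩
    · exact Or.inl rfl
    · exact Or.inr ⟨v', w', h, rfl⟩
  · rintro (rfl | ⟨v', w', h, rfl⟩)
    · exact ⟨v, w, Or.inl ⟨rfl, rfl⟩, rfl⟩
    · exact ⟨v', w', Or.inr h, rfl⟩

lemma pathEdges_singleton (v : Vertex μ ν) : pathEdges [v] = ∅ := by
  ext z
  simp only [pathEdges, Set.mem_ofPred_eq, Set.mem_empty_iff_false, iff_false]
  rintro ⟨v', w', h, -⟩
  have := h.length_le
  simp at this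

/-- An inner path is added vertex pair by vertex pair, each pair being a row vertex and its mate;
all row vertices but the first are joined to their parents by links. -/
lemma Forest.add_inner : ∀ (Q : List (Vertex μ ν)) {S : State F μ ν}
    {pr : Fin μ → Bool → Fin ν × Bool} {dep : Fin μ → Bool → ℕ} (_ : Forest P S pr dep)
    (_ : Searching P k S) {b : Fin ν} {s : Bool} {a : Fin μ} {t : Bool}
    (_ : InnerSeq P S.x t Q) (_ : Q.Nodup) (_ : Q.head? = some (.row a t))
    (_ : ∀ z ∈ Q, z ∉ S.nodes) (_ : .row a t ∉ target P S.x) (_ : .col b s ∈ S.nodes)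
    (_ : TightEdge P S.x a t b s) (_ : Admissible P S.x b s a t),
    Searching P k ⟨S.x, S.nodes ∪ {z | z ∈ Q},
      S.edges ∪ {s(.col b s, .row a t)} ∪ pathEdges Q⟩ ∧
    ∃ pr dep, Forest P ⟨S.x, S.nodes ∪ {z | z ∈ Q},
      S.edges ∪ {s(.col b s, .row a t)} ∪ pathEdges Q⟩ pr dep := by
  intro Q
  induction hQ : Q.length using Nat.strong_induction_on generalizing Q with
  | _ n ih =>
  intro S pr dep hf h b s a t hs hn hh hav hT hb ht hadm
  cases hs with
  | last a1 b1 he hsg hti =>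
    simp only [List.head?_cons, Option.some.injEq, Vertex.row.injEq, and_true] at hh
    subst hh
    have hm : Mate S.x a1 b1 t := ⟨(Finset.mem_sdiff.1 he).1, Or.inl hsg⟩
    have hF := hav (.row a1 t) (by simp)
    have hS : (⟨S.x, S.nodes ∪ {z | z ∈ [Vertex.row a1 t, .col b1 t]},
        S.edges ∪ {s(.col b s, .row a1 t)} ∪ pathEdges [.row a1 t, .col b1 t]⟩ : State F μ ν) =
        grown S b s a1 t b1 := by
      rw [pathEdges_cons_cons, pathEdges_singleton]
      simp only [grown, State.mk.injEq, true_and]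
      constructor
      · ext z; simp; tauto
      · ext z; simp; tauto
    rw [hS]
    exact ⟨h.grow hT hm, _, _, hf.grow h hF hb ht hadm hm⟩
  | cons a1 b1 a2 R he hsg hti he' hsg' hti' hrest =>
    simp only [List.head?_cons, Option.some.injEq, Vertex.row.injEq, and_true] at hh
    subst hh
    have hm : Mate S.x a1 b1 t := ⟨(Finset.mem_sdiff.1 he).1, Or.inl hsg⟩
    have hlk : Link P S.x a2 b1 t :=
      ⟨(Finset.mem_sdiff.1 he').1, (Finset.mem_sdiff.1 he').2, hsg', hti'⟩
    have hF := hav (.row a1 t) (by simp)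
    have hS : (⟨S.x, S.nodes ∪ {z | z ∈ Vertex.row a1 t :: .col b1 t :: .row a2 t :: R},
        S.edges ∪ {s(.col b s, .row a1 t)} ∪
          pathEdges (.row a1 t :: .col b1 t :: .row a2 t :: R)⟩ : State F μ ν) =
        ⟨(grown S b s a1 t b1).x, (grown S b s a1 t b1).nodes ∪ {z | z ∈ Vertex.row a2 t :: R},
          (grown S b s a1 t b1).edges ∪ {s(.col b1 t, .row a2 t)} ∪
            pathEdges (.row a2 t :: R)⟩ := by
      rw [pathEdges_cons_cons, pathEdges_cons_cons]
      simp only [grown, State.mk.injEq, true_and]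
      constructor
      · ext z; simp; tauto
      · ext z; simp; tauto
    rw [hS]
    refine ih _ ?_ (.row a2 t :: R) rfl (hf.grow h hF hb ht hadm hm) (h.grow hT hm) hrest
      (hn.sublist (by simp)) rfl ?_ ?_ ?_ hti' (Or.inr ⟨hlk, rfl⟩)
    · rw [← hQ]; simp
    · intro z hz hz'
      simp only [grown, Set.mem_union, Set.mem_insert_iff, Set.mem_singleton_iff] at hz'
      rw [List.nodup_cons, List.nodup_cons] at hn
      rcases hz' with hz' | rfl | rfl
      · exact hav z (by simp only [List.mem_cons] at hz ⊢; tauto) hz'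
      · exact hn.1 (List.mem_cons_of_mem _ hz)
      · exact hn.2.1 hz
    · intro hT2
      exact hT ((h.opt.target_tstep (.mate hm)).1 ((h.opt.target_tstep (.link hlk)).1 hT2))
    · exact Or.inr (Or.inr rfl)

/-- A dual update leaves the forest as it is, up to additional roots. -/
lemma Forest.dual (hf : Forest P S pr dep) (h : Searching P k S) (hd : DualStep P S ε) :
    Forest P ⟨dualConf S ε, S.nodes ∪ source P (dualConf S ε), S.edges⟩ pr dep := by
  have hpl : ∀ {a s}, Planted P ⟨dualConf S ε, S.nodes ∪ source P (dualConf S ε), S.edges⟩ a s ↔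
      Planted P S a s := by
    intro a s
    constructor
    · rintro ⟨h1, h2⟩
      exact ⟨h1.resolve_right h2, fun h3 => h2 (h.source_dual_sup hd h3)⟩
    · rintro ⟨h1, h2⟩
      exact ⟨Or.inl h1, fun h3 => h2 (h.source_dual_inter hd h3 h1)⟩
  refine ⟨?_, hf.bip, ⟨fun hp => hp.2, ?_, ?_⟩, ?_, ?_, ?_⟩
  · intro a s b t
    rw [hpl]
    exact hf.edge
  · intro a s hp
    have hp := hpl.1 hp
    exact (tightEdge_dual_iff (iff_of_true hp.1 (hf.mem hp))).2 (hf.parents.tight hp)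
  · intro a s hp
    have hp := hpl.1 hp
    rcases hf.parents.kind hp with hk | ⟨hk, hs⟩
    · exact Or.inl hk
    · have hm := hf.mem hp
      rw [hs] at hm
      exact Or.inr ⟨⟨hk.1, hk.2.1, hk.2.2.1,
        (tightEdge_dual_iff (iff_of_true hp.1 hm)).2 hk.2.2.2⟩, hs⟩
  · intro a s hp
    exact Or.inl (hf.mem (hpl.1 hp))
  · intro a s a' hp hp' hm
    exact hf.dep_lt (hpl.1 hp) (hpl.1 hp') hm
  · intro a s hp
    exact (hf.dep_le (hpl.1 hp)).trans (rowCount_mono Set.subset_union_left)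

/-- The invariant of the search. -/
def SearchInv (P : PartMatrix F μ ν) (k : ℕ) (S : State F μ ν) : Prop :=
  Searching P k S ∧ ∃ pr dep, Forest P S pr dep

lemma SearchInv.step (h : SearchInv P k S) {S' : State F μ ν} (hs : Step P S S') :
    SearchInv P k S' := by
  obtain ⟨h, pr, dep, hf⟩ := h
  cases hs with
  | P2 b s a t b' L' hl hT hI hr =>
    have hm : Mate (S.relabel L').x a b' t := ⟨h.opt.pair.subset hI, Or.inr hI⟩
    have h' := h.relabel hl hI hr
    refine ⟨h'.grow (b := b) (s := s) ?_ hm, _, _, (hf.relabel h hl hI hr).grow h' hl.2.2 hl.2.1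
      (hl.relabel_tight h hI hr) (hl.relabel_admissible h hI hr) hm⟩
    exact h'.opt.not_mem_target_of_I hI t
  | P3 b s a t Q hl hT hc hi hst hav hlong =>
    have hnI : ∀ b', (a, b') ∉ S.x.I := by
      intro b' hb'
      obtain ⟨b1, hb1⟩ := hc
      obtain ⟨h1, h2⟩ := Finset.mem_sdiff.1 hb1
      exact h2 (h.opt.isolated_row hb' h1 ▸ hb')
    exact Forest.add_inner Q hf h hi.1 hi.2 hst hav hT hl.2.1 hl.1 (hl.admissible h hnI)
  | D23 ε hd hr ht =>
    have hdis := (h.dual_opt hd).not_rearrangeable_iff.1 hr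
    exact ⟨h.dual hd hdis ht _, _, _, hf.dual h hd⟩

lemma SearchInv.init {x : Conf F μ ν} (h : IsInput P k x) : SearchInv P k (initState P x) := by
  refine ⟨Searching.init (S := initState P x) h.optimal h.not_rearrangeable,
    fun _ _ => (⟨0, ?_⟩, true), _, Forest.init x _⟩
  have := h.size_lt
  omega

lemma SearchInv.run {S₀ : State F μ ν} (h : SearchInv P k S₀) {n : ℕ} (hr : Run P S₀ n S) :
    SearchInv P k S := by
  induction hr with
  | zero => exact h
  | succ n S' S'' _ hs ih => exact ih.step hs

/-! ### The number of updates -/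

/-- A bound on the number `n` of updates by the size of the forest: every primal update adds a vertex
of each side, and a dual update that does not leaves an edge with which the next update is primal. -/
def CountInv (P : PartMatrix F μ ν) (n : ℕ) (S : State F μ ν) : Prop :=
  (n ≤ 2 * rowCount S ∧ n ≤ 2 * colCount S) ∨
    (n ≤ 2 * rowCount S + 1 ∧ n ≤ 2 * colCount S + 1 ∧ ∃ b s a t, Leaves P S b s a t)

lemma CountInv.of_lt {n : ℕ} {S' : State F μ ν} (hn : CountInv P n S)
    (h1 : rowCount S < rowCount S') (h2 : colCount S < colCount S') : CountInv P (n + 1) S' := by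
  left
  rcases hn with hn | hn <;> omega

lemma InnerSeq.exists_col {x : Conf F μ ν} {t : Bool} {Q : List (Vertex μ ν)}
    (h : InnerSeq P x t Q) : ∃ b, Vertex.col b t ∈ Q := by
  cases h with
  | last a b => exact ⟨b, by simp⟩
  | cons a b => exact ⟨b, by simp⟩

lemma CountInv.step (h : SearchInv P k S) {n : ℕ} (hn : CountInv P n S) {S' : State F μ ν}
    (hs : Step P S S') : CountInv P (n + 1) S' := by
  obtain ⟨h, -⟩ := h
  cases hs with
  | P2 b s a t b' L' hl hT hI hr =>
    have hm : Mate S.x a b' t := ⟨h.opt.pair.subset hI, Or.inr hI⟩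
    exact hn.of_lt (rowCount_lt Set.subset_union_left hl.2.2 (Or.inr (Or.inl rfl)))
      (colCount_lt Set.subset_union_left (fun hc => hl.2.2 ((h.mate hm).2 hc))
        (Or.inr (Or.inr rfl)))
  | P3 b s a t Q hl hT hc hi hst hav hlong =>
    obtain ⟨b', hb'⟩ := hi.1.exists_col
    exact hn.of_lt (rowCount_lt Set.subset_union_left hl.2.2 (Or.inr (List.mem_of_head? hst)))
      (colCount_lt Set.subset_union_left (hav _ hb') (Or.inr hb'))
  | D23 ε hd hr ht =>
    have hdis := (h.dual_opt hd).not_rearrangeable_iff.1 hr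
    rcases h.dual_progress hd hdis S.edges with hl | ⟨⟨a, s, h1, h2⟩, b, t, h3, h4⟩
    · have hn' := hn.resolve_right fun hn' => by
        obtain ⟨-, -, b, s, a, t, hl⟩ := hn'
        exact hd.1 b s a t hl
      have h1 := rowCount_mono (S := S)
        (S' := ⟨dualConf S ε, S.nodes ∪ source P (dualConf S ε), S.edges⟩) Set.subset_union_left
      have h2 := colCount_mono (S := S)
        (S' := ⟨dualConf S ε, S.nodes ∪ source P (dualConf S ε), S.edges⟩) Set.subset_union_left
      exact Or.inr ⟨by omega, by omega, hl⟩
    · exact hn.of_lt (rowCount_lt Set.subset_union_left h1 (Or.inr h2))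
        (colCount_lt Set.subset_union_left h3 (Or.inr h4))

lemma CountInv.run {x : Conf F μ ν} (h : IsInput P k x) {n : ℕ} (hr : Run P (initState P x) n S) :
    CountInv P n S := by
  induction hr with
  | zero => exact Or.inl ⟨Nat.zero_le _, Nat.zero_le _⟩
  | succ n S' S'' hr hs ih => exact ih.step ((SearchInv.init h).run hr) hs

lemma IsInput.run_le {x : Conf F μ ν} (h : IsInput P k x) {n : ℕ}
    (hr : Run P (initState P x) n S) : n ≤ 5 * min μ ν := by
  have h1 := rowCount_le_two_mul S
  have h2 := colCount_le_two_mul S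
  have h3 := h.size_lt
  have h4 := CountInv.run h hr
  unfold CountInv at h4
  rcases h4 with h4 | ⟨h4, h5, -⟩ <;> omega

/-! ### Paths of the forest -/

/-- A height function for the forest. -/
lemma Forest.exists_height (hf : Forest P S pr dep) (h : Searching P k S) :
    ∃ f : Vertex μ ν → ℕ, ∀ {v w}, IsParent S.x (Planted P S) pr v w → f w < f v := by
  classical
  refine ⟨fun v => match v with
    | .row a s => 2 * dep a s + 1
    | .col b t => if hp : ∃ a, Planted P S a t ∧ Mate S.x a b t then 2 * dep hp.choose t + 2 else 0,
    ?_⟩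
  intro v w hp
  cases hp with
  | @row a s hp =>
    dsimp only
    split_ifs with he
    · have := hf.dep_lt hp he.choose_spec.1 he.choose_spec.2
      omega
    · omega
  | @col a b s hp hm =>
    have he : ∃ a, Planted P S a s ∧ Mate S.x a b s := ⟨a, hp, hm⟩
    dsimp only
    rw [dif_pos he, h.opt.mate_col he.choose_spec.2 hm]
    omega

/-- Chains from children to parents have no repetitions. -/
lemma Forest.nodup (hf : Forest P S pr dep) (h : Searching P k S) {l : List (Vertex μ ν)}
    (hl : l.IsChain (IsParent S.x (Planted P S) pr)) : l.Nodup := by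
  obtain ⟨f, hf⟩ := hf.exists_height h
  have h1 : l.IsChain (fun v w => f w < f v) := hl.imp fun v w hp => hf hp
  have : IsTrans (Vertex μ ν) (fun v w => f w < f v) := ⟨fun _ _ _ h1 h2 => lt_trans h2 h1⟩
  refine (List.isChain_iff_pairwise.1 h1).imp ?_
  rintro v w hvw rfl
  exact lt_irrefl _ hvw

lemma Forest.edge_iff (hf : Forest P S pr dep) {v w : Vertex μ ν} :
    s(v, w) ∈ S.edges ↔
      IsParent S.x (Planted P S) pr w v ∨ IsParent S.x (Planted P S) pr v w := by
  have key : ∀ {a s b t}, s(Vertex.row a s, Vertex.col b t) ∈ S.edges ↔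
      IsParent S.x (Planted P S) pr (.row a s) (.col b t) ∨
        IsParent S.x (Planted P S) pr (.col b t) (.row a s) := by
    intro a s b t
    rw [hf.edge]
    constructor
    · rintro ⟨hp, he | ⟨rfl, hm⟩⟩
      · left
        have := IsParent.row (x := S.x) (pr := pr) hp
        rwa [he] at this
      · exact Or.inr (.col hp hm)
    · rintro (hp | hp)
      · generalize hz : Vertex.col b t = z at hp
        cases hp with
        | row hp =>
          simp only [Vertex.col.injEq] at hz
          exact ⟨hp, Or.inl (Prod.ext hz.1.symm hz.2.symm)⟩
      · cases hp with
        | col hp hm => exact ⟨hp, Or.inr ⟨rfl, hm⟩⟩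
  constructor
  · intro he
    obtain ⟨a, s, b, t, hz⟩ := hf.bip _ he
    rw [hz] at he
    rcases Sym2.eq_iff.1 hz with ⟨rfl, rfl⟩ | ⟨rfl, rfl⟩
    · exact (key.1 he).symm
    · exact key.1 he
  · rintro (hp | hp)
    · cases hp with
      | row hp => rw [Sym2.eq_swap]; exact key.2 (Or.inl (.row hp))
      | col hp hm => exact key.2 (Or.inr (.col hp hm))
    · cases hp with
      | row hp => exact key.2 (Or.inl (.row hp))
      | col hp hm => rw [Sym2.eq_swap]; exact key.2 (Or.inr (.col hp hm))

/-- A chain from a child to a vertex without parent is determined by its first vertex. -/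
lemma isChain_unique {V : Type*} {Par : V → V → Prop}
    (huniq : ∀ {v w w'}, Par v w → Par v w' → w = w') :
    ∀ {l l' : List V} {v : V}, (v :: l).IsChain Par → (v :: l').IsChain Par →
      (∀ z ∈ (v :: l).getLast?, ∀ w, ¬ Par z w) → (∀ z ∈ (v :: l').getLast?, ∀ w, ¬ Par z w) →
      l = l'
  | [], [], _, _, _, _, _ => rfl
  | [], w :: l', v, _, h2, h3, _ => by
    rw [List.isChain_cons_cons] at h2
    exact absurd h2.1 (h3 v (by simp) w)
  | w :: l, [], v, h1, _, _, h4 => by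
    rw [List.isChain_cons_cons] at h1
    exact absurd h1.1 (h4 v (by simp) w)
  | w :: l, w' :: l', v, h1, h2, h3, h4 => by
    rw [List.isChain_cons_cons] at h1 h2
    have := huniq h1.1 h2.1
    subst this
    rw [isChain_unique (Par := Par) huniq h1.2 h2.2 (by simpa using h3) (by simpa using h4)]

/-- A chain from a vertex up to a root is a path of the forest. -/
lemma Forest.isPathFromTo (hf : Forest P S pr dep) (h : Searching P k S)
    {X Y : Set (Vertex μ ν)} {l : List (Vertex μ ν)}
    (hl : l.IsChain (IsParent S.x (Planted P S) pr)) (hX : ∃ z ∈ X, l.getLast? = some z)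
    (hY : ∃ z ∈ Y, l.head? = some z) : IsPathFromTo S.edges X Y l.reverse := by
  refine ⟨?_, List.nodup_reverse.2 (hf.nodup h hl), by simpa using hX, by simpa using hY⟩
  rw [List.isChain_reverse]
  exact hl.imp fun v w hp => hf.edge_iff.2 (Or.inl hp)

/-- A path of the forest that starts at a vertex without parent is a chain from parents to
children. -/
lemma Forest.isChain_of_path (hf : Forest P S pr dep) (h : Searching P k S)
    {X Y : Set (Vertex μ ν)} {R : List (Vertex μ ν)} (hR : IsPathFromTo S.edges X Y R)
    (hX : ∀ z ∈ X, ∀ w, ¬ IsParent S.x (Planted P S) pr z w) :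
    R.reverse.IsChain (IsParent S.x (Planted P S) pr) := by
  rw [List.isChain_reverse]
  obtain ⟨z, hz, hz'⟩ := hR.first
  rcases R with _ | ⟨z1, R⟩
  · simp
  simp only [List.head?_cons, Option.some.injEq] at hz'
  subst hz'
  exact isChain_parent (Par := IsParent S.x (Planted P S) pr) h.opt.isParent_unique
    (hR.chain.imp fun v w he => hf.edge_iff.1 he) hR.nodup fun w _ => hX _ hz w

lemma Forest.not_isParent (hf : Forest P S pr dep) (h : Searching P k S) :
    ∀ z ∈ source P S.x, ∀ w, ¬ IsParent S.x (Planted P S) pr z w :=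
  fun _ hz _ => hf.parents.not_isParent h.opt hz

lemma IsParent.mem_nodes (h : Searching P k S) {v w : Vertex μ ν}
    (hp : IsParent S.x (Planted P S) pr v w) : v ∈ S.nodes := by
  cases hp with
  | row hp => exact hp.1
  | col hp hm => exact (h.mate hm).1 hp.1

lemma Forest.not_isParent_dual (hf : Forest P S pr dep) (h : Searching P k S)
    (hd : DualStep P S ε) :
    ∀ z ∈ source P (dualConf S ε), ∀ w, ¬ IsParent S.x (Planted P S) pr z w :=
  fun z hz w hp => hf.not_isParent h z (h.source_dual_inter hd hz (hp.mem_nodes h)) w hp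

/-- A chain of the forest from a target vertex up to a root, without further target vertices, is
as required after a dual update. -/
lemma Forest.minimal (hf : Forest P S pr dep) (h : Searching P k S) (hd : DualStep P S ε)
    {v : Vertex μ ν} {l : List (Vertex μ ν)}
    (hl : (v :: l).IsChain (IsParent S.x (Planted P S) pr))
    (hv : v ∈ S.nodes ∩ target P (dualConf S ε)) (hl' : ∀ w ∈ l, w ∉ target P (dualConf S ε))
    (hX : ∃ z ∈ source P (dualConf S ε), (v :: l).getLast? = some z) (R' : List (Vertex μ ν))
    (hR : IsPathFromTo S.edges (source P (dualConf S ε)) (S.nodes ∩ target P (dualConf S ε)) R')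
    (hsub : R' ⊆ (v :: l).reverse) : (v :: l).reverse ⊆ R' := by
  have h1 := hf.isChain_of_path h hR (hf.not_isParent_dual h hd)
  obtain ⟨z, hz, hz'⟩ := hR.last
  obtain ⟨y, hy, hy'⟩ := hR.first
  have hzv : z = v := by
    have := hsub (List.mem_of_getLast? hz')
    rw [List.mem_reverse, List.mem_cons] at this
    exact this.resolve_right fun h2 => hl' z h2 hz.2
  subst hzv
  rw [← List.head?_reverse] at hz'
  rw [← List.getLast?_reverse] at hy'
  rcases hRr : R'.reverse with _ | ⟨z1, l'⟩
  · rw [hRr] at hz'; simp at hz'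
  rw [hRr] at h1 hz' hy'
  simp only [List.head?_cons, Option.some.injEq] at hz'
  subst hz'
  have h2 := isChain_unique (Par := IsParent S.x (Planted P S) pr) h.opt.isParent_unique hl h1
    (by
      intro z2 hz2
      obtain ⟨z3, hz3, hz3'⟩ := hX
      rw [hz3'] at hz2
      cases hz2
      exact hf.not_isParent_dual h hd _ hz3)
    (by
      intro z2 hz2
      rw [hy'] at hz2
      cases hz2
      exact hf.not_isParent_dual h hd _ hy)
  rw [h2, ← hRr, List.reverse_reverse]
  exact List.Subset.refl _

/-- Inner paths with the same first vertex are initial segments of each other; so an inner path is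
longest if it cannot be extended. -/
lemma InnerSeq.length_le {x : Conf F μ ν} (h : IsOptimal P k x) {t : Bool}
    {Q : List (Vertex μ ν)} (hQ : InnerSeq P x t Q) :
    ∀ {N : Set (Vertex μ ν)} {Q' : List (Vertex μ ν)}, InnerSeq P x t Q' → Q'.Nodup →
      Q'.head? = Q.head? → (∀ z ∈ Q', z ∉ N) →
      (∀ b, Q.getLast? = some (.col b t) → ∀ a, Link P x a b t →
        .row a t ∈ N ∨ .row a t ∈ Q) → Q'.length ≤ Q.length := by
  induction hQ with
  | last a b he hsg hti =>
    intro N Q' hQ' hn hh hav hend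
    cases hQ' with
    | last => simp
    | cons a1 b1 a2 R he1 hsg1 hti1 he2 hsg2 hti2 hrest =>
      exfalso
      simp only [List.head?_cons, Option.some.injEq, Vertex.row.injEq, and_true] at hh
      subst hh
      have := h.sgn_row (Finset.mem_sdiff.1 he).1 (Finset.mem_sdiff.1 he1).1 (hsg.trans hsg1.symm)
      subst this
      rcases hend b (by simp) a2 ⟨(Finset.mem_sdiff.1 he2).1, (Finset.mem_sdiff.1 he2).2, hsg2, hti2⟩
        with h1 | h1
      · exact hav _ (by simp) h1
      · simp only [List.mem_cons, Vertex.row.injEq, and_true, reduceCtorEq, List.not_mem_nil,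
          or_false] at h1
        subst h1
        simp at hn
  | cons a b a' R he hsg hti he' hsg' hti' hrest ih =>
    intro N Q' hQ' hn hh hav hend
    cases hQ' with
    | last => simp
    | cons a1 b1 a2 R' he1 hsg1 hti1 he2 hsg2 hti2 hrest2 =>
      simp only [List.head?_cons, Option.some.injEq, Vertex.row.injEq, and_true] at hh
      subst hh
      have := h.sgn_row (Finset.mem_sdiff.1 he).1 (Finset.mem_sdiff.1 he1).1 (hsg.trans hsg1.symm)
      subst this
      have := h.sgn_col (Finset.mem_sdiff.1 he').1 (Finset.mem_sdiff.1 he2).1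
        (hsg'.trans hsg2.symm)
      subst this
      have := ih (N := N ∪ {.row a1 t}) hrest2 (hn.sublist (by simp)) rfl ?_ ?_
      · simpa using this
      · intro z hz hz'
        rcases hz' with hz' | rfl
        · exact hav z (by simp only [List.mem_cons] at hz ⊢; tauto) hz'
        · rw [List.nodup_cons] at hn
          exact hn.1 (List.mem_cons_of_mem _ hz)
      · intro b2 hb2 a2 hl
        have := hend b2 (by simpa using hb2) a2 hl
        simp only [List.mem_cons, Set.mem_union, Set.mem_singleton_iff, reduceCtorEq,
          false_or] at this ⊢
        tauto

/-! ### The outputs -/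

/-- The last edge of the path is outside `M`, since a link would put its other end, which is in the
forest, into the target set. -/
lemma SearchInv.output_P1 (h : SearchInv P k S) {x : Conf F μ ν} {R : List (Vertex μ ν)}
    (hs : Stops P S (.P1 x R)) : IsOptimal P k x ∧ IsAugmentingPath P x R := by
  obtain ⟨h, pr, dep, hf⟩ := h
  cases hs with
  | P1 b s a t _ hl hT hR =>
  refine ⟨h.opt, ?_⟩
  have hnI : ∀ b', (a, b') ∉ S.x.I := fun b' hb' => h.opt.not_mem_target_of_I hb' t hT
  have hM : (a, b) ∉ S.x.M := by
    intro hM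
    obtain ⟨hlk, rfl⟩ := hl.link_of_mem h hM
    exact Set.disjoint_left.1 h.target_disj hl.2.1 ((h.opt.target_tstep (.link hlk)).1 hT)
  -- the parents, including the one of the new vertex `a^t`
  let pr' : Fin μ → Bool → Fin ν × Bool := fun a1 s1 => if a1 = a ∧ s1 = t then (b, s) else pr a1 s1
  have hne : ∀ {a1 s1}, Planted P S a1 s1 → pr' a1 s1 = pr a1 s1 := by
    intro a1 s1 hp
    refine if_neg ?_
    rintro ⟨rfl, rfl⟩
    exact hl.2.2 hp.1
  have hpr : pr' a t = (b, s) := if_pos ⟨rfl, rfl⟩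
  have hG : IsParents P S.x (fun a1 s1 => Planted P S a1 s1 ∨ (a1 = a ∧ s1 = t)) pr' := by
    refine ⟨?_, ?_, ?_⟩
    · rintro a1 s1 (hp | ⟨rfl, rfl⟩)
      · exact hp.2
      · exact fun h1 => hl.2.2 (h.source_sub h1)
    · rintro a1 s1 (hp | ⟨rfl, rfl⟩)
      · rw [hne hp]; exact hf.parents.tight hp
      · rw [hpr]; exact hl.1
    · rintro a1 s1 (hp | ⟨rfl, rfl⟩)
      · rw [hne hp]; exact hf.parents.kind hp
      · rw [hpr]; exact Or.inl ⟨hM, fun b' hb' => absurd hb' (hnI b')⟩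
  have hmono : ∀ {v w}, IsParent S.x (Planted P S) pr v w →
      IsParent S.x (fun a1 s1 => Planted P S a1 s1 ∨ (a1 = a ∧ s1 = t)) pr' v w := by
    intro v w hp
    cases hp with
    | row hp => rw [← hne hp]; exact .row (Or.inl hp)
    | col hp hm => exact .col (Or.inl hp) hm
  have hnew : IsParent S.x (fun a1 s1 => Planted P S a1 s1 ∨ (a1 = a ∧ s1 = t)) pr'
      (.row a t) (.col b s) := by
    have := IsParent.row (x := S.x) (G := fun a1 s1 => Planted P S a1 s1 ∨ (a1 = a ∧ s1 = t))
      (pr := pr') (a := a) (s := t) (Or.inr ⟨rfl, rfl⟩)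
    rwa [hpr] at this
  obtain ⟨z, hz, hz'⟩ := hR.last
  rw [Set.mem_singleton_iff] at hz
  subst hz
  refine hG.isAugmentingPath h.opt h.disj (hR.chain.imp ?_) hR.nodup hR.first ⟨_, hT, hz'⟩
    ⟨a, t, hz', by rw [hpr]; exact hM⟩
  rintro v w (he | he)
  · exact (hf.edge_iff.1 he).imp hmono hmono
  · rw [Set.mem_singleton_iff, Sym2.eq_iff] at he
    rcases he with ⟨rfl, rfl⟩ | ⟨rfl, rfl⟩
    · exact Or.inl hnew
    · exact Or.inr hnew

/-- The edges of the forest remain tight in the dual update. The last edge of the path is outside `M`,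
since otherwise its other end would be in the target set, and a shorter path would do. -/
lemma SearchInv.output_D22 (h : SearchInv P k S) {x : Conf F μ ν} {R : List (Vertex μ ν)}
    (hs : Stops P S (.D22 x R)) : IsOptimal P k x ∧ IsAugmentingPath P x R := by
  obtain ⟨h, pr, dep, hf⟩ := h
  cases hs with
  | D22 ε hd hr ht _ hR hmin =>
  have hopt := h.dual_opt hd
  have hdis := hopt.not_rearrangeable_iff.1 hr
  refine ⟨hopt, ?_⟩
  have hf' := hf.dual h hd
  have hG : IsParents P (dualConf S ε) (Planted P S) pr := by
    have hpl : ∀ {a s}, Planted P S a s →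
        Planted P ⟨dualConf S ε, S.nodes ∪ source P (dualConf S ε), S.edges⟩ a s := fun hp =>
      ⟨Or.inl hp.1, fun h3 => hp.2 (h.source_dual_inter hd h3 hp.1)⟩
    exact ⟨fun hp => hf'.parents.not_source (hpl hp), fun hp => hf'.parents.tight (hpl hp),
      fun hp => hf'.parents.kind (hpl hp)⟩
  have hmono : ∀ {v w}, IsParent S.x (Planted P S) pr v w →
      IsParent (dualConf S ε) (Planted P S) pr v w := by
    intro v w hp
    cases hp with
    | row hp => exact .row hp
    | col hp hm => exact .col hp hm
  obtain ⟨z, ⟨hz, hzT⟩, hz'⟩ := hR.last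
  refine hG.isAugmentingPath hopt hdis (hR.chain.imp fun v w he =>
    (hf.edge_iff.1 he).imp hmono hmono) hR.nodup hR.first ⟨z, hzT, hz'⟩ ?_
  -- by minimality, the parent of the last vertex is not in the target set
  have hchain := hf.isChain_of_path h hR (hf.not_isParent_dual h hd)
  obtain ⟨y, hy, hy'⟩ := hR.first
  rcases hRr : R.reverse with _ | ⟨z1, _ | ⟨w, l⟩⟩
  · rw [List.reverse_eq_nil_iff] at hRr
    rw [hRr] at hz'; simp at hz'
  · rw [← List.head?_reverse, hRr] at hz'
    rw [← List.getLast?_reverse, hRr] at hy'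
    simp only [List.head?_cons, List.getLast?_singleton, Option.some.injEq] at hz' hy'
    exact absurd hzT (Set.disjoint_left.1 hdis (by rw [← hz', hy']; exact hy))
  rw [hRr] at hchain
  have hz1 : z1 = z := by
    rw [← List.head?_reverse, hRr] at hz'
    simpa using hz'
  subst hz1
  rw [List.isChain_cons_cons] at hchain
  obtain ⟨hpar, hchain⟩ := hchain
  have hwF : w ∈ S.nodes := by
    cases hpar with
    | row hp => exact hf.mem hp
    | col hp hm => exact hp.1
  have hwT : w ∉ target P (dualConf S ε) := by
    intro hwT
    have hn := List.nodup_reverse.2 hR.nodup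
    rw [hRr] at hn
    have hRe : R = (w :: l).reverse ++ [z1] := by
      rw [← List.reverse_reverse R, hRr]; simp
    have hlast : (w :: l).getLast? = some y := by
      rw [← List.getLast?_reverse, hRr] at hy'
      simpa using hy'
    have := hmin (w :: l).reverse
      (hf.isPathFromTo h hchain ⟨y, hy, hlast⟩ ⟨w, ⟨hwF, hwT⟩, rfl⟩)
      (by rw [hRe]; exact List.subset_append_left _ _)
      (by rw [hRe]; simp : z1 ∈ R)
    rw [List.mem_reverse] at this
    exact (List.nodup_cons.1 hn).1 this
  cases hpar with
  | col hp hm =>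
    exact absurd ((hopt.target_tstep (.mate (mate_dual_iff.2 hm))).1 hzT) hwT
  | @row a s hp =>
    refine ⟨a, s, hz', ?_⟩
    rcases hG.kind hp with hk | ⟨hk, hs⟩
    · exact hk.1
    · rw [hs] at hwT
      exact absurd ((hopt.target_tstep (.link hk)).1 hzT) hwT

lemma SearchInv.output_D21 (h : SearchInv P k S) {x : Conf F μ ν} (hs : Stops P S (.D21 x)) :
    IsOptimal P (k + 1) x := by
  cases hs with
  | D21 ε hd C σ hr => exact (h.1.dual_opt hd).rearrange hr

end

/-! ### The bound on the rank when no dual update is possible -/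

section

variable {F : Type u} [Field F] {μ ν : ℕ}

/-- Generators of two distinct lines, with the dual basis. -/
lemma exists_dual_basis (X : Bool → Line F) (h : X true ≠ X false) :
    ∃ v g : Bool → Fin 2 → F, (∀ s, (X s).1 = Submodule.span F {v s}) ∧
      ∀ i j, v true i * g true j + v false i * g false j = if i = j then 1 else 0 := by
  obtain ⟨p, hp, hp'⟩ := (X true).exists_span
  obtain ⟨q, hq, hq'⟩ := (X false).exists_span
  have hD : p 0 * q 1 - p 1 * q 0 ≠ 0 := by
    intro hD
    apply h
    refine Line.eq_of_le (X := X true) (Y := X false) ?_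
    rw [hp', hq', Submodule.span_singleton_le_iff_mem]
    have h1 : p ∈ Submodule.span F {![(![-q 1, q 0] : Fin 2 → F) 1, 0 - (![-q 1, q 0] : Fin 2 → F) 0]} := by
      rw [mem_span_rot]
      · simp; linear_combination -hD
      · intro h0
        have h0' := congrFun h0 0
        have h1' := congrFun h0 1
        apply hq
        ext i; fin_cases i
        · simpa using h1'
        · simpa using h0'
    have h2 : ![(![-q 1, q 0] : Fin 2 → F) 1, 0 - (![-q 1, q 0] : Fin 2 → F) 0] = q := by
      ext i; fin_cases i <;> simp
    rwa [h2] at h1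
  refine ⟨fun s => if s then p else q,
    fun s => if s then ![q 1 / (p 0 * q 1 - p 1 * q 0), -q 0 / (p 0 * q 1 - p 1 * q 0)]
      else ![-p 1 / (p 0 * q 1 - p 1 * q 0), p 0 / (p 0 * q 1 - p 1 * q 0)], ?_, ?_⟩
  · rintro (_ | _)
    · simpa using hq'
    · simpa using hp'
  · intro i j
    fin_cases i <;> fin_cases j <;> simp <;> field_simp <;> ring

variable {P : PartMatrix F μ ν} {k : ℕ} {S : State F μ ν}

/-- There are at most `k` row vertices in the forest and column vertices outside. -/
lemma Searching.card_le (h : Searching P k S) :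
    Nat.card {i : Fin μ × Bool // Vertex.row i.1 i.2 ∈ S.nodes} +
      Nat.card {i : Fin ν × Bool // Vertex.col i.1 i.2 ∉ S.nodes} ≤ k := by
  classical
  have h1 := sum_matched_row h.opt.pair h.opt.coloring
    fun i : Fin μ × Bool => if Vertex.row i.1 i.2 ∈ S.nodes then 1 else 0
  have h2 := sum_matched_col h.opt.pair h.opt.coloring
    fun i : Fin ν × Bool => if Vertex.col i.1 i.2 ∈ S.nodes then 0 else 1
  have h3 : ∀ e ∈ S.x.M, (if Vertex.row e.1 (!S.x.sgn e.1 e.2) ∈ S.nodes then 1 else 0) +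
      (if Vertex.col e.2 (!S.x.sgn e.1 e.2) ∈ S.nodes then 0 else 1) = 1 := by
    intro e he
    have := h.mate (a := e.1) (b := e.2) (s := !S.x.sgn e.1 e.2) ⟨he, Or.inl (by simp)⟩
    by_cases hr : Vertex.row e.1 (!S.x.sgn e.1 e.2) ∈ S.nodes
    · rw [if_pos hr, if_pos (this.1 hr)]
    · rw [if_neg hr, if_neg fun hc => hr (this.2 hc)]
  have h4 : ∀ e ∈ S.x.I, (if Vertex.row e.1 (S.x.sgn e.1 e.2) ∈ S.nodes then 1 else 0) +
      (if Vertex.col e.2 (S.x.sgn e.1 e.2) ∈ S.nodes then 0 else 1) = 1 := by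
    intro e he
    have := h.mate (a := e.1) (b := e.2) (s := S.x.sgn e.1 e.2)
      ⟨h.opt.pair.subset he, Or.inr he⟩
    by_cases hr : Vertex.row e.1 (S.x.sgn e.1 e.2) ∈ S.nodes
    · rw [if_pos hr, if_pos (this.1 hr)]
    · rw [if_neg hr, if_neg fun hc => hr (this.2 hc)]
  have h5 := Finset.sum_congr rfl h3
  have h6 := Finset.sum_congr rfl h4
  rw [Finset.sum_add_distrib] at h5 h6
  simp only [Finset.sum_const, smul_eq_mul, mul_one] at h5 h6
  have h7 : Nat.card {i : Fin μ × Bool // Vertex.row i.1 i.2 ∈ S.nodes} =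
      ∑ i : Fin μ × Bool with ∃ b, Mate S.x i.1 b i.2,
        if Vertex.row i.1 i.2 ∈ S.nodes then 1 else 0 := by
    rw [Nat.card_eq_fintype_card, Fintype.card_subtype, Finset.card_filter, Finset.sum_filter]
    refine Finset.sum_congr rfl fun i _ => ?_
    split_ifs with h8 h9
    · rfl
    · exfalso
      push Not at h9
      exact Set.disjoint_left.1 h.target_disj h8 (h.opt.unmatched_mem_target h9)
    · rfl
    · rfl
  have h8 : Nat.card {i : Fin ν × Bool // Vertex.col i.1 i.2 ∉ S.nodes} =
      ∑ i : Fin ν × Bool with ∃ a, Mate S.x a i.1 i.2,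
        if Vertex.col i.1 i.2 ∈ S.nodes then 0 else 1 := by
    rw [Nat.card_eq_fintype_card, Fintype.card_subtype, Finset.card_filter, Finset.sum_filter]
    refine Finset.sum_congr rfl fun i _ => ?_
    by_cases h8 : Vertex.col i.1 i.2 ∈ S.nodes
    · simp [h8]
    · by_cases h9 : ∃ a, Mate S.x a i.1 i.2
      · simp [h8, h9]
      · push Not at h9
        exact absurd (h.source_sub (h.opt.unmatched_mem_source h9)) h8
  simp only at h1 h2
  rw [h7, h8, ← h1, ← h2, ← h.opt.size]
  omega

/-- If no edge of the transformed matrix leads from a column vertex of the forest to a row vertex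
outside, all minors of order `k + 1` vanish: a combination of `k + 1` columns is annihilated by
all rows as soon as `k` linear conditions are satisfied. -/
lemma Searching.delta_eq_bot (h : Searching P k S) (hs : slacks P S = ∅) :
    P.delta (k + 1) = ⊥ := by
  classical
  have hzero : ∀ b s a s', Vertex.col b s ∈ S.nodes → Vertex.row a s' ∉ S.nodes →
      Orth (P.A a b) (S.x.L.U a s') (S.x.L.V b s) := by
    intro b s a s' hb ha
    by_contra ho
    have : S.x.p.row a (S.x.L.U a s') + S.x.p.col b (S.x.L.V b s) + S.x.c - P.d a b ∈ slacks P S :=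
      ⟨b, s, a, s', hb, ha, ho, rfl⟩
    rw [hs] at this
    exact this
  choose u gu hu hgu using fun a => exists_dual_basis (S.x.L.U a) (S.x.L.U_ne a)
  choose v gv hv hgv using fun b => exists_dual_basis (S.x.L.V b) (S.x.L.V_ne b)
  have hbil : ∀ b s a s', Vertex.col b s ∈ S.nodes → Vertex.row a s' ∉ S.nodes →
      bil (P.A a b) (u a s') (v b s) = 0 := by
    intro b s a s' hb ha
    have := hzero b s a s' hb ha
    rwa [hu, hv, orth_span_iff] at this
  rw [PartMatrix.delta, Finset.sup_eq_bot_iff]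
  rintro ⟨r, c⟩ -
  suffices hdet : (P.toMatrix.submatrix r c).det = 0 by rw [hdet]; simp
  let R := LaurentPolynomial (MvPolynomial (Fin μ × Fin ν) F)
  let φ : F →+* R := LaurentPolynomial.C.comp MvPolynomial.C
  let m : Fin μ → Fin ν → R := fun a b =>
    LaurentPolynomial.C (MvPolynomial.X (a, b)) * LaurentPolynomial.T (P.d a b)
  have hent : ∀ a i b j, P.toMatrix (a, i) (b, j) = φ (P.A a b i j) * m a b := by
    intro a i b j
    simp only [PartMatrix.toMatrix, φ, m, map_mul, RingHom.comp_apply]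
    ring
  -- the combination `w` of columns with coefficients `y`
  let w : (Fin (k + 1) → R) →ₗ[R] (Fin ν × Fin 2 → R) :=
    { toFun := fun y q => ∑ l, if c l = q then y l else 0
      map_add' := by
        intro y y'; funext q; simp only [Pi.add_apply, ← Finset.sum_add_distrib]
        exact Finset.sum_congr rfl fun l _ => by split_ifs <;> simp
      map_smul' := by
        intro z y; funext q; simp only [Pi.smul_apply, smul_eq_mul, RingHom.id_apply]; rw [Finset.mul_sum]
        exact Finset.sum_congr rfl fun l _ => by split_ifs <;> simp }
  -- the conditions: the transformed rows in the forest annihilate `w`, and the coordinates of `w` at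
  -- the transformed columns outside vanish
  let f : (Fin (k + 1) → R) →ₗ[R]
      ({i : Fin μ × Bool // Vertex.row i.1 i.2 ∈ S.nodes} ⊕
        {i : Fin ν × Bool // Vertex.col i.1 i.2 ∉ S.nodes} → R) :=
    LinearMap.pi fun z => Sum.elim
      (fun i => ∑ b, ∑ l : Fin 2, ∑ j : Fin 2,
        (φ (u i.1.1 i.1.2 l * P.A i.1.1 b l j) * m i.1.1 b) • LinearMap.proj (b, j) ∘ₗ w)
      (fun i => ∑ j : Fin 2, φ (gv i.1.1 i.1.2 j) • LinearMap.proj (i.1.1, j) ∘ₗ w) z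
  have hninj : ¬ Function.Injective f := by
    intro hinj
    have h1 := card_le_of_injective R f hinj
    have h2 := h.card_le
    simp only [Nat.card_eq_fintype_card] at h2
    rw [Fintype.card_sum, Fintype.card_fin] at h1
    omega
  obtain ⟨y, hy, hy0⟩ : ∃ y, f y = 0 ∧ y ≠ 0 := by
    by_contra hcon
    push Not at hcon
    exact hninj ((injective_iff_map_eq_zero f).2 fun y hy => hcon y hy)
  have hrow : ∀ a s, Vertex.row a s ∈ S.nodes →
      ∑ b, ∑ l : Fin 2, ∑ j : Fin 2, φ (u a s l * P.A a b l j) * m a b * w y (b, j) = 0 := by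
    intro a s ha
    have := congrFun hy (Sum.inl ⟨(a, s), ha⟩)
    simpa [f, LinearMap.sum_apply] using this
  have hcol : ∀ b s, Vertex.col b s ∉ S.nodes → ∑ j : Fin 2, φ (gv b s j) * w y (b, j) = 0 := by
    intro b s hb
    have := congrFun hy (Sum.inr ⟨(b, s), hb⟩)
    simpa [f, LinearMap.sum_apply] using this
  have hw : ∀ b i, w y (b, i) = φ (v b true i) * ∑ j : Fin 2, φ (gv b true j) * w y (b, j) +
      φ (v b false i) * ∑ j : Fin 2, φ (gv b false j) * w y (b, j) := by
    intro b i
    have e0 := congrArg φ (hgv b i 0)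
    have e1 := congrArg φ (hgv b i 1)
    simp only [map_add, map_mul] at e0 e1
    rw [Fin.sum_univ_two, Fin.sum_univ_two]
    have : w y (b, i) = φ (if i = 0 then 1 else 0) * w y (b, 0) +
        φ (if i = 1 then 1 else 0) * w y (b, 1) := by
      fin_cases i <;> simp
    rw [this, ← e0, ← e1]
    ring
  -- Rows outside the forest see only columns outside, at which the dual coordinates vanish.
  have hrow' : ∀ a s,
      ∑ b, ∑ l : Fin 2, ∑ j : Fin 2, φ (u a s l * P.A a b l j) * m a b * w y (b, j) = 0 := by
    intro a s
    by_cases ha : Vertex.row a s ∈ S.nodes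
    · exact hrow a s ha
    · refine Finset.sum_eq_zero fun b _ => ?_
      have hterm : ∀ t, φ (bil (P.A a b) (u a s) (v b t)) *
          (∑ j : Fin 2, φ (gv b t j) * w y (b, j)) = 0 := by
        intro t
        by_cases hb : Vertex.col b t ∈ S.nodes
        · rw [hbil b t a s hb ha]; simp
        · rw [hcol b t hb]; simp
      have h1 := hterm true
      have h2 := hterm false
      simp only [bil_eq, map_add, map_mul] at h1 h2
      simp only [Fin.sum_univ_two (f := fun l => ∑ j : Fin 2, _)]
      rw [Fin.sum_univ_two, Fin.sum_univ_two, hw b 0, hw b 1]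
      simp only [map_mul]
      linear_combination m a b * h1 + m a b * h2
  apply Matrix.exists_mulVec_eq_zero_iff.1
  refine ⟨y, hy0, ?_⟩
  funext l
  obtain ⟨⟨a, i⟩, hai⟩ : ∃ q, r l = q := ⟨_, rfl⟩
  have hsum : ((P.toMatrix.submatrix r c).mulVec y) l =
      ∑ b, ∑ j : Fin 2, φ (P.A a b i j) * m a b * w y (b, j) := by
    have : ∀ b j, φ (P.A a b i j) * m a b * w y (b, j) =
        ∑ l', if c l' = (b, j) then P.toMatrix (r l) (c l') * y l' else 0 := by
      intro b j
      change φ (P.A a b i j) * m a b * (∑ l', if c l' = (b, j) then y l' else 0) = _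
      rw [Finset.mul_sum]
      refine Finset.sum_congr rfl fun l' _ => ?_
      split_ifs with hc
      · rw [hc, hai, hent]
      · simp
    simp only [this]
    rw [← Fintype.sum_prod_type' (f := fun b j => ∑ l', if c l' = (b, j) then
      P.toMatrix (r l) (c l') * y l' else 0), Finset.sum_comm]
    simp [Matrix.mulVec, dotProduct]
  rw [hsum]
  have e1 := hrow' a true
  have e2 := hrow' a false
  have key : ∀ b j, φ (P.A a b i j) =
      φ (gu a true i) * (∑ l : Fin 2, φ (u a true l * P.A a b l j)) +
      φ (gu a false i) * (∑ l : Fin 2, φ (u a false l * P.A a b l j)) := by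
    intro b j
    rw [Fin.sum_univ_two, Fin.sum_univ_two, ← map_add, ← map_add, ← map_mul, ← map_mul, ← map_add]
    congr 1
    have f0 := hgu a 0 i
    have f1 := hgu a 1 i
    have : P.A a b i j = (if (0 : Fin 2) = i then 1 else 0) * P.A a b 0 j +
        (if (1 : Fin 2) = i then 1 else 0) * P.A a b 1 j := by
      fin_cases i <;> simp
    rw [this, ← f0, ← f1]
    ring
  have : ∑ b, ∑ j : Fin 2, φ (P.A a b i j) * m a b * w y (b, j) =
      φ (gu a true i) * (∑ b, ∑ l : Fin 2, ∑ j : Fin 2,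
        φ (u a true l * P.A a b l j) * m a b * w y (b, j)) +
      φ (gu a false i) * (∑ b, ∑ l : Fin 2, ∑ j : Fin 2,
        φ (u a false l * P.A a b l j) * m a b * w y (b, j)) := by
    rw [Finset.mul_sum, Finset.mul_sum, ← Finset.sum_add_distrib]
    refine Finset.sum_congr rfl fun b _ => ?_
    simp only [key, Fin.sum_univ_two]
    ring
  rw [this, e1, e2]
  simp

end

/-! ### Reasoning about programs

The arrays of natural numbers that `StoresMatrix` and `StoresState` do not prescribe are used as
follows.
* `13`: the vertices of the path that is being extracted, from its end to its start;
* `20`, `21`: the mates of row and column vertices; `22`, `23`: their links;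
* `24`, `25`: the parents of row vertices, of sign `false` and `true`;
* `26`, `27`: the row and column vertices in the source set; `28`, `29`: those in the target set;
* `30`, `31`: the row and column vertices on a chain that may be rearranged;
* `32`, `33`: for each row vertex, a column of sign `false` and `true` from which an edge leaves the
  forest.

The entries that stand for rows and columns are shifted by `1`, and `0` means that there is none. The
registers are `34` for the result of a search, `40` to `42` for the counters of loops, `43` for the
current index on a chain, `50` to `54` for the chosen vertices and flags, and `60` to `65` for the
extraction of a path.
-/

/-- The arrays of natural numbers that a program may change. -/
def Cmd.natW : Cmd → List ℕ
  | .skip => []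
  | .setNat x _ _ _ => [x]
  | .setFld _ _ _ _ => []
  | .setReal _ _ _ _ => []
  | .seq p q => p.natW ++ q.natW
  | .ite _ p q => p.natW ++ q.natW
  | .loop x _ p => x :: p.natW

/-- The arrays of field elements that a program may change. -/
def Cmd.fldW : Cmd → List ℕ
  | .skip => []
  | .setNat _ _ _ _ => []
  | .setFld x _ _ _ => [x]
  | .setReal _ _ _ _ => []
  | .seq p q => p.fldW ++ q.fldW
  | .ite _ p q => p.fldW ++ q.fldW
  | .loop _ _ p => p.fldW

/-- The arrays of real numbers that a program may change. -/
def Cmd.realW : Cmd → List ℕ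
  | .skip => []
  | .setNat _ _ _ _ => []
  | .setFld _ _ _ _ => []
  | .setReal x _ _ _ => [x]
  | .seq p q => p.realW ++ q.realW
  | .ite _ p q => p.realW ++ q.realW
  | .loop _ _ p => p.realW

/-- The number of rows. -/
def rows : NExp := .get 0 (.const 0) (.const 0)

/-- The number of columns. -/
def cols : NExp := .get 0 (.const 0) (.const 1)

/-- The register `x`, that is, the cell `(x, 0, 0)`. -/
def reg (x : ℕ) : NExp := .get x (.const 0) (.const 0)

/-- The expressions that bound loops, with exponents `(i, j)` such that their value is
`O(μ ^ i * ν ^ j)`. -/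
def NExp.deg : NExp → Option (ℕ × ℕ)
  | .const _ => some (0, 0)
  | .get 0 (.const 0) (.const 0) => some (1, 0)
  | .get 0 (.const 0) (.const 1) => some (0, 1)
  | .add e f => e.deg.bind fun d => f.deg.map fun d' => (max d.1 d'.1, max d.2 d'.2)
  | _ => none

/-- Exponents `(i, j)` such that the running time is `O(μ ^ i * ν ^ j)`. The array `0`, which holds
`μ` and `ν`, must not be changed. -/
def Cmd.deg : Cmd → Option (ℕ × ℕ)
  | .skip => some (0, 0)
  | .setNat x _ _ _ => if x = 0 then none else some (0, 0)
  | .setFld _ _ _ _ => some (0, 0)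
  | .setReal _ _ _ _ => some (0, 0)
  | .seq p q => p.deg.bind fun d => q.deg.map fun d' => (max d.1 d'.1, max d.2 d'.2)
  | .ite _ p q => p.deg.bind fun d => q.deg.map fun d' => (max d.1 d'.1, max d.2 d'.2)
  | .loop x e p =>
    if x = 0 then none else e.deg.bind fun d => p.deg.map fun d' => (d.1 + d'.1, d.2 + d'.2)

section

variable {F : Type u}

/-- The memory after an assignment to a cell of an array of natural numbers. -/
def Mem.put (m : Mem F) (x i j y : ℕ) : Mem F := { m with nat := setCell m.nat x i j y }

lemma Mem.put_nat (m : Mem F) (x i j y x' i' j' : ℕ) :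
    (m.put x i j y).nat x' i' j' = if x' = x ∧ i' = i ∧ j' = j then y else m.nat x' i' j' := rfl

lemma Mem.put_same (m : Mem F) (x i j y : ℕ) : (m.put x i j y).nat x i j = y := by
  simp [Mem.put_nat]

lemma Mem.put_ne (m : Mem F) {x x' : ℕ} (h : x' ≠ x) (i j y : ℕ) :
    (m.put x i j y).nat x' = m.nat x' := by
  funext i' j'; simp [Mem.put_nat, h]

/-- `m'` differs from `m` only in arrays that `p` may change. -/
structure Frame (p : Cmd) (m m' : Mem F) : Prop where
  nat : ∀ x ∉ p.natW, m'.nat x = m.nat x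
  fld : ∀ x ∉ p.fldW, m'.fld x = m.fld x
  real : ∀ x ∉ p.realW, m'.real x = m.real x

lemma Frame.rfl {p : Cmd} {m : Mem F} : Frame p m m :=
  ⟨fun _ _ => _root_.rfl, fun _ _ => _root_.rfl, fun _ _ => _root_.rfl⟩

lemma Frame.trans {p : Cmd} {m m' m'' : Mem F} (h : Frame p m m') (h' : Frame p m' m'') :
    Frame p m m'' :=
  ⟨fun x hx => (h'.nat x hx).trans (h.nat x hx), fun x hx => (h'.fld x hx).trans (h.fld x hx),
    fun x hx => (h'.real x hx).trans (h.real x hx)⟩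

lemma Frame.mono {p q : Cmd} {m m' : Mem F} (h : Frame p m m') (h1 : p.natW ⊆ q.natW)
    (h2 : p.fldW ⊆ q.fldW) (h3 : p.realW ⊆ q.realW) : Frame q m m' :=
  ⟨fun x hx => h.nat x fun h => hx (h1 h), fun x hx => h.fld x fun h => hx (h2 h),
    fun x hx => h.real x fun h => hx (h3 h)⟩

lemma Frame.put {p : Cmd} {m m' : Mem F} (h : Frame p m m') {x : ℕ} (hx : x ∈ p.natW)
    (i j y : ℕ) : Frame p m (m'.put x i j y) :=
  ⟨fun x' hx' => by rw [Mem.put_ne _ (by rintro rfl; exact hx' hx), h.nat x' hx'], h.fld, h.real⟩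

lemma setCell_ne {T : Type u} (f : ℕ → ℕ → ℕ → T) {x x' : ℕ} (h : x' ≠ x) (i j : ℕ) (y : T) :
    setCell f x i j y x' = f x' := by
  funext i' j'; simp [setCell, h]

variable [Field F]

/-- The memory after the execution of a program. -/
noncomputable def Cmd.exec (p : Cmd) (m : Mem F) : Mem F := (p.run m).1

lemma Cmd.exec_seq (p q : Cmd) (m : Mem F) : (Cmd.seq p q).exec m = q.exec (p.exec m) := rfl

lemma Cmd.exec_setNat (x : ℕ) (i j e : NExp) (m : Mem F) :
    (Cmd.setNat x i j e).exec m = m.put x (i.eval m) (j.eval m) (e.eval m) := rfl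

lemma Cmd.exec_skip (m : Mem F) : Cmd.skip.exec m = m := rfl

open Classical in
lemma Cmd.exec_ite (b : Test) (p q : Cmd) (m : Mem F) :
    (Cmd.ite b p q).exec m = if b.Holds m then p.exec m else q.exec m := by
  unfold Cmd.exec
  rw [Cmd.run]
  split_ifs <;> rfl

lemma Cmd.exec_ite_pos {b : Test} {p q : Cmd} {m : Mem F} (h : b.Holds m) :
    (Cmd.ite b p q).exec m = p.exec m := by rw [Cmd.exec_ite, if_pos h]

lemma Cmd.exec_ite_neg {b : Test} {p q : Cmd} {m : Mem F} (h : ¬ b.Holds m) :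
    (Cmd.ite b p q).exec m = q.exec m := by rw [Cmd.exec_ite, if_neg h]

/-- An invariant of the body is an invariant of the loop. -/
lemma Cmd.exec_loop_of_frame {x : ℕ} {e : NExp} {p : Cmd} {m : Mem F}
    (hp : ∀ m : Mem F, Frame p m (p.exec m)) (Inv : ℕ → Mem F → Prop)
    {n : ℕ} (hn : e.eval m = n) (h0 : Inv 0 m)
    (hs : ∀ i m', i < n → Frame (.loop x e p) m m' → Inv i m' →
      Inv (i + 1) (p.exec (m'.put x 0 0 i))) :
    Inv n ((Cmd.loop x e p).exec m) ∧ Frame (.loop x e p) m ((Cmd.loop x e p).exec m) := by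
  have key : ∀ i ≤ n, ∀ t, Inv i ((List.range i).foldl
      (fun mt i =>
        let r := p.run { mt.1 with nat := setCell mt.1.nat x 0 0 i }
        (r.1, mt.2 + r.2 + 1)) (m, t)).1 ∧ Frame (.loop x e p) m ((List.range i).foldl
      (fun mt i =>
        let r := p.run { mt.1 with nat := setCell mt.1.nat x 0 0 i }
        (r.1, mt.2 + r.2 + 1)) (m, t)).1 := by
    intro i
    induction i with
    | zero => intro _ t; exact ⟨h0, .rfl⟩
    | succ i ih =>
      intro hi t
      rw [List.range_succ, List.foldl_append]
      obtain ⟨h1, h2⟩ := ih (by omega) t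
      refine ⟨hs i _ (by omega) h2 h1, (h2.put (x := x) (by simp [Cmd.natW]) 0 0 i).trans ?_⟩
      exact (hp _).mono (by simp [Cmd.natW]) (by simp [Cmd.fldW]) (by simp [Cmd.realW])
  have := key n le_rfl (e.cost + 1)
  subst hn
  exact this

lemma Cmd.frame (p : Cmd) : ∀ m : Mem F, Frame p m (p.exec m) := by
  induction p with
  | skip => intro m; exact .rfl
  | setNat x i j e =>
    intro m
    exact Frame.rfl.put (by simp [Cmd.natW]) _ _ _
  | setFld x i j e =>
    intro m
    refine ⟨fun _ _ => rfl, fun x' hx' => ?_, fun _ _ => rfl⟩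
    exact setCell_ne _ (by simpa [Cmd.fldW] using hx') _ _ _
  | setReal x i j e =>
    intro m
    refine ⟨fun _ _ => rfl, fun _ _ => rfl, fun x' hx' => ?_⟩
    funext i' j'
    have : x' ≠ x := by simpa [Cmd.realW] using hx'
    simp [Cmd.exec, Cmd.run, setCell, this]
  | seq p q ihp ihq =>
    intro m
    exact ((ihp m).mono (by simp [Cmd.natW]) (by simp [Cmd.fldW]) (by simp [Cmd.realW])).trans
      ((ihq _).mono (by simp [Cmd.natW]) (by simp [Cmd.fldW]) (by simp [Cmd.realW]))
  | ite b p q ihp ihq =>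
    intro m
    by_cases hb : b.Holds m
    · rw [Cmd.exec_ite_pos hb]
      exact (ihp m).mono (by simp [Cmd.natW]) (by simp [Cmd.fldW]) (by simp [Cmd.realW])
    · rw [Cmd.exec_ite_neg hb]
      exact (ihq m).mono (by simp [Cmd.natW]) (by simp [Cmd.fldW]) (by simp [Cmd.realW])
  | loop x e p ihp =>
    intro m
    exact (Cmd.exec_loop_of_frame ihp (fun _ _ => True) rfl trivial fun _ _ _ _ _ => trivial).2

lemma Cmd.exec_loop {x : ℕ} {e : NExp} {p : Cmd} {m : Mem F} (Inv : ℕ → Mem F → Prop)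
    {n : ℕ} (hn : e.eval m = n) (h0 : Inv 0 m)
    (hs : ∀ i m', i < n → Frame (.loop x e p) m m' → Inv i m' →
      Inv (i + 1) (p.exec (m'.put x 0 0 i))) :
    Inv n ((Cmd.loop x e p).exec m) :=
  (Cmd.exec_loop_of_frame p.frame Inv hn h0 hs).1

lemma eval_reg (m : Mem F) (x : ℕ) : (reg x).eval m = m.nat x 0 0 := rfl

/-! ### The running time of programs -/

lemma NExp.eval_le {e : NExp} {d : ℕ × ℕ} (h : e.deg = some d) :
    ∃ K, ∀ (F : Type u) [Field F] (m : Mem F), 1 ≤ m.nat 0 0 0 → 1 ≤ m.nat 0 0 1 →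
      e.eval m ≤ K * (m.nat 0 0 0 ^ d.1 * m.nat 0 0 1 ^ d.2) := by
  induction e generalizing d with
  | const k =>
    simp only [NExp.deg, Option.some.injEq] at h
    subst h
    exact ⟨k, fun F _ m _ _ => by simp [NExp.eval]⟩
  | get x i j =>
    unfold NExp.deg at h
    split at h
    · cases ‹NExp.get x i j = _›
    · cases ‹NExp.get x i j = _›
      cases h
      exact ⟨1, fun F _ m _ _ => by simp [NExp.eval]⟩
    · cases ‹NExp.get x i j = _›
      cases h
      exact ⟨1, fun F _ m _ _ => by simp [NExp.eval]⟩
    · cases ‹NExp.get x i j = _›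
    · cases h
  | add e f ihe ihf =>
    simp only [NExp.deg, Option.bind_eq_some_iff, Option.map_eq_some_iff] at h
    obtain ⟨d1, h1, d2, h2, rfl⟩ := h
    obtain ⟨K1, hK1⟩ := ihe h1
    obtain ⟨K2, hK2⟩ := ihf h2
    refine ⟨K1 + K2, fun F _ m hm hn => ?_⟩
    rw [NExp.eval, add_mul]
    refine add_le_add ((hK1 F m hm hn).trans ?_) ((hK2 F m hm hn).trans ?_)
    · gcongr <;> simp [hm, hn]
    · gcongr <;> simp [hm, hn]
  | sub e f => simp [NExp.deg] at h

lemma Cmd.zero_notMem_natW {p : Cmd} {d : ℕ × ℕ} (h : p.deg = some d) : 0 ∉ p.natW := by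
  induction p generalizing d with
  | skip => simp [Cmd.natW]
  | setNat x i j e =>
    rw [Cmd.deg] at h
    split_ifs at h with hx
    simpa [Cmd.natW] using Ne.symm hx
  | setFld x i j e => simp [Cmd.natW]
  | setReal x i j e => simp [Cmd.natW]
  | seq p q ihp ihq =>
    simp only [Cmd.deg, Option.bind_eq_some_iff, Option.map_eq_some_iff] at h
    obtain ⟨d1, h1, d2, h2, rfl⟩ := h
    simp [Cmd.natW, ihp h1, ihq h2]
  | ite b p q ihp ihq =>
    simp only [Cmd.deg, Option.bind_eq_some_iff, Option.map_eq_some_iff] at h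
    obtain ⟨d1, h1, d2, h2, rfl⟩ := h
    simp [Cmd.natW, ihp h1, ihq h2]
  | loop x e p ihp =>
    rw [Cmd.deg] at h
    split_ifs at h with hx
    simp only [Option.bind_eq_some_iff, Option.map_eq_some_iff] at h
    obtain ⟨d1, h1, d2, h2, rfl⟩ := h
    simp [Cmd.natW, ihp h2, Ne.symm hx]

lemma Cmd.run_loop_le {x : ℕ} {e : NExp} {p : Cmd} {m : Mem F} {B : ℕ}
    (hB : ∀ m' : Mem F, m'.nat 0 = m.nat 0 → (p.run m').2 ≤ B) (hp : 0 ∉ p.natW) (hx : x ≠ 0) :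
    ((Cmd.loop x e p).run m).2 ≤ e.cost + 1 + e.eval m * (B + 1) := by
  let f : Mem F × ℕ → ℕ → Mem F × ℕ := fun mt i =>
    ((p.run (mt.1.put x 0 0 i)).1, mt.2 + (p.run (mt.1.put x 0 0 i)).2 + 1)
  have key : ∀ i : ℕ, ((List.range i).foldl f (m, e.cost + 1)).2 ≤ e.cost + 1 + i * (B + 1) ∧
      ((List.range i).foldl f (m, e.cost + 1)).1.nat 0 = m.nat 0 := by
    intro i
    induction i with
    | zero => simp
    | succ i ih =>
      rw [List.range_succ, List.foldl_append]
      simp only [List.foldl_cons, List.foldl_nil]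
      generalize (List.range i).foldl _ _ = z at ih ⊢
      have h1 : (z.1.put x 0 0 i).nat 0 = m.nat 0 := by
        rw [← ih.2]; exact Mem.put_ne _ hx.symm _ _ _
      have h2 := hB _ h1
      refine ⟨?_, ((p.frame _).nat 0 hp).trans h1⟩
      have := ih.1
      rw [add_mul]
      simp only [f]
      omega
  exact (key _).1

/-- The running time is as announced by `Cmd.deg`. -/
lemma Cmd.run_le {p : Cmd} {d : ℕ × ℕ} (h : p.deg = some d) :
    ∃ K, ∀ (F : Type u) [Field F] (m : Mem F), 1 ≤ m.nat 0 0 0 → 1 ≤ m.nat 0 0 1 →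
      (p.run m).2 ≤ K * (m.nat 0 0 0 ^ d.1 * m.nat 0 0 1 ^ d.2) := by
  induction p generalizing d with
  | skip =>
    cases h
    exact ⟨1, fun F _ m _ _ => by simp [Cmd.run]⟩
  | setNat x i j e =>
    rw [Cmd.deg] at h
    split_ifs at h with hx
    cases h
    exact ⟨i.cost + j.cost + e.cost + 1, fun F _ m _ _ => by simp [Cmd.run]⟩
  | setFld x i j e =>
    cases h
    exact ⟨i.cost + j.cost + e.cost + 1, fun F _ m _ _ => by simp [Cmd.run]⟩
  | setReal x i j e =>
    cases h
    exact ⟨i.cost + j.cost + e.cost + 1, fun F _ m _ _ => by simp [Cmd.run]⟩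
  | seq p q ihp ihq =>
    simp only [Cmd.deg, Option.bind_eq_some_iff, Option.map_eq_some_iff] at h
    obtain ⟨d1, h1, d2, h2, rfl⟩ := h
    obtain ⟨K1, hK1⟩ := ihp h1
    obtain ⟨K2, hK2⟩ := ihq h2
    refine ⟨K1 + K2, fun F _ m hm hn => ?_⟩
    have hp : (p.run m).1.nat 0 = m.nat 0 := (p.frame m).nat 0 (Cmd.zero_notMem_natW h1)
    have e1 := hK1 F m hm hn
    have e2 := hK2 F (p.run m).1 (by rw [hp]; exact hm) (by rw [hp]; exact hn)
    rw [hp] at e2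
    rw [Cmd.run, add_mul]
    refine add_le_add (e1.trans ?_) (e2.trans ?_)
    · gcongr <;> simp [hm, hn]
    · gcongr <;> simp [hm, hn]
  | ite b p q ihp ihq =>
    simp only [Cmd.deg, Option.bind_eq_some_iff, Option.map_eq_some_iff] at h
    obtain ⟨d1, h1, d2, h2, rfl⟩ := h
    obtain ⟨K1, hK1⟩ := ihp h1
    obtain ⟨K2, hK2⟩ := ihq h2
    refine ⟨K1 + K2 + (b.cost + 1), fun F _ m hm hn => ?_⟩
    · have e1 : (p.run m).2 ≤ K1 * (m.nat 0 0 0 ^ max d1.1 d2.1 * m.nat 0 0 1 ^ max d1.2 d2.2) :=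
        (hK1 F m hm hn).trans (by gcongr <;> simp [hm, hn])
      have e2 : (q.run m).2 ≤ K2 * (m.nat 0 0 0 ^ max d1.1 d2.1 * m.nat 0 0 1 ^ max d1.2 d2.2) :=
        (hK2 F m hm hn).trans (by gcongr <;> simp [hm, hn])
      have e3 : b.cost + 1 ≤ (b.cost + 1) *
          (m.nat 0 0 0 ^ max d1.1 d2.1 * m.nat 0 0 1 ^ max d1.2 d2.2) :=
        Nat.le_mul_of_pos_right _ (Nat.mul_pos (Nat.pow_pos hm) (Nat.pow_pos hn))
      rw [Cmd.run, add_mul, add_mul]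
      split_ifs
      · dsimp only; omega
      · dsimp only; omega
  | loop x e p ihp =>
    rw [Cmd.deg] at h
    split_ifs at h with hx
    simp only [Option.bind_eq_some_iff, Option.map_eq_some_iff] at h
    obtain ⟨d1, h1, d2, h2, rfl⟩ := h
    obtain ⟨K1, hK1⟩ := NExp.eval_le h1
    obtain ⟨K2, hK2⟩ := ihp h2
    refine ⟨e.cost + 1 + K1 * (K2 + 1), fun F _ m hm hn => ?_⟩
    have hB : ∀ m' : Mem F, m'.nat 0 = m.nat 0 →
        (p.run m').2 ≤ K2 * (m.nat 0 0 0 ^ d2.1 * m.nat 0 0 1 ^ d2.2) := by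
      intro m' hm'
      have := hK2 F m' (by rw [hm']; exact hm) (by rw [hm']; exact hn)
      rwa [hm'] at this
    refine (Cmd.run_loop_le hB (Cmd.zero_notMem_natW h2) hx).trans ?_
    have e1 := hK1 F m hm hn
    have p1 : 0 < m.nat 0 0 0 ^ d1.1 * m.nat 0 0 1 ^ d1.2 :=
      Nat.mul_pos (Nat.pow_pos hm) (Nat.pow_pos hn)
    have p2 : 0 < m.nat 0 0 0 ^ d2.1 * m.nat 0 0 1 ^ d2.2 :=
      Nat.mul_pos (Nat.pow_pos hm) (Nat.pow_pos hn)
    rw [pow_add, pow_add, mul_mul_mul_comm]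
    generalize m.nat 0 0 0 ^ d1.1 * m.nat 0 0 1 ^ d1.2 = A at *
    generalize m.nat 0 0 0 ^ d2.1 * m.nat 0 0 1 ^ d2.2 = B at *
    have e2 : e.cost + 1 ≤ (e.cost + 1) * (A * B) := Nat.le_mul_of_pos_right _ (Nat.mul_pos p1 p2)
    have e3 : e.eval m * (K2 * B + 1) ≤ (K1 * A) * ((K2 + 1) * B) := by
      refine Nat.mul_le_mul e1 ?_
      rw [add_mul]
      omega
    calc _ ≤ (e.cost + 1) * (A * B) + (K1 * A) * ((K2 + 1) * B) := add_le_add e2 e3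
      _ = _ := by ring

end

/-! ### Searching and marking programs -/

/-- Do `f true` and `f false`. -/
def both (f : Bool → Cmd) : Cmd := .seq (f true) (f false)

/-- Set the cell `(x, i, j)` to `k + 1` for the last value `k < e` of the register `v` that satisfies
the test `t`, and to `0` if there is none. -/
def search (x : ℕ) (i j : NExp) (v : ℕ) (e : NExp) (t : Test) : Cmd :=
  .seq (.setNat x i j (.const 0))
    (.loop v e (.ite t (.setNat x i j (.add (reg v) (.const 1))) .skip))

/-- Search for all values `i < e` of the register `v` and all signs `s`; the results are stored in
the cells `(x, i, s)`. -/
def lookup (x v : ℕ) (e : NExp) (v' : ℕ) (e' : NExp) (t : Bool → Test) : Cmd :=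
  .loop v e (both fun s => search x (reg v) (.const s.toNat) v' e' (t s))

/-- The array `T` is a table of a partial function with graph contained in `φ` and with the largest
possible domain. -/
def Table {n k : ℕ} (T : ℕ → ℕ → ℕ) (φ : Fin n → Bool → Fin k → Prop) : Prop :=
  ∀ (i : Fin n) (s : Bool),
    (T i s.toNat = 0 ∧ ∀ j, ¬ φ i s j) ∨ ∃ j : Fin k, T i s.toNat = j + 1 ∧ φ i s j

/-- The cells `(i, s)` of `T` with value `1` are those with `φ i s`. -/
def Marks {n : ℕ} (T : ℕ → ℕ → ℕ) (φ : Fin n → Bool → Prop) : Prop :=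
  ∀ (i : Fin n) (s : Bool), T i s.toNat = 1 ↔ φ i s

lemma toNat_inj {s t : Bool} : s.toNat = t.toNat ↔ s = t := by
  cases s <;> cases t <;> decide

section

variable {F : Type u} [Field F]

lemma Frame.left {p q : Cmd} {m m' : Mem F} (h : Frame p m m') : Frame (.seq p q) m m' :=
  h.mono (by simp [Cmd.natW]) (by simp [Cmd.fldW]) (by simp [Cmd.realW])

lemma Frame.right {p q : Cmd} {m m' : Mem F} (h : Frame q m m') : Frame (.seq p q) m m' :=
  h.mono (by simp [Cmd.natW]) (by simp [Cmd.fldW]) (by simp [Cmd.realW])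

lemma Frame.body {x : ℕ} {e : NExp} {p : Cmd} {m m' : Mem F} (h : Frame p m m') :
    Frame (.loop x e p) m m' :=
  h.mono (by simp [Cmd.natW]) (by simp [Cmd.fldW]) (by simp [Cmd.realW])

lemma Frame.loopVar {x : ℕ} {e : NExp} {p : Cmd} {m m' : Mem F} (h : Frame (.loop x e p) m m')
    (i : ℕ) : Frame (.loop x e p) m (m'.put x 0 0 i) := h.put (by simp [Cmd.natW]) _ _ _

/-- A property that `f true` and `f false` establish one after the other. -/
lemma exec_both {f : Bool → Cmd} {m : Mem F} (Inv : (Bool → Prop) → Mem F → Prop)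
    (h0 : Inv (fun _ => False) m)
    (hs : ∀ s A m', (∀ t, A t → t ≠ s) → Frame (both f) m m' → Inv A m' →
      Inv (fun t => t = s ∨ A t) ((f s).exec m')) : Inv (fun _ => True) ((both f).exec m) := by
  have h1 := hs true _ m (by simp) .rfl h0
  have h2 := hs false _ _ (by simp) ((f true).frame m).left h1
  have h3 : (fun t => t = false ∨ t = true ∨ False) = fun _ => True := by
    funext t; cases t <;> simp
  rw [h3] at h2
  exact h2

lemma search_spec {x v : ℕ} {i j e : NExp} {t : Test} {m : Mem F} {i0 j0 n : ℕ} {φ : ℕ → Prop}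
    (hxv : x ≠ v)
    (hi : ∀ m', Frame (search x i j v e t) m m' → i.eval m' = i0)
    (hj : ∀ m', Frame (search x i j v e t) m m' → j.eval m' = j0)
    (he : ∀ m', Frame (search x i j v e t) m m' → e.eval m' = n)
    (ht : ∀ m', Frame (search x i j v e t) m m' → ∀ k < n, m'.nat v 0 0 = k → (t.Holds m' ↔ φ k)) :
    ((((search x i j v e t).exec m).nat x i0 j0 = 0 ∧ ∀ k < n, ¬ φ k) ∨
      ∃ k < n, φ k ∧ ((search x i j v e t).exec m).nat x i0 j0 = k + 1) ∧
    ∀ i' j', ¬ (i' = i0 ∧ j' = j0) → ((search x i j v e t).exec m).nat x i' j' = m.nat x i' j' := by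
  have hx : x ∈ (search x i j v e t).natW := by simp [search, Cmd.natW]
  have hf0 : Frame (search x i j v e t) m (m.put x i0 j0 0) := Frame.rfl.put hx _ _ _
  have h0 : (search x i j v e t).exec m =
      (Cmd.loop v e (.ite t (.setNat x i j (.add (reg v) (.const 1))) .skip)).exec
        (m.put x i0 j0 0) := by
    rw [search, Cmd.exec_seq, Cmd.exec_setNat, hi m .rfl, hj m .rfl]; rfl
  rw [h0]
  refine Cmd.exec_loop (n := n) (fun l m' =>
    ((m'.nat x i0 j0 = 0 ∧ ∀ k < l, ¬ φ k) ∨ ∃ k < l, φ k ∧ m'.nat x i0 j0 = k + 1) ∧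
    ∀ i' j', ¬ (i' = i0 ∧ j' = j0) → m'.nat x i' j' = m.nat x i' j') (he _ hf0) ?_ ?_
  · refine ⟨Or.inl ⟨m.put_same _ _ _ _, by simp⟩, fun i' j' hne => ?_⟩
    rw [Mem.put_nat, if_neg]
    exact fun h => hne h.2
  · rintro l m' hl hf ⟨h1, h2⟩
    have hf2 : Frame (search x i j v e t) m (m'.put v 0 0 l) := hf0.trans (hf.loopVar l).right
    have ht' := ht _ hf2 l hl (Mem.put_same _ _ _ _ _)
    by_cases hφ : φ l
    · rw [Cmd.exec_ite_pos (ht'.2 hφ), Cmd.exec_setNat, hi _ hf2, hj _ hf2]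
      refine ⟨Or.inr ⟨l, by omega, hφ, ?_⟩, fun i' j' hne => ?_⟩
      · rw [Mem.put_same]
        simp [NExp.eval, eval_reg, Mem.put_same]
      · rw [Mem.put_nat, if_neg (fun h => hne h.2), Mem.put_ne _ hxv]
        exact h2 i' j' hne
    · rw [Cmd.exec_ite_neg (fun h => hφ (ht'.1 h)), Cmd.exec_skip, Mem.put_ne _ hxv]
      refine ⟨?_, h2⟩
      rcases h1 with ⟨h1, h3⟩ | ⟨k, hk, h3⟩
      · refine Or.inl ⟨h1, fun k hk => ?_⟩
        rcases Nat.lt_succ_iff_lt_or_eq.1 hk with hk | rfl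
        · exact h3 k hk
        · exact hφ
      · exact Or.inr ⟨k, by omega, h3⟩

/-- `lookup` makes a table of the relation that its test decides. -/
lemma lookup_spec {x v v' : ℕ} {e e' : NExp} {t : Bool → Test} {m : Mem F} {n k : ℕ}
    {φ : Fin n → Bool → Fin k → Prop} (hxv : x ≠ v) (hxv' : x ≠ v') (hvv : v ≠ v')
    (he : e.eval m = n)
    (he' : ∀ m', Frame (lookup x v e v' e' t) m m' → e'.eval m' = k)
    (ht : ∀ m', Frame (lookup x v e v' e' t) m m' → ∀ (i : Fin n) (s : Bool) (j : Fin k),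
      m'.nat v 0 0 = i → m'.nat v' 0 0 = j → ((t s).Holds m' ↔ φ i s j)) :
    Table (((lookup x v e v' e' t).exec m).nat x) φ := by
  have key : ∀ i : Fin n, (i : ℕ) < n → ∀ s : Bool,
      (((lookup x v e v' e' t).exec m).nat x i s.toNat = 0 ∧ ∀ j, ¬ φ i s j) ∨
      ∃ j : Fin k, ((lookup x v e v' e' t).exec m).nat x i s.toNat = j + 1 ∧ φ i s j := by
    refine Cmd.exec_loop (n := n) (fun l m' => ∀ i : Fin n, (i : ℕ) < l → ∀ s : Bool,
      (m'.nat x i s.toNat = 0 ∧ ∀ j, ¬ φ i s j) ∨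
      ∃ j : Fin k, m'.nat x i s.toNat = j + 1 ∧ φ i s j) he (by simp) ?_
    intro l m' hl hf hInv
    have hf1 := hf.loopVar l
    have := exec_both (f := fun s => search x (reg v) (.const s.toNat) v' e' (t s))
      (m := m'.put v 0 0 l) (fun A m'' => ∀ i : Fin n, (i : ℕ) < l + 1 → ∀ s : Bool,
        (i : ℕ) < l ∨ A s → (m''.nat x i s.toNat = 0 ∧ ∀ j, ¬ φ i s j) ∨
      ∃ j : Fin k, m''.nat x i s.toNat = j + 1 ∧ φ i s j) ?_ ?_
    · intro i hi s
      exact this i hi s (Or.inr trivial)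
    · intro i hi s hA
      rw [Mem.put_ne _ hxv]
      exact hInv i (by simpa using hA) s
    · intro s A m'' hA hf2 hInv2
      have hf3 : Frame (lookup x v e v' e' t) m m'' := hf1.trans hf2.body
      have hf4 : ∀ m3, Frame (search x (reg v) (.const s.toNat) v' e' (t s)) m'' m3 →
          Frame (lookup x v e v' e' t) m m3 := by
        intro m3 h3
        refine hf3.trans (Frame.body ?_)
        cases s
        · exact h3.right
        · exact h3.left
      have hv : m''.nat v 0 0 = l := by
        rw [hf2.nat v (by simp [both, search, Cmd.natW, hxv.symm, hvv]), Mem.put_same]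
      have hv' : ∀ m3, Frame (search x (reg v) (.const s.toNat) v' e' (t s)) m'' m3 →
          m3.nat v 0 0 = l := by
        intro m3 h3
        rw [h3.nat v (by simp [search, Cmd.natW, hxv.symm, hvv]), hv]
      obtain ⟨h1, h2⟩ := search_spec (m := m'') (i := reg v) (j := .const s.toNat) (v := v')
        (e := e') (t := t s) (x := x) (i0 := l) (j0 := s.toNat) (n := k)
        (φ := fun j => ∃ h : j < k, φ ⟨l, hl⟩ s ⟨j, h⟩) hxv' hv' (fun _ _ => rfl)
        (fun m3 h3 => he' m3 (hf4 m3 h3)) (by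
          intro m3 h3 j hj hj'
          rw [ht m3 (hf4 m3 h3) ⟨l, hl⟩ s ⟨j, hj⟩ (hv' m3 h3) hj']
          exact ⟨fun h => ⟨hj, h⟩, fun ⟨_, h⟩ => h⟩)
      intro i hi s' hs'
      by_cases hc : (i : ℕ) = l ∧ s' = s
      · obtain ⟨hc1, rfl⟩ := hc
        have hil : i = ⟨l, hl⟩ := Fin.ext hc1
        rw [hil]
        rcases h1 with ⟨h1, h3⟩ | ⟨j, hj, ⟨_, h3⟩, h4⟩
        · exact Or.inl ⟨h1, fun j h => h3 j j.2 ⟨j.2, h⟩⟩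
        · exact Or.inr ⟨⟨j, hj⟩, h4, h3⟩
      · rw [h2 i s'.toNat (by rwa [toNat_inj])]
        refine hInv2 i hi s' ?_
        rcases hs' with h | rfl | h
        · exact Or.inl h
        · exact Or.inl (by simp only [and_true] at hc; omega)
        · exact Or.inr h
  exact fun i s => key i i.2 s

/-- Set the cells `(x, i, s)` with `i < e` to `0`. -/
def clear (x v : ℕ) (e : NExp) : Cmd :=
  .loop v e (both fun s => .setNat x (reg v) (.const s.toNat) (.const 0))

lemma clear_spec {x v : ℕ} {e : NExp} {m : Mem F} {n : ℕ} (hxv : x ≠ v) (he : e.eval m = n) :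
    Marks (n := n) (((clear x v e).exec m).nat x) fun _ _ => False := by
  have key : ∀ i : Fin n, (i : ℕ) < n → ∀ s : Bool,
      ((clear x v e).exec m).nat x i s.toNat = 0 := by
    refine Cmd.exec_loop (n := n) (fun l m' => ∀ i : Fin n, (i : ℕ) < l → ∀ s : Bool,
      m'.nat x i s.toNat = 0) he (by simp) ?_
    intro l m' hl hf hInv i hi s
    simp only [both, Cmd.exec_seq, Cmd.exec_setNat, NExp.eval, reg, Mem.put_nat]
    rcases Nat.lt_succ_iff_lt_or_eq.1 hi with hi | hi
    · have := hInv i hi s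
      cases s <;> simp_all
    · cases s <;> simp [hi, hxv.symm]
  intro i s
  rw [key i i.2 s]
  simp

end

/-! ### Following alternating chains -/

/-- One step along alternating chains, for the sign `s`. -/
inductive Hop {n k : ℕ} (φ : Fin n → Bool → Fin k → Prop) (ψ : Fin k → Bool → Fin n → Prop)
    (s : Bool) : Fin n ⊕ Fin k → Fin n ⊕ Fin k → Prop
  | fst {i : Fin n} {j : Fin k} (h : φ i s j) : Hop φ ψ s (.inl i) (.inr j)
  | snd {i : Fin n} {j : Fin k} (h : ψ j s i) : Hop φ ψ s (.inr j) (.inl i)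

/-- Follow the chain that starts at the index in the register `c` (shifted by `1`) and whose steps
are given by the tables `lk` and `mt`; mark its elements in the arrays `x` and `y`. -/
def chase (x y lk mt c v : ℕ) (e : NExp) (s : Bool) : Cmd :=
  .loop v e (.ite (.natEq (reg c) (.const 0)) .skip
    (.seq (.setNat x (.sub (reg c) (.const 1)) (.const s.toNat) (.const 1))
    (.seq (.setNat c (.const 0) (.const 0)
      (.get lk (.sub (reg c) (.const 1)) (.const s.toNat)))
    (.ite (.natEq (reg c) (.const 0)) .skip
      (.seq (.setNat y (.sub (reg c) (.const 1)) (.const s.toNat) (.const 1))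
      (.setNat c (.const 0) (.const 0)
        (.get mt (.sub (reg c) (.const 1)) (.const s.toNat))))))))

/-- Mark the elements of all chains that start at an index with entry `0` in the table `ch`. -/
def flood (x y lk mt ch c v w : ℕ) (e e' : NExp) : Cmd :=
  .seq (clear x w e) (.seq (clear y w e')
    (.loop w e (both fun s => .ite (.natEq (.get ch (reg w) (.const s.toNat)) (.const 0))
      (.seq (.setNat c (.const 0) (.const 0) (.add (reg w) (.const 1)))
        (chase x y lk mt c v (.add e' (.const 1)) s))
      .skip)))

section

variable {F : Type u} [Field F] {n k : ℕ} {φ : Fin n → Bool → Fin k → Prop}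
  {ψ : Fin k → Bool → Fin n → Prop}

/-- By injectivity of the steps, the chain from a start without predecessor does not return to an index
that it has passed. Each round but the last uses up one of the `k` indices of the other side, so that
`k + 1` rounds are enough. -/
lemma chase_spec {x y lk mt c v : ℕ} {e : NExp} {s : Bool} {m : Mem F} {i0 : Fin n}
    (hd : [x, y, lk, mt, c, v].Nodup) (he : e.eval m = k + 1) (hlk : Table (m.nat lk) φ)
    (hmt : Table (m.nat mt) ψ) (hc : m.nat c 0 0 = i0 + 1)
    (hφ : ∀ {i j j'}, φ i s j → φ i s j' → j = j') (hψ : ∀ {i j j'}, ψ i s j → ψ i s j' → j = j')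
    (hφ' : ∀ {i i' j}, φ i s j → φ i' s j → i = i')
    (hψ' : ∀ {i i' j}, ψ i s j → ψ i' s j → i = i') (h0 : ∀ j, ¬ ψ j s i0) :
    (∀ a t, ((chase x y lk mt c v e s).exec m).nat x a t = 1 ↔ m.nat x a t = 1 ∨
      t = s.toNat ∧ ∃ a' : Fin n, a = a' ∧ Relation.ReflTransGen (Hop φ ψ s) (.inl i0) (.inl a')) ∧
    ∀ b t, ((chase x y lk mt c v e s).exec m).nat y b t = 1 ↔ m.nat y b t = 1 ∨
      t = s.toNat ∧ ∃ b' : Fin k, b = b' ∧ Relation.ReflTransGen (Hop φ ψ s) (.inl i0) (.inr b') := by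
  simp only [List.nodup_cons, List.mem_cons, not_or, List.not_mem_nil, not_false_eq_true,
    List.nodup_nil, and_true, ← ne_eq] at hd
  obtain ⟨⟨hxy, hxl, hxm, hxc, hxv⟩, ⟨hyl, hym, hyc, hyv⟩, ⟨hlm, hlc, hlv⟩, ⟨hmc, hmv⟩, hcv⟩ := hd
  have key := Cmd.exec_loop (m := m) (x := v) (e := e) (n := k + 1)
    (p := .ite (.natEq (reg c) (.const 0)) .skip
      (.seq (.setNat x (.sub (reg c) (.const 1)) (.const s.toNat) (.const 1))
      (.seq (.setNat c (.const 0) (.const 0)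
        (.get lk (.sub (reg c) (.const 1)) (.const s.toNat)))
      (.ite (.natEq (reg c) (.const 0)) .skip
        (.seq (.setNat y (.sub (reg c) (.const 1)) (.const s.toNat) (.const 1))
        (.setNat c (.const 0) (.const 0)
          (.get mt (.sub (reg c) (.const 1)) (.const s.toNat))))))))
    (fun l m' => ∃ L : List (Fin n), L.Nodup ∧
      (∀ a ∈ L, Relation.ReflTransGen (Hop φ ψ s) (.inl i0) (.inl a)) ∧
      (∀ a t, m'.nat x a t = 1 ↔ m.nat x a t = 1 ∨ t = s.toNat ∧ ∃ a' ∈ L, a = a') ∧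
      (∀ b t, m'.nat y b t = 1 ↔ m.nat y b t = 1 ∨
        t = s.toNat ∧ ∃ a ∈ L, ∃ b' : Fin k, φ a s b' ∧ b = b') ∧
      ((m'.nat c 0 0 = 0 ∧ i0 ∈ L ∧ ∀ a ∈ L, ∀ b a', φ a s b → ψ b s a' → a' ∈ L) ∨
        ∃ a : Fin n, m'.nat c 0 0 = a + 1 ∧
          Relation.ReflTransGen (Hop φ ψ s) (.inl i0) (.inl a) ∧ L.length = l ∧ (a :: L).Nodup ∧
          (∀ a1 ∈ L, ∃ b, φ a1 s b) ∧
          i0 ∈ a :: L ∧ (∀ a1 ∈ a :: L, a1 = i0 ∨ ∃ a2 ∈ L, ∃ b, φ a2 s b ∧ ψ b s a1) ∧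
          ∀ a1 ∈ L, ∀ b a', φ a1 s b → ψ b s a' → a' ∈ a :: L)) he ?_ ?_
  · obtain ⟨L, hn, hr, hx, hy, hcur⟩ := key
    have hcl : i0 ∈ L ∧ ∀ a ∈ L, ∀ b a', φ a s b → ψ b s a' → a' ∈ L := by
      rcases hcur with hcur | ⟨a, -, -, hl, -, hn'⟩
      · exact hcur.2
      · -- the elements of `L` have different successors in `Fin k`
        obtain ⟨hs, -⟩ := hn'
        choose f hf using hs
        have := (hn.pmap (f := f) (H := fun _ h => h) fun a ha b hb hab =>
          hφ' (hf a ha) (hab ▸ hf b hb)).length_le_card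
        simp only [List.length_pmap, Fintype.card_fin] at this
        omega
    have hreach : ∀ z, Relation.ReflTransGen (Hop φ ψ s) (.inl i0) z →
        (∀ a, z = .inl a → a ∈ L) ∧ ∀ b, z = .inr b → ∃ a ∈ L, φ a s b := by
      intro z hz
      induction hz with
      | refl => exact ⟨fun a ha => (by cases ha; exact hcl.1), fun b hb => by cases hb⟩
      | tail _ hst ih =>
        cases hst with
        | fst h => exact ⟨fun a ha => (by cases ha), fun b hb => by cases hb; exact ⟨_, ih.1 _ rfl, h⟩⟩
        | snd h =>
          obtain ⟨a, ha, hab⟩ := ih.2 _ rfl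
          exact ⟨fun a' ha' => (by cases ha'; exact hcl.2 a ha _ _ hab h), fun b hb => by cases hb⟩
    refine ⟨fun a t => (hx a t).trans ?_, fun b t => (hy b t).trans ?_⟩
    · refine or_congr_right (and_congr_right fun _ => ⟨?_, ?_⟩)
      · rintro ⟨a', ha', rfl⟩; exact ⟨a', rfl, hr a' ha'⟩
      · rintro ⟨a', rfl, ha'⟩; exact ⟨a', (hreach _ ha').1 a' rfl, rfl⟩
    · refine or_congr_right (and_congr_right fun _ => ⟨?_, ?_⟩)
      · rintro ⟨a, ha, b', hb, rfl⟩; exact ⟨b', rfl, (hr a ha).tail (.fst hb)⟩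
      · rintro ⟨b', rfl, hb'⟩
        obtain ⟨a, ha, hab⟩ := (hreach _ hb').2 b' rfl
        exact ⟨a, ha, b', hab, rfl⟩
  · exact ⟨[], by simp, by simp, by simp, by simp, Or.inr ⟨i0, hc, .refl, by simp⟩⟩
  · rintro l m' hl hf ⟨L, hn, hr, hx, hy, hcur⟩
    have hlk' : m'.nat lk = m.nat lk := hf.nat lk (by
      simp [Cmd.natW, hxl.symm, hyl.symm, hlc, hlv])
    have hmt' : m'.nat mt = m.nat mt := hf.nat mt (by
      simp [Cmd.natW, hxm.symm, hym.symm, hmc, hmv])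
    have hcv' : (m'.put v 0 0 l).nat c 0 0 = m'.nat c 0 0 := by rw [Mem.put_ne _ hcv]
    rcases hcur with ⟨h1, h2⟩ | ⟨a, h1, har, hlen, hal, hlk1, h2, h3, h4⟩
    · rw [Cmd.exec_ite_pos (by simp only [Test.Holds, eval_reg, NExp.eval]; rw [hcv', h1]),
        Cmd.exec_skip]
      refine ⟨L, hn, hr, fun a t => ?_, fun b t => ?_, Or.inl ⟨hcv'.trans h1, h2⟩⟩
      · rw [Mem.put_ne _ hxv]; exact hx a t
      · rw [Mem.put_ne _ hyv]; exact hy b t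
    rw [Cmd.exec_ite_neg (by simp only [Test.Holds, eval_reg, NExp.eval]; rw [hcv', h1]; omega)]
    have hX : ∀ a1 t : ℕ, (t = s.toNat ∧ a1 = a ∨ m.nat x a1 t = 1 ∨ t = s.toNat ∧ ∃ a' ∈ L, a1 = a') ↔
        m.nat x a1 t = 1 ∨ t = s.toNat ∧ ∃ a' ∈ a :: L, a1 = a' := by
      intro a1 t; simp only [List.mem_cons, exists_eq_or_imp]; tauto
    simp only [Cmd.exec_seq, Cmd.exec_setNat, NExp.eval, eval_reg, hcv', h1, Nat.add_sub_cancel,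
      Mem.put_ne _ hlv, Mem.put_ne _ hxl.symm, hlk']
    rw [Mem.put_ne _ hxc.symm, hcv', h1, Nat.add_sub_cancel]
    rcases hlk a s with ⟨hT, hno⟩ | ⟨b, hT, hb⟩
    · rw [hT, Cmd.exec_ite_pos (by simp [Test.Holds, eval_reg, NExp.eval, Mem.put_same]),
        Cmd.exec_skip]
      refine ⟨a :: L, hal, ?_, fun a1 t => ?_, fun b t => ?_, Or.inl ⟨Mem.put_same _ _ _ _ _, h2, ?_⟩⟩
      · rintro a1 (_ | ⟨_, h⟩)
        · exact har
        · exact hr a1 h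
      · rw [Mem.put_ne _ hxc, Mem.put_nat, Mem.put_ne _ hxv, ← hX, ← hx]
        split_ifs with h
        · simp [h]
        · simp; tauto
      · rw [Mem.put_ne _ hyc, Mem.put_ne _ (Ne.symm hxy), Mem.put_ne _ hyv, hy]
        refine or_congr_right (and_congr_right fun _ => ?_)
        simp [hno]
      · rintro a1 (_ | ⟨_, h⟩) b a' hb hb'
        · exact absurd hb (hno b)
        · exact h4 a1 h b a' hb hb'
    · rw [hT, Cmd.exec_ite_neg (by simp [Test.Holds, eval_reg, NExp.eval, Mem.put_same])]
      simp only [Cmd.exec_seq, Cmd.exec_setNat, NExp.eval, eval_reg, Mem.put_same,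
        Nat.add_sub_cancel, Mem.put_ne _ hyc.symm, Mem.put_ne _ hym.symm, Mem.put_ne _ hmc,
        Mem.put_ne _ hxm.symm, Mem.put_ne _ hmv, hmt']
      refine ⟨a :: L, hal, ?_, fun a1 t => ?_, fun b1 t => ?_, ?_⟩
      · rintro a1 (_ | ⟨_, h⟩)
        · exact har
        · exact hr a1 h
      · rw [Mem.put_ne _ hxc, Mem.put_ne _ hxy, Mem.put_ne _ hxc, Mem.put_nat, Mem.put_ne _ hxv,
          ← hX, ← hx]
        split_ifs with h
        · simp [h]
        · simp; tauto
      · rw [Mem.put_ne _ hyc, Mem.put_nat, Mem.put_ne _ hyc, Mem.put_ne _ (Ne.symm hxy),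
          Mem.put_ne _ hyv]
        have hY : (m.nat y b1 t = 1 ∨
            t = s.toNat ∧ ∃ a1 ∈ a :: L, ∃ b' : Fin k, φ a1 s b' ∧ b1 = b') ↔
            (t = s.toNat ∧ b1 = b ∨ m'.nat y b1 t = 1) := by
          rw [hy]
          simp only [List.mem_cons, exists_eq_or_imp]
          have : (∃ b' : Fin k, φ a s b' ∧ b1 = b') ↔ b1 = b := by
            constructor
            · rintro ⟨b', h1, h2⟩; rw [h2, hφ h1 hb]
            · rintro h; exact ⟨b, hb, h⟩
          rw [this]
          tauto
        rw [hY]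
        split_ifs with h
        · simp [h]
        · simp; tauto
      · rcases hmt b s with ⟨hT2, hno⟩ | ⟨a', hT2, ha'⟩
        · left
          refine ⟨hT2, h2, ?_⟩
          rintro a1 (_ | ⟨_, h⟩) b' a' hb1 hb2
          · rw [hφ hb1 hb] at hb2; exact absurd hb2 (hno a')
          · exact h4 a1 h b' a' hb1 hb2
        · right
          have hnew : a' ∉ a :: L := by
            intro hmem
            rcases h3 a' hmem with rfl | ⟨a2, ha2, b2, hb2, hb2'⟩
            · exact h0 b ha'
            · rw [hψ' hb2' ha'] at hb2
              rw [hφ' hb2 hb] at ha2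
              exact (List.nodup_cons.1 hal).1 ha2
          refine ⟨a', hT2, (har.tail (.fst hb)).tail (.snd ha'), by simp [hlen],
            List.nodup_cons.2 ⟨hnew, hal⟩, ?_, List.mem_cons_of_mem _ h2, ?_, ?_⟩
          · rintro a1 (_ | ⟨_, h⟩)
            · exact ⟨b, hb⟩
            · exact hlk1 a1 h
          · rintro a1 (_ | ⟨_, h⟩)
            · exact Or.inr ⟨a, by simp, b, hb, ha'⟩
            · rcases h3 a1 h with h | ⟨a2, h5, h6⟩
              · exact Or.inl h
              · exact Or.inr ⟨a2, List.mem_cons_of_mem _ h5, h6⟩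
          · rintro a1 (_ | ⟨_, h⟩) b1 a2 hb1 hb2
            · rw [hφ hb1 hb] at hb2
              rw [hψ hb2 ha']
              simp
            · exact List.mem_cons_of_mem _ (h4 a1 h b1 a2 hb1 hb2)

/-- The marked indices are the ones that are reached from an index without predecessor. -/
lemma flood_spec {x y lk mt ch c v w : ℕ} {e e' : NExp} {m : Mem F}
    {χ : Fin n → Bool → Fin k → Prop}
    (hd : [x, y, lk, mt, ch, c, v, w].Nodup)
    (he : ∀ m', Frame (flood x y lk mt ch c v w e e') m m' → e.eval m' = n)
    (he' : ∀ m', Frame (flood x y lk mt ch c v w e e') m m' → e'.eval m' = k)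
    (hlk : Table (m.nat lk) φ) (hmt : Table (m.nat mt) ψ) (hch : Table (m.nat ch) χ)
    (hφ : ∀ {s i j j'}, φ i s j → φ i s j' → j = j')
    (hψ : ∀ {s i j j'}, ψ i s j → ψ i s j' → j = j')
    (hφ' : ∀ {s i i' j}, φ i s j → φ i' s j → i = i')
    (hψ' : ∀ {s i i' j}, ψ i s j → ψ i' s j → i = i') (hχ : ∀ {s i j}, χ i s j ↔ ψ j s i) :
    Marks (n := n) (((flood x y lk mt ch c v w e e').exec m).nat x) (fun i s => ∃ i0 : Fin n,
      (∀ j, ¬ χ i0 s j) ∧ Relation.ReflTransGen (Hop φ ψ s) (.inl i0) (.inl i)) ∧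
    Marks (n := k) (((flood x y lk mt ch c v w e e').exec m).nat y) (fun j s => ∃ i0 : Fin n,
      (∀ j, ¬ χ i0 s j) ∧ Relation.ReflTransGen (Hop φ ψ s) (.inl i0) (.inr j)) := by
  have hd' : [x, y, lk, mt, c, v].Nodup := hd.sublist (by
    simp only [List.cons_sublist_cons]
    exact .cons _ (by simp))
  simp only [List.nodup_cons, List.mem_cons, not_or, List.not_mem_nil, not_false_eq_true,
    List.nodup_nil, and_true, ← ne_eq] at hd
  obtain ⟨⟨hxy, hxl, hxm, hxh, hxc, hxv, hxw⟩, ⟨hyl, hym, hyh, hyc, hyv, hyw⟩,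
    ⟨hlm, hlh, hlc, hlv, hlw⟩, ⟨hmh, hmc, hmv, hmw⟩, ⟨hhc, hhv, hhw⟩, ⟨hcv, hcw⟩, hvw⟩ := hd
  have f1 : Frame (flood x y lk mt ch c v w e e') m ((clear x w e).exec m) :=
    ((clear x w e).frame m).left
  have f2 : Frame (flood x y lk mt ch c v w e e') m ((clear y w e').exec ((clear x w e).exec m)) :=
    f1.trans ((clear y w e').frame _).left.right
  have hx0 : Marks (n := n) (((clear y w e').exec ((clear x w e).exec m)).nat x)
      fun _ _ => False := by
    rw [((clear y w e').frame _).nat x (by simp [clear, both, Cmd.natW, hxy, hxw])]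
    exact clear_spec hxw (he m .rfl)
  have hy0 : Marks (n := k) (((clear y w e').exec ((clear x w e).exec m)).nat y)
      fun _ _ => False := clear_spec hyw (he' _ f1)
  have hex : (flood x y lk mt ch c v w e e').exec m = (Cmd.loop w e (both fun s =>
      .ite (.natEq (.get ch (reg w) (.const s.toNat)) (.const 0))
      (.seq (.setNat c (.const 0) (.const 0) (.add (reg w) (.const 1)))
        (chase x y lk mt c v (.add e' (.const 1)) s))
      .skip)).exec ((clear y w e').exec ((clear x w e).exec m)) := rfl
  rw [hex]
  generalize (clear y w e').exec ((clear x w e).exec m) = m0 at f2 hx0 hy0 ⊢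
  have key := Cmd.exec_loop (m := m0) (x := w) (e := e) (n := n)
    (p := both fun s =>
      .ite (.natEq (.get ch (reg w) (.const s.toNat)) (.const 0))
      (.seq (.setNat c (.const 0) (.const 0) (.add (reg w) (.const 1)))
        (chase x y lk mt c v (.add e' (.const 1)) s))
      .skip)
    (fun l m' =>
      (Marks (n := n) (m'.nat x) fun i s => ∃ i0 : Fin n, (i0 : ℕ) < l ∧
        (∀ j, ¬ χ i0 s j) ∧ Relation.ReflTransGen (Hop φ ψ s) (.inl i0) (.inl i)) ∧
      Marks (n := k) (m'.nat y) fun i s => ∃ i0 : Fin n, (i0 : ℕ) < l ∧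
        (∀ j, ¬ χ i0 s j) ∧ Relation.ReflTransGen (Hop φ ψ s) (.inl i0) (.inr i))
    (he _ f2) ⟨by simpa using hx0, by simpa using hy0⟩ ?_
  · simpa only [Fin.is_lt, true_and] using key
  rintro l m' hl hf ⟨h1, h2⟩
  have hf1 := hf.loopVar l
  have := exec_both (f := fun s => .ite (.natEq (.get ch (reg w) (.const s.toNat)) (.const 0))
      (.seq (.setNat c (.const 0) (.const 0) (.add (reg w) (.const 1)))
        (chase x y lk mt c v (.add e' (.const 1)) s))
      .skip) (m := m'.put w 0 0 l) (fun A m' =>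
      (Marks (n := n) (m'.nat x) fun i s => ∃ i0 : Fin n, ((i0 : ℕ) < l ∨ (i0 : ℕ) = l ∧ A s) ∧
        (∀ j, ¬ χ i0 s j) ∧ Relation.ReflTransGen (Hop φ ψ s) (.inl i0) (.inl i)) ∧
      Marks (n := k) (m'.nat y) fun i s => ∃ i0 : Fin n, ((i0 : ℕ) < l ∨ (i0 : ℕ) = l ∧ A s) ∧
        (∀ j, ¬ χ i0 s j) ∧ Relation.ReflTransGen (Hop φ ψ s) (.inl i0) (.inr i))
      (by simp only [and_false, or_false]; rw [Mem.put_ne _ hxw, Mem.put_ne _ hyw]; exact ⟨h1, h2⟩) ?_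
  · simpa only [and_true, ← Nat.lt_succ_iff_lt_or_eq] using this
  rintro s A m2 hA hf2 ⟨h1, h2⟩
  have hf3 : Frame (flood x y lk mt ch c v w e e') m m2 :=
    f2.trans (hf1.trans hf2.body).right.right
  have hw : m2.nat w 0 0 = l := by
    rw [hf2.nat w (by simp [both, chase, Cmd.natW, hxw.symm, hyw.symm, hcw.symm, hvw.symm]),
      Mem.put_same]
  have hch' : m2.nat ch = m.nat ch := hf3.nat ch (by
    simp [flood, clear, both, chase, Cmd.natW, hxh.symm, hyh.symm, hhc, hhv, hhw])
  have hlk' : m2.nat lk = m.nat lk := hf3.nat lk (by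
    simp [flood, clear, both, chase, Cmd.natW, hxl.symm, hyl.symm, hlc, hlv, hlw])
  have hmt' : m2.nat mt = m.nat mt := hf3.nat mt (by
    simp [flood, clear, both, chase, Cmd.natW, hxm.symm, hym.symm, hmc, hmv, hmw])
  have hsplit : ∀ (t : Bool) (C : Fin n → Prop),
      (∃ i0 : Fin n, ((i0 : ℕ) < l ∨ (i0 : ℕ) = l ∧ (t = s ∨ A t)) ∧ C i0) ↔
        (∃ i0 : Fin n, ((i0 : ℕ) < l ∨ (i0 : ℕ) = l ∧ A t) ∧ C i0) ∨ t = s ∧ C ⟨l, hl⟩ := by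
    intro t C
    constructor
    · rintro ⟨i0, h | ⟨h, rfl | h'⟩, hC⟩
      · exact Or.inl ⟨i0, Or.inl h, hC⟩
      · subst h; exact Or.inr ⟨rfl, hC⟩
      · exact Or.inl ⟨i0, Or.inr ⟨h, h'⟩, hC⟩
    · rintro (⟨i0, h, hC⟩ | ⟨rfl, hC⟩)
      · exact ⟨i0, h.imp_right fun h => ⟨h.1, Or.inr h.2⟩, hC⟩
      · exact ⟨_, Or.inr ⟨rfl, Or.inl rfl⟩, hC⟩
  have hT := hch ⟨l, hl⟩ s
  simp only [← hch'] at hT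
  rcases hT with ⟨hT, hno⟩ | ⟨j, hT, hj⟩
  · rw [Cmd.exec_ite_pos (by simp only [Test.Holds, NExp.eval, eval_reg, hw]; exact hT),
      Cmd.exec_seq, Cmd.exec_setNat]
    simp only [NExp.eval, eval_reg, hw]
    have hchase := chase_spec (m := m2.put c 0 0 (l + 1)) (x := x) (y := y) (lk := lk) (mt := mt)
      (c := c) (v := v) (e := .add e' (.const 1)) (s := s) (φ := φ) (ψ := ψ) (i0 := ⟨l, hl⟩) hd'
      (congrArg (· + 1) (he' _ (hf3.put (by simp [flood, chase, both, Cmd.natW]) _ _ _)))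
      (by rw [Mem.put_ne _ hlc, hlk']; exact hlk) (by rw [Mem.put_ne _ hmc, hmt']; exact hmt)
      (Mem.put_same _ _ _ _ _) hφ hψ hφ' hψ' (fun j hj => hno j (hχ.2 hj))
    refine ⟨fun i t => (hchase.1 i t.toNat).trans (Iff.trans ?_ (hsplit t _).symm),
      fun i t => (hchase.2 i t.toNat).trans (Iff.trans ?_ (hsplit t _).symm)⟩
    · rw [Mem.put_ne _ hxc, h1 i t, toNat_inj]
      refine or_congr_right (and_congr_right ?_)
      rintro rfl
      constructor
      · rintro ⟨a', ha', hr⟩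
        rw [← Fin.ext ha'] at hr
        exact ⟨hno, hr⟩
      · rintro ⟨-, hr⟩
        exact ⟨i, rfl, hr⟩
    · rw [Mem.put_ne _ hyc, h2 i t, toNat_inj]
      refine or_congr_right (and_congr_right ?_)
      rintro rfl
      constructor
      · rintro ⟨a', ha', hr⟩
        rw [← Fin.ext ha'] at hr
        exact ⟨hno, hr⟩
      · rintro ⟨-, hr⟩
        exact ⟨i, rfl, hr⟩
  · rw [Cmd.exec_ite_neg (by simp only [Test.Holds, NExp.eval, eval_reg, hw]; rw [hT]; omega),
      Cmd.exec_skip]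
    have hne : ∀ (t : Bool) (C : Fin n → Prop),
        ¬ (t = s ∧ (∀ j, ¬ χ ⟨l, hl⟩ t j) ∧ C ⟨l, hl⟩) := by
      rintro t C ⟨rfl, h, -⟩
      exact h j hj
    exact ⟨fun i t => (h1 i t).trans ((or_iff_left (hne t fun i0 => _)).symm.trans
        (hsplit t _).symm),
      fun i t => (h2 i t).trans ((or_iff_left (hne t fun i0 => _)).symm.trans (hsplit t _).symm)⟩

end

/-! ### Computing the source set and the target set -/

/-- `(a, b)` is in `M`, and it has the sign opposite to `s` or is in `I`. -/
def mateTest (a b : NExp) (s : Bool) : Test :=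
  .and (.not (.natEq (.get 1 a b) (.const 0)))
    (.not (.and (.not (.natEq (.get 1 a b) (.const 2)))
      (.natEq (.get 2 a b) (.const s.toNat))))

/-- The value of the bilinear form of the block at the generators of `U_a^s` and `V_b^t`. -/
def bilExp (a : NExp) (s : Bool) (b : NExp) (t : Bool) : FExp :=
  .add
    (.mul (.get 4 a (.const s.toNat))
      (.add (.mul (.get 0 a b) (.get 6 b (.const t.toNat)))
        (.mul (.get 1 a b) (.get 7 b (.const t.toNat)))))
    (.mul (.get 5 a (.const s.toNat))
      (.add (.mul (.get 2 a b) (.get 6 b (.const t.toNat)))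
        (.mul (.get 3 a b) (.get 7 b (.const t.toNat)))))

/-- `p(U_a^s) + p(V_b^t) + c`. -/
def sumExp (a : NExp) (s : Bool) (b : NExp) (t : Bool) : RExp :=
  .add (.add (.get 1 a (.const s.toNat)) (.get 2 b (.const t.toNat)))
    (.get 3 (.const 0) (.const 0))

/-- `a^s b^t` is an edge of the auxiliary graph. -/
def tightTest (a : NExp) (s : Bool) (b : NExp) (t : Bool) : Test :=
  .and (.not (.fldEq (bilExp a s b t) .zero))
    (.and (.realLe (sumExp a s b t) (.get 0 a b)) (.realLe (.get 0 a b) (sumExp a s b t)))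

/-- `(a, b)` is an edge of `M \ I` with sign `s` and `a^s b^s` is an edge of the auxiliary graph. -/
def linkTest (a b : NExp) (s : Bool) : Test :=
  .and (.natEq (.get 1 a b) (.const 1))
    (.and (.natEq (.get 2 a b) (.const s.toNat)) (tightTest a s b s))

/-- Compute the tables of mates and links, the source set and the target set. -/
def analyze : Cmd :=
  .seq (lookup 20 40 rows 41 cols (mateTest (reg 40) (reg 41)))
  (.seq (lookup 21 41 cols 40 rows (mateTest (reg 40) (reg 41)))
  (.seq (lookup 22 40 rows 41 cols (linkTest (reg 40) (reg 41)))
  (.seq (lookup 23 41 cols 40 rows (linkTest (reg 40) (reg 41)))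
  (.seq (flood 27 26 23 20 21 43 42 41 cols rows)
    (flood 28 29 22 21 20 43 42 40 rows cols)))))

section

variable {F : Type u} [Field F] {μ ν : ℕ} {P : PartMatrix F μ ν} {k : ℕ} {x : Conf F μ ν}
  {m m' : Mem F} {S : State F μ ν}

lemma StoresMatrix.congr (h : StoresMatrix m P) (hn : m'.nat 0 = m.nat 0)
    (hf : ∀ i < 4, m'.fld i = m.fld i) (hr : m'.real 0 = m.real 0) : StoresMatrix m' P where
  rows := by rw [hn]; exact h.rows
  cols := by rw [hn]; exact h.cols
  block a b := by
    rw [hf 0 (by decide), hf 1 (by decide), hf 2 (by decide), hf 3 (by decide)]; exact h.block a b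
  exponent a b := by rw [hr]; exact h.exponent a b

lemma StoresConf.congr (h : StoresConf m x) (hn : ∀ i < 3, 1 ≤ i → m'.nat i = m.nat i)
    (hf : ∀ i < 8, m'.fld i = m.fld i) (hr : ∀ i < 4, m'.real i = m.real i) : StoresConf m' x where
  edge a b := by rw [hn 1 (by decide) (by decide)]; exact h.edge a b
  sign a b := by rw [hn 2 (by decide) (by decide)]; exact h.sign a b
  row_space a s := by rw [hf 4 (by decide), hf 5 (by decide)]; exact h.row_space a s
  col_space a s := by rw [hf 6 (by decide), hf 7 (by decide)]; exact h.col_space a s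
  row_value a s := by rw [hr 1 (by decide)]; exact h.row_value a s
  col_value a s := by rw [hr 2 (by decide)]; exact h.col_value a s
  shift := by rw [hr 3 (by decide)]; exact h.shift

lemma StoresState.congr (h : StoresState m S) (hn : ∀ i < 11, 1 ≤ i → m'.nat i = m.nat i)
    (hf : ∀ i < 8, m'.fld i = m.fld i) (hr : ∀ i < 4, m'.real i = m.real i) :
    StoresState m' S where
  running := by rw [hn 3 (by decide) (by decide)]; exact h.running
  conf := h.conf.congr (fun i hi => hn i (by omega)) hf hr
  row_node a s := by rw [hn 5 (by decide) (by decide)]; exact h.row_node a s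
  col_node a s := by rw [hn 6 (by decide) (by decide)]; exact h.col_node a s
  edge a s b t := by
    rw [hn _ (by cases s <;> cases t <;> decide) (by omega)]; exact h.edge a s b t

/-- The program changes only arrays that are used for intermediate results. -/
def Cmd.Aux (p : Cmd) : Prop :=
  (∀ x ∈ p.natW, 11 ≤ x) ∧ (∀ x ∈ p.fldW, 11 ≤ x) ∧ ∀ x ∈ p.realW, 11 ≤ x

instance (p : Cmd) : Decidable p.Aux := by unfold Cmd.Aux; infer_instance

lemma StoresMatrix.frame (h : StoresMatrix m P) {p : Cmd} (hf : Frame p m m') (hp : p.Aux) :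
    StoresMatrix m' P :=
  h.congr (hf.nat 0 fun h => by have := hp.1 _ h; omega)
    (fun i hi => hf.fld i fun h => by have := hp.2.1 _ h; omega)
    (hf.real 0 fun h => by have := hp.2.2 _ h; omega)

lemma StoresConf.frame (h : StoresConf m x) {p : Cmd} (hf : Frame p m m') (hp : p.Aux) :
    StoresConf m' x :=
  h.congr (fun i hi _ => hf.nat i fun h => by have := hp.1 _ h; omega)
    (fun i hi => hf.fld i fun h => by have := hp.2.1 _ h; omega)
    (fun i hi => hf.real i fun h => by have := hp.2.2 _ h; omega)

lemma StoresState.frame (h : StoresState m S) {p : Cmd} (hf : Frame p m m') (hp : p.Aux) :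
    StoresState m' S :=
  h.congr (fun i hi _ => hf.nat i fun h => by have := hp.1 _ h; omega)
    (fun i hi => hf.fld i fun h => by have := hp.2.1 _ h; omega)
    (fun i hi => hf.real i fun h => by have := hp.2.2 _ h; omega)

lemma eval_rows (h : StoresMatrix m P) : rows.eval m = μ := h.rows

lemma eval_cols (h : StoresMatrix m P) : cols.eval m = ν := h.cols

lemma StoresConf.edge_zero_iff (h : StoresConf m x) (hI : x.I ⊆ x.M) {a : Fin μ} {b : Fin ν} :
    m.nat 1 a b = 0 ↔ (a, b) ∉ x.M := by
  rw [h.edge]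
  split_ifs with h1 h2
  · simp [hI h1]
  · simp [h2]
  · simp [h2]

lemma StoresConf.edge_two_iff (h : StoresConf m x) {a : Fin μ} {b : Fin ν} :
    m.nat 1 a b = 2 ↔ (a, b) ∈ x.I := by
  rw [h.edge]
  split_ifs with h1 <;> simp [h1]

lemma StoresConf.edge_one_iff (h : StoresConf m x) {a : Fin μ} {b : Fin ν} :
    m.nat 1 a b = 1 ↔ (a, b) ∈ x.M ∧ (a, b) ∉ x.I := by
  rw [h.edge]
  split_ifs with h1 h2
  · simp [h1]
  · simp [h1, h2]
  · simp [h2]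

lemma mateTest_holds (h : StoresConf m x) (hI : x.I ⊆ x.M) {a b : NExp} {a0 : Fin μ}
    {b0 : Fin ν} (ha : a.eval m = a0) (hb : b.eval m = b0) (s : Bool) :
    (mateTest a b s).Holds m ↔ Mate x a0 b0 s := by
  simp only [mateTest, Test.Holds, NExp.eval, ha, hb, h.edge_zero_iff hI, h.edge_two_iff,
    not_not, Mate]
  refine and_congr_right fun hM => ?_
  rw [h.sign _ _ hM, toNat_inj]
  generalize x.sgn a0 b0 = t
  by_cases hab : (a0, b0) ∈ x.I <;> cases s <;> cases t <;> simp [hab]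

lemma bilExp_eval (hP : StoresMatrix m P) {a b : NExp} {a0 : Fin μ}
    {b0 : Fin ν} (ha : a.eval m = a0) (hb : b.eval m = b0) (s t : Bool) :
    (bilExp a s b t).eval m =
      bil (P.A a0 b0) ![m.fld 4 a0 s.toNat, m.fld 5 a0 s.toNat]
        ![m.fld 6 b0 t.toNat, m.fld 7 b0 t.toNat] := by
  rw [bil_eq, hP.block]
  simp only [bilExp, FExp.eval, NExp.eval, ha, hb]
  simp

lemma bilExp_eq_zero_iff (hP : StoresMatrix m P) (h : StoresConf m x) {a b : NExp} {a0 : Fin μ}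
    {b0 : Fin ν} (ha : a.eval m = a0) (hb : b.eval m = b0) (s t : Bool) :
    (bilExp a s b t).eval m = 0 ↔ Orth (P.A a0 b0) (x.L.U a0 s) (x.L.V b0 t) := by
  rw [bilExp_eval hP ha hb, h.row_space, h.col_space, orth_span_iff]

lemma sumExp_eval (h : StoresConf m x) {a b : NExp} {a0 : Fin μ}
    {b0 : Fin ν} (ha : a.eval m = a0) (hb : b.eval m = b0) (s t : Bool) :
    (sumExp a s b t).eval m =
      x.p.row a0 (x.L.U a0 s) + x.p.col b0 (x.L.V b0 t) + x.c := by
  simp only [sumExp, RExp.eval, NExp.eval, ha, hb, h.row_value, h.col_value, h.shift]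

lemma tightTest_holds (hP : StoresMatrix m P) (h : StoresConf m x) {a b : NExp} {a0 : Fin μ}
    {b0 : Fin ν} (ha : a.eval m = a0) (hb : b.eval m = b0) (s t : Bool) :
    (tightTest a s b t).Holds m ↔ TightEdge P x a0 s b0 t := by
  simp only [tightTest, Test.Holds, FExp.eval, bilExp_eq_zero_iff hP h ha hb,
    sumExp_eval h ha hb, RExp.eval, ha, hb, hP.exponent, TightEdge, le_antisymm_iff]

lemma linkTest_holds (hP : StoresMatrix m P) (h : StoresConf m x) {a b : NExp} {a0 : Fin μ}
    {b0 : Fin ν} (ha : a.eval m = a0) (hb : b.eval m = b0) (s : Bool) :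
    (linkTest a b s).Holds m ↔ Link P x a0 b0 s := by
  simp only [linkTest, Test.Holds, tightTest_holds hP h ha hb, NExp.eval, ha, hb, h.edge_one_iff,
    Link, and_assoc]
  refine and_congr_right fun hM => ?_
  rw [h.sign _ _ hM, toNat_inj]

/-- The memory holds the tables of mates and links, the source set and the target set. -/
structure Analyzed (P : PartMatrix F μ ν) (x : Conf F μ ν) (m : Mem F) : Prop where
  mateR : Table (m.nat 20) fun (a : Fin μ) s (b : Fin ν) => Mate x a b s
  mateC : Table (m.nat 21) fun (b : Fin ν) s (a : Fin μ) => Mate x a b s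
  linkR : Table (m.nat 22) fun (a : Fin μ) s (b : Fin ν) => Link P x a b s
  linkC : Table (m.nat 23) fun (b : Fin ν) s (a : Fin μ) => Link P x a b s
  sourceR : Marks (m.nat 26) fun (a : Fin μ) s => .row a s ∈ source P x
  sourceC : Marks (m.nat 27) fun (b : Fin ν) s => .col b s ∈ source P x
  targetR : Marks (m.nat 28) fun (a : Fin μ) s => .row a s ∈ target P x
  targetC : Marks (m.nat 29) fun (b : Fin ν) s => .col b s ∈ target P x

lemma Analyzed.frame (h : Analyzed P x m) {p : Cmd} (hf : Frame p m m')
    (hp : ∀ i ∈ [20, 21, 22, 23, 26, 27, 28, 29], i ∉ p.natW) : Analyzed P x m' := by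
  have hn := fun i hi => hf.nat i (hp i hi)
  constructor
  · rw [hn 20 (by decide)]; exact h.mateR
  · rw [hn 21 (by decide)]; exact h.mateC
  · rw [hn 22 (by decide)]; exact h.linkR
  · rw [hn 23 (by decide)]; exact h.linkC
  · rw [hn 26 (by decide)]; exact h.sourceR
  · rw [hn 27 (by decide)]; exact h.sourceC
  · rw [hn 28 (by decide)]; exact h.targetR
  · rw [hn 29 (by decide)]; exact h.targetC

/-- The sign of a vertex. -/
def Vertex.sign : Vertex μ ν → Bool
  | .row _ s => s
  | .col _ s => s

lemma sign_eq_of_reflTransGen {z z' : Vertex μ ν} (h : Relation.ReflTransGen (TStep P x) z z') :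
    z.sign = z'.sign := by
  induction h with
  | refl => rfl
  | tail _ h ih => rw [ih]; cases h <;> rfl

/-- Chains of steps from a row vertex. -/
lemma reflTransGen_tstep_iff (a : Fin μ) (s : Bool) (z : Fin μ ⊕ Fin ν) :
    Relation.ReflTransGen (Hop (fun a s b => Link P x a b s) (fun b s a => Mate x a b s) s)
      (.inl a) z ↔
    Relation.ReflTransGen (TStep P x) (.row a s) (z.elim (.row · s) (.col · s)) := by
  constructor
  · intro h
    induction h with
    | refl => exact .refl
    | tail _ h ih =>
      cases h with
      | fst h => exact ih.tail (.link h)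
      | snd h => exact ih.tail (.mate h)
  · intro h
    generalize hy : z.elim (Vertex.row · s) (Vertex.col · s) = y at h
    induction h generalizing z with
    | refl =>
      rcases z with a' | b
      · cases hy; exact .refl
      · cases hy
    | tail _ h ih =>
      cases h with
      | @link a1 b1 s1 h =>
        rcases z with a' | b
        · cases hy
        · cases hy
          exact (ih (.inl a1) rfl).tail (.fst h)
      | @mate a1 b1 s1 h =>
        rcases z with a' | b
        · cases hy
          exact (ih (.inr b1) rfl).tail (.snd h)
        · cases hy

/-- Chains of steps to a column vertex. -/
lemma reflTransGen_tstep_iff' (b : Fin ν) (s : Bool) (z : Fin ν ⊕ Fin μ) :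
    Relation.ReflTransGen (Hop (fun b s a => Link P x a b s) (fun a s b => Mate x a b s) s)
      (.inl b) z ↔
    Relation.ReflTransGen (TStep P x) (z.elim (.col · s) (.row · s)) (.col b s) := by
  constructor
  · intro h
    induction h with
    | refl => exact .refl
    | tail _ h ih =>
      cases h with
      | fst h => exact .head (.link h) ih
      | snd h => exact .head (.mate h) ih
  · intro h
    generalize hy : z.elim (Vertex.col · s) (Vertex.row · s) = y at h
    induction h using Relation.ReflTransGen.head_induction_on generalizing z with
    | refl =>
      rcases z with a' | b
      · cases hy; exact .refl
      · cases hy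
    | head h _ ih =>
      cases h with
      | @link a1 b1 s1 h =>
        rcases z with a' | b
        · cases hy
        · cases hy
          exact (ih (.inl b1) rfl).tail (.fst h)
      | @mate a1 b1 s1 h =>
        rcases z with a' | b
        · cases hy
          exact (ih (.inr a1) rfl).tail (.snd h)
        · cases hy

lemma analyze_aux : analyze.Aux := by decide

lemma analyze_spec (hP : StoresMatrix m P) (hx : StoresConf m x) (h : IsOptimal P k x) :
    Analyzed P x (analyze.exec m) := by
  have hI := h.pair.subset
  unfold analyze
  rw [Cmd.exec_seq]
  have hP' : ∀ {p : Cmd} {m m' : Mem F}, StoresMatrix m P → p.Aux → Frame p m m' →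
    StoresMatrix m' P := fun h h' hf => h.frame hf h'
  have hx' : ∀ {p : Cmd} {m m' : Mem F}, StoresConf m x → p.Aux → Frame p m m' →
    StoresConf m' x := fun h h' hf => h.frame hf h'
  -- the table of mates of row vertices
  have aux1 : (lookup 20 40 rows 41 cols (mateTest (reg 40) (reg 41))).Aux := by decide
  have T1 : Table (((lookup 20 40 rows 41 cols (mateTest (reg 40) (reg 41))).exec m).nat 20)
      fun (a : Fin μ) s (b : Fin ν) => Mate x a b s :=
    lookup_spec (by decide) (by decide) (by decide) (eval_rows hP)
      (fun m' hf => eval_cols (hP' hP aux1 hf))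
      fun m' hf i s j hi hj => mateTest_holds (a := reg 40) (b := reg 41) (hx' hx aux1 hf) hI hi hj s
  have hP1 := hP' hP aux1 (Cmd.frame _ m)
  have hx1 := hx' hx aux1 (Cmd.frame _ m)
  generalize (lookup 20 40 rows 41 cols (mateTest (reg 40) (reg 41))).exec m = m1 at T1 hP1 hx1 ⊢
  rw [Cmd.exec_seq]
  -- the table of mates of column vertices
  have aux2 : (lookup 21 41 cols 40 rows (mateTest (reg 40) (reg 41))).Aux := by decide
  have T2 : Table (((lookup 21 41 cols 40 rows (mateTest (reg 40) (reg 41))).exec m1).nat 21)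
      fun (b : Fin ν) s (a : Fin μ) => Mate x a b s :=
    lookup_spec (by decide) (by decide) (by decide) (eval_cols hP1)
      (fun m' hf => eval_rows (hP' hP1 aux2 hf))
      fun m' hf i s j hi hj => mateTest_holds (a := reg 40) (b := reg 41) (hx' hx1 aux2 hf) hI hj hi s
  rw [← (Cmd.frame (lookup 21 41 cols 40 rows (mateTest (reg 40) (reg 41))) m1).nat 20
    (by decide)] at T1
  have hP2 := hP' hP1 aux2 (Cmd.frame _ m1)
  have hx2 := hx' hx1 aux2 (Cmd.frame _ m1)
  generalize (lookup 21 41 cols 40 rows (mateTest (reg 40) (reg 41))).exec m1 = m2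
    at T1 T2 hP2 hx2 ⊢
  rw [Cmd.exec_seq]
  -- the table of links of row vertices
  have aux3 : (lookup 22 40 rows 41 cols (linkTest (reg 40) (reg 41))).Aux := by decide
  have T3 : Table (((lookup 22 40 rows 41 cols (linkTest (reg 40) (reg 41))).exec m2).nat 22)
      fun (a : Fin μ) s (b : Fin ν) => Link P x a b s :=
    lookup_spec (by decide) (by decide) (by decide) (eval_rows hP2)
      (fun m' hf => eval_cols (hP' hP2 aux3 hf))
      fun m' hf i s j hi hj => linkTest_holds (a := reg 40) (b := reg 41) (hP' hP2 aux3 hf) (hx' hx2 aux3 hf) hi hj s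
  have f3 := Cmd.frame (lookup 22 40 rows 41 cols (linkTest (reg 40) (reg 41))) m2
  rw [← f3.nat 20 (by decide)] at T1
  rw [← f3.nat 21 (by decide)] at T2
  have hP3 := hP' hP2 aux3 f3
  have hx3 := hx' hx2 aux3 f3
  clear f3
  generalize (lookup 22 40 rows 41 cols (linkTest (reg 40) (reg 41))).exec m2 = m3
    at T1 T2 T3 hP3 hx3 ⊢
  rw [Cmd.exec_seq]
  -- the table of links of column vertices
  have aux4 : (lookup 23 41 cols 40 rows (linkTest (reg 40) (reg 41))).Aux := by decide
  have T4 : Table (((lookup 23 41 cols 40 rows (linkTest (reg 40) (reg 41))).exec m3).nat 23)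
      fun (b : Fin ν) s (a : Fin μ) => Link P x a b s :=
    lookup_spec (by decide) (by decide) (by decide) (eval_cols hP3)
      (fun m' hf => eval_rows (hP' hP3 aux4 hf))
      fun m' hf i s j hi hj => linkTest_holds (a := reg 40) (b := reg 41) (hP' hP3 aux4 hf) (hx' hx3 aux4 hf) hj hi s
  have f4 := Cmd.frame (lookup 23 41 cols 40 rows (linkTest (reg 40) (reg 41))) m3
  rw [← f4.nat 20 (by decide)] at T1
  rw [← f4.nat 21 (by decide)] at T2
  rw [← f4.nat 22 (by decide)] at T3
  have hP4 := hP' hP3 aux4 f4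
  clear f4
  generalize (lookup 23 41 cols 40 rows (linkTest (reg 40) (reg 41))).exec m3 = m4
    at T1 T2 T3 T4 hP4 ⊢
  rw [Cmd.exec_seq]
  -- the source set
  have aux5 : (flood 27 26 23 20 21 43 42 41 cols rows).Aux := by decide
  have T5 := flood_spec (m := m4) (x := 27) (y := 26) (lk := 23) (mt := 20) (ch := 21) (c := 43)
    (v := 42) (w := 41) (e := cols) (e' := rows) (by decide)
    (fun m' hf => eval_cols (hP' hP4 aux5 hf)) (fun m' hf => eval_rows (hP' hP4 aux5 hf))
    T4 T1 T2 h.link_col h.mate_row h.link_row h.mate_col Iff.rfl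
  have f5 := Cmd.frame (flood 27 26 23 20 21 43 42 41 cols rows) m4
  rw [← f5.nat 20 (by decide)] at T1
  rw [← f5.nat 21 (by decide)] at T2
  rw [← f5.nat 22 (by decide)] at T3
  rw [← f5.nat 23 (by decide)] at T4
  have hP5 := hP' hP4 aux5 f5
  clear f5
  generalize (flood 27 26 23 20 21 43 42 41 cols rows).exec m4 = m5 at T1 T2 T3 T4 T5 hP5 ⊢
  -- the target set
  have aux6 : (flood 28 29 22 21 20 43 42 40 rows cols).Aux := by decide
  have T6 := flood_spec (m := m5) (x := 28) (y := 29) (lk := 22) (mt := 21) (ch := 20) (c := 43)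
    (v := 42) (w := 40) (e := rows) (e' := cols) (by decide)
    (fun m' hf => eval_rows (hP' hP5 aux6 hf)) (fun m' hf => eval_cols (hP' hP5 aux6 hf))
    T3 T2 T1 h.link_row h.mate_col h.link_col h.mate_row Iff.rfl
  have f6 := Cmd.frame (flood 28 29 22 21 20 43 42 40 rows cols) m5
  simp only [reflTransGen_tstep_iff', reflTransGen_tstep_iff] at T5 T6
  refine ⟨?_, ?_, ?_, ?_, ?_, ?_, ?_, ?_⟩
  · rw [f6.nat 20 (by decide)]; exact T1
  · rw [f6.nat 21 (by decide)]; exact T2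
  · rw [f6.nat 22 (by decide)]; exact T3
  · rw [f6.nat 23 (by decide)]; exact T4
  · rw [f6.nat 26 (by decide)]
    intro a s
    refine (T5.2 a s).trans (Iff.trans ?_ h.mem_source.symm)
    constructor
    · rintro ⟨b, hb, hr⟩; exact ⟨b, s, hb, hr⟩
    · rintro ⟨b, t, hb, hr⟩
      obtain rfl : s = t := sign_eq_of_reflTransGen hr
      exact ⟨b, hb, hr⟩
  · rw [f6.nat 27 (by decide)]
    intro a s
    refine (T5.1 a s).trans (Iff.trans ?_ h.mem_source.symm)
    constructor
    · rintro ⟨b, hb, hr⟩; exact ⟨b, s, hb, hr⟩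
    · rintro ⟨b, t, hb, hr⟩
      obtain rfl : s = t := sign_eq_of_reflTransGen hr
      exact ⟨b, hb, hr⟩
  · intro a s
    refine (T6.1 a s).trans (Iff.trans ?_ h.mem_target.symm)
    constructor
    · rintro ⟨b, hb, hr⟩; exact ⟨b, s, hb, hr⟩
    · rintro ⟨b, t, hb, hr⟩
      obtain rfl : t = s := sign_eq_of_reflTransGen hr
      exact ⟨b, hb, hr⟩
  · intro a s
    refine (T6.2 a s).trans (Iff.trans ?_ h.mem_target.symm)
    constructor
    · rintro ⟨b, hb, hr⟩; exact ⟨b, s, hb, hr⟩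
    · rintro ⟨b, t, hb, hr⟩
      obtain rfl : t = s := sign_eq_of_reflTransGen hr
      exact ⟨b, hb, hr⟩

end

/-! ### Extracting a path from the forest -/

/-- Append a vertex, given by its codes, to the list in the array `13`. -/
def push (k a s : NExp) : Cmd :=
  .seq (.setNat 13 (reg 62) (.const 0) k)
  (.seq (.setNat 13 (reg 62) (.const 1) a)
  (.seq (.setNat 13 (reg 62) (.const 2) s)
  (.setNat 62 (.const 0) (.const 0) (.add (reg 62) (.const 1)))))

/-- Append the column vertex in the registers `64`, `65`; stop if it is in the source set, and go on
to its mate otherwise. -/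
def enterCol : Cmd :=
  .seq (push (.const 1) (reg 64) (reg 65))
  (.ite (.natEq (.get 27 (reg 64) (reg 65)) (.const 1))
    (.setNat 63 (.const 0) (.const 0) (.const 0))
    (.seq (.setNat 60 (.const 0) (.const 0) (.sub (.get 21 (reg 64) (reg 65)) (.const 1)))
      (.setNat 61 (.const 0) (.const 0) (reg 65))))

/-- Go from the row vertex in the registers `60`, `61` to its parent. At a vertex of the target set,
the list is started afresh. -/
def climbStep : Cmd :=
  .seq (.ite (.natEq (.get 28 (reg 60) (reg 61)) (.const 1))
    (.setNat 62 (.const 0) (.const 0) (.const 0)) .skip)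
  (.seq (push (.const 0) (reg 60) (reg 61))
  (.seq (.ite (.natEq (.get 25 (reg 60) (reg 61)) (.const 0))
      (.seq (.setNat 64 (.const 0) (.const 0) (.sub (.get 24 (reg 60) (reg 61)) (.const 1)))
        (.setNat 65 (.const 0) (.const 0) (.const 0)))
      (.seq (.setNat 64 (.const 0) (.const 0) (.sub (.get 25 (reg 60) (reg 61)) (.const 1)))
        (.setNat 65 (.const 0) (.const 0) (.const 1))))
  enterCol))

/-- Follow the parents up to the source set. -/
def climb : Cmd :=
  .loop 42 (.add (.add rows rows) (.const 1))
    (.ite (.natEq (reg 63) (.const 1)) climbStep .skip)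

/-- Output the list in the array `13` in reverse order, with the stopping case `c`. -/
def finish (c : ℕ) : Cmd :=
  .seq (.loop 42 (.add (.add rows rows) (.add cols cols))
    (.seq (.setNat 4 (reg 42) (.const 0)
      (.get 13 (.sub (.sub (reg 62) (.const 1)) (reg 42)) (.const 0)))
    (.seq (.setNat 4 (reg 42) (.const 1)
      (.get 13 (.sub (.sub (reg 62) (.const 1)) (reg 42)) (.const 1)))
    (.setNat 4 (reg 42) (.const 2)
      (.get 13 (.sub (.sub (reg 62) (.const 1)) (reg 42)) (.const 2))))))
  (.seq (.setNat 3 (.const 0) (.const 1) (reg 62)) (.setNat 3 (.const 0) (.const 0) (.const c)))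

section

variable {F : Type u} {μ ν : ℕ}

/-- The array `13` holds the list `l` of vertices. -/
def StoresList (m : Mem F) (l : List (Vertex μ ν)) : Prop :=
  m.nat 62 0 0 = l.length ∧ ∀ (i : ℕ) (z : Vertex μ ν), l[i]? = some z →
    (m.nat 13 i 0, m.nat 13 i 1, m.nat 13 i 2) = z.code

lemma StoresList.congr {m m' : Mem F} {l : List (Vertex μ ν)} (h : StoresList m l)
    (h1 : m'.nat 13 = m.nat 13) (h2 : m'.nat 62 = m.nat 62) : StoresList m' l := by
  unfold StoresList
  rw [h1, h2]
  exact h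

lemma length_le_of_nodup {l : List (Vertex μ ν)} (h : l.Nodup) : l.length ≤ μ + μ + (ν + ν) := by
  let f : Vertex μ ν → (Fin μ × Bool) ⊕ (Fin ν × Bool) := fun z => match z with
    | .row a s => .inl (a, s)
    | .col b s => .inr (b, s)
  have hf : Function.Injective f := by
    rintro (⟨a, s⟩ | ⟨b, s⟩) (⟨a', s'⟩ | ⟨b', s'⟩) h <;> simp_all [f]
  have := (h.map hf).length_le_card
  simp at this
  omega

variable [Field F] {P : PartMatrix F μ ν} {k : ℕ} {m : Mem F} {S : State F μ ν}

lemma push_spec {k a s : NExp} {l : List (Vertex μ ν)} {z : Vertex μ ν} (h : StoresList m l)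
    (hk : ∀ m' : Mem F, (∀ i, i ≠ 13 → m'.nat i = m.nat i) → k.eval m' = z.code.1)
    (ha : ∀ m' : Mem F, (∀ i, i ≠ 13 → m'.nat i = m.nat i) → a.eval m' = z.code.2.1)
    (hs : ∀ m' : Mem F, (∀ i, i ≠ 13 → m'.nat i = m.nat i) → s.eval m' = z.code.2.2) :
    StoresList ((push k a s).exec m) (l ++ [z]) := by
  obtain ⟨h1, h2⟩ := h
  have hm1 : ∀ i j y, ∀ i', i' ≠ 13 → (m.put 13 i j y).nat i' = m.nat i' :=
    fun i j y i' hi' => Mem.put_ne _ hi' _ _ _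
  have hm2 : ∀ i j y i1 j1 y1, ∀ i', i' ≠ 13 →
      ((m.put 13 i j y).put 13 i1 j1 y1).nat i' = m.nat i' :=
    fun i j y i1 j1 y1 i' hi' => by rw [Mem.put_ne _ hi', Mem.put_ne _ hi']
  simp only [push, Cmd.exec_seq, Cmd.exec_setNat, hk m (fun _ _ => rfl), ha _ (hm1 _ _ _),
    hs _ (hm2 _ _ _ _ _ _), NExp.eval, eval_reg]
  have e1 : ∀ (m : Mem F) i j y, (m.put 13 i j y).nat 62 = m.nat 62 :=
    fun m i j y => Mem.put_ne _ (by decide) _ _ _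
  simp only [e1, h1]
  refine ⟨by rw [Mem.put_same]; simp, fun i z' hz' => ?_⟩
  rw [List.getElem?_append] at hz'
  simp only [Mem.put_nat]
  split_ifs at hz' with hi
  · have := h2 i z' hz'
    simp [hi.ne, this]
  · have hi' : i = l.length := by
      have := (List.getElem?_eq_some_iff.1 hz').1
      simp at this
      omega
    subst hi'
    simp at hz'
    subst hz'
    simp

/-- What is known about the memory and the forest while a path is extracted. `X` is the source set
and `T` the target set; the parents are those of the forest of `S`. -/
structure Climbing (S : State F μ ν) (P : PartMatrix F μ ν) (pr : Fin μ → Bool → Fin ν × Bool)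
    (dep : Fin μ → Bool → ℕ) (X T : Set (Vertex μ ν)) (m : Mem F) : Prop where
  rows : m.nat 0 0 0 = μ
  par : ∀ t : Bool, Table (m.nat (24 + t.toNat)) fun (a : Fin μ) s (b : Fin ν) =>
    Planted P S a s ∧ pr a s = (b, t)
  mateC : Table (m.nat 21) fun (b : Fin ν) s (a : Fin μ) => Mate S.x a b s
  sourceC : Marks (m.nat 27) fun (b : Fin ν) s => Vertex.col b s ∈ X
  targetR : Marks (m.nat 28) fun (a : Fin μ) s => Vertex.row a s ∈ T
  disj : ∀ {b t}, Vertex.col b t ∈ X → Vertex.col b t ∉ T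
  mate : ∀ {b t}, Vertex.col b t ∈ S.nodes → Vertex.col b t ∉ X →
    ∃ a, Mate S.x a b t ∧ Planted P S a t ∧ (Vertex.row a t ∈ T ↔ Vertex.col b t ∈ T)
  mate_unique : ∀ {a a' b t}, Mate S.x a b t → Mate S.x a' b t → a = a'
  mem : ∀ {a s}, Planted P S a s → .col (pr a s).1 (pr a s).2 ∈ S.nodes
  dep_lt : ∀ {a s a'}, Planted P S a s → Planted P S a' (pr a s).2 →
    Mate S.x a' (pr a s).1 (pr a s).2 → dep a' (pr a s).2 < dep a s

variable {pr : Fin μ → Bool → Fin ν × Bool} {dep : Fin μ → Bool → ℕ} {X T V : Set (Vertex μ ν)}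
  {Par : Vertex μ ν → Vertex μ ν → Prop}

lemma Climbing.congr {m' : Mem F} (h : Climbing S P pr dep X T m)
    (hn : ∀ i < 30, i = 0 ∨ 20 ≤ i → m'.nat i = m.nat i) : Climbing S P pr dep X T m' := by
  refine ⟨?_, ?_, ?_, ?_, ?_, h.disj, h.mate, h.mate_unique, h.mem, h.dep_lt⟩
  · rw [hn 0 (by decide) (by decide)]; exact h.rows
  · intro t
    rw [hn _ (by cases t <;> decide) (by omega)]; exact h.par t
  · rw [hn 21 (by decide) (by decide)]; exact h.mateC
  · rw [hn 27 (by decide) (by decide)]; exact h.sourceC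
  · rw [hn 28 (by decide) (by decide)]; exact h.targetR

/-- The extraction of a path, in state `1` of the register `63`, has arrived at a row vertex that
is not in the list yet. The list is a chain of parents whose first element is its only one in `T`.
It may be empty as long as a vertex of `T` is about to be entered. The depths bound the number of
steps that remain. -/
def ClimbAlive (S : State F μ ν) (P : PartMatrix F μ ν) (dep : Fin μ → Bool → ℕ)
    (T V : Set (Vertex μ ν)) (Par : Vertex μ ν → Vertex μ ν → Prop) (i : ℕ) (m : Mem F) : Prop :=
  m.nat 63 0 0 = 1 ∧ ∃ (a : Fin μ) (s : Bool) (L : List (Vertex μ ν)),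
    m.nat 60 0 0 = a ∧ m.nat 61 0 0 = s.toNat ∧ StoresList m L ∧
    (L ++ [Vertex.row a s]).IsChain Par ∧ Planted P S a s ∧ dep a s + i ≤ 2 * μ ∧
    (Vertex.row a s ∈ T ∨ ∃ v l, L = v :: l ∧ v ∈ T ∩ V ∧ ∀ w ∈ l, w ∉ T)

/-- The extraction of a path is complete: the list is a chain of parents that leads from a vertex of
`T ∩ V`, without further vertices of `T`, to a vertex of `X`. -/
def ClimbDone (X T V : Set (Vertex μ ν)) (Par : Vertex μ ν → Vertex μ ν → Prop)
    (m : Mem F) : Prop :=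
  m.nat 63 0 0 = 0 ∧ ∃ v l, StoresList m (v :: l) ∧ (v :: l).IsChain Par ∧ v ∈ T ∩ V ∧
    (∀ w ∈ l, w ∉ T) ∧ ∃ z ∈ X, (v :: l).getLast? = some z

lemma enterCol_spec (h : Climbing S P pr dep X T m) {b : Fin ν} {t : Bool} {i : ℕ}
    (hPar : ∀ {v w}, IsParent S.x (Planted P S) pr v w → Par v w)
    (h64 : m.nat 64 0 0 = b) (h65 : m.nat 65 0 0 = t.toNat) (h63 : m.nat 63 0 0 = 1)
    {v : Vertex μ ν} {l : List (Vertex μ ν)} (hl : StoresList m (v :: l))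
    (hc : (v :: l ++ [Vertex.col b t]).IsChain Par) (hv : v ∈ T ∩ V) (hl' : ∀ w ∈ l, w ∉ T)
    (hb : .col b t ∈ S.nodes)
    (hdep : ∀ a, Planted P S a t → Mate S.x a b t → dep a t + i ≤ 2 * μ) :
    ClimbAlive S P dep T V Par i (enterCol.exec m) ∨ ClimbDone X T V Par (enterCol.exec m) := by
  unfold enterCol
  rw [Cmd.exec_seq]
  have hl1 := push_spec (k := .const 1) (a := reg 64) (s := reg 65) (z := .col b t) hl
    (fun _ _ => rfl) (fun m' hm' => by rw [eval_reg, hm' 64 (by decide), h64]; rfl)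
    (fun m' hm' => by rw [eval_reg, hm' 65 (by decide), h65]; rfl)
  have hf := (push (.const 1) (reg 64) (reg 65)).frame m
  generalize (push (.const 1) (reg 64) (reg 65)).exec m = m1 at hl1 hf
  have e64 : m1.nat 64 0 0 = b := by rw [hf.nat 64 (by decide), h64]
  have e65 : m1.nat 65 0 0 = t.toNat := by rw [hf.nat 65 (by decide), h65]
  have e63 : m1.nat 63 0 0 = 1 := by rw [hf.nat 63 (by decide), h63]
  have h1 : Climbing S P pr dep X T m1 := h.congr fun i hi hi' => hf.nat i (by
    simp [push, Cmd.natW]; omega)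
  by_cases hX : Vertex.col b t ∈ X
  · right
    rw [Cmd.exec_ite_pos (by
      simp only [Test.Holds, NExp.eval, eval_reg, e64, e65]
      exact (h1.sourceC b t).2 hX), Cmd.exec_setNat]
    rw [List.cons_append] at hc hl1
    refine ⟨Mem.put_same _ _ _ _ _, v, l ++ [Vertex.col b t],
      hl1.congr (Mem.put_ne _ (by decide) _ _ _) (Mem.put_ne _ (by decide) _ _ _), hc, hv, ?_, _,
      hX, by simp [List.getLast?_cons]⟩
    intro w hw
    rcases List.mem_append.1 hw with hw | hw
    · exact hl' w hw
    · rw [List.mem_singleton] at hw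
      subst hw
      exact h1.disj hX
  · left
    obtain ⟨a, hm, hp, hT⟩ := h1.mate hb hX
    rw [Cmd.exec_ite_neg (by
      simp only [Test.Holds, NExp.eval, eval_reg, e64, e65]
      exact fun he => hX ((h1.sourceC b t).1 he)), Cmd.exec_seq, Cmd.exec_setNat, Cmd.exec_setNat]
    obtain ⟨a', ha', hm'⟩ : ∃ a' : Fin μ, m1.nat 21 b t.toNat = a' + 1 ∧ Mate S.x a' b t := by
      rcases h1.mateC b t with ⟨-, hno⟩ | ha
      · exact absurd hm (hno a)
      · exact ha
    obtain rfl := h1.mate_unique hm hm'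
    have e61 : ∀ (m : Mem F) i j y, (m.put 60 i j y).nat 65 = m.nat 65 :=
      fun m i j y => Mem.put_ne _ (by decide) _ _ _
    have hL : ∀ i j, StoresList ((m1.put 60 0 0 i).put 61 0 0 j) (v :: l ++ [Vertex.col b t]) := by
      intro i j
      refine hl1.congr ?_ ?_ <;> rw [Mem.put_ne _ (by decide), Mem.put_ne _ (by decide)]
    refine ⟨?_, a, t, v :: l ++ [Vertex.col b t], ?_, ?_, hL _ _, ?_, hp, hdep a hp hm, ?_⟩
    · rw [Mem.put_ne _ (by decide), Mem.put_ne _ (by decide), e63]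
    · rw [Mem.put_ne _ (by decide)]
      simp [NExp.eval, reg, e64, e65, ha', Mem.put_same]
    · simp [NExp.eval, reg, e61, e65, Mem.put_same]
    · rw [List.isChain_append]
      refine ⟨hc, List.isChain_singleton _, fun y hy z hz => ?_⟩
      simp only [List.getLast?_append, List.getLast?_singleton, Option.some_or,
        Option.mem_def, Option.some.injEq, List.head?_cons] at hy hz
      subst hy hz
      exact hPar (.col hp hm)
    · by_cases ha : Vertex.row a t ∈ T
      · exact Or.inl ha
      · refine Or.inr ⟨v, l ++ [Vertex.col b t], rfl, hv, fun w hw => ?_⟩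
        rcases List.mem_append.1 hw with hw | hw
        · exact hl' w hw
        · rw [List.mem_singleton] at hw
          subst hw
          exact fun hc => ha (hT.2 hc)

/-- If the parent of the current row vertex is in the source set, the path is complete. Otherwise the
mate of the parent is the next row vertex, and its depth is smaller. -/
lemma climbStep_spec (h : Climbing S P pr dep X T m) {i : ℕ}
    (hPar : ∀ {v w}, IsParent S.x (Planted P S) pr v w → Par v w)
    (hV : ∀ {a s}, Planted P S a s → Vertex.row a s ∈ V)
    (ha : ClimbAlive S P dep T V Par i m) :
    ClimbAlive S P dep T V Par (i + 1) (climbStep.exec m) ∨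
      ClimbDone X T V Par (climbStep.exec m) := by
  obtain ⟨h63, a, s, L, h60, h61, hL, hc, hp, hd, hT⟩ := ha
  unfold climbStep
  rw [Cmd.exec_seq]
  -- the list is started afresh if necessary
  have step1 : ∃ L1, StoresList ((Cmd.ite (.natEq (.get 28 (reg 60) (reg 61)) (.const 1))
      (.setNat 62 (.const 0) (.const 0) (.const 0)) .skip).exec m) L1 ∧
      (L1 ++ [Vertex.row a s]).IsChain Par ∧ ∃ v l, L1 ++ [Vertex.row a s] = v :: l ∧ v ∈ T ∩ V ∧
        ∀ w ∈ l, w ∉ T := by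
    have h28 : (Test.natEq (.get 28 (reg 60) (reg 61)) (.const 1)).Holds m ↔
        Vertex.row a s ∈ T := by
      rw [Test.Holds]
      simp only [NExp.eval, eval_reg, h60, h61]
      exact h.targetR a s
    by_cases hTa : Vertex.row a s ∈ T
    · rw [Cmd.exec_ite_pos (h28.2 hTa), Cmd.exec_setNat]
      refine ⟨[], ⟨Mem.put_same _ _ _ _ _, by simp⟩, by simp, _, [], rfl, ⟨hTa, hV hp⟩, by simp⟩
    · rw [Cmd.exec_ite_neg (fun hh => hTa (h28.1 hh)), Cmd.exec_skip]
      obtain ⟨v, l, rfl, hv, hl⟩ := hT.resolve_left hTa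
      refine ⟨v :: l, hL, hc, v, l ++ [.row a s], rfl, hv, fun w hw => ?_⟩
      rcases List.mem_append.1 hw with hw | hw
      · exact hl w hw
      · rw [List.mem_singleton] at hw
        subst hw
        exact hTa
  have hf := (Cmd.ite (.natEq (.get 28 (reg 60) (reg 61)) (.const 1))
      (.setNat 62 (.const 0) (.const 0) (.const 0)) .skip).frame m
  generalize (Cmd.ite (.natEq (.get 28 (reg 60) (reg 61)) (.const 1))
      (.setNat 62 (.const 0) (.const 0) (.const 0)) .skip).exec m = m1 at step1 hf ⊢
  have h1 : Climbing S P pr dep X T m1 := h.congr fun i hi hi' => hf.nat i (by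
    simp [Cmd.natW]; omega)
  have e60 : m1.nat 60 0 0 = a := by rw [hf.nat 60 (by decide), h60]
  have e61 : m1.nat 61 0 0 = s.toNat := by rw [hf.nat 61 (by decide), h61]
  have e63 : m1.nat 63 0 0 = 1 := by rw [hf.nat 63 (by decide), h63]
  clear hf hL hc hT h60 h61 h63 h
  obtain ⟨L1, hL1, hc1, v, l, hvl, hv, hl⟩ := step1
  rw [Cmd.exec_seq]
  have hl2 := push_spec (k := .const 0) (a := reg 60) (s := reg 61) (z := .row a s) hL1
    (fun _ _ => rfl) (fun m' hm' => by rw [eval_reg, hm' 60 (by decide), e60]; rfl)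
    (fun m' hm' => by rw [eval_reg, hm' 61 (by decide), e61]; rfl)
  have hf := (push (.const 0) (reg 60) (reg 61)).frame m1
  generalize (push (.const 0) (reg 60) (reg 61)).exec m1 = m2 at hl2 hf ⊢
  have f60 : m2.nat 60 0 0 = a := by rw [hf.nat 60 (by decide), e60]
  have f61 : m2.nat 61 0 0 = s.toNat := by rw [hf.nat 61 (by decide), e61]
  have f63 : m2.nat 63 0 0 = 1 := by rw [hf.nat 63 (by decide), e63]
  have h2 : Climbing S P pr dep X T m2 := h1.congr fun i hi hi' => hf.nat i (by
    simp [push, Cmd.natW]; omega)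
  clear hf e60 e61 e63 h1
  rw [Cmd.exec_seq]
  -- the parent
  let c : Cmd := .ite (.natEq (.get 25 (reg 60) (reg 61)) (.const 0))
      (.seq (.setNat 64 (.const 0) (.const 0) (.sub (.get 24 (reg 60) (reg 61)) (.const 1)))
        (.setNat 65 (.const 0) (.const 0) (.const 0)))
      (.seq (.setNat 64 (.const 0) (.const 0) (.sub (.get 25 (reg 60) (reg 61)) (.const 1)))
        (.setNat 65 (.const 0) (.const 0) (.const 1)))
  have step2 : (c.exec m2).nat 64 0 0 = (pr a s).1 ∧
      (c.exec m2).nat 65 0 0 = (pr a s).2.toNat := by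
    have h25 : (Test.natEq (.get 25 (reg 60) (reg 61)) (.const 0)).Holds m2 ↔
        m2.nat 25 a s.toNat = 0 := by
      simp only [Test.Holds, NExp.eval, eval_reg, f60, f61]
    have p1 := h2.par true a s
    have p0 := h2.par false a s
    simp only [Bool.toNat_true, Bool.toNat_false, Nat.add_zero, Nat.reduceAdd] at p1 p0
    rcases p1 with ⟨p1, hno⟩ | ⟨b, p1, -, hb⟩
    · rw [Cmd.exec_ite_pos (h25.2 p1)]
      rcases p0 with ⟨p0, hno'⟩ | ⟨b, p0, -, hb⟩
      · exfalso
        rcases hpr : pr a s with ⟨b, _ | _⟩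
        · exact hno' b ⟨hp, hpr⟩
        · exact hno b ⟨hp, hpr⟩
      · simp [hb, Cmd.exec_seq, Cmd.exec_setNat, NExp.eval, reg, f60, f61, p0, Mem.put_nat]
    · rw [Cmd.exec_ite_neg (by rw [h25, p1]; omega)]
      simp [hb, Cmd.exec_seq, Cmd.exec_setNat, NExp.eval, reg, f60, f61, p1, Mem.put_nat]
  have hf := c.frame m2
  change ClimbAlive S P dep T V Par (i + 1) (enterCol.exec (c.exec m2)) ∨
    ClimbDone X T V Par (enterCol.exec (c.exec m2))
  rw [hvl] at hl2
  have hc2 : (v :: l ++ [Vertex.col (pr a s).1 (pr a s).2]).IsChain Par := by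
    rw [← hvl, List.isChain_append]
    refine ⟨hc1, List.isChain_singleton _, fun y hy z hz => ?_⟩
    simp only [List.getLast?_append, List.getLast?_singleton, Option.some_or,
      Option.mem_def, Option.some.injEq, List.head?_cons] at hy hz
    subst hy hz
    exact hPar (.row hp)
  have h3 : Climbing S P pr dep X T (c.exec m2) := h2.congr fun i hi hi' => hf.nat i (by
    simp [c, Cmd.natW]; omega)
  refine enterCol_spec h3 hPar step2.1 step2.2 ?_ (hl2.congr ?_ ?_) hc2 hv hl (h3.mem hp) ?_
  · rw [hf.nat 63 (by simp [c, Cmd.natW]), f63]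
  · rw [hf.nat 13 (by simp [c, Cmd.natW])]
  · rw [hf.nat 62 (by simp [c, Cmd.natW])]
  · intro a' hp' hm'
    have := h3.dep_lt hp hp' hm'
    omega

lemma climb_spec (h : Climbing S P pr dep X T m)
    (hPar : ∀ {v w}, IsParent S.x (Planted P S) pr v w → Par v w)
    (hV : ∀ {a s}, Planted P S a s → Vertex.row a s ∈ V)
    (ha : ClimbAlive S P dep T V Par 0 m ∨ ClimbDone X T V Par m) :
    ClimbDone X T V Par (climb.exec m) := by
  have key := Cmd.exec_loop (m := m) (x := 42) (e := .add (.add rows rows) (.const 1))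
    (p := .ite (.natEq (reg 63) (.const 1)) climbStep .skip) (n := 2 * μ + 1)
    (fun i m' => Climbing S P pr dep X T m' ∧
      (ClimbAlive S P dep T V Par i m' ∨ ClimbDone X T V Par m'))
    (by simp only [NExp.eval, rows, h.rows]; omega) ⟨h, ha⟩ ?_
  · refine key.2.resolve_left ?_
    rintro ⟨-, a, s, L, -, -, -, -, -, hd, -⟩
    omega
  · rintro i m' hi - ⟨h1, h2⟩
    have hput : ∀ x ≠ 42, (m'.put 42 0 0 i).nat x = m'.nat x :=
      fun x hx => Mem.put_ne _ hx _ _ _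
    have h1' : Climbing S P pr dep X T (m'.put 42 0 0 i) :=
      h1.congr fun j hj _ => hput j (by omega)
    have hSL : ∀ {L : List (Vertex μ ν)}, StoresList m' L → StoresList (m'.put 42 0 0 i) L :=
      fun hL => hL.congr (hput _ (by decide)) (hput _ (by decide))
    rcases h2 with h2 | ⟨h63, v, l, hL, h2⟩
    · have h2' : ClimbAlive S P dep T V Par i (m'.put 42 0 0 i) := by
        obtain ⟨h63, a, s, L, h60, h61, hL, h2⟩ := h2
        exact ⟨by rw [hput _ (by decide), h63], a, s, L, by rw [hput _ (by decide), h60],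
          by rw [hput _ (by decide), h61], hSL hL, h2⟩
      rw [Cmd.exec_ite_pos (by simp only [Test.Holds, NExp.eval, eval_reg]; exact h2'.1)]
      exact ⟨h1'.congr fun j hj hj' => (climbStep.frame _).nat j (by
        simp [climbStep, enterCol, push, Cmd.natW]; omega), climbStep_spec h1' hPar hV h2'⟩
    · rw [Cmd.exec_ite_neg (by
        simp only [Test.Holds, NExp.eval, eval_reg, hput _ (show 63 ≠ 42 by decide), h63]
        decide), Cmd.exec_skip]
      exact ⟨h1', Or.inr ⟨by rw [hput _ (by decide), h63], v, l, hSL hL, h2⟩⟩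

lemma finish_spec {c : ℕ} {l : List (Vertex μ ν)} (hr : m.nat 0 0 0 = μ) (hc : m.nat 0 0 1 = ν)
    (hl : StoresList m l) (hn : l.Nodup) :
    ((finish c).exec m).nat 3 0 0 = c ∧ StoresPath ((finish c).exec m) l.reverse := by
  have hlen := length_le_of_nodup hn
  let body : Cmd := .seq (.setNat 4 (reg 42) (.const 0)
      (.get 13 (.sub (.sub (reg 62) (.const 1)) (reg 42)) (.const 0)))
    (.seq (.setNat 4 (reg 42) (.const 1)
      (.get 13 (.sub (.sub (reg 62) (.const 1)) (reg 42)) (.const 1)))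
    (.setNat 4 (reg 42) (.const 2)
      (.get 13 (.sub (.sub (reg 62) (.const 1)) (reg 42)) (.const 2))))
  have key := Cmd.exec_loop (m := m) (x := 42) (e := .add (.add rows rows) (.add cols cols))
    (p := body) (n := μ + μ + (ν + ν))
    (fun i m' => ∀ j < i, ∀ t < 3, m'.nat 4 j t = m.nat 13 (l.length - 1 - j) t)
    (by simp [NExp.eval, rows, cols, hr, hc]) (by simp) ?_
  · have hf := (Cmd.loop 42 (.add (.add rows rows) (.add cols cols)) body).frame m
    change ((Cmd.seq (.setNat 3 (.const 0) (.const 1) (reg 62))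
      (.setNat 3 (.const 0) (.const 0) (.const c))).exec
        ((Cmd.loop 42 (.add (.add rows rows) (.add cols cols)) body).exec m)).nat 3 0 0 = c ∧
      StoresPath ((Cmd.seq (.setNat 3 (.const 0) (.const 1) (reg 62))
      (.setNat 3 (.const 0) (.const 0) (.const c))).exec
        ((Cmd.loop 42 (.add (.add rows rows) (.add cols cols)) body).exec m)) l.reverse
    generalize (Cmd.loop 42 (.add (.add rows rows) (.add cols cols)) body).exec m = m1 at key hf
    simp only [Cmd.exec_seq, Cmd.exec_setNat, NExp.eval, eval_reg]
    have e62 : m1.nat 62 = m.nat 62 := hf.nat 62 (by simp [body, Cmd.natW])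
    refine ⟨Mem.put_same _ _ _ _ _, ?_, fun i z hz => ?_⟩
    · simp [Mem.put_nat, e62, hl.1]
    · rw [Mem.put_ne _ (by decide), Mem.put_ne _ (by decide)]
      have hi := (List.getElem?_eq_some_iff.1 hz).1
      rw [List.length_reverse] at hi
      rw [List.getElem?_reverse hi] at hz
      rw [key i (by omega) 0 (by decide), key i (by omega) 1 (by decide),
        key i (by omega) 2 (by decide)]
      exact hl.2 _ z hz
  · intro i m' hi hf h j hj t ht
    have e62 : m'.nat 62 = m.nat 62 := hf.nat 62 (by simp [body, Cmd.natW])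
    have e13 : m'.nat 13 = m.nat 13 := hf.nat 13 (by simp [body, Cmd.natW])
    have h62 := hl.1
    simp only [body, Cmd.exec_seq, Cmd.exec_setNat, NExp.eval, reg, Mem.put_nat]
    rcases Nat.lt_succ_iff_lt_or_eq.1 hj with hj | rfl
    · have := h j hj t ht
      simp [hj.ne, this]
    · interval_cases t <;> simp [e62, e13, h62]

end

/-! ### The output of augmenting paths -/

/-- The column vertex given by the registers `41` and `t` is the parent of the row vertex given by
the registers `40` and `s`. -/
def parentTest (s t : Bool) : Test :=
  bif s == t then
    .and (.natEq (.get (7 + 2 * s.toNat + t.toNat) (reg 40) (reg 41)) (.const 1))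
      (.not (mateTest (reg 40) (reg 41) s))
  else .natEq (.get (7 + 2 * s.toNat + t.toNat) (reg 40) (reg 41)) (.const 1)

/-- Compute the tables of parents of row vertices. -/
def parents : Cmd := both fun t => lookup (24 + t.toNat) 40 rows 41 cols fun s => parentTest s t

/-- List, in the array `13` and beginning with its last vertex, the path that leaves the forest
through the edge from the column vertex given by the register `51` and `s` to the row vertex given
by the register `50` and `t`. -/
def leavingPath (s t : Bool) : Cmd :=
  .seq parents (.seq (.setNat 62 (.const 0) (.const 0) (.const 0))
  (.seq (push (.const 0) (reg 50) (.const t.toNat))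
  (.seq (.setNat 64 (.const 0) (.const 0) (reg 51))
  (.seq (.setNat 65 (.const 0) (.const 0) (.const s.toNat))
  (.seq (.setNat 63 (.const 0) (.const 0) (.const 1))
  (.seq enterCol climb))))))

/-- List, beginning with its last vertex, a shortest path in the forest that ends at the row vertex
given by the register `50` and `s`, or at a vertex of the target set that precedes it. -/
def innerPath (s : Bool) : Cmd :=
  .seq parents (.seq (.setNat 62 (.const 0) (.const 0) (.const 0))
  (.seq (.setNat 60 (.const 0) (.const 0) (reg 50))
  (.seq (.setNat 61 (.const 0) (.const 0) (.const s.toNat))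
  (.seq (.setNat 63 (.const 0) (.const 0) (.const 1)) climb))))

section

variable {F : Type u} [Field F] {μ ν : ℕ} {P : PartMatrix F μ ν} {k : ℕ} {m : Mem F}
  {S : State F μ ν} {x : Conf F μ ν} {pr : Fin μ → Bool → Fin ν × Bool} {dep : Fin μ → Bool → ℕ}
  {ε : ℝ}

lemma Forest.parent_iff (hf : Forest P S pr dep) {a : Fin μ} {s : Bool} {b : Fin ν} {t : Bool} :
    Planted P S a s ∧ pr a s = (b, t) ↔
      s(Vertex.row a s, Vertex.col b t) ∈ S.edges ∧ (s = t → ¬ Mate S.x a b s) := by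
  rw [hf.edge]
  constructor
  · rintro ⟨hp, hpr⟩
    refine ⟨⟨hp, Or.inl hpr⟩, fun _ hm => ?_⟩
    have := hf.parents.kind hp
    rw [hpr] at this
    rcases this with h | h
    · exact h.1 hm.1
    · exact h.1.not_mate hm
  · rintro ⟨⟨hp, h | ⟨h, hm⟩⟩, hn⟩
    · exact ⟨hp, h⟩
    · exact absurd hm (hn h)

lemma parents_spec (hP : StoresMatrix m P) (hx : StoresConf m x) (hI : x.I ⊆ x.M)
    (hM : ∀ {a b s}, Mate x a b s ↔ Mate S.x a b s)
    (hE : ∀ (a : Fin μ) (s : Bool) (b : Fin ν) (t : Bool),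
      m.nat (7 + 2 * s.toNat + t.toNat) a b = 1 ↔ s(Vertex.row a s, Vertex.col b t) ∈ S.edges)
    (hf : Forest P S pr dep) (t : Bool) :
    Table ((parents.exec m).nat (24 + t.toNat)) fun (a : Fin μ) s (b : Fin ν) =>
      Planted P S a s ∧ pr a s = (b, t) := by
  have hT : ∀ (t : Bool) (m' : Mem F) (s : Bool) (a : Fin μ) (b : Fin ν), Frame parents m m' →
      m'.nat 40 0 0 = a → m'.nat 41 0 0 = b →
      ((parentTest s t).Holds m' ↔ Planted P S a s ∧ pr a s = (b, t)) := by
    intro t m' s a b hf' ha hb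
    have aux : parents.Aux := by decide
    rw [hf.parent_iff, ← hE, ← hM, ← mateTest_holds (hx.frame hf' aux) hI (a := reg 40)
      (b := reg 41) ha hb]
    have hn : m'.nat (7 + 2 * s.toNat + t.toNat) = m.nat (7 + 2 * s.toNat + t.toNat) :=
      hf'.nat _ fun hmem => by
        have := aux.1 _ hmem
        cases s <;> cases t <;> simp at this
    rw [← hn]
    cases s <;> cases t <;>
      simp [parentTest, Test.Holds, NExp.eval, eval_reg, ha, hb]
  have aux : ∀ t : Bool, (lookup (24 + t.toNat) 40 rows 41 cols fun s => parentTest s t).Aux := by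
    decide
  have hl : ∀ (t : Bool) (m1 : Mem F), Frame parents m m1 →
      (∀ m', Frame (lookup (24 + t.toNat) 40 rows 41 cols fun s => parentTest s t) m1 m' →
        Frame parents m m') →
      Table (((lookup (24 + t.toNat) 40 rows 41 cols fun s => parentTest s t).exec m1).nat
        (24 + t.toNat)) fun (a : Fin μ) s (b : Fin ν) => Planted P S a s ∧ pr a s = (b, t) := by
    intro t m1 h1 h2
    have hP1 := hP.frame h1 (by decide)
    exact lookup_spec (by cases t <;> decide) (by cases t <;> decide) (by decide) (eval_rows hP1)
      (fun m' hf' => eval_cols (hP1.frame hf' (aux t)))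
      fun m' hf' a s b ha hb => hT t m' s a b (h2 m' hf') ha hb
  cases t
  · exact hl false _ ((Cmd.frame _ m).left) fun m' hf' => ((Cmd.frame _ m).left).trans hf'.right
  · have h1 := hl true m .rfl fun m' hf' => hf'.left
    rw [show (24 + true.toNat) = 25 from rfl] at h1 ⊢
    rw [parents, both, Cmd.exec_seq, (Cmd.frame _ _).nat 25 (by decide)]
    exact h1

lemma Analyzed.climbing (hA : Analyzed P x m)
    (hpar : ∀ t : Bool, Table (m.nat (24 + t.toNat)) fun (a : Fin μ) s (b : Fin ν) =>
      Planted P S a s ∧ pr a s = (b, t))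
    (hr : m.nat 0 0 0 = μ) (hx : IsOptimal P k x) (hM : ∀ {a b s}, Mate x a b s ↔ Mate S.x a b s)
    (hd : Disjoint (source P x) (target P x)) (hf : Forest P S pr dep) (h : Searching P k S)
    (hsub : source P S.x ⊆ source P x) :
    Climbing S P pr dep (source P x) (target P x) m where
  rows := hr
  par := hpar
  mateC b s := by simpa only [hM] using hA.mateC b s
  sourceC := hA.sourceC
  targetR := hA.targetR
  disj hb := Set.disjoint_left.1 hd hb
  mate {b t} hb hb' := by
    have : ∃ a, Mate x a b t := by
      by_contra hno
      push Not at hno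
      exact hb' (hx.unmatched_mem_source hno)
    obtain ⟨a, ha⟩ := this
    refine ⟨a, hM.1 ha, ⟨(h.mate (hM.1 ha)).2 hb, fun hs => hb' ?_⟩,
      (hx.target_tstep (.mate ha)).symm⟩
    exact (hx.source_tstep (.mate ha)).2 (hsub hs)
  mate_unique := h.opt.mate_col
  mem := hf.mem
  dep_lt := hf.dep_lt

/-- The path obtained when a vertex of the target set is reached through an edge that leaves the
forest. -/
lemma Forest.isPathFromTo_leaving (hf : Forest P S pr dep) (h : Searching P k S) {b : Fin ν}
    {s : Bool} {a : Fin μ} {t : Bool} (ha : Vertex.row a t ∉ S.nodes)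
    {v : Vertex μ ν} {l : List (Vertex μ ν)}
    (hl : (v :: l).IsChain fun v w => IsParent S.x (Planted P S) pr v w ∨
      v = .row a t ∧ w = .col b s)
    (hv : v = .row a t) (hl' : ∀ w ∈ l, w ∉ target P S.x) (ht : Vertex.row a t ∈ target P S.x)
    (hz : ∃ z ∈ source P S.x, (v :: l).getLast? = some z) :
    (v :: l).Nodup ∧ IsPathFromTo (S.edges ∪ {s(.col b s, .row a t)}) (source P S.x)
      {.row a t} (v :: l).reverse := by
  subst hv
  have hn : (Vertex.row a t :: l).Nodup := by
    rw [List.nodup_cons]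
    refine ⟨fun hmem => hl' _ hmem ht, hf.nodup h ?_⟩
    refine List.IsChain.imp_of_mem_imp (fun v w hv _ hvw => ?_) hl.tail
    refine hvw.resolve_right fun h1 => hl' v hv ?_
    rw [h1.1]
    exact ht
  refine ⟨hn, ?_, List.nodup_reverse.2 hn, ?_, ?_⟩
  · rw [List.isChain_reverse]
    refine hl.imp fun v w hvw => ?_
    rcases hvw with hvw | ⟨rfl, rfl⟩
    · exact Or.inl (hf.edge_iff.2 (Or.inl hvw))
    · exact Or.inr rfl
  · obtain ⟨z, hz, hz'⟩ := hz
    exact ⟨z, hz, by rw [List.head?_reverse]; exact hz'⟩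
  · simp

lemma StoresList.nil (h : m.nat 62 0 0 = 0) : StoresList m ([] : List (Vertex μ ν)) :=
  ⟨h, by simp⟩

/-- The extraction starts with the vertex `a^t` of the target set, whose parent is to be `b^s`. -/
lemma leavingPath_spec (hP : StoresMatrix m P) (hS : StoresState m S) (hA : Analyzed P S.x m)
    (h : Searching P k S) (hf : Forest P S pr dep) {b : Fin ν} {s : Bool} {a : Fin μ} {t : Bool}
    (hb : Vertex.col b s ∈ S.nodes) (hT : Vertex.row a t ∈ target P S.x)
    (h50 : m.nat 50 0 0 = a) (h51 : m.nat 51 0 0 = b) :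
    ClimbDone (source P S.x) (target P S.x) {z | z = .row a t ∨ z ∈ S.nodes}
      (fun v w => IsParent S.x (Planted P S) pr v w ∨ v = .row a t ∧ w = .col b s)
      ((leavingPath s t).exec m) := by
  unfold leavingPath
  rw [Cmd.exec_seq]
  have hfr := parents.frame m
  have aux : parents.Aux := by decide
  have hC := (hA.frame hfr (by decide)).climbing
    (parents_spec hP hS.conf h.opt.pair.subset Iff.rfl hS.edge hf) (hP.frame hfr aux).rows h.opt
    Iff.rfl h.disj hf h subset_rfl
  have h50' : (parents.exec m).nat 50 0 0 = a := by rw [hfr.nat 50 (by decide), h50]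
  have h51' : (parents.exec m).nat 51 0 0 = b := by rw [hfr.nat 51 (by decide), h51]
  clear hfr aux
  generalize parents.exec m = m1 at *
  rw [Cmd.exec_seq, Cmd.exec_setNat, Cmd.exec_seq]
  simp only [NExp.eval]
  have hl1 := push_spec (m := m1.put 62 0 0 0) (k := .const 0) (a := reg 50) (s := .const t.toNat)
    (z := Vertex.row (ν := ν) a t) (l := []) (.nil (Mem.put_same _ _ _ _ _)) (fun _ _ => rfl)
    (fun m' hm' => by rw [eval_reg, hm' 50 (by decide), Mem.put_ne _ (by decide), h50']; rfl)
    (fun m' hm' => rfl)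
  have hf1 := (push (.const 0) (reg 50) (.const t.toNat)).frame (m1.put 62 0 0 0)
  have h51'' : ((push (.const 0) (reg 50) (.const t.toNat)).exec (m1.put 62 0 0 0)).nat 51 0 0 = b := by
    rw [hf1.nat 51 (by simp [push, Cmd.natW]), Mem.put_ne _ (by decide), h51']
  have hC2 := hC.congr (m' := (push (.const 0) (reg 50) (.const t.toNat)).exec (m1.put 62 0 0 0))
    fun i hi hi' => by
      rw [hf1.nat i (by simp [push, Cmd.natW]; omega), Mem.put_ne _ (by omega)]
  clear hf1
  generalize (push (.const 0) (reg 50) (.const t.toNat)).exec (m1.put 62 0 0 0) = m2 at *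
  rw [Cmd.exec_seq, Cmd.exec_setNat, Cmd.exec_seq, Cmd.exec_setNat, Cmd.exec_seq, Cmd.exec_setNat,
    Cmd.exec_seq]
  simp only [NExp.eval, eval_reg, h51'']
  have hput : ∀ i, i < 64 → i ≠ 63 →
      (((m2.put 64 0 0 b).put 65 0 0 s.toNat).put 63 0 0 1).nat i = m2.nat i := by
    intro i hi hi'
    rw [Mem.put_ne _ hi', Mem.put_ne _ (by omega), Mem.put_ne _ (by omega)]
  have hC3 := hC2.congr (m' := ((m2.put 64 0 0 b).put 65 0 0 s.toNat).put 63 0 0 1)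
    fun i hi hi' => hput i (by omega) (by omega)
  have hP' : ∀ {v w}, IsParent S.x (Planted P S) pr v w →
    IsParent S.x (Planted P S) pr v w ∨ v = .row a t ∧ w = .col b s := fun h => Or.inl h
  refine climb_spec (hC3.congr fun i hi hi' => (enterCol.frame _).nat i (by
        simp [enterCol, push, Cmd.natW]; omega)) hP' (fun h => Or.inr h.1) ?_
  refine enterCol_spec (b := b) (t := s) hC3 hP' ?_ ?_ ?_ (hl1.congr (hput _ (by decide) (by decide))
    (hput _ (by decide) (by decide))) ?_ ⟨hT, Or.inl rfl⟩ (by simp) hb ?_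
  · simp [Mem.put_nat]
  · simp [Mem.put_nat]
  · simp [Mem.put_nat]
  · simp
  · intro a' hp _
    have := hf.dep_le hp
    have := rowCount_le_two_mul S
    omega

lemma innerPath_spec (hP : StoresMatrix m P) (hx : StoresConf m x)
    (hE : ∀ (a : Fin μ) (s : Bool) (b : Fin ν) (t : Bool),
      m.nat (7 + 2 * s.toNat + t.toNat) a b = 1 ↔ s(Vertex.row a s, Vertex.col b t) ∈ S.edges)
    (hA : Analyzed P x m) (h : Searching P k S) (hf : Forest P S pr dep) (hopt : IsOptimal P k x)
    (hM : ∀ {a b s}, Mate x a b s ↔ Mate S.x a b s)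
    (hd : Disjoint (source P x) (target P x)) (hsub : source P S.x ⊆ source P x)
    {a : Fin μ} {s : Bool} (ha : Vertex.row a s ∈ S.nodes) (hT : Vertex.row a s ∈ target P x)
    (h50 : m.nat 50 0 0 = a) :
    ClimbDone (source P x) (target P x) S.nodes (IsParent S.x (Planted P S) pr)
      ((innerPath s).exec m) := by
  unfold innerPath
  rw [Cmd.exec_seq]
  have hfr := parents.frame m
  have aux : parents.Aux := by decide
  have hC := (hA.frame hfr (by decide)).climbing
    (parents_spec hP hx hopt.pair.subset hM hE hf) (hP.frame hfr aux).rows hopt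
    hM hd hf h hsub
  have h50' : (parents.exec m).nat 50 0 0 = a := by rw [hfr.nat 50 (by decide), h50]
  clear hfr aux
  generalize parents.exec m = m1 at *
  rw [Cmd.exec_seq, Cmd.exec_setNat, Cmd.exec_seq, Cmd.exec_setNat, Cmd.exec_seq, Cmd.exec_setNat,
    Cmd.exec_seq, Cmd.exec_setNat]
  simp only [NExp.eval, eval_reg]
  rw [Mem.put_ne _ (show 50 ≠ 62 by decide), h50']
  have hput : ∀ i < 60,
      ((((m1.put 62 0 0 0).put 60 0 0 a).put 61 0 0 s.toNat).put 63 0 0 1).nat i = m1.nat i := by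
    intro i hi
    rw [Mem.put_ne _ (by omega), Mem.put_ne _ (by omega), Mem.put_ne _ (by omega),
      Mem.put_ne _ (by omega)]
  have hp : Planted P S a s := ⟨ha, fun hs => Set.disjoint_left.1 hd (hsub hs) hT⟩
  refine climb_spec (hC.congr fun i hi _ => hput i (by omega)) (fun h => h) (fun h => h.1) ?_
  refine Or.inl ⟨?_, a, s, [], ?_, ?_, .nil ?_, ?_, hp, ?_, Or.inl hT⟩
  · simp [Mem.put_nat]
  · simp [Mem.put_nat]
  · simp [Mem.put_nat]
  · simp [Mem.put_nat]
  · simp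
  · have := hf.dep_le hp
    have := rowCount_le_two_mul S
    omega

lemma finish_conf {c : ℕ} (hx : StoresConf m x) : StoresConf ((finish c).exec m) x :=
  hx.congr (fun i hi hi' => ((finish c).frame m).nat i (by simp [finish, Cmd.natW]; omega))
    (fun i _ => ((finish c).frame m).fld i (by simp [finish, Cmd.fldW]))
    (fun i _ => ((finish c).frame m).real i (by simp [finish, Cmd.realW]))

lemma output_leaving (hP : StoresMatrix m P) (hS : StoresState m S) (hA : Analyzed P S.x m)
    (h : SearchInv P k S) {b : Fin ν} {s : Bool} {a : Fin μ} {t : Bool}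
    (hl : Leaves P S b s a t) (hT : Vertex.row a t ∈ target P S.x)
    (h50 : m.nat 50 0 0 = a) (h51 : m.nat 51 0 0 = b) :
    ∃ o, Stops P S o ∧ StoresOutcome ((Cmd.seq (leavingPath s t) (finish 1)).exec m) o := by
  obtain ⟨h, pr, dep, hf⟩ := h
  have aux : (leavingPath s t).Aux := by cases s <;> cases t <;> decide
  rw [Cmd.exec_seq]
  obtain ⟨-, v, l, hL, hc, ⟨hvT, hv⟩, hl', hz⟩ :=
    leavingPath_spec hP hS hA h hf hl.2.1 hT h50 h51
  have hfr := (leavingPath s t).frame m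
  have hP1 := hP.frame hfr aux
  have hv' : v = .row a t := hv.resolve_right fun hn => Set.disjoint_left.1 h.target_disj hn hvT
  obtain ⟨hn, hR⟩ := hf.isPathFromTo_leaving h hl.2.2 hc hv' hl' hT hz
  obtain ⟨h1, h2⟩ := finish_spec (c := 1) hP1.rows hP1.cols hL hn
  exact ⟨.P1 S.x (v :: l).reverse, .P1 b s a t _ hl hT hR, h1, finish_conf (hS.conf.frame hfr aux),
    h2⟩

lemma output_inner (hP : StoresMatrix m P) (hx : StoresConf m (dualConf S ε))
    (hE : ∀ (a : Fin μ) (s : Bool) (b : Fin ν) (t : Bool),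
      m.nat (7 + 2 * s.toNat + t.toNat) a b = 1 ↔ s(Vertex.row a s, Vertex.col b t) ∈ S.edges)
    (hA : Analyzed P (dualConf S ε) m) (h : SearchInv P k S) (hd : DualStep P S ε)
    (hr : ∀ C σ, ¬ IsRearrangeable P (dualConf S ε) C σ)
    {a : Fin μ} {s : Bool} (ha : Vertex.row a s ∈ S.nodes)
    (hT : Vertex.row a s ∈ target P (dualConf S ε)) (h50 : m.nat 50 0 0 = a) :
    ∃ o, Stops P S o ∧ StoresOutcome ((Cmd.seq (innerPath s) (finish 4)).exec m) o := by
  obtain ⟨h, pr, dep, hf⟩ := h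
  have aux : (innerPath s).Aux := by cases s <;> decide
  rw [Cmd.exec_seq]
  have hopt := h.dual_opt hd
  obtain ⟨-, v, l, hL, hc, ⟨hvT, hv⟩, hl', z, hz, hz'⟩ :=
    innerPath_spec hP hx hE hA h hf hopt Iff.rfl (hopt.not_rearrangeable_iff.1 hr)
      (h.source_dual_sup hd) ha hT h50
  have hfr := (innerPath s).frame m
  have hP1 := hP.frame hfr aux
  obtain ⟨h1, h2⟩ := finish_spec (c := 4) hP1.rows hP1.cols hL (hf.nodup h hc)
  refine ⟨.D22 (dualConf S ε) (v :: l).reverse, .D22 ε hd hr ?_ _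
    (hf.isPathFromTo h hc ⟨z, hz, hz'⟩ ⟨v, ⟨hv, hvT⟩, rfl⟩)
    (hf.minimal h hd hc ⟨hv, hvT⟩ hl' ⟨z, hz, hz'⟩), h1, finish_conf (hx.frame hfr aux), h2⟩
  exact (h.target_grows_iff hd).2 fun hdis => Set.disjoint_left.1 hdis hv hvT

end

/-! ### Program schemes -/

/-- Store in the register `50` a row `a < μ` that satisfies the test `t` for the value `a` of the
register `40`; the cell `(34, 0, 0)` tells whether there is one. -/
def probe (t : Test) : Cmd :=
  .seq (search 34 (.const 0) (.const 0) 40 rows t)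
    (.setNat 50 (.const 0) (.const 0) (.sub (reg 34) (.const 1)))

/-- Search a row that satisfies the test `t`; do `p` if there is one and `q` otherwise. -/
def attempt (t : Test) (p q : Cmd) : Cmd :=
  .seq (probe t) (.ite (.natEq (reg 34) (.const 0)) q p)

/-- Do `p s t` for all values `a < μ` and `b < ν` of the registers `40`, `41` and all `s`, `t`. -/
def scan (p : Bool → Bool → Cmd) : Cmd :=
  .loop 40 rows (.loop 41 cols (both fun s => both fun t => p s t))

/-- Do `p s` for all values `i < e` of the register `40` and all `s`. -/
def each (e : NExp) (p : Bool → Cmd) : Cmd := .loop 40 e (both p)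

section

variable {F : Type u} [Field F] {μ ν : ℕ} {m : Mem F}

lemma probe_aux (t : Test) : (probe t).Aux := by
  simp [probe, search, Cmd.Aux, Cmd.natW, Cmd.fldW, Cmd.realW]

/-- `attempt` does `p` with a row that satisfies the test in the register `50`, or `q` if there is none. -/
lemma attempt_spec {t : Test} {p q : Cmd} {φ : Fin μ → Prop} (Q : Mem F → Prop)
    (hr : m.nat 0 0 0 = μ)
    (ht : ∀ m', Frame (probe t) m m' → ∀ a : Fin μ, m'.nat 40 0 0 = a → (t.Holds m' ↔ φ a))
    (hp : ∀ m', Frame (probe t) m m' → ∀ a : Fin μ, φ a → m'.nat 50 0 0 = a → Q (p.exec m'))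
    (hq : ∀ m', Frame (probe t) m m' → (∀ a, ¬ φ a) → Q (q.exec m')) :
    Q ((attempt t p q).exec m) := by
  unfold attempt
  rw [Cmd.exec_seq]
  have hf := (probe t).frame m
  obtain ⟨h1, -⟩ := search_spec (m := m) (x := 34) (v := 40) (i := .const 0) (j := .const 0)
    (e := rows) (t := t) (i0 := 0) (j0 := 0) (n := μ)
    (φ := fun k => ∃ h : k < μ, φ ⟨k, h⟩) (by decide) (fun _ _ => rfl) (fun _ _ => rfl)
    (fun m' h' => by
      rw [rows, NExp.eval, h'.nat 0 (by simp [search, Cmd.natW])]; exact hr)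
    (fun m' h' k hk hk' => by
      rw [ht m' h'.left ⟨k, hk⟩ hk']
      exact ⟨fun h => ⟨hk, h⟩, fun ⟨_, h⟩ => h⟩)
  have e34 : ((probe t).exec m).nat 34 0 0 =
      ((search 34 (.const 0) (.const 0) 40 rows t).exec m).nat 34 0 0 := by
    rw [probe, Cmd.exec_seq, Cmd.exec_setNat, Mem.put_ne _ (by decide)]
  have e50 : ((probe t).exec m).nat 50 0 0 =
      ((search 34 (.const 0) (.const 0) 40 rows t).exec m).nat 34 0 0 - 1 := by
    rw [probe, Cmd.exec_seq, Cmd.exec_setNat]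
    simp [Mem.put_nat, NExp.eval, reg]
  rcases h1 with ⟨h1, h2⟩ | ⟨k, hk, ⟨_, h2⟩, h3⟩
  · rw [Cmd.exec_ite_pos (by simp only [Test.Holds, NExp.eval, eval_reg, e34, h1])]
    exact hq _ hf fun a ha => h2 a a.2 ⟨a.2, ha⟩
  · rw [Cmd.exec_ite_neg (by simp only [Test.Holds, NExp.eval, eval_reg, e34, h3]; omega)]
    exact hp _ hf ⟨k, hk⟩ h2 (by rw [e50, h3]; rfl)

/-- The rule for loops over all pairs of vertices: `Inv A` holds when the pairs in `A` are done. -/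
lemma exec_scan {p : Bool → Bool → Cmd} (Inv : Set (Fin μ × Fin ν × Bool × Bool) → Mem F → Prop)
    (hr : m.nat 0 0 0 = μ) (hc : m.nat 0 0 1 = ν) (h0 : Inv ∅ m)
    (hw : ∀ x ∈ [0, 40, 41], x ∉ (p true true).natW ++ (p true false).natW ++
      ((p false true).natW ++ (p false false).natW))
    (hput : ∀ A m' i x, x = 40 ∨ x = 41 → Inv A m' → Inv A (m'.put x 0 0 i))
    (hs : ∀ A m' (a : Fin μ) (b : Fin ν) (s t : Bool), Frame (scan p) m m' → m'.nat 40 0 0 = a →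
      m'.nat 41 0 0 = b → Inv A m' → Inv (insert (a, b, s, t) A) ((p s t).exec m')) :
    Inv Set.univ ((scan p).exec m) := by
  have hw' : ∀ x ∈ [0, 40, 41], ∀ s t, x ∉ (p s t).natW := by
    intro x hx s t
    have := hw x hx
    simp only [List.mem_append, not_or] at this
    cases s <;> cases t <;> tauto
  have key := Cmd.exec_loop (m := m) (x := 40) (e := rows) (n := μ)
    (p := .loop 41 cols (both fun s => both fun t => p s t))
    (fun i m' => Inv {q | (q.1 : ℕ) < i} m') (by rw [rows, NExp.eval]; exact hr)
    (by simpa using h0) ?_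
  · simpa [scan] using key
  intro i m' hi hf h1
  have hf1 := hf.loopVar i
  have h1' := hput _ _ i 40 (Or.inl rfl) h1
  have hc' : cols.eval (m'.put 40 0 0 i) = ν := by
    rw [cols, NExp.eval, hf1.nat 0 (by simp [Cmd.natW, both, hw' 0 (by simp)])]
    exact hc
  have h40 : (m'.put 40 0 0 i).nat 40 0 0 = i := Mem.put_same _ _ _ _ _
  generalize m'.put 40 0 0 i = m1 at *
  have key := Cmd.exec_loop (m := m1) (x := 41) (e := cols) (n := ν)
    (p := both fun s => both fun t => p s t)
    (fun j m' => Inv {q | (q.1 : ℕ) < i ∨ (q.1 : ℕ) = i ∧ (q.2.1 : ℕ) < j} m') hc'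
    (by simpa using h1') ?_
  · have : {q : Fin μ × Fin ν × Bool × Bool | (q.1 : ℕ) < i + 1} =
        {q | (q.1 : ℕ) < i ∨ (q.1 : ℕ) = i ∧ (q.2.1 : ℕ) < ν} := by
      ext q
      simp only [Set.mem_ofPred_eq, Fin.is_lt, and_true, Nat.lt_succ_iff_lt_or_eq]
    rw [this]
    exact key
  intro j m2 hj hf2 h2
  have hf3 := hf2.loopVar j
  have h2' := hput _ _ j 41 (Or.inr rfl) h2
  have e40 : (m2.put 41 0 0 j).nat 40 0 0 = i := by
    rw [hf3.nat 40 (by simp [Cmd.natW, both, hw' 40 (by simp)]), h40]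
  have e41 : (m2.put 41 0 0 j).nat 41 0 0 = j := Mem.put_same _ _ _ _ _
  generalize m2.put 41 0 0 j = m3 at *
  have key := exec_both (f := fun s => both fun t => p s t) (m := m3)
    (fun A m' => Inv {q | (q.1 : ℕ) < i ∨ (q.1 : ℕ) = i ∧ ((q.2.1 : ℕ) < j ∨
      (q.2.1 : ℕ) = j ∧ A q.2.2.1)} m') (by simpa using h2') ?_
  · have : {q : Fin μ × Fin ν × Bool × Bool | (q.1 : ℕ) < i ∨ (q.1 : ℕ) = i ∧ (q.2.1 : ℕ) < j + 1} =
        {q | (q.1 : ℕ) < i ∨ (q.1 : ℕ) = i ∧ ((q.2.1 : ℕ) < j ∨ (q.2.1 : ℕ) = j ∧ True)} := by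
      ext q
      simp only [Set.mem_ofPred_eq, Fin.is_lt, and_true, Nat.lt_succ_iff_lt_or_eq]
    rw [this]
    exact key
  intro s A m4 hA hf4 h4
  have key := exec_both (f := fun t => p s t) (m := m4)
    (fun B m' => Inv {q | (q.1 : ℕ) < i ∨ (q.1 : ℕ) = i ∧ ((q.2.1 : ℕ) < j ∨
      (q.2.1 : ℕ) = j ∧ (A q.2.2.1 ∨ q.2.2.1 = s ∧ B q.2.2.2))} m') (by simpa using h4) ?_
  · have : {q : Fin μ × Fin ν × Bool × Bool | (q.1 : ℕ) < i ∨ (q.1 : ℕ) = i ∧ ((q.2.1 : ℕ) < j ∨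
          (q.2.1 : ℕ) = j ∧ (q.2.2.1 = s ∨ A q.2.2.1))} =
        {q | (q.1 : ℕ) < i ∨ (q.1 : ℕ) = i ∧ ((q.2.1 : ℕ) < j ∨
      (q.2.1 : ℕ) = j ∧ (A q.2.2.1 ∨ q.2.2.1 = s ∧ True))} := by
      ext q
      simp [or_comm]
    rw [this]
    exact key
  intro t B m5 hB hf5 h5
  have hf6 : Frame (both fun s => both fun t => p s t) m3 m5 := by
    refine hf4.trans ?_
    cases s
    · exact hf5.right
    · exact hf5.left
  have hf7 : Frame (scan p) m m5 := hf1.trans (hf3.trans hf6.body).body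
  have h40' : m5.nat 40 0 0 = i := by
    rw [hf6.nat 40 (by simp [Cmd.natW, both, hw' 40 (by simp)]), e40]
  have h41' : m5.nat 41 0 0 = j := by
    rw [hf6.nat 41 (by simp [Cmd.natW, both, hw' 41 (by simp)]), e41]
  have := hs _ m5 ⟨i, hi⟩ ⟨j, hj⟩ s t hf7 h40' h41' h5
  convert this using 1
  ext ⟨a, b, s', t'⟩
  simp only [Set.mem_ofPred_eq, Set.mem_insert_iff, Prod.mk.injEq, Fin.ext_iff]
  tauto

/-- The rule for loops over all vertices of a side: `Inv A` holds when the vertices in `A` are done. -/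
lemma exec_each {e : NExp} {p : Bool → Cmd} {n : ℕ} (Inv : Set (Fin n × Bool) → Mem F → Prop)
    (hn : e.eval m = n) (h0 : Inv ∅ m) (hw : 40 ∉ (p true).natW ++ (p false).natW)
    (hput : ∀ A m' i, Inv A m' → Inv A (m'.put 40 0 0 i))
    (hs : ∀ A m' (a : Fin n) (s : Bool), (a, s) ∉ A → Frame (each e p) m m' → m'.nat 40 0 0 = a →
      Inv A m' → Inv (insert (a, s) A) ((p s).exec m')) :
    Inv Set.univ ((each e p).exec m) := by
  have key := Cmd.exec_loop (m := m) (x := 40) (e := e) (n := n) (p := both p)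
    (fun i m' => Inv {q | (q.1 : ℕ) < i} m') hn (by simpa using h0) ?_
  · simpa [each] using key
  intro i m' hi hf h1
  have hf1 := hf.loopVar i
  have h1' := hput _ _ i h1
  have h40 : (m'.put 40 0 0 i).nat 40 0 0 = i := Mem.put_same _ _ _ _ _
  generalize m'.put 40 0 0 i = m1 at *
  have key := exec_both (f := p) (m := m1)
    (fun A m' => Inv {q | (q.1 : ℕ) < i ∨ (q.1 : ℕ) = i ∧ A q.2} m') (by simpa using h1') ?_
  · have : {q : Fin n × Bool | (q.1 : ℕ) < i + 1} =
        {q | (q.1 : ℕ) < i ∨ (q.1 : ℕ) = i ∧ True} := by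
      ext q
      simp only [Set.mem_ofPred_eq, Fin.is_lt, and_true, Nat.lt_succ_iff_lt_or_eq]
    rw [this]
    exact key
  intro s A m2 hA hf2 h2
  have h40' : m2.nat 40 0 0 = i := by
    rw [hf2.nat 40 (by simpa [Cmd.natW, both] using hw), h40]
  have := hs _ m2 ⟨i, hi⟩ s ?_ (hf1.trans hf2.body) h40' h2
  · convert this using 1
    ext ⟨a, s'⟩
    simp only [Set.mem_ofPred_eq, Set.mem_insert_iff, Prod.mk.injEq, Fin.ext_iff]
    tauto
  · simp only [Set.mem_ofPred_eq, lt_irrefl, true_and, false_or]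
    exact fun h => hA s h rfl

end

/-! ### Programs for primal updates -/

/-- Add the vertices `a^t` and `b^t` to the forest, where `a` and `b` are given by the registers
`50` and `52`, and join them. -/
def plant (t : Bool) : Cmd :=
  .seq (.setNat 5 (reg 50) (.const t.toNat) (.const 1))
  (.seq (.setNat 6 (reg 52) (.const t.toNat) (.const 1))
    (.setNat (7 + 2 * t.toNat + t.toNat) (reg 50) (reg 52) (.const 1)))

/-- Join the vertices `a^t` and `b^s`, where `a` and `b` are given by the registers `50`, `51`. -/
def graft (s t : Bool) : Cmd :=
  .setNat (7 + 2 * t.toNat + s.toNat) (reg 50) (reg 51) (.const 1)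

/-- Replace `U_a^{!t}` and `V_b'^t`; here `a`, `b`, `b'` are given by the registers `50`, `51`,
`52`. -/
def relabelSpaces (s t : Bool) : Cmd :=
  .seq (.setFld 4 (reg 50) (.const (!t).toNat)
    (.add (.mul (.get 2 (reg 50) (reg 51)) (.get 6 (reg 51) (.const s.toNat)))
      (.mul (.get 3 (reg 50) (reg 51)) (.get 7 (reg 51) (.const s.toNat)))))
  (.seq (.setFld 5 (reg 50) (.const (!t).toNat)
    (.sub .zero (.add (.mul (.get 0 (reg 50) (reg 51)) (.get 6 (reg 51) (.const s.toNat)))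
      (.mul (.get 1 (reg 50) (reg 51)) (.get 7 (reg 51) (.const s.toNat))))))
  (.seq (.setFld 6 (reg 52) (.const t.toNat)
    (.add (.mul (.get 4 (reg 50) (.const (!t).toNat)) (.get 1 (reg 50) (reg 52)))
      (.mul (.get 5 (reg 50) (.const (!t).toNat)) (.get 3 (reg 50) (reg 52)))))
  (.setFld 7 (reg 52) (.const t.toNat)
    (.sub .zero (.add (.mul (.get 4 (reg 50) (.const (!t).toNat)) (.get 0 (reg 50) (reg 52)))
      (.mul (.get 5 (reg 50) (.const (!t).toNat)) (.get 2 (reg 50) (reg 52))))))))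

/-- Extend an inner path, whose last vertex is given by the register `52`, by two vertices. -/
def extendStep (t : Bool) : Cmd :=
  .ite (.and (.not (.natEq (.get 23 (reg 52) (.const t.toNat)) (.const 0)))
      (.not (.natEq (.get 5 (.sub (.get 23 (reg 52) (.const t.toNat)) (.const 1))
        (.const t.toNat)) (.const 1))))
    (.seq (.setNat 50 (.const 0) (.const 0) (.sub (.get 23 (reg 52) (.const t.toNat)) (.const 1)))
    (.seq (.setNat (7 + 2 * t.toNat + t.toNat) (reg 50) (reg 52) (.const 1))
    (.seq (.setNat 52 (.const 0) (.const 0) (.sub (.get 20 (reg 50) (.const t.toNat)) (.const 1)))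
      (plant t))))
    (.setNat 53 (.const 0) (.const 0) (.const 0))

/-- Add a longest inner path to the forest. -/
def addInner (s t : Bool) : Cmd :=
  .seq (graft s t) (.seq (plant t) (.seq (.setNat 53 (.const 0) (.const 0) (.const 1))
    (.loop 42 rows (.ite (.natEq (reg 53) (.const 1)) (extendStep t) .skip))))

/-- The primal update with the edge between `b^s` and `a^t`, where `a` is given by the register
`50` and `b` by the table of edges that leave the forest. -/
def primal (s t : Bool) : Cmd :=
  .seq (.setNat 51 (.const 0) (.const 0)
    (.sub (.get (32 + s.toNat) (reg 50) (.const t.toNat)) (.const 1)))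
  (.ite (.natEq (.get 28 (reg 50) (.const t.toNat)) (.const 1))
    (.seq (leavingPath s t) (finish 1))
    (.seq (.setNat 52 (.const 0) (.const 0)
      (.sub (.get 20 (reg 50) (.const t.toNat)) (.const 1)))
    (.ite (.natEq (.get 1 (reg 50) (reg 52)) (.const 2))
      (.seq (relabelSpaces s t) (.seq (graft s t) (plant t)))
      (addInner s t))))

section

variable {F : Type u} [Field F] {μ ν : ℕ} {P : PartMatrix F μ ν} {k : ℕ} {m : Mem F}
  {S : State F μ ν} {x : Conf F μ ν}

lemma StoresState.put_aux (h : StoresState m S) {x : ℕ} (hx : 11 ≤ x) (i j y : ℕ) :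
    StoresState (m.put x i j y) S :=
  h.congr (fun i' hi' _ => Mem.put_ne _ (by omega) _ _ _) (fun _ _ => rfl) fun _ _ => rfl

lemma StoresState.put_row (h : StoresState m S) (a : Fin μ) (t : Bool) :
    StoresState (m.put 5 a t.toNat 1) ⟨S.x, insert (.row a t) S.nodes, S.edges⟩ where
  running := by rw [Mem.put_ne _ (by decide)]; exact h.running
  conf := h.conf.congr (fun i hi _ => Mem.put_ne _ (by omega) _ _ _) (fun _ _ => rfl)
    fun _ _ => rfl
  row_node a' s := by
    rw [Mem.put_nat, Set.mem_insert_iff, ← h.row_node]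
    simp only [true_and, Fin.val_inj, toNat_inj, Vertex.row.injEq]
    split_ifs with hc <;> simp [hc]
  col_node b s := by
    rw [Mem.put_ne _ (by decide), Set.mem_insert_iff, ← h.col_node]
    simp
  edge a' s b t' := by
    rw [Mem.put_ne _ (by omega)]; exact h.edge a' s b t'

lemma StoresState.put_col (h : StoresState m S) (b : Fin ν) (t : Bool) :
    StoresState (m.put 6 b t.toNat 1) ⟨S.x, insert (.col b t) S.nodes, S.edges⟩ where
  running := by rw [Mem.put_ne _ (by decide)]; exact h.running
  conf := h.conf.congr (fun i hi _ => Mem.put_ne _ (by omega) _ _ _) (fun _ _ => rfl)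
    fun _ _ => rfl
  row_node a s := by
    rw [Mem.put_ne _ (by decide), Set.mem_insert_iff, ← h.row_node]
    simp
  col_node b' s := by
    rw [Mem.put_nat, Set.mem_insert_iff, ← h.col_node]
    simp only [true_and, Fin.val_inj, toNat_inj, Vertex.col.injEq]
    split_ifs with hc <;> simp [hc]
  edge a' s b t' := by
    rw [Mem.put_ne _ (by omega)]; exact h.edge a' s b t'

lemma StoresState.put_edge (h : StoresState m S) (a : Fin μ) (t : Bool) (b : Fin ν) (s : Bool) :
    StoresState (m.put (7 + 2 * t.toNat + s.toNat) a b 1)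
      ⟨S.x, S.nodes, insert s(.row a t, .col b s) S.edges⟩ where
  running := by rw [Mem.put_ne _ (by omega)]; exact h.running
  conf := h.conf.congr (fun i hi _ => Mem.put_ne _ (by omega) _ _ _) (fun _ _ => rfl)
    fun _ _ => rfl
  row_node a' s' := by rw [Mem.put_ne _ (by omega)]; exact h.row_node a' s'
  col_node b' s' := by rw [Mem.put_ne _ (by omega)]; exact h.col_node b' s'
  edge a' t' b' s' := by
    rw [Mem.put_nat, Set.mem_insert_iff, ← h.edge]
    have : (7 + 2 * t'.toNat + s'.toNat = 7 + 2 * t.toNat + s.toNat) ↔ t' = t ∧ s' = s := by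
      cases s <;> cases t <;> cases s' <;> cases t' <;> decide
    simp only [this, Fin.val_inj, Sym2.eq_iff, Vertex.row.injEq, Vertex.col.injEq, reduceCtorEq,
      false_and, or_false]
    split_ifs with hc
    · simp [hc]
    · have : ¬ ((a' = a ∧ t' = t) ∧ b' = b ∧ s' = s) := by tauto
      simp [this]

lemma graft_spec (h : StoresState m S) {a : Fin μ} {b : Fin ν} {s t : Bool}
    (h50 : m.nat 50 0 0 = a) (h51 : m.nat 51 0 0 = b) :
    StoresState ((graft s t).exec m) ⟨S.x, S.nodes, insert s(.row a t, .col b s) S.edges⟩ := by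
  rw [graft, Cmd.exec_setNat]
  simp only [NExp.eval, eval_reg, h50, h51]
  exact h.put_edge a t b s

lemma plant_spec (h : StoresState m S) {a : Fin μ} {b : Fin ν} {t : Bool}
    (h50 : m.nat 50 0 0 = a) (h52 : m.nat 52 0 0 = b) :
    StoresState ((plant t).exec m) ⟨S.x, insert (.col b t) (insert (.row a t) S.nodes),
      insert s(.row a t, .col b t) S.edges⟩ := by
  rw [plant, Cmd.exec_seq, Cmd.exec_seq, Cmd.exec_setNat, Cmd.exec_setNat, Cmd.exec_setNat]
  simp only [NExp.eval, eval_reg, h50, h52, Mem.put_ne _ (show 52 ≠ 5 by decide),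
    Mem.put_ne _ (show 52 ≠ 6 by decide), Mem.put_ne _ (show 50 ≠ 5 by decide),
    Mem.put_ne _ (show 50 ≠ 6 by decide)]
  exact ((h.put_row a t).put_col b t).put_edge a t b t

/-- The memory after an assignment to a cell of an array of field elements. -/
def Mem.putFld (m : Mem F) (x i j : ℕ) (y : F) : Mem F := { m with fld := setCell m.fld x i j y }

lemma Mem.putFld_fld (m : Mem F) (x i j : ℕ) (y : F) (x' i' j' : ℕ) :
    (m.putFld x i j y).fld x' i' j' =
      if x' = x ∧ i' = i ∧ j' = j then y else m.fld x' i' j' := rfl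

lemma Cmd.exec_setFld (x : ℕ) (i j : NExp) (e : FExp) (m : Mem F) :
    (Cmd.setFld x i j e).exec m = m.putFld x (i.eval m) (j.eval m) (e.eval m) := rfl

lemma relabelSpaces_spec (hP : StoresMatrix m P) (hx : StoresState m S) (h : Searching P k S)
    {b : Fin ν} {s : Bool} {a : Fin μ} {t : Bool} {b' : Fin ν} (hl : Leaves P S b s a t)
    (hI : (a, b') ∈ S.x.I) {L' : Labeling F μ ν} (hr : IsRelabeling P S.x.L L' b s a t b')
    (h50 : m.nat 50 0 0 = a) (h51 : m.nat 51 0 0 = b) (h52 : m.nat 52 0 0 = b') :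
    StoresState ((relabelSpaces s t).exec m) (S.relabel L') := by
  have hn : ((relabelSpaces s t).exec m).nat = m.nat := rfl
  have hre : ((relabelSpaces s t).exec m).real = m.real := rfl
  -- the vectors that span the new spaces
  let v : Fin 2 → F := ![m.fld 6 b s.toNat, m.fld 7 b s.toNat]
  let w := (P.A a b).mulVec v
  let u : Fin 2 → F := ![w 1, 0 - w 0]
  let y := (P.A a b').vecMul u
  have hw0 : w 0 = m.fld 0 a b * m.fld 6 b s.toNat + m.fld 1 a b * m.fld 7 b s.toNat := by
    simp [w, v, hP.block]
  have hw1 : w 1 = m.fld 2 a b * m.fld 6 b s.toNat + m.fld 3 a b * m.fld 7 b s.toNat := by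
    simp [w, v, hP.block]
  have hy0 : y 0 = w 1 * m.fld 0 a b' + (0 - w 0) * m.fld 2 a b' := by
    simp [y, u, hP.block]
  have hy1 : y 1 = w 1 * m.fld 1 a b' + (0 - w 0) * m.fld 3 a b' := by
    simp [y, u, hP.block]
  have hfld : ∀ i, ((relabelSpaces s t).exec m).fld i = fun (j l : ℕ) =>
      if i = 7 ∧ j = b' ∧ l = t.toNat then 0 - y 0 else
      if i = 6 ∧ j = b' ∧ l = t.toNat then y 1 else
      if i = 5 ∧ j = a ∧ l = (!t).toNat then 0 - w 0 else
      if i = 4 ∧ j = a ∧ l = (!t).toNat then w 1 else m.fld i j l := by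
    intro i
    funext j l
    simp only [relabelSpaces, Cmd.exec_seq, Cmd.exec_setFld, Mem.putFld_fld, NExp.eval, FExp.eval,
      eval_reg, h50, h51, hy0, hy1, hw0, hw1]
    simp only [Mem.putFld, h50, h51, h52]
    simp
  have hv : (S.x.L.V b s).1 = Submodule.span F {v} := hx.conf.col_space b s
  have hwne : w ≠ 0 := by
    have ho := hl.1.1
    rw [hx.conf.row_space, hv, orth_span_iff] at ho
    exact mulVec_ne_zero_of_bil ho
  have hU : (L'.U a (!t)).1 = Submodule.span F {u} := by
    ext z
    rw [hr.row_new, hv, mem_perp_left hwne]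
  have hyne : y ≠ 0 := by
    have ho := (h.relabel_opt hl hI hr).not_orth_I hI (!t)
    change ¬ Orth (P.A a b') (L'.U a (!t)) (L'.V b' (!t)) at ho
    rw [hr.V_eq, hU, hx.conf.col_space, orth_span_iff] at ho
    exact vecMul_ne_zero_of_bil ho
  have hV : (L'.V b' t).1 = Submodule.span F {![y 1, 0 - y 0]} := by
    ext z
    rw [hr.col_new, hU, mem_perp_right hyne]
  refine ⟨?_, ⟨?_, ?_, ?_, ?_, ?_, ?_, ?_⟩, ?_, ?_, ?_⟩
  · rw [hn]; exact hx.running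
  · rw [hn]; exact hx.conf.edge
  · rw [hn]; exact hx.conf.sign
  · intro a1 s1
    change (L'.U a1 s1).1 = _
    rw [hfld, hfld]
    by_cases hc : (a1, s1) = (a, !t)
    · cases hc
      simpa [u] using hU
    · have hc' : ¬ ((a1 : ℕ) = a ∧ s1.toNat = (!t).toNat) := by
        rwa [Fin.val_inj, toNat_inj, ← Prod.mk.injEq]
      rw [hr.row_old _ _ hc, hx.conf.row_space]
      simp [hc']
  · intro b1 s1
    change (L'.V b1 s1).1 = _
    rw [hfld, hfld]
    by_cases hc : (b1, s1) = (b', t)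
    · cases hc
      simpa using hV
    · have hc' : ¬ ((b1 : ℕ) = b' ∧ s1.toNat = t.toNat) := by
        rwa [Fin.val_inj, toNat_inj, ← Prod.mk.injEq]
      rw [hr.col_old _ _ hc, hx.conf.col_space]
      simp [hc']
  · intro a1 s1
    rw [hre, hx.conf.row_value]
    exact (h.relabel_row hl hr a1 s1).symm
  · intro b1 s1
    rw [hre, hx.conf.col_value]
    exact (h.relabel_col hl hI hr b1 s1).symm
  · rw [hre]; exact hx.conf.shift
  · rw [hn]; exact hx.row_node
  · rw [hn]; exact hx.col_node
  · rw [hn]; exact hx.edge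

end

/-! ### Correctness of primal updates -/

section

variable {F : Type u} [Field F] {μ ν : ℕ} {P : PartMatrix F μ ν} {k : ℕ} {m : Mem F}
  {S : State F μ ν} {x : Conf F μ ν}

lemma pathEdges_concat : ∀ {Q : List (Vertex μ ν)} {v w : Vertex μ ν}, Q.getLast? = some v →
    pathEdges (Q ++ [w]) = insert s(v, w) (pathEdges Q)
  | [], _, _, h => by simp at h
  | [u], v, w, h => by
    simp only [List.getLast?_singleton, Option.some.injEq] at h
    subst h
    rw [List.singleton_append, pathEdges_cons_cons, pathEdges_singleton, pathEdges_singleton]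
    simp
  | u :: u' :: Q, v, w, h => by
    have ih := pathEdges_concat (Q := u' :: Q) (v := v) (w := w) (by simpa using h)
    rw [List.cons_append, List.cons_append, pathEdges_cons_cons, ← List.cons_append, ih,
      pathEdges_cons_cons]
    ext z
    simp only [Set.mem_union, Set.mem_insert_iff, Set.mem_singleton_iff]
    tauto

/-- An inner path can be prolonged by a link and the edge to the mate. -/
lemma InnerSeq.concat {t : Bool} {Q : List (Vertex μ ν)} (hQ : InnerSeq P x t Q) {b b' : Fin ν}
    {a : Fin μ} (hb : Q.getLast? = some (.col b t)) (hl : Link P x a b t)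
    (hm : (a, b') ∈ x.M \ x.I) (hs : x.sgn a b' = !t) (ht : TightEdge P x a t b' t) :
    InnerSeq P x t (Q ++ [.row a t, .col b' t]) := by
  have hab : (a, b) ∈ x.M \ x.I := Finset.mem_sdiff.2 ⟨hl.1, hl.2.1⟩
  induction hQ with
  | last a0 b0 h1 h2 h3 =>
    simp only [List.getLast?_cons_cons, List.getLast?_singleton, Option.some.injEq,
      Vertex.col.injEq, and_true] at hb
    subst hb
    exact .cons a0 b0 a _ h1 h2 h3 hab hl.2.2.1 hl.2.2.2 (.last a b' hm hs ht)
  | cons a0 b0 a1 R h1 h2 h3 h4 h5 h6 _ ih =>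
    exact .cons a0 b0 a1 _ h1 h2 h3 h4 h5 h6 (ih (by simpa using hb))

/-- The state after an inner path, joined to the forest, has been added. -/
def extended (S : State F μ ν) (b : Fin ν) (s : Bool) (a : Fin μ) (t : Bool)
    (Q : List (Vertex μ ν)) : State F μ ν :=
  ⟨S.x, S.nodes ∪ {z | z ∈ Q}, S.edges ∪ {s(.col b s, .row a t)} ∪ pathEdges Q⟩

/-- The invariant of the construction of a longest inner path: `Q` is the path found so far. -/
structure Extending (P : PartMatrix F μ ν) (S : State F μ ν) (b : Fin ν) (s : Bool) (a : Fin μ)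
    (t : Bool) (i : ℕ) (m : Mem F) (Q : List (Vertex μ ν)) : Prop where
  state : StoresState m (extended S b s a t Q)
  tables : Table (m.nat 20) (fun (a : Fin μ) s (b : Fin ν) => Mate S.x a b s) ∧
    Table (m.nat 23) fun (b : Fin ν) s (a : Fin μ) => Link P S.x a b s
  inner : InnerSeq P S.x t Q
  nodup : Q.Nodup
  head : Q.head? = some (.row a t)
  avoid : ∀ z ∈ Q, z ∉ S.nodes
  mate : ∀ {a' b'}, Mate S.x a' b' t → (Vertex.row a' t ∈ Q ↔ Vertex.col b' t ∈ Q)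
  last : (m.nat 53 0 0 = 1 ∧ ∃ b', Q.getLast? = some (.col b' t) ∧ m.nat 52 0 0 = b' ∧
      Vertex.col b' t ∉ target P S.x ∧
      ∃ A : List (Fin μ), A.Nodup ∧ A.length = i + 1 ∧ ∀ a' ∈ A, Vertex.row a' t ∈ Q) ∨
    (m.nat 53 0 0 = 0 ∧ ∀ b', Q.getLast? = some (.col b' t) → ∀ a', Link P S.x a' b' t →
      Vertex.row a' t ∈ S.nodes ∨ Vertex.row a' t ∈ Q)

variable {b : Fin ν} {s : Bool} {a : Fin μ} {t : Bool} {Q : List (Vertex μ ν)} {i : ℕ}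

lemma Extending.put (h : Extending P S b s a t i m Q) (j : ℕ) :
    Extending P S b s a t i (m.put 42 0 0 j) Q := by
  refine ⟨h.state.put_aux (by decide) _ _ _, ?_, h.inner, h.nodup, h.head, h.avoid, h.mate, ?_⟩
  · rw [Mem.put_ne _ (by decide), Mem.put_ne _ (by decide)]; exact h.tables
  · rw [Mem.put_ne _ (by decide), Mem.put_ne _ (by decide)]; exact h.last

/-- One round extends the inner path by a link and a mate, or finds that it cannot be extended. -/
lemma extendStep_spec (h : Searching P k S) (hE : Extending P S b s a t i m Q)
    (h53 : m.nat 53 0 0 = 1) : ∃ Q', Extending P S b s a t (i + 1) ((extendStep t).exec m) Q' := by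
  obtain ⟨hS, ⟨h20, h23⟩, hin, hnd, hhd, hav, hmt, hlast⟩ := hE
  obtain ⟨-, b', hb', h52, hbT, A, hA, hlen, hAQ⟩ := hlast.resolve_right (by omega)
  have hbQ : Vertex.col b' t ∈ Q := List.mem_of_getLast? hb'
  by_cases hc : ∃ a', Link P S.x a' b' t ∧ Vertex.row a' t ∉ S.nodes ∧ Vertex.row a' t ∉ Q
  · obtain ⟨a', hl, hn, hq⟩ := hc
    obtain ⟨b'', hm⟩ : ∃ b'', Mate S.x a' b'' t := by
      by_contra hno
      push Not at hno
      exact hbT ((h.opt.target_tstep (.link hl)).1 (h.opt.unmatched_mem_target hno))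
    have e23 : m.nat 23 b' t.toNat = a' + 1 := by
      rcases h23 b' t with ⟨-, hno⟩ | ⟨a1, h1, h2⟩
      · exact absurd hl (hno a')
      · rw [h1, h.opt.link_col h2 hl]
    have e20 : m.nat 20 a' t.toNat = b'' + 1 := by
      rcases h20 a' t with ⟨-, hno⟩ | ⟨a1, h1, h2⟩
      · exact absurd hm (hno b'')
      · rw [h1, h.opt.mate_row h2 hm]
    have hnot5 : m.nat 5 a' t.toNat ≠ 1 := by
      rw [Ne, hS.row_node]
      exact fun hmem => hmem.elim hn hq
    have hmI : (a', b'') ∉ S.x.I := fun hI =>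
      hl.2.1 (h.opt.isolated_row hI hl.1 ▸ hI)
    have hq' : Vertex.col b'' t ∉ Q := fun hmem => hq ((hmt hm).2 hmem)
    have hn' : Vertex.col b'' t ∉ S.nodes := fun hmem => hn ((h.mate hm).2 hmem)
    refine ⟨Q ++ [.row a' t, .col b'' t], ?_, ?_, ?_, ?_, ?_, ?_, ?_, ?_⟩
    · unfold extendStep
      rw [Cmd.exec_ite_pos (by
        simp only [Test.Holds, NExp.eval, eval_reg, h52, e23]
        exact ⟨by omega, hnot5⟩), Cmd.exec_seq, Cmd.exec_setNat]
      simp only [NExp.eval, eval_reg, h52, e23, Nat.add_sub_cancel]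
      have hS1 := hS.put_aux (x := 50) (by decide) 0 0 a'
      have e50 : (m.put 50 0 0 a').nat 50 0 0 = a' := Mem.put_same _ _ _ _ _
      have e52 : (m.put 50 0 0 a').nat 52 0 0 = b' := by rw [Mem.put_ne _ (by decide), h52]
      have f20 : (m.put 50 0 0 a').nat 20 = m.nat 20 := Mem.put_ne _ (by decide) _ _ _
      generalize m.put 50 0 0 a' = m1 at *
      rw [Cmd.exec_seq, Cmd.exec_setNat]
      simp only [NExp.eval, eval_reg, e50, e52]
      have hS2 := hS1.put_edge a' t b' t
      have g50 : (m1.put (7 + 2 * t.toNat + t.toNat) a' b' 1).nat 50 0 0 = a' := by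
        rw [Mem.put_ne _ (by cases t <;> decide), e50]
      have g20 : (m1.put (7 + 2 * t.toNat + t.toNat) a' b' 1).nat 20 = m.nat 20 := by
        rw [Mem.put_ne _ (by cases t <;> decide), f20]
      generalize m1.put (7 + 2 * t.toNat + t.toNat) a' b' 1 = m2 at *
      rw [Cmd.exec_seq, Cmd.exec_setNat]
      simp only [NExp.eval, eval_reg, g50, g20, e20, Nat.add_sub_cancel]
      have hS3 := plant_spec (b := b'') (t := t) (a := a') (hS2.put_aux (x := 52) (by decide) 0 0 b'')
        (by rw [Mem.put_ne _ (by decide), g50]) (Mem.put_same _ _ _ _ _)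
      convert hS3 using 1
      simp only [extended, State.mk.injEq, true_and]
      constructor
      · ext z
        simp only [Set.mem_union, Set.mem_insert_iff, Set.mem_ofPred_eq, List.mem_append,
          List.mem_cons, List.not_mem_nil, or_false]
        tauto
      · rw [show Q ++ [Vertex.row a' t, .col b'' t] = (Q ++ [.row a' t]) ++ [.col b'' t] by simp,
          pathEdges_concat (v := .row a' t) (by simp), pathEdges_concat hb',
          Sym2.eq_swap (a := Vertex.col b' t)]
        ext z
        simp only [Set.mem_union, Set.mem_insert_iff, Set.mem_singleton_iff]
        tauto
    · have hfr := (extendStep t).frame m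
      rw [hfr.nat 20 (by cases t <;> decide), hfr.nat 23 (by cases t <;> decide)]
      exact ⟨h20, h23⟩
    · exact hin.concat hb' hl (Finset.mem_sdiff.2 ⟨hm.1, hmI⟩) (hm.2.resolve_right hmI)
        (h.opt.mate_tight hm)
    · rw [List.nodup_append]
      refine ⟨hnd, by simp, ?_⟩
      rintro z hz w hw rfl
      simp only [List.mem_cons, List.not_mem_nil, or_false] at hw
      rcases hw with rfl | rfl
      · exact hq hz
      · exact hq' hz
    · rw [List.head?_append, hhd]; rfl
    · intro z hz
      simp only [List.mem_append, List.mem_cons, List.not_mem_nil, or_false] at hz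
      rcases hz with hz | rfl | rfl
      · exact hav z hz
      · exact hn
      · exact hn'
    · intro a1 b1 hm1
      simp only [List.mem_append, List.mem_cons, List.not_mem_nil, or_false, hmt hm1,
        Vertex.row.injEq, Vertex.col.injEq, and_true, reduceCtorEq, false_or]
      refine or_congr_right ⟨?_, ?_⟩
      · rintro rfl; exact h.opt.mate_row hm1 hm
      · rintro rfl; exact h.opt.mate_col hm1 hm
    · left
      unfold extendStep
      rw [Cmd.exec_ite_pos (by
        simp only [Test.Holds, NExp.eval, eval_reg, h52, e23]
        exact ⟨by omega, hnot5⟩)]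
      refine ⟨?_, b'', by simp, ?_, fun hT => hbT ?_, a' :: A, ?_, by simp [hlen], ?_⟩
      · rw [(Cmd.frame _ _).nat 53 (by cases t <;> decide), h53]
      · simp only [plant, Cmd.exec_seq, Cmd.exec_setNat, NExp.eval, reg]
        have h1 : ∀ i, 20 ≤ i → ¬ i = 7 + 2 * t.toNat + t.toNat := by cases t <;> simp <;> omega
        simp [Mem.put_nat, h1, h52, e23, e20]
      · exact (h.opt.target_tstep (.link hl)).1 ((h.opt.target_tstep (.mate hm)).1 hT)
      · rw [List.nodup_cons]
        exact ⟨fun hmem => hq (hAQ a' hmem), hA⟩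
      · intro a1 ha1
        rcases List.mem_cons.1 ha1 with rfl | ha1
        · simp
        · simp [hAQ a1 ha1]
  · have hend : ∀ a', Link P S.x a' b' t → Vertex.row a' t ∈ S.nodes ∨ Vertex.row a' t ∈ Q := by
      intro a' hl
      by_contra hno
      rw [not_or] at hno
      exact hc ⟨a', hl, hno⟩
    unfold extendStep
    rw [Cmd.exec_ite_neg, Cmd.exec_setNat]
    · refine ⟨Q, hS.put_aux (by decide) _ _ _, ?_, hin, hnd, hhd, hav, hmt, Or.inr ⟨?_, ?_⟩⟩
      · rw [Mem.put_ne _ (by decide), Mem.put_ne _ (by decide)]; exact ⟨h20, h23⟩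
      · exact Mem.put_same _ _ _ _ _
      · intro b1 hb1
        rw [hb'] at hb1
        simp only [Option.some.injEq, Vertex.col.injEq, and_true] at hb1
        subst hb1
        exact hend
    · simp only [Test.Holds, NExp.eval, eval_reg, h52]
      rcases h23 b' t with ⟨h1, -⟩ | ⟨a', h1, hl⟩
      · simp [h1]
      · rw [h1, Nat.add_sub_cancel, hS.row_node]
        exact fun hno => hno.2 (hend a' hl)

/-- After `μ` rounds the inner path cannot be extended, as it would pass more than `μ` rows otherwise.
This makes it a longest one, by `InnerSeq.length_le`. -/
lemma addInner_spec (hP : StoresMatrix m P) (hS : StoresState m S) (hA : Analyzed P S.x m) (h : Searching P k S)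
    (hl : Leaves P S b s a t) (hT : Vertex.row a t ∉ target P S.x) {b' : Fin ν}
    (hm : Mate S.x a b' t) (hI : (a, b') ∉ S.x.I) (h50 : m.nat 50 0 0 = a)
    (h51 : m.nat 51 0 0 = b) (h52 : m.nat 52 0 0 = b') :
    ∃ S', Step P S S' ∧ StoresState ((addInner s t).exec m) S' := by
  have hlast : ∃ Q, Extending P S b s a t μ ((addInner s t).exec m) Q := by
    unfold addInner
    rw [Cmd.exec_seq]
    have hf := (graft s t).frame m
    have hS1 := graft_spec (s := s) (t := t) hS h50 h51
    have e50 : ((graft s t).exec m).nat 50 0 0 = a := by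
      rw [hf.nat 50 (by cases s <;> cases t <;> decide), h50]
    have e52 : ((graft s t).exec m).nat 52 0 0 = b' := by
      rw [hf.nat 52 (by cases s <;> cases t <;> decide), h52]
    have hA1 := hA.frame hf (by cases s <;> cases t <;> decide)
    have e0 : ((graft s t).exec m).nat 0 0 0 = μ := by
      rw [hf.nat 0 (by cases s <;> cases t <;> decide)]; exact hP.rows
    generalize (graft s t).exec m = m1 at *
    clear hf hS hA hP
    rw [Cmd.exec_seq]
    have hf := (plant t).frame m1
    have hS2 := plant_spec (t := t) hS1 e50 e52
    have hA2 := hA1.frame hf (by cases t <;> decide)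
    have f0 : ((plant t).exec m1).nat 0 0 0 = μ := by
      rw [hf.nat 0 (by cases t <;> decide), e0]
    have f52 : ((plant t).exec m1).nat 52 0 0 = b' := by
      rw [hf.nat 52 (by cases t <;> decide), e52]
    generalize (plant t).exec m1 = m2 at *
    clear hf hS1 hA1
    rw [Cmd.exec_seq, Cmd.exec_setNat]
    simp only [NExp.eval]
    have hn' : Vertex.col b' t ∉ S.nodes := fun hmem => hl.2.2 ((h.mate hm).2 hmem)
    have key := Cmd.exec_loop (m := m2.put 53 0 0 1) (x := 42) (e := rows) (n := μ)
      (p := .ite (.natEq (reg 53) (.const 1)) (extendStep t) .skip)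
      (fun i m' => ∃ Q, Extending P S b s a t i m' Q) ?_ ?_ ?_
    · exact key
    · rw [rows, NExp.eval, Mem.put_ne _ (by decide)]; exact f0
    · refine ⟨[.row a t, .col b' t], ?_, ?_, ?_, ?_, rfl, ?_, ?_, Or.inl ⟨?_, b', ?_⟩⟩
      · convert hS2.put_aux (x := 53) (by decide) 0 0 1 using 1
        simp only [extended, State.mk.injEq, true_and]
        constructor
        · ext z
          simp only [Set.mem_union, Set.mem_insert_iff, Set.mem_ofPred_eq,
            List.mem_cons, List.not_mem_nil, or_false]
          tauto
        · rw [pathEdges_cons_cons, pathEdges_singleton, Sym2.eq_swap (a := Vertex.col b s)]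
          ext z
          simp only [Set.mem_union, Set.mem_insert_iff, Set.mem_singleton_iff,
            Set.mem_empty_iff_false]
          tauto
      · rw [Mem.put_ne _ (by decide), Mem.put_ne _ (by decide)]; exact ⟨hA2.mateR, hA2.linkC⟩
      · exact .last a b' (Finset.mem_sdiff.2 ⟨hm.1, hI⟩) (hm.2.resolve_right hI)
          (h.opt.mate_tight hm)
      · simp
      · intro z hz
        simp only [List.mem_cons, List.not_mem_nil, or_false] at hz
        rcases hz with rfl | rfl
        · exact hl.2.2
        · exact hn'
      · intro a1 b1 hm1
        simp only [List.mem_cons, List.not_mem_nil, or_false,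
          Vertex.row.injEq, Vertex.col.injEq, and_true, reduceCtorEq, false_or]
        refine ⟨?_, ?_⟩
        · rintro rfl; exact h.opt.mate_row hm1 hm
        · rintro rfl; exact h.opt.mate_col hm1 hm
      · exact Mem.put_same _ _ _ _ _
      · refine ⟨rfl, ?_, fun hc => hT ((h.opt.target_tstep (.mate hm)).1 hc), [a], by simp, rfl,
          by simp⟩
        rw [Mem.put_ne _ (by decide), f52]
    · rintro i m' - - ⟨Q, hE⟩
      have hE' := hE.put i
      rcases hE'.last with h1 | h1
      · rw [Cmd.exec_ite_pos (by simp only [Test.Holds, NExp.eval, eval_reg]; exact h1.1)]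
        exact extendStep_spec h hE' h1.1
      · rw [Cmd.exec_ite_neg (by simp only [Test.Holds, NExp.eval, eval_reg, h1.1]; decide),
          Cmd.exec_skip]
        exact ⟨Q, hE'.state, hE'.tables, hE'.inner, hE'.nodup, hE'.head, hE'.avoid, hE'.mate,
          Or.inr h1⟩
  obtain ⟨Q, hE⟩ := hlast
  have hend : ∀ b', Q.getLast? = some (.col b' t) → ∀ a', Link P S.x a' b' t →
      Vertex.row a' t ∈ S.nodes ∨ Vertex.row a' t ∈ Q := by
    rcases hE.last with ⟨-, _, -, -, -, A, hA, hlen, -⟩ | h1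
    · have := hA.length_le_card
      simp at this
      omega
    · exact h1.2
  refine ⟨_, .P3 b s a t Q hl hT ⟨b', Finset.mem_sdiff.2 ⟨hm.1, hI⟩⟩ ⟨hE.inner, hE.nodup⟩ hE.head
    hE.avoid ?_, hE.state⟩
  intro Q' hQ' hhd hav
  exact hE.inner.length_le h.opt hQ'.1 hQ'.2 (hhd.trans hE.head.symm) hav hend

/-- The case distinction (P1), (P2), (P3): the row vertex is in the target set, or it has a mate, which
belongs to an edge of `I` or of `M \ I`. -/
lemma primal_spec (hP : StoresMatrix m P) (hS : StoresState m S) (hA : Analyzed P S.x m)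
    (h : SearchInv P k S) (hT : ∀ s : Bool, Table (m.nat (32 + s.toNat))
      fun (a : Fin μ) t (b : Fin ν) => Leaves P S b s a t)
    (hl : ∃ b, Leaves P S b s a t) (h50 : m.nat 50 0 0 = a) :
    (∃ S', Step P S S' ∧ StoresState ((primal s t).exec m) S') ∨
      ∃ o, Stops P S o ∧ StoresOutcome ((primal s t).exec m) o := by
  have hopt := h.1.opt
  unfold primal
  rw [Cmd.exec_seq, Cmd.exec_setNat]
  obtain ⟨b, hb, hlb⟩ : ∃ b : Fin ν, m.nat (32 + s.toNat) a t.toNat = b + 1 ∧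
      Leaves P S b s a t := by
    rcases hT s a t with ⟨-, hno⟩ | hb
    · exact absurd hl.choose_spec (hno _)
    · exact hb
  simp only [NExp.eval, eval_reg, h50, hb, Nat.add_sub_cancel]
  have hP1 : StoresMatrix (m.put 51 0 0 b) P :=
    hP.congr (Mem.put_ne _ (by decide) _ _ _) (fun _ _ => rfl) rfl
  have hS1 := hS.put_aux (x := 51) (by decide) 0 0 b
  have hA1 : Analyzed P S.x (m.put 51 0 0 b) := by
    have hf : Frame (.setNat 51 (.const 0) (.const 0) (.const b)) m (m.put 51 0 0 b) :=
      Cmd.frame (.setNat 51 (.const 0) (.const 0) (.const b)) m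
    exact hA.frame hf (by simp [Cmd.natW])
  have e50 : (m.put 51 0 0 b).nat 50 0 0 = a := by rw [Mem.put_ne _ (by decide), h50]
  have e51 : (m.put 51 0 0 b).nat 51 0 0 = b := Mem.put_same _ _ _ _ _
  generalize m.put 51 0 0 b = m1 at *
  clear hP hS hA hT hb h50
  have htest : (Test.natEq (.get 28 (reg 50) (.const t.toNat)) (.const 1)).Holds m1 ↔
      Vertex.row a t ∈ target P S.x := by
    rw [Test.Holds]
    simp only [NExp.eval, eval_reg, e50]
    exact hA1.targetR a t
  by_cases hT : Vertex.row a t ∈ target P S.x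
  · rw [Cmd.exec_ite_pos (htest.2 hT)]
    exact Or.inr (output_leaving hP1 hS1 hA1 h hlb hT e50 e51)
  left
  rw [Cmd.exec_ite_neg (fun hh => hT (htest.1 hh)), Cmd.exec_seq, Cmd.exec_setNat]
  obtain ⟨b', hb', hm⟩ : ∃ b' : Fin ν, m1.nat 20 a t.toNat = b' + 1 ∧ Mate S.x a b' t := by
    rcases hA1.mateR a t with ⟨-, hno⟩ | hb
    · exact absurd (hopt.unmatched_mem_target hno) hT
    · exact hb
  simp only [NExp.eval, eval_reg, e50, hb', Nat.add_sub_cancel]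
  have hP2 : StoresMatrix (m1.put 52 0 0 b') P :=
    hP1.congr (Mem.put_ne _ (by decide) _ _ _) (fun _ _ => rfl) rfl
  have hS2 := hS1.put_aux (x := 52) (by decide) 0 0 b'
  have hA2 : Analyzed P S.x (m1.put 52 0 0 b') := by
    have hf : Frame (.setNat 52 (.const 0) (.const 0) (.const b')) m1 (m1.put 52 0 0 b') :=
      Cmd.frame (.setNat 52 (.const 0) (.const 0) (.const b')) m1
    exact hA1.frame hf (by simp [Cmd.natW])
  have f50 : (m1.put 52 0 0 b').nat 50 0 0 = a := by rw [Mem.put_ne _ (by decide), e50]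
  have f51 : (m1.put 52 0 0 b').nat 51 0 0 = b := by rw [Mem.put_ne _ (by decide), e51]
  have f52 : (m1.put 52 0 0 b').nat 52 0 0 = b' := Mem.put_same _ _ _ _ _
  generalize m1.put 52 0 0 b' = m2 at *
  clear hP1 hS1 hA1 e50 e51 htest hb'
  have htest : (Test.natEq (.get 1 (reg 50) (reg 52)) (.const 2)).Holds m2 ↔ (a, b') ∈ S.x.I := by
    simp only [Test.Holds, NExp.eval, eval_reg, f50, f52]
    exact hS2.conf.edge_two_iff
  by_cases hI : (a, b') ∈ S.x.I
  · rw [Cmd.exec_ite_pos (htest.2 hI), Cmd.exec_seq, Cmd.exec_seq]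
    obtain ⟨L', hr⟩ := hlb.exists_relabeling h.1 hI
    refine ⟨_, .P2 b s a t b' L' hlb hT hI hr, ?_⟩
    have hS3 := relabelSpaces_spec hP2 hS2 h.1 hlb hI hr f50 f51 f52
    have hf := (relabelSpaces s t).frame m2
    have hS4 := graft_spec (s := s) (t := t) hS3 (by rw [hf.nat 50 (by simp [relabelSpaces, Cmd.natW]), f50])
      (by rw [hf.nat 51 (by simp [relabelSpaces, Cmd.natW]), f51])
    have hf' := (graft s t).frame ((relabelSpaces s t).exec m2)
    have hS5 := plant_spec (t := t) (a := a) (b := b') hS4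
      (by rw [hf'.nat 50 (by cases s <;> cases t <;> decide),
        hf.nat 50 (by simp [relabelSpaces, Cmd.natW]), f50])
      (by rw [hf'.nat 52 (by cases s <;> cases t <;> decide),
        hf.nat 52 (by simp [relabelSpaces, Cmd.natW]), f52])
    convert hS5 using 1
    simp only [State.relabel, relabeled, State.mk.injEq, true_and]
    constructor
    · ext z
      simp only [Set.mem_union, Set.mem_insert_iff, Set.mem_singleton_iff]
      tauto
    · rw [Sym2.eq_swap (a := Vertex.col b s)]
      ext z
      simp only [Set.mem_union, Set.mem_insert_iff, Set.mem_singleton_iff]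
      tauto
  · rw [Cmd.exec_ite_neg (fun hh => hI (htest.1 hh))]
    exact addInner_spec hP2 hS2 hA2 h.1 hlb hT hm hI f50 f51 f52

end

/-! ### Programs for dual updates -/

/-- The column vertex `b^s` is in the forest, the row vertex `a^t` is outside, and their spaces are not
orthogonal, so that they contribute to the step length. The registers `40` and `41` hold `a` and
`b`. -/
def gapTest (s t : Bool) : Test :=
  .and (.natEq (.get 6 (reg 41) (.const s.toNat)) (.const 1))
    (.and (.not (.natEq (.get 5 (reg 40) (.const t.toNat)) (.const 1)))
      (.not (.fldEq (bilExp (reg 40) t (reg 41) s) .zero)))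

/-- The contribution to the step length. -/
def gap (s t : Bool) : RExp :=
  .sub (sumExp (reg 40) t (reg 41) s) (.get 0 (reg 40) (reg 41))

/-- The real number found so far is stored in the array `11`; the register `53` tells whether there
is one. -/
def gapStep (s t : Bool) : Cmd :=
  .ite (gapTest s t)
    (.ite (.and (.natEq (reg 53) (.const 1)) (.realLe (.get 11 (.const 0) (.const 0)) (gap s t)))
      .skip
      (.seq (.setReal 11 (.const 0) (.const 0) (gap s t))
        (.setNat 53 (.const 0) (.const 0) (.const 1))))
    .skip

/-- Compute the step length of a dual update. -/
def stepLength : Cmd := .seq (.setNat 53 (.const 0) (.const 0) (.const 0)) (scan gapStep)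

/-- Change the potential by the step length. -/
def shift : Cmd :=
  .seq (.setReal 3 (.const 0) (.const 0)
    (.sub (.get 3 (.const 0) (.const 0)) (.get 11 (.const 0) (.const 0))))
  (.seq (each rows fun s => .ite (.natEq (.get 5 (reg 40) (.const s.toNat)) (.const 1))
      (.setReal 1 (reg 40) (.const s.toNat)
        (.add (.get 1 (reg 40) (.const s.toNat)) (.get 11 (.const 0) (.const 0)))) .skip)
    (each cols fun s => .ite (.natEq (.get 6 (reg 40) (.const s.toNat)) (.const 1)) .skip
      (.setReal 2 (reg 40) (.const s.toNat)
        (.add (.get 2 (reg 40) (.const s.toNat)) (.get 11 (.const 0) (.const 0))))))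

/-- Add the source set to the forest. -/
def absorb : Cmd :=
  .seq (each rows fun s => .ite (.natEq (.get 26 (reg 40) (.const s.toNat)) (.const 1))
      (.setNat 5 (reg 40) (.const s.toNat) (.const 1)) .skip)
    (each cols fun s => .ite (.natEq (.get 27 (reg 40) (.const s.toNat)) (.const 1))
      (.setNat 6 (reg 40) (.const s.toNat) (.const 1)) .skip)

/-- Rearrange the edge given by the registers `40` and `41` if it belongs to the component whose
rows are marked in the array `30`. -/
def switchEdge (s : Bool) : Cmd :=
  .ite (.and (.natEq (.get 1 (reg 40) (reg 41)) (.const 1))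
      (.natEq (.get 30 (reg 40) (.const s.toNat)) (.const 1)))
    (.ite (.natEq (.get 2 (reg 40) (reg 41)) (.const s.toNat))
      (.setNat 1 (reg 40) (reg 41) (.const 2)) (.setNat 1 (reg 40) (reg 41) (.const 0)))
    .skip

/-- Mark the component of the row vertex given by the register `50` and `s`. -/
def markComponent (s : Bool) : Cmd :=
  .seq (clear 30 42 rows) (.seq (clear 31 42 cols)
  (.seq (.setNat 54 (.const 0) (.const 0) (.add (reg 50) (.const 1)))
    (chase 30 31 22 21 54 42 (.add cols (.const 1)) s)))

/-- Rearrange the component of the row vertex given by the register `50` and `s`. -/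
def switchComponent (s : Bool) : Cmd :=
  .seq (markComponent s) (.seq (scan fun _ _ => switchEdge s)
    (.setNat 3 (.const 0) (.const 0) (.const 3)))

/-- The row vertex given by the register `40` and `s` is unmatched and lies in the source set. -/
def switchTest (s : Bool) : Test :=
  .and (.natEq (.get 20 (reg 40) (.const s.toNat)) (.const 0))
    (.natEq (.get 26 (reg 40) (.const s.toNat)) (.const 1))

/-- The row vertex given by the register `40` and `s` lies in the forest and in the target set. -/
def goalTest (s : Bool) : Test :=
  .and (.natEq (.get 5 (reg 40) (.const s.toNat)) (.const 1))
    (.natEq (.get 28 (reg 40) (.const s.toNat)) (.const 1))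

/-- The dual update. -/
def dual : Cmd :=
  .seq stepLength (.ite (.natEq (reg 53) (.const 0)) (.setNat 3 (.const 0) (.const 0) (.const 2))
  (.seq shift (.seq analyze
  (attempt (switchTest true) (switchComponent true)
  (attempt (switchTest false) (switchComponent false)
  (attempt (goalTest true) (.seq (innerPath true) (finish 4))
  (attempt (goalTest false) (.seq (innerPath false) (finish 4)) absorb)))))))

section

variable {F : Type u} [Field F] {μ ν : ℕ} {P : PartMatrix F μ ν} {k : ℕ} {m : Mem F}
  {S : State F μ ν} {x : Conf F μ ν} {ε : ℝ}

lemma StoresMatrix.put (h : StoresMatrix m P) {x : ℕ} (hx : x ≠ 0) (i j y : ℕ) :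
    StoresMatrix (m.put x i j y) P :=
  h.congr (Mem.put_ne _ hx.symm _ _ _) (fun _ _ => rfl) rfl

/-- The memory after an assignment to a cell of an array of real numbers. -/
def Mem.putReal (m : Mem F) (x i j : ℕ) (y : ℝ) : Mem F :=
  { m with real := fun x' i' j' => if x' = x ∧ i' = i ∧ j' = j then y else m.real x' i' j' }

lemma Cmd.exec_setReal (x : ℕ) (i j : NExp) (e : RExp) (m : Mem F) :
    (Cmd.setReal x i j e).exec m = m.putReal x (i.eval m) (j.eval m) (e.eval m) := rfl

/-- The set of all contributions to the step length from `A`. -/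
def gaps (P : PartMatrix F μ ν) (S : State F μ ν) (A : Set (Fin μ × Fin ν × Bool × Bool)) :
    Set ℝ :=
  {r | ∃ a b s t, (a, b, s, t) ∈ A ∧ Vertex.col b s ∈ S.nodes ∧ Vertex.row a t ∉ S.nodes ∧
    ¬ Orth (P.A a b) (S.x.L.U a t) (S.x.L.V b s) ∧
    r = S.x.p.row a (S.x.L.U a t) + S.x.p.col b (S.x.L.V b s) + S.x.c - P.d a b}

lemma gaps_univ : gaps P S Set.univ = slacks P S := by
  ext r
  constructor
  · rintro ⟨a, b, s, t, -, h⟩; exact ⟨b, s, a, t, h⟩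
  · rintro ⟨b, s, a, t, h⟩; exact ⟨a, b, s, t, trivial, h⟩

/-- The register `53` tells whether there is a step length at all. -/
lemma stepLength_spec (hP : StoresMatrix m P) (hS : StoresState m S) :
    StoresMatrix (stepLength.exec m) P ∧ StoresState (stepLength.exec m) S ∧
    (((stepLength.exec m).nat 53 0 0 = 0 ∧ slacks P S = ∅) ∨
      ((stepLength.exec m).nat 53 0 0 = 1 ∧
        IsLeast (slacks P S) ((stepLength.exec m).real 11 0 0))) := by
  have aux : stepLength.Aux := by decide
  have hf := stepLength.frame m
  refine ⟨hP.frame hf aux, hS.frame hf aux, ?_⟩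
  clear hf aux
  unfold stepLength
  rw [Cmd.exec_seq, Cmd.exec_setNat]
  simp only [NExp.eval]
  have hP1 := hP.put (x := 53) (by decide) 0 0 0
  have hS1 := hS.put_aux (x := 53) (by decide) 0 0 0
  have e53 : (m.put 53 0 0 0).nat 53 0 0 = 0 := Mem.put_same _ _ _ _ _
  generalize m.put 53 0 0 0 = m1 at *
  rw [← gaps_univ]
  refine exec_scan (m := m1) (p := gapStep)
    (fun A m' => (m'.nat 53 0 0 = 0 ∧ gaps P S A = ∅) ∨
      (m'.nat 53 0 0 = 1 ∧ IsLeast (gaps P S A) (m'.real 11 0 0)))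
    hP1.rows hP1.cols (Or.inl ⟨e53, by simp [gaps]⟩) (by decide) ?_ ?_
  · rintro A m' i x hx h
    rw [Mem.put_ne _ (by omega)]
    exact h
  · intro A m' a b s t hf h40 h41 hInv
    have aux : (scan gapStep).Aux := by decide
    have hP2 := hP1.frame hf aux
    have hS2 := hS1.frame hf aux
    have htest : (gapTest s t).Holds m' ↔ Vertex.col b s ∈ S.nodes ∧ Vertex.row a t ∉ S.nodes ∧
        ¬ Orth (P.A a b) (S.x.L.U a t) (S.x.L.V b s) := by
      simp only [gapTest, Test.Holds, NExp.eval, FExp.eval, eval_reg, h40, h41, hS2.row_node,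
        hS2.col_node, bilExp_eq_zero_iff hP2 hS2.conf (a := reg 40) (b := reg 41) h40 h41]
    have hgap : (gap s t).eval m' =
        S.x.p.row a (S.x.L.U a t) + S.x.p.col b (S.x.L.V b s) + S.x.c - P.d a b := by
      simp only [gap, RExp.eval, sumExp_eval hS2.conf (a := reg 40) (b := reg 41) h40 h41,
        eval_reg, h40, h41, hP2.exponent]
    unfold gapStep
    by_cases hg : (gapTest s t).Holds m'
    · have hins : gaps P S (insert (a, b, s, t) A) = insert ((gap s t).eval m') (gaps P S A) := by
        ext r
        simp only [gaps, Set.mem_insert_iff, Set.mem_ofPred_eq, Prod.mk.injEq]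
        constructor
        · rintro ⟨a1, b1, s1, t1, ⟨rfl, rfl, rfl, rfl⟩ | h1, h2⟩
          · exact Or.inl (h2.2.2.2.trans hgap.symm)
          · exact Or.inr ⟨a1, b1, s1, t1, h1, h2⟩
        · rintro (h1 | ⟨a1, b1, s1, t1, h1, h2⟩)
          · obtain ⟨g1, g2, g3⟩ := htest.1 hg
            exact ⟨a, b, s, t, Or.inl ⟨rfl, rfl, rfl, rfl⟩, g1, g2, g3, h1.trans hgap⟩
          · exact ⟨a1, b1, s1, t1, Or.inr h1, h2⟩
      rw [Cmd.exec_ite_pos hg, hins]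
      right
      by_cases hle : (Test.and (.natEq (reg 53) (.const 1))
          (.realLe (.get 11 (.const 0) (.const 0)) (gap s t))).Holds m'
      · rw [Cmd.exec_ite_pos hle, Cmd.exec_skip]
        obtain ⟨h53, hle⟩ := hle
        simp only [Test.Holds, NExp.eval, eval_reg, RExp.eval] at h53 hle
        obtain ⟨-, h1, h2⟩ := hInv.resolve_left (fun h => by omega)
        refine ⟨h53, Or.inr h1, ?_⟩
        rintro r (rfl | hr)
        · exact hle
        · exact h2 hr
      · rw [Cmd.exec_ite_neg hle, Cmd.exec_seq, Cmd.exec_setReal, Cmd.exec_setNat]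
        refine ⟨Mem.put_same _ _ _ _ _, ?_⟩
        have hval : ((m'.putReal 11 ((NExp.const 0).eval m') ((NExp.const 0).eval m')
          ((gap s t).eval m')).real 11 0 0) = (gap s t).eval m' := by
          simp [Mem.putReal, NExp.eval]
        change IsLeast _ ((m'.putReal 11 ((NExp.const 0).eval m') ((NExp.const 0).eval m')
          ((gap s t).eval m')).real 11 0 0)
        rw [hval]
        refine ⟨Or.inl rfl, ?_⟩
        simp only [Test.Holds, NExp.eval, eval_reg, RExp.eval, not_and, not_le] at hle
        rintro r (rfl | hr)
        · exact le_rfl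
        · rcases hInv with ⟨-, h2⟩ | ⟨h1, h2⟩
          · rw [h2] at hr; exact absurd hr (Set.notMem_empty _)
          · exact ((hle h1).le).trans (h2.2 hr)
    · have hins : gaps P S (insert (a, b, s, t) A) = gaps P S A := by
        ext r
        simp only [gaps, Set.mem_insert_iff, Set.mem_ofPred_eq, Prod.mk.injEq]
        constructor
        · rintro ⟨a1, b1, s1, t1, ⟨rfl, rfl, rfl, rfl⟩ | h1, h2⟩
          · exact absurd (htest.2 ⟨h2.1, h2.2.1, h2.2.2.1⟩) hg
          · exact ⟨a1, b1, s1, t1, h1, h2⟩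
        · rintro ⟨a1, b1, s1, t1, h1, h2⟩
          exact ⟨a1, b1, s1, t1, Or.inr h1, h2⟩
      rw [Cmd.exec_ite_neg hg, Cmd.exec_skip, hins]
      exact hInv

open Classical in
lemma shift_spec (hP : StoresMatrix m P) (hS : StoresState m S) (hε : m.real 11 0 0 = ε) :
    StoresState (shift.exec m) ⟨dualConf S ε, S.nodes, S.edges⟩ := by
  have hnat : ∀ i, i ≠ 40 → (shift.exec m).nat i = m.nat i := fun i hi =>
    (shift.frame m).nat i (by simp [shift, each, both, Cmd.natW, hi])
  have hfld : (shift.exec m).fld = m.fld := by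
    funext i
    exact (shift.frame m).fld i (by simp [shift, each, both, Cmd.fldW])
  have key : (shift.exec m).real 3 0 0 = S.x.c - ε ∧
      (∀ (a : Fin μ) (s : Bool), (shift.exec m).real 1 a s.toNat =
        m.real 1 a s.toNat + if Vertex.row a s ∈ S.nodes then ε else 0) ∧
      ∀ (b : Fin ν) (s : Bool), (shift.exec m).real 2 b s.toNat =
        m.real 2 b s.toNat + if Vertex.col b s ∈ S.nodes then 0 else ε := by
    unfold shift
    rw [Cmd.exec_seq, Cmd.exec_setReal, Cmd.exec_seq]
    simp only [NExp.eval, RExp.eval, hε, hS.conf.shift]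
    have h3 : (m.putReal 3 0 0 (S.x.c - ε)).real 3 0 0 = S.x.c - ε := by simp [Mem.putReal]
    have h11 : (m.putReal 3 0 0 (S.x.c - ε)).real 11 0 0 = ε := by simp [Mem.putReal, hε]
    have h1 : ∀ i j, (m.putReal 3 0 0 (S.x.c - ε)).real 1 i j = m.real 1 i j := by
      simp [Mem.putReal]
    have h2 : ∀ i j, (m.putReal 3 0 0 (S.x.c - ε)).real 2 i j = m.real 2 i j := by
      simp [Mem.putReal]
    have hn : (m.putReal 3 0 0 (S.x.c - ε)).nat = m.nat := rfl
    generalize m.putReal 3 0 0 (S.x.c - ε) = m1 at *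
    clear hnat hfld hε
    -- the rows
    let p : Bool → Cmd := fun s => .ite (.natEq (.get 5 (reg 40) (.const s.toNat)) (.const 1))
      (.setReal 1 (reg 40) (.const s.toNat)
        (.add (.get 1 (reg 40) (.const s.toNat)) (.get 11 (.const 0) (.const 0)))) .skip
    have hp := exec_each (m := m1) (e := rows) (p := p) (n := μ)
      (fun A m' => ∀ (a : Fin μ) (s : Bool), m'.real 1 a s.toNat = m.real 1 a s.toNat +
        if (a, s) ∈ A ∧ Vertex.row a s ∈ S.nodes then ε else 0)
      (by rw [rows, NExp.eval, hn]; exact hP.rows) (by simpa using fun (a : Fin μ) (s : Bool) => h1 a s.toNat)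
      (by decide) (fun A m' i h => h) ?_
    · have hf := (each rows p).frame m1
      change ((each cols _).exec ((each rows p).exec m1)).real 3 0 0 = _ ∧ (∀ (a : Fin μ) (s : Bool),
        ((each cols _).exec ((each rows p).exec m1)).real 1 a s.toNat = _) ∧ ∀ (b : Fin ν) (s : Bool),
        ((each cols _).exec ((each rows p).exec m1)).real 2 b s.toNat = _
      have g3 : ((each rows p).exec m1).real 3 0 0 = S.x.c - ε := by
        rw [hf.real 3 (by simp [p, each, both, Cmd.realW]), h3]
      have g11 : ((each rows p).exec m1).real 11 0 0 = ε := by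
        rw [hf.real 11 (by simp [p, each, both, Cmd.realW]), h11]
      have g2 : ∀ i j, ((each rows p).exec m1).real 2 i j = m.real 2 i j := by
        rw [hf.real 2 (by simp [p, each, both, Cmd.realW])]; exact h2
      have gn : ∀ i, i ≠ 40 → ((each rows p).exec m1).nat i = m.nat i := fun i hi => by
        rw [hf.nat i (by simp [p, each, both, Cmd.natW, hi]), hn]
      generalize (each rows p).exec m1 = m2 at *
      clear hf h1 h2 h3 h11 hn
      -- the columns
      let q : Bool → Cmd := fun s => .ite (.natEq (.get 6 (reg 40) (.const s.toNat)) (.const 1))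
        .skip (.setReal 2 (reg 40) (.const s.toNat)
          (.add (.get 2 (reg 40) (.const s.toNat)) (.get 11 (.const 0) (.const 0))))
      have hq := exec_each (m := m2) (e := cols) (p := q) (n := ν)
        (fun A m' => ∀ (b : Fin ν) (s : Bool), m'.real 2 b s.toNat = m.real 2 b s.toNat +
          if (b, s) ∈ A ∧ Vertex.col b s ∉ S.nodes then ε else 0)
        (by rw [cols, NExp.eval, gn 0 (by decide)]; exact hP.cols)
        (by simpa using fun (b : Fin ν) (s : Bool) => g2 b s.toNat) (by decide) (fun A m' i h => h) ?_
      · have hf := (each cols q).frame m2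
        refine ⟨?_, fun a s => ?_, fun b s => ?_⟩
        · change ((each cols q).exec m2).real 3 0 0 = _
          rw [hf.real 3 (by simp [q, each, both, Cmd.realW]), g3]
        · change ((each cols q).exec m2).real 1 a s.toNat = _
          rw [hf.real 1 (by simp [q, each, both, Cmd.realW]), hp]
          simp
        · change ((each cols q).exec m2).real 2 b s.toNat = _
          rw [hq]
          simp only [Set.mem_univ, true_and]
          split_ifs <;> simp_all
      · intro A m' b s hA hf h40 hInv b' s'
        have e6 : m'.nat 6 = m.nat 6 := by
          rw [hf.nat 6 (by simp [q, each, both, Cmd.natW]), gn 6 (by decide)]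
        have e11 : m'.real 11 0 0 = ε := by
          rw [hf.real 11 (by simp [q, each, both, Cmd.realW]), g11]
        have htest : (Test.natEq (.get 6 (reg 40) (.const s.toNat)) (.const 1)).Holds m' ↔
            Vertex.col b s ∈ S.nodes := by
          simp only [Test.Holds, NExp.eval, eval_reg, h40, e6]
          exact hS.col_node b s
        have hInv' := hInv b' s'
        by_cases hc : Vertex.col b s ∈ S.nodes
        · change ((Cmd.ite _ _ _).exec m').real _ _ _ = _
          rw [Cmd.exec_ite_pos (htest.2 hc), Cmd.exec_skip, hInv']
          congr 2
          simp only [Set.mem_insert_iff, Prod.mk.injEq, eq_iff_iff]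
          constructor
          · exact fun h => ⟨Or.inr h.1, h.2⟩
          · rintro ⟨⟨rfl, rfl⟩ | h1, h2⟩
            · exact absurd hc h2
            · exact ⟨h1, h2⟩
        · change ((Cmd.ite _ _ _).exec m').real _ _ _ = _
          rw [Cmd.exec_ite_neg (fun h => hc (htest.1 h)), Cmd.exec_setReal]
          simp only [NExp.eval, RExp.eval, eval_reg, h40, e11, Mem.putReal, true_and, Fin.val_inj,
            toNat_inj]
          by_cases hbs : b' = b ∧ s' = s
          · obtain ⟨rfl, rfl⟩ := hbs
            rw [if_pos ⟨rfl, rfl⟩, hInv', if_neg (fun h => hA h.1), if_pos ⟨Or.inl rfl, hc⟩, add_zero]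
          · rw [if_neg hbs, hInv']
            congr 2
            simp only [Set.mem_insert_iff, Prod.mk.injEq, eq_iff_iff]
            tauto
    · intro A m' b s hA hf h40 hInv b' s'
      have e5 : m'.nat 5 = m.nat 5 := by
        rw [hf.nat 5 (by simp [p, each, both, Cmd.natW]), hn]
      have e11 : m'.real 11 0 0 = ε := by
        rw [hf.real 11 (by simp [p, each, both, Cmd.realW]), h11]
      have htest : (Test.natEq (.get 5 (reg 40) (.const s.toNat)) (.const 1)).Holds m' ↔
          Vertex.row b s ∈ S.nodes := by
        simp only [Test.Holds, NExp.eval, eval_reg, h40, e5]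
        exact hS.row_node b s
      have hInv' := hInv b' s'
      by_cases hc : Vertex.row b s ∈ S.nodes
      · change ((Cmd.ite _ _ _).exec m').real _ _ _ = _
        rw [Cmd.exec_ite_pos (htest.2 hc), Cmd.exec_setReal]
        simp only [NExp.eval, RExp.eval, eval_reg, h40, e11, Mem.putReal, true_and, Fin.val_inj,
          toNat_inj]
        by_cases hbs : b' = b ∧ s' = s
        · obtain ⟨rfl, rfl⟩ := hbs
          rw [if_pos ⟨rfl, rfl⟩, hInv', if_neg (fun h => hA h.1), if_pos ⟨Or.inl rfl, hc⟩, add_zero]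
        · rw [if_neg hbs, hInv']
          congr 2
          simp only [Set.mem_insert_iff, Prod.mk.injEq, eq_iff_iff]
          tauto
      · change ((Cmd.ite _ _ _).exec m').real _ _ _ = _
        rw [Cmd.exec_ite_neg (fun h => hc (htest.1 h)), Cmd.exec_skip, hInv']
        congr 2
        simp only [Set.mem_insert_iff, Prod.mk.injEq, eq_iff_iff]
        constructor
        · exact fun h => ⟨Or.inr h.1, h.2⟩
        · rintro ⟨⟨rfl, rfl⟩ | h1, h2⟩
          · exact absurd h2 hc
          · exact ⟨h1, h2⟩
  refine ⟨?_, ⟨?_, ?_, ?_, ?_, ?_, ?_, key.1⟩, ?_, ?_, ?_⟩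
  · rw [hnat 3 (by decide)]; exact hS.running
  · rw [hnat 1 (by decide)]; exact hS.conf.edge
  · rw [hnat 2 (by decide)]; exact hS.conf.sign
  · rw [hfld]; exact hS.conf.row_space
  · rw [hfld]; exact hS.conf.col_space
  · intro a s
    rw [key.2.1, hS.conf.row_value]
    exact (dualPotential_row S ε a s).symm
  · intro b s
    rw [key.2.2, hS.conf.col_value]
    exact (dualPotential_col S ε b s).symm
  · rw [hnat 5 (by decide)]; exact hS.row_node
  · rw [hnat 6 (by decide)]; exact hS.col_node
  · intro a s b t
    rw [hnat _ (by cases s <;> cases t <;> decide)]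
    exact hS.edge a s b t

end

/-! ### Correctness of dual updates -/

section

variable {F : Type u} [Field F] {μ ν : ℕ} {P : PartMatrix F μ ν} {k : ℕ} {m : Mem F}
  {S : State F μ ν} {x : Conf F μ ν} {ε : ℝ}

lemma absorb_spec (hP : StoresMatrix m P) (hS : StoresState m S) (hA : Analyzed P S.x m) :
    StoresState (absorb.exec m) ⟨S.x, S.nodes ∪ source P S.x, S.edges⟩ := by
  let p : Bool → Cmd := fun s => .ite (.natEq (.get 26 (reg 40) (.const s.toNat)) (.const 1))
      (.setNat 5 (reg 40) (.const s.toNat) (.const 1)) .skip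
  let q : Bool → Cmd := fun s => .ite (.natEq (.get 27 (reg 40) (.const s.toNat)) (.const 1))
      (.setNat 6 (reg 40) (.const s.toNat) (.const 1)) .skip
  let f : Fin μ × Bool → Vertex μ ν := fun i => .row i.1 i.2
  let g : Fin ν × Bool → Vertex μ ν := fun i => .col i.1 i.2
  change StoresState ((each cols q).exec ((each rows p).exec m)) _
  have hp := exec_each (m := m) (e := rows) (p := p) (n := μ)
    (fun A m' => StoresState m' ⟨S.x, S.nodes ∪ f '' A ∩ source P S.x, S.edges⟩)
    (eval_rows hP) (by simpa using hS) (by decide)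
    (fun A m' i h => h.put_aux (by decide) _ _ _) ?_
  · have hf := (each rows p).frame m
    have hP1 : ((each rows p).exec m).nat 0 0 1 = ν := by
      rw [hf.nat 0 (by simp [each, both, p, Cmd.natW])]; exact hP.cols
    have hA1 := hA.frame hf (by simp [each, both, p, Cmd.natW])
    generalize (each rows p).exec m = m1 at *
    have hq := exec_each (m := m1) (e := cols) (p := q) (n := ν)
      (fun A m' => StoresState m' ⟨S.x, S.nodes ∪ f '' Set.univ ∩ source P S.x ∪
        g '' A ∩ source P S.x, S.edges⟩)
      hP1 (by simpa using hp) (by decide) (fun A m' i h => h.put_aux (by decide) _ _ _) ?_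
    · convert hq using 2
      ext z
      rcases z with ⟨a, s⟩ | ⟨b, s⟩ <;> simp [f, g]
    · intro A m' b s hA hf h40 hInv
      have h27 : (Test.natEq (.get 27 (reg 40) (.const s.toNat)) (.const 1)).Holds m' ↔
          Vertex.col b s ∈ source P S.x := by
        rw [Test.Holds]
        simp only [NExp.eval, eval_reg, h40, hf.nat 27 (by simp [each, both, q, Cmd.natW])]
        exact hA1.sourceC b s
      change StoresState ((Cmd.ite _ _ _).exec m') _
      rw [Set.image_insert_eq]
      by_cases hc : Vertex.col b s ∈ source P S.x
      · rw [Cmd.exec_ite_pos (h27.2 hc), Cmd.exec_setNat, Set.insert_inter_of_mem hc,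
          Set.union_insert]
        simp only [NExp.eval, eval_reg, h40]
        exact hInv.put_col b s
      · rw [Cmd.exec_ite_neg (fun h => hc (h27.1 h)), Cmd.exec_skip,
          Set.insert_inter_of_notMem hc]
        exact hInv
  · intro A m' a s hA' hf h40 hInv
    have h26 : (Test.natEq (.get 26 (reg 40) (.const s.toNat)) (.const 1)).Holds m' ↔
        Vertex.row a s ∈ source P S.x := by
      rw [Test.Holds]
      simp only [NExp.eval, eval_reg, h40, hf.nat 26 (by simp [each, both, p, Cmd.natW])]
      exact hA.sourceR a s
    change StoresState ((Cmd.ite _ _ _).exec m') _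
    rw [Set.image_insert_eq]
    by_cases hc : Vertex.row a s ∈ source P S.x
    · rw [Cmd.exec_ite_pos (h26.2 hc), Cmd.exec_setNat, Set.insert_inter_of_mem hc,
        Set.union_insert]
      simp only [NExp.eval, eval_reg, h40]
      exact hInv.put_row a s
    · rw [Cmd.exec_ite_neg (fun h => hc (h26.1 h)), Cmd.exec_skip, Set.insert_inter_of_notMem hc]
      exact hInv

lemma markComponent_spec (hP : StoresMatrix m P) (hA : Analyzed P x m) (h : IsOptimal P k x)
    {a : Fin μ} {s : Bool} (hu : ∀ b, ¬ Mate x a b s) (h50 : m.nat 50 0 0 = a) (a' : Fin μ) :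
    ((markComponent s).exec m).nat 30 a' s.toNat = 1 ↔
      Relation.ReflTransGen (TStep P x) (.row a s) (.row a' s) := by
  unfold markComponent
  rw [Cmd.exec_seq]
  have hm := clear_spec (x := 30) (v := 42) (m := m) (by decide) (eval_rows hP)
  have hf := (clear 30 42 rows).frame m
  have hP1 := hP.frame hf (by decide)
  have hA1 := hA.frame hf (by decide)
  have e50 : ((clear 30 42 rows).exec m).nat 50 0 0 = a := by rw [hf.nat 50 (by decide), h50]
  generalize (clear 30 42 rows).exec m = m1 at *
  clear hf hP hA h50
  rw [Cmd.exec_seq]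
  have hf := (clear 31 42 cols).frame m1
  have hP2 := hP1.frame hf (by decide)
  have hA2 := hA1.frame hf (by decide)
  have f50 : ((clear 31 42 cols).exec m1).nat 50 0 0 = a := by rw [hf.nat 50 (by decide), e50]
  rw [← hf.nat 30 (by decide)] at hm
  generalize (clear 31 42 cols).exec m1 = m2 at *
  clear hf hP1 hA1 e50
  rw [Cmd.exec_seq, Cmd.exec_setNat]
  simp only [NExp.eval, eval_reg, f50]
  have hput : ∀ i ≠ 54, (m2.put 54 0 0 (a + 1)).nat i = m2.nat i :=
    fun i hi => Mem.put_ne _ hi _ _ _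
  have key := (chase_spec (m := m2.put 54 0 0 (a + 1)) (x := 30) (y := 31) (lk := 22) (mt := 21)
    (c := 54) (v := 42) (e := .add cols (.const 1)) (s := s) (i0 := a)
    (φ := fun a s b => Link P x a b s) (ψ := fun b s a => Mate x a b s) (by decide)
    (congrArg (· + 1) (eval_cols (hP2.put (by decide) _ _ _))) (by rw [hput _ (by decide)]; exact hA2.linkR)
    (by rw [hput _ (by decide)]; exact hA2.mateC) (Mem.put_same _ _ _ _ _) h.link_row h.mate_col
    h.link_col h.mate_row hu).1 a' s.toNat
  rw [key, hput _ (by decide), hm a' s]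
  simp only [false_or, true_and]
  constructor
  · rintro ⟨a1, h1, h2⟩
    obtain rfl := Fin.ext h1
    exact (reflTransGen_tstep_iff a s (.inl a')).1 h2
  · intro h1
    exact ⟨a', rfl, (reflTransGen_tstep_iff a s (.inl a')).2 h1⟩

open Classical in
lemma switchComponent_spec (hP : StoresMatrix m P) (hx : StoresConf m x) (hA : Analyzed P x m)
    (h : IsOptimal P k x) {a : Fin μ} {s : Bool} (hu : ∀ b, ¬ Mate x a b s)
    (h50 : m.nat 50 0 0 = a) :
    ∃ C, IsComponentOf P x a s C ∧ StoresConf ((switchComponent s).exec m) (rearrange x C s) := by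
  obtain ⟨C, hC⟩ := exists_isComponentOf P x a s
  refine ⟨C, hC, ?_⟩
  unfold switchComponent
  rw [Cmd.exec_seq]
  have hmark := markComponent_spec hP hA h hu h50
  have hf := (markComponent s).frame m
  have aux : (markComponent s).Aux := by cases s <;> decide
  have hP1 := hP.frame hf aux
  have hx1 := hx.frame hf aux
  generalize (markComponent s).exec m = m1 at *
  clear hf aux hP hx hA h50
  rw [Cmd.exec_seq, Cmd.exec_setNat]
  have hf := (scan fun _ _ => switchEdge s).frame m1
  have hCmem : ∀ a' b', (a', b') ∈ C ↔ m1.nat 1 a' b' = 1 ∧ m1.nat 30 a' s.toNat = 1 := by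
    intro a' b'
    rw [hC, hmark, hx1.edge_one_iff, Finset.mem_sdiff]
  have key := exec_scan (m := m1) (p := fun _ _ => switchEdge s)
    (fun A m' => ∀ (a' : Fin μ) (b' : Fin ν), m'.nat 1 a' b' =
      if (∃ s t, (a', b', s, t) ∈ A) ∧ (a', b') ∈ C then
        if m1.nat 2 a' b' = s.toNat then 2 else 0 else m1.nat 1 a' b')
    hP1.rows hP1.cols (by simp) (by cases s <;> decide) ?_ ?_
  · simp only [Set.mem_univ, exists_const, true_and] at key
    have hnat : ∀ i, i ∉ [1, 40, 41] → ((scan fun _ _ => switchEdge s).exec m1).nat i = m1.nat i :=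
      fun i hi => hf.nat i (by simp [scan, switchEdge, both, Cmd.natW] at hi ⊢; omega)
    have hfld : ((scan fun _ _ => switchEdge s).exec m1).fld = m1.fld := by
      funext i
      exact hf.fld i (by simp [scan, switchEdge, both, Cmd.fldW])
    have hreal : ((scan fun _ _ => switchEdge s).exec m1).real = m1.real := by
      funext i
      exact hf.real i (by simp [scan, switchEdge, both, Cmd.realW])
    generalize (scan fun _ _ => switchEdge s).exec m1 = m2 at *
    suffices hs : StoresConf m2 (rearrange x C s) from
      hs.congr (fun i hi _ => Mem.put_ne _ (by omega) _ _ _) (fun _ _ => rfl) fun _ _ => rfl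
    refine ⟨fun a' b' => ?_, fun a' b' hab => ?_, ?_, ?_, ?_, ?_, ?_⟩
    · rw [key]
      simp only [rearrange, Finset.mem_union, Finset.mem_sdiff, Finset.mem_filter]
      by_cases hc : (a', b') ∈ C
      · have hab := Finset.mem_sdiff.1 ((hC a' b').1 hc).1
        rw [if_pos hc]
        simp only [hx1.sign _ _ hab.1, toNat_inj]
        by_cases hs : x.sgn a' b' = s
        · simp [hs, hc, hab.2]
        · have hs' : x.sgn a' b' = !s := by revert hs; cases x.sgn a' b' <;> cases s <;> simp
          simp [hs', hc, hab.2]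
      · rw [if_neg hc, hx1.edge]
        simp [hc]
    · rw [hnat 2 (by decide)]
      exact hx1.sign a' b' (Finset.mem_sdiff.1 hab).1
    · rw [hfld]; exact hx1.row_space
    · rw [hfld]; exact hx1.col_space
    · rw [hreal]; exact hx1.row_value
    · rw [hreal]; exact hx1.col_value
    · rw [hreal]; exact hx1.shift
  · intro A m' i y hy hInv a' b'
    rw [Mem.put_ne _ (by omega)]
    exact hInv a' b'
  · intro A m' a' b' s' t' hf' h40 h41 hInv a1 b1
    have e30 : m'.nat 30 = m1.nat 30 := hf'.nat 30 (by simp [scan, switchEdge, both, Cmd.natW])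
    have e2 : m'.nat 2 = m1.nat 2 := hf'.nat 2 (by simp [scan, switchEdge, both, Cmd.natW])
    have h1 := hInv a' b'
    have h2 := hInv a1 b1
    have hmem : (∃ s t, (a1, b1, s, t) ∈ insert (a', b', s', t') A) ↔
        (a1 = a' ∧ b1 = b') ∨ ∃ s t, (a1, b1, s, t) ∈ A := by
      simp only [Set.mem_insert_iff, Prod.mk.injEq]
      constructor
      · rintro ⟨s1, t1, h | h⟩
        · exact Or.inl ⟨h.1, h.2.1⟩
        · exact Or.inr ⟨s1, t1, h⟩
      · rintro (⟨rfl, rfl⟩ | ⟨s1, t1, h⟩)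
        · exact ⟨s', t', Or.inl ⟨rfl, rfl, rfl, rfl⟩⟩
        · exact ⟨s1, t1, Or.inr h⟩
    simp only [hmem]
    unfold switchEdge
    by_cases hv : ∃ s t, (a', b', s, t) ∈ A
    · -- the edge has been treated before
      have hstep : (Cmd.ite (.and (.natEq (.get 1 (reg 40) (reg 41)) (.const 1))
          (.natEq (.get 30 (reg 40) (.const s.toNat)) (.const 1)))
          (.ite (.natEq (.get 2 (reg 40) (reg 41)) (.const s.toNat))
            (.setNat 1 (reg 40) (reg 41) (.const 2)) (.setNat 1 (reg 40) (reg 41) (.const 0)))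
          .skip).exec m' = m' := by
        rw [Cmd.exec_ite_neg, Cmd.exec_skip]
        simp only [Test.Holds, NExp.eval, eval_reg, h40, h41, e30]
        rintro ⟨h3, h4⟩
        rw [h1] at h3
        by_cases hc : (a', b') ∈ C
        · rw [if_pos ⟨hv, hc⟩] at h3
          split_ifs at h3
          omega
        · rw [if_neg (fun h => hc h.2)] at h3
          exact hc ((hCmem a' b').2 ⟨h3, h4⟩)
      rw [hstep, h2]
      congr 2
      rw [eq_iff_iff]
      constructor
      · exact fun h => Or.inr h
      · rintro (⟨rfl, rfl⟩ | h)
        · exact hv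
        · exact h
    · rw [if_neg (fun h => hv h.1)] at h1
      have htest : (Test.and (.natEq (.get 1 (reg 40) (reg 41)) (.const 1))
          (.natEq (.get 30 (reg 40) (.const s.toNat)) (.const 1))).Holds m' ↔ (a', b') ∈ C := by
        simp only [Test.Holds, NExp.eval, eval_reg, h40, h41, e30, h1, hCmem]
      have htest' : (Test.natEq (.get 2 (reg 40) (reg 41)) (.const s.toNat)).Holds m' ↔
          m1.nat 2 a' b' = s.toNat := by
        simp only [Test.Holds, NExp.eval, eval_reg, h40, h41, e2]
      by_cases hc : (a', b') ∈ C
      · rw [Cmd.exec_ite_pos (htest.2 hc)]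
        have hset : ((Cmd.ite (.natEq (.get 2 (reg 40) (reg 41)) (.const s.toNat))
            (.setNat 1 (reg 40) (reg 41) (.const 2))
            (.setNat 1 (reg 40) (reg 41) (.const 0))).exec m').nat 1 a1 b1 =
            if (a1 : ℕ) = a' ∧ (b1 : ℕ) = b' then if m1.nat 2 a' b' = s.toNat then 2 else 0
            else m'.nat 1 a1 b1 := by
          by_cases hs : m1.nat 2 a' b' = s.toNat
          · rw [Cmd.exec_ite_pos (htest'.2 hs), Cmd.exec_setNat, if_pos hs]
            simp only [NExp.eval, eval_reg, h40, h41, Mem.put_nat, true_and]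
          · rw [Cmd.exec_ite_neg (fun h => hs (htest'.1 h)), Cmd.exec_setNat, if_neg hs]
            simp only [NExp.eval, eval_reg, h40, h41, Mem.put_nat, true_and]
        rw [hset]
        simp only [Fin.val_inj]
        by_cases hab : a1 = a' ∧ b1 = b'
        · obtain ⟨rfl, rfl⟩ := hab
          simp [hc]
        · rw [if_neg hab, h2]
          simp only [hab, false_or]
      · rw [Cmd.exec_ite_neg (fun h => hc (htest.1 h)), Cmd.exec_skip, h2]
        by_cases hab : a1 = a' ∧ b1 = b'
        · obtain ⟨rfl, rfl⟩ := hab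
          rw [if_neg (fun h => hc h.2), if_neg (fun h => hc h.2)]
        · simp only [hab, false_or]

lemma switchComponent_code (s : Bool) (m : Mem F) :
    ((switchComponent s).exec m).nat 3 0 0 = 3 := by
  unfold switchComponent
  rw [Cmd.exec_seq, Cmd.exec_seq, Cmd.exec_setNat]
  exact Mem.put_same _ _ _ _ _

/-- What an update achieves: it is a step of the procedure or its end. -/
def Updated (P : PartMatrix F μ ν) (S : State F μ ν) (m : Mem F) : Prop :=
  (∃ S', Step P S S' ∧ StoresState m S') ∨ ∃ o, Stops P S o ∧ StoresOutcome m o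

/-- If no edge leaves the forest, `dual` carries out one of (D1), (D2-1), (D2-2), (D2-3). -/
lemma dual_spec (hP : StoresMatrix m P) (hS : StoresState m S) (h : SearchInv P k S)
    (hl : ∀ b s a t, ¬ Leaves P S b s a t) : Updated P S (dual.exec m) := by
  unfold dual
  rw [Cmd.exec_seq]
  obtain ⟨hP1, hS1, hε⟩ := stepLength_spec hP hS
  generalize stepLength.exec m = m1 at *
  clear hP hS
  rcases hε with ⟨h53, hε⟩ | ⟨h53, hε⟩
  · rw [Cmd.exec_ite_pos (by simp only [Test.Holds, NExp.eval, eval_reg, h53]), Cmd.exec_setNat]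
    exact Or.inr ⟨.D1, .D1 hl hε, Mem.put_same _ _ _ _ _⟩
  rw [Cmd.exec_ite_neg (by simp only [Test.Holds, NExp.eval, eval_reg, h53]; decide), Cmd.exec_seq]
  have hd : DualStep P S (m1.real 11 0 0) := ⟨hl, hε⟩
  have hS2 := shift_spec hP1 hS1 rfl
  generalize m1.real 11 0 0 = ε at *
  have hP2 : StoresMatrix (shift.exec m1) P := by
    have hf := shift.frame m1
    refine hP1.congr (hf.nat 0 (by decide)) (fun i _ => hf.fld i ?_) (hf.real 0 (by decide))
    simp [shift, each, both, Cmd.fldW]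
  generalize shift.exec m1 = m2 at *
  clear hP1 hS1 h53
  rw [Cmd.exec_seq]
  have hopt := h.1.dual_opt hd
  have hA := analyze_spec hP2 hS2.conf hopt
  have hf := analyze.frame m2
  have hP3 := hP2.frame hf analyze_aux
  have hS3 := hS2.frame hf analyze_aux
  generalize analyze.exec m2 = m3 at *
  clear hP2 hS2 hf
  -- what is known about the memory, which is not affected by the searches
  let G : Mem F → Prop := fun m => StoresMatrix m P ∧
    StoresState m ⟨dualConf S ε, S.nodes, S.edges⟩ ∧ Analyzed P (dualConf S ε) m
  have hG : ∀ {t : Test} {m m' : Mem F}, Frame (probe t) m m' → G m → G m' := by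
    rintro t m m' hf ⟨h1, h2, h3⟩
    exact ⟨h1.frame hf (probe_aux t), h2.frame hf (probe_aux t), h3.frame hf (by
      simp [probe, search, Cmd.natW])⟩
  have hswitch : ∀ {m : Mem F} {s : Bool} {q : Cmd}, G m →
      (∀ m', G m' → (∀ a, ¬ ((∀ b, ¬ Mate (dualConf S ε) a b s) ∧
        Vertex.row a s ∈ source P (dualConf S ε))) → Updated P S (q.exec m')) →
      Updated P S ((attempt (switchTest s) (switchComponent s) q).exec m) := by
    intro m s q hm hq
    refine attempt_spec (φ := fun a : Fin μ => (∀ b, ¬ Mate (dualConf S ε) a b s) ∧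
      Vertex.row a s ∈ source P (dualConf S ε)) (Updated P S) hm.1.rows ?_ ?_ ?_
    · intro m' hf a ha
      obtain ⟨-, -, hA'⟩ := hG hf hm
      simp only [switchTest, Test.Holds, NExp.eval, eval_reg, ha]
      refine and_congr ?_ (hA'.sourceR a s)
      rcases hA'.mateR a s with ⟨h1, h2⟩ | ⟨b, h1, h2⟩
      · simp [h1, h2]
      · simp only [h1, Nat.add_eq_zero_iff, one_ne_zero, and_false, false_iff]
        exact fun hno => hno b h2
    · rintro m' hf a ⟨hu, hsrc⟩ h50
      obtain ⟨h1, h2, h3⟩ := hG hf hm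
      obtain ⟨C, hC, hx⟩ := switchComponent_spec h1 h2.conf h3 hopt hu h50
      exact Or.inr ⟨.D21 _, .D21 ε hd C s (hopt.isRearrangeable hu hsrc hC),
        switchComponent_code s m', hx⟩
    · exact fun m' hf hno => hq m' (hG hf hm) hno
  have hgoal : ∀ {m : Mem F} {s : Bool} {q : Cmd}, G m →
      (∀ C σ, ¬ IsRearrangeable P (dualConf S ε) C σ) →
      (∀ m', G m' → (∀ a, ¬ (Vertex.row a s ∈ S.nodes ∧
        Vertex.row a s ∈ target P (dualConf S ε))) → Updated P S (q.exec m')) →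
      Updated P S ((attempt (goalTest s) (.seq (innerPath s) (finish 4)) q).exec m) := by
    intro m s q hm hr hq
    refine attempt_spec (φ := fun a : Fin μ => Vertex.row a s ∈ S.nodes ∧
        Vertex.row a s ∈ target P (dualConf S ε)) (Updated P S) hm.1.rows ?_ ?_ ?_
    · intro m' hf a ha
      obtain ⟨-, hS', hA'⟩ := hG hf hm
      simp only [goalTest, Test.Holds, NExp.eval, eval_reg, ha]
      exact and_congr (hS'.row_node a s) (hA'.targetR a s)
    · rintro m' hf a ⟨hn, ht⟩ h50
      obtain ⟨h1, h2, h3⟩ := hG hf hm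
      exact Or.inr (output_inner h1 h2.conf h2.edge h3 h hd hr hn ht h50)
    · exact fun m' hf hno => hq m' (hG hf hm) hno
  refine hswitch ⟨hP3, hS3, hA⟩ fun m4 h4 hno1 => hswitch h4 fun m5 h5 hno2 => ?_
  have hr : ∀ C σ, ¬ IsRearrangeable P (dualConf S ε) C σ := by
    rw [hopt.not_rearrangeable_iff']
    rintro a (_ | _) hu hs
    · exact hno2 a ⟨hu, hs⟩
    · exact hno1 a ⟨hu, hs⟩
  refine hgoal h5 hr fun m6 h6 hno3 => hgoal h6 hr fun m7 h7 hno4 => ?_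
  have ht : ¬ target P S.x ⊂ target P (dualConf S ε) := by
    rw [h.1.target_grows_iff hd]
    intro hdis
    obtain ⟨a, _ | _, ha⟩ := h.1.exists_row_target hd (hopt.not_rearrangeable_iff.1 hr) hdis
    · exact hno4 a ha
    · exact hno3 a ha
  exact Or.inl ⟨_, .D23 ε hd hr ht, absorb_spec h7.1 h7.2.1 h7.2.2⟩

end

/-! ### The program of the procedure -/

/-- The edge `b^s a^t` leaves the forest. -/
def leavesTest (a : NExp) (t : Bool) (b : NExp) (s : Bool) : Test :=
  .and (tightTest a t b s) (.and (.natEq (.get 6 b (.const s.toNat)) (.const 1))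
    (.not (.natEq (.get 5 a (.const t.toNat)) (.const 1))))

/-- Store, for each row vertex `a^t` and each sign `s`, a column `b` for which `b^s a^t` leaves the
forest. -/
def tables : Cmd :=
  both fun s => lookup (32 + s.toNat) 40 rows 41 cols fun t => leavesTest (reg 40) t (reg 41) s

/-- Do a primal update with an edge `b^s a^t` if there is one that leaves the forest, and `q`
otherwise. -/
def pursue (s t : Bool) (q : Cmd) : Cmd :=
  attempt (.not (.natEq (.get (32 + s.toNat) (reg 40) (.const t.toNat)) (.const 0))) (primal s t) q

/-- One update of the procedure. -/
def update : Cmd :=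
  .seq analyze (.seq tables
    (pursue true true (pursue true false (pursue false true (pursue false false dual)))))

/-- Make the forest empty. -/
def reset : Cmd :=
  .seq (clear 5 42 rows) (.seq (clear 6 42 cols)
  (.seq (scan fun s t => .setNat (7 + 2 * s.toNat + t.toNat) (reg 40) (reg 41) (.const 0))
    (.setNat 3 (.const 0) (.const 0) (.const 0))))

/-- Start the procedure with the source set as forest. -/
def start : Cmd := .seq reset (.seq analyze absorb)

section

variable {F : Type u} [Field F] {μ ν : ℕ} {P : PartMatrix F μ ν} {k : ℕ} {m : Mem F}
  {S : State F μ ν} {x : Conf F μ ν}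

lemma tables_spec (hP : StoresMatrix m P) (hS : StoresState m S) (s : Bool) :
    Table ((tables.exec m).nat (32 + s.toNat))
      fun (a : Fin μ) t (b : Fin ν) => Leaves P S b s a t := by
  refine exec_both (f := fun s => lookup (32 + s.toNat) 40 rows 41 cols
    fun t => leavesTest (reg 40) t (reg 41) s) (m := m)
    (fun A m' => ∀ s, A s → Table (m'.nat (32 + s.toNat))
      fun (a : Fin μ) t (b : Fin ν) => Leaves P S b s a t) (by simp) ?_ s trivial
  rintro s A m' hA hf hInv s' (rfl | hs')
  · have aux : tables.Aux := by decide
    have hP1 := hP.frame hf aux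
    have hS1 := hS.frame hf aux
    have aux' : (lookup (32 + s'.toNat) 40 rows 41 cols
        fun t => leavesTest (reg 40) t (reg 41) s').Aux := by cases s' <;> decide
    refine lookup_spec (by cases s' <;> decide) (by cases s' <;> decide) (by decide)
      (eval_rows hP1) (fun m2 hf2 => eval_cols (hP1.frame hf2 aux')) ?_
    intro m2 hf2 a t b ha hb
    have hP2 := hP1.frame hf2 aux'
    have hS2 := hS1.frame hf2 aux'
    simp only [leavesTest, Test.Holds,
      tightTest_holds hP2 hS2.conf (a := reg 40) (b := reg 41) ha hb, NExp.eval, eval_reg, ha, hb,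
      hS2.row_node, hS2.col_node]
    rfl
  · have hne := hA s' hs'
    rw [(Cmd.frame _ m').nat (32 + s'.toNat) (by
      revert hne; cases s <;> cases s' <;> decide)]
    exact hInv s' hs'

lemma update_deg : update.deg = some (1, 1) := by rfl

lemma start_deg : start.deg = some (1, 1) := by rfl

lemma StoresMatrix.update (hP : StoresMatrix m P) : StoresMatrix (update.exec m) P := by
  have hf := GPM.update.frame m
  have hw : ∀ i ≤ 3, i ∉ GPM.update.fldW := by decide
  exact hP.congr (hf.nat 0 (Cmd.zero_notMem_natW update_deg))
    (fun i hi => hf.fld i (hw i (by omega))) (hf.real 0 (by decide))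

/-- One execution of the program `update` performs one update of the procedure. In particular, the
procedure never gets stuck. -/
lemma update_spec (hP : StoresMatrix m P) (hS : StoresState m S) (h : SearchInv P k S) :
    Updated P S (update.exec m) := by
  unfold update
  rw [Cmd.exec_seq]
  have hA := analyze_spec hP hS.conf h.1.opt
  have hf := analyze.frame m
  have hP1 := hP.frame hf analyze_aux
  have hS1 := hS.frame hf analyze_aux
  generalize analyze.exec m = m1 at *
  clear hP hS hf
  rw [Cmd.exec_seq]
  have hT := tables_spec hP1 hS1
  have hf := tables.frame m1
  have hP2 := hP1.frame hf (by decide)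
  have hS2 := hS1.frame hf (by decide)
  have hA2 := hA.frame hf (by decide)
  generalize tables.exec m1 = m2 at *
  clear hP1 hS1 hA hf
  let G : Mem F → Prop := fun m => StoresMatrix m P ∧ StoresState m S ∧ Analyzed P S.x m ∧
    ∀ s : Bool, Table (m.nat (32 + s.toNat)) fun (a : Fin μ) t (b : Fin ν) => Leaves P S b s a t
  have hG : ∀ {t : Test} {m m' : Mem F}, Frame (probe t) m m' → G m → G m' := by
    rintro t m m' hf ⟨h1, h2, h3, h4⟩
    refine ⟨h1.frame hf (probe_aux t), h2.frame hf (probe_aux t), h3.frame hf (by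
      simp [probe, search, Cmd.natW]), fun s => ?_⟩
    rw [hf.nat _ (by cases s <;> simp [probe, search, Cmd.natW])]
    exact h4 s
  have key : ∀ {m : Mem F} {s t : Bool} {q : Cmd}, G m →
      (∀ m', G m' → (∀ a b, ¬ Leaves P S b s a t) → Updated P S (q.exec m')) →
      Updated P S ((pursue s t q).exec m) := by
    intro m s t q hm hq
    refine attempt_spec (φ := fun a : Fin μ => ∃ b, Leaves P S b s a t) (Updated P S) hm.1.rows
      ?_ ?_ ?_
    · intro m' hf a ha
      simp only [Test.Holds, NExp.eval, eval_reg, ha]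
      rcases (hG hf hm).2.2.2 s a t with ⟨h1, h2⟩ | ⟨b, h1, h2⟩
      · simp [h1, h2]
      · simp only [h1, Nat.add_eq_zero_iff, one_ne_zero, and_false, not_false_eq_true, true_iff]
        exact ⟨b, h2⟩
    · intro m' hf a ha h50
      obtain ⟨h1, h2, h3, h4⟩ := hG hf hm
      exact primal_spec h1 h2 h3 h h4 ha h50
    · exact fun m' hf hno => hq m' (hG hf hm) fun a b hl => hno a ⟨b, hl⟩
  refine key ⟨hP2, hS2, hA2, hT⟩ fun m3 h3 n1 => key h3 fun m4 h4 n2 => key h4 fun m5 h5 n3 =>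
    key h5 fun m6 h6 n4 => dual_spec h6.1 h6.2.1 h ?_
  rintro b (_ | _) a (_ | _)
  · exact n4 a b
  · exact n3 a b
  · exact n2 a b
  · exact n1 a b

lemma reset_spec (hP : StoresMatrix m P) (hx : StoresConf m x) :
    StoresState (reset.exec m) ⟨x, ∅, ∅⟩ := by
  have hf := reset.frame m
  have hw : ∀ i < 3, i ∉ reset.natW := by decide
  have hx' : StoresConf (reset.exec m) x := hx.congr (fun i hi _ => hf.nat i (hw i hi))
    (fun i _ => hf.fld i (by simp [reset, scan, both, clear, Cmd.fldW]))
    (fun i _ => hf.real i (by simp [reset, scan, both, clear, Cmd.realW]))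
  clear hf hw hx
  unfold reset at hx' ⊢
  rw [Cmd.exec_seq] at hx' ⊢
  have h5 := clear_spec (x := 5) (v := 42) (m := m) (by decide) (eval_rows hP)
  have hf := (clear 5 42 rows).frame m
  have hn : ((clear 5 42 rows).exec m).nat 0 = m.nat 0 := hf.nat 0 (by decide)
  have hr : ((clear 5 42 rows).exec m).nat 0 0 0 = μ := by rw [hn]; exact hP.rows
  have hc : ((clear 5 42 rows).exec m).nat 0 0 1 = ν := by rw [hn]; exact hP.cols
  generalize (clear 5 42 rows).exec m = m1 at *
  clear hf hn hP
  rw [Cmd.exec_seq] at hx' ⊢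
  have h6 := clear_spec (x := 6) (v := 42) (m := m1) (e := cols) (by decide) hc
  have hf := (clear 6 42 cols).frame m1
  rw [← hf.nat 5 (by decide)] at h5
  rw [← hf.nat 0 (by decide)] at hr hc
  generalize (clear 6 42 cols).exec m1 = m2 at *
  clear hf
  rw [Cmd.exec_seq, Cmd.exec_setNat] at hx' ⊢
  let p : Bool → Bool → Cmd := fun s t =>
    .setNat (7 + 2 * s.toNat + t.toNat) (reg 40) (reg 41) (.const 0)
  have hf := (scan p).frame m2
  rw [← hf.nat 5 (by decide)] at h5
  rw [← hf.nat 6 (by decide)] at h6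
  have key := exec_scan (m := m2) (p := p)
    (fun A m' => ∀ (a : Fin μ) (b : Fin ν) (s t : Bool), (a, b, s, t) ∈ A →
      m'.nat (7 + 2 * s.toNat + t.toNat) a b = 0) hr hc (by simp) (by decide) ?_ ?_
  · change StoresConf (((scan p).exec m2).put 3 0 0 0) x at hx'
    change StoresState (((scan p).exec m2).put 3 0 0 0) _
    refine ⟨Mem.put_same _ _ _ _ _, hx', fun a s => ?_, fun b s => ?_, fun a s b t => ?_⟩
    · rw [Mem.put_ne _ (by decide), h5]; simp
    · rw [Mem.put_ne _ (by decide), h6]; simp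
    · rw [Mem.put_ne _ (by omega), key a b s t trivial]; simp
  · intro A m' i y hy hInv a b s t hA
    rw [Mem.put_ne _ (by cases s <;> cases t <;> simp <;> omega)]
    exact hInv a b s t hA
  · intro A m' a b s t hf' h40 h41 hInv a' b' s' t' hA
    rw [Cmd.exec_setNat]
    simp only [NExp.eval, eval_reg, h40, h41, Mem.put_nat]
    split_ifs with hc
    · rfl
    · rcases hA with hA | hA
      · simp only [Prod.mk.injEq] at hA
        obtain ⟨rfl, rfl, rfl, rfl⟩ := hA
        exact absurd ⟨rfl, rfl, rfl⟩ hc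
      · exact hInv a' b' s' t' hA

lemma start_spec (hP : StoresMatrix m P) (hx : StoresConf m x) (h : IsOptimal P k x) :
    StoresMatrix (start.exec m) P ∧ StoresState (start.exec m) (initState P x) := by
  have hf := start.frame m
  have hP1 : ∀ {p : Cmd} {m m' : Mem F}, StoresMatrix m P → Frame p m m' → 0 ∉ p.natW →
      p.fldW = [] → p.realW = [] → StoresMatrix m' P := fun hP hf h1 h2 h3 =>
    hP.congr (hf.nat 0 h1) (fun i _ => hf.fld i (by simp [h2])) (hf.real 0 (by simp [h3]))
  refine ⟨hP1 hP hf (by decide) (by decide) (by decide), ?_⟩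
  unfold start
  rw [Cmd.exec_seq]
  have hS := reset_spec hP hx
  have hP2 := hP1 hP (reset.frame m) (by decide) (by decide) (by decide)
  generalize reset.exec m = m1 at *
  rw [Cmd.exec_seq]
  have hA := analyze_spec hP2 hS.conf h
  have hf := analyze.frame m1
  have := absorb_spec (hP2.frame hf analyze_aux) (hS.frame hf analyze_aux) hA
  rwa [Set.empty_union] at this

/-- The array with the entries `f i j`, extended by `z`. -/
def tabulate {T : Type*} {n l : ℕ} (z : T) (f : Fin n → Fin l → T) (i j : ℕ) : T :=
  if h : i < n ∧ j < l then f ⟨i, h.1⟩ ⟨j, h.2⟩ else z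

lemma tabulate_fin {T : Type*} {n l : ℕ} (z : T) (f : Fin n → Fin l → T) (i : Fin n) (j : Fin l) :
    tabulate z f i j = f i j := by
  simp [tabulate]

lemma tabulate_toNat {T : Type*} {n : ℕ} (z : T) (f : Fin n → Bool → T) (i : Fin n) (s : Bool) :
    tabulate z (fun i (j : Fin 2) => f i (decide (j = 1))) i s.toNat = f i s := by
  cases s <;> simp [tabulate]

lemma exists_stores (P : PartMatrix F μ ν) (S : State F μ ν) :
    ∃ m : Mem F, StoresMatrix m P ∧ StoresState m S := by
  classical
  choose u _ hu using fun a s => (S.x.L.U a s).exists_span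
  choose v _ hv using fun b s => (S.x.L.V b s).exists_span
  refine ⟨⟨fun
    | 0 => fun _ j => if j = 0 then μ else ν
    | 1 => tabulate 0 fun a b => if (a, b) ∈ S.x.I then 2 else if (a, b) ∈ S.x.M then 1 else 0
    | 2 => tabulate 0 fun a b => (S.x.sgn a b).toNat
    | 5 => tabulate 0 fun a (j : Fin 2) => if Vertex.row a (decide (j = 1)) ∈ S.nodes then 1 else 0
    | 6 => tabulate 0 fun b (j : Fin 2) => if Vertex.col b (decide (j = 1)) ∈ S.nodes then 1 else 0
    | 7 => tabulate 0 fun a b => if s(Vertex.row a false, Vertex.col b false) ∈ S.edges then 1 else 0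
    | 8 => tabulate 0 fun a b => if s(Vertex.row a false, Vertex.col b true) ∈ S.edges then 1 else 0
    | 9 => tabulate 0 fun a b => if s(Vertex.row a true, Vertex.col b false) ∈ S.edges then 1 else 0
    | 10 => tabulate 0 fun a b => if s(Vertex.row a true, Vertex.col b true) ∈ S.edges then 1 else 0
    | _ => fun _ _ => 0, fun
    | 0 => tabulate 0 fun a b => P.A a b 0 0
    | 1 => tabulate 0 fun a b => P.A a b 0 1
    | 2 => tabulate 0 fun a b => P.A a b 1 0
    | 3 => tabulate 0 fun a b => P.A a b 1 1
    | 4 => tabulate 0 fun a (j : Fin 2) => u a (decide (j = 1)) 0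
    | 5 => tabulate 0 fun a (j : Fin 2) => u a (decide (j = 1)) 1
    | 6 => tabulate 0 fun b (j : Fin 2) => v b (decide (j = 1)) 0
    | 7 => tabulate 0 fun b (j : Fin 2) => v b (decide (j = 1)) 1
    | _ => fun _ _ => 0, fun
    | 0 => tabulate 0 fun a b => (P.d a b : ℝ)
    | 1 => tabulate 0 fun a (j : Fin 2) => S.x.p.row a (S.x.L.U a (decide (j = 1)))
    | 2 => tabulate 0 fun b (j : Fin 2) => S.x.p.col b (S.x.L.V b (decide (j = 1)))
    | _ => fun _ _ => S.x.c⟩, ⟨rfl, rfl, fun a b => ?_, fun a b =>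
      tabulate_fin 0 (fun a b => (P.d a b : ℝ)) a b⟩,
    ⟨rfl, ⟨fun a b => ?_, fun a b _ =>
      tabulate_fin 0 (fun a b => (S.x.sgn a b).toNat) a b, fun a s => ?_,
      fun b s => ?_, fun a s => tabulate_toNat _ (fun a s => S.x.p.row a (S.x.L.U a s)) a s,
      fun b s => tabulate_toNat _ (fun b s => S.x.p.col b (S.x.L.V b s)) b s, rfl⟩,
      fun a s => ?_, fun b s => ?_, fun a s b t => ?_⟩⟩
  · simp only [tabulate_fin]
    exact Matrix.eta_fin_two _
  · simp only [tabulate_fin]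
  · simp only [tabulate_toNat _ (fun a s => u a s 0), tabulate_toNat _ (fun a s => u a s 1)]
    rw [hu]
    congr 2
    ext i; fin_cases i <;> rfl
  · simp only [tabulate_toNat _ (fun b s => v b s 0), tabulate_toNat _ (fun b s => v b s 1)]
    rw [hv]
    congr 2
    ext i; fin_cases i <;> rfl
  · simp only [tabulate_toNat _ (fun a s => if Vertex.row a s ∈ S.nodes then 1 else 0)]
    simp
  · simp only [tabulate_toNat _ (fun b s => if Vertex.col b s ∈ S.nodes then 1 else 0)]
    simp
  · cases s <;> cases t <;> simp [tabulate_fin]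

/-! ### Executions of the program -/

lemma memAfter_matrix (hP : StoresMatrix m P) (hx : StoresConf m x) (h : IsOptimal P k x) :
    ∀ i, StoresMatrix (memAfter start update m i) P
  | 0 => (start_spec hP hx h).1
  | i + 1 => (memAfter_matrix hP hx h i).update

lemma Run.of_seq {S₀ : State F μ ν} {S : ℕ → State F μ ν} {n : ℕ} (h0 : S 0 = S₀)
    (h : ∀ i < n, Step P (S i) (S (i + 1))) : Run P S₀ n (S n) := by
  induction n with
  | zero => rw [h0]; exact .zero
  | succ n ih => exact .succ n _ _ (ih fun i hi => h i (by omega)) (h n (by omega))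

/-- The program either goes on or has carried out a complete execution of the procedure. -/
lemma execution (hP : StoresMatrix m P) (hx : StoresConf m x) (h : IsInput P k x) (l : ℕ) :
    (∃ S : ℕ → State F μ ν, S 0 = initState P x ∧ (∀ i < l, Step P (S i) (S (i + 1))) ∧
      ∀ i ≤ l, StoresState (memAfter start update m i) (S i)) ∨
    ∃ n ≤ 5 * min μ ν, CarriesOut start update P x m (timeAfter start update m (n + 1)) := by
  induction l with
  | zero =>
    refine Or.inl ⟨fun _ => initState P x, rfl, by simp, ?_⟩
    rintro i hi
    obtain rfl := Nat.le_zero.1 hi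
    exact (start_spec hP hx h.optimal).2
  | succ l ih =>
    rcases ih with ⟨S, h0, hS, hm⟩ | ih
    · have hr := Run.of_seq h0 hS
      rcases update_spec (memAfter_matrix hP hx h.optimal l) (hm l le_rfl)
        ((SearchInv.init h).run hr) with ⟨S', hs, hm'⟩ | ⟨o, ho, hm'⟩
      · refine Or.inl ⟨fun i => if i ≤ l then S i else S', by simpa using h0, fun i hi => ?_,
          fun i hi => ?_⟩
        · rcases Nat.lt_succ_iff_lt_or_eq.1 hi with hi | rfl
          · simpa [hi.le, Nat.succ_le_of_lt hi] using hS i hi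
          · simpa using hs
        · rcases Nat.le_succ_iff.1 hi with hi | rfl
          · simpa [hi] using hm i hi
          · simp only [if_neg (Nat.not_succ_le_self l)]
            exact hm'
      · exact Or.inr ⟨l, h.run_le hr, l, S, o, h0, hS, ho, hm, hm', rfl⟩
    · exact Or.inr ih

lemma carriesOut (hP : StoresMatrix m P) (hx : StoresConf m x) (h : IsInput P k x) :
    ∃ n ≤ 5 * min μ ν, CarriesOut start update P x m (timeAfter start update m (n + 1)) := by
  rcases execution hP hx h (5 * min μ ν + 1) with ⟨S, h0, hS, -⟩ | h1
  · have := h.run_le (Run.of_seq h0 hS)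
    omega
  · exact h1

lemma timeAfter_le (hP : StoresMatrix m P) (hx : StoresConf m x) (h : IsOptimal P k x) {B C : ℕ}
    (hB : (start.run m).2 ≤ B)
    (hC : ∀ m' : Mem F, StoresMatrix m' P → (update.run m').2 + 1 ≤ C) (n : ℕ) :
    timeAfter start update m n ≤ B + n * C := by
  induction n with
  | zero => simpa [timeAfter] using hB
  | succ n ih =>
    have := hC _ (memAfter_matrix hP hx h n)
    rw [timeAfter, Nat.succ_mul]
    omega

end

end GPM

theorem theorem3p3 :
    ∃ (init upd : Cmd) (K : ℕ), ∀ (F : Type u) [Field F] (μ ν : ℕ) (P : PartMatrix F μ ν) (k : ℕ)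
      (x₀ : Conf F μ ν), IsInput P k x₀ →
      -- stopping at (P1) or (D2-2)
      (∀ x R, Outputs P x₀ (.P1 x R) ∨ Outputs P x₀ (.D22 x R) →
        IsOptimal P k x ∧ IsAugmentingPath P x R) ∧
      -- stopping at (D1)
      (Outputs P x₀ .D1 → P.delta (k + 1) = ⊥) ∧
      -- stopping at (D2-1)
      (∀ x, Outputs P x₀ (.D21 x) → IsOptimal P (k + 1) x) ∧
      -- whatever choices are made, the procedure never gets stuck and stops after few updates
      (∀ n S, Run P (initState P x₀) n S →
        n ≤ K * min μ ν ∧ ((∃ S', Step P S S') ∨ ∃ o, Stops P S o)) ∧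
      -- the running time
      (∀ m : Mem F, StoresMatrix m P → StoresConf m x₀ →
        ∃ t, CarriesOut init upd P x₀ m t ∧ t ≤ K * (μ * ν * min μ ν)) := by
  obtain ⟨B, hB⟩ := Cmd.run_le.{u} start_deg
  obtain ⟨C, hC⟩ := Cmd.run_le.{u} update_deg
  refine ⟨start, update, 5 + B + 6 * (C + 1), fun F _ μ ν P k x₀ h => ⟨?_, ?_, ?_, ?_, ?_⟩⟩
  · rintro x R (⟨n, S, hr, hs⟩ | ⟨n, S, hr, hs⟩)
    · exact ((SearchInv.init h).run hr).output_P1 hs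
    · exact ((SearchInv.init h).run hr).output_D22 hs
  · rintro ⟨n, S, hr, hs⟩
    cases hs with
    | D1 _ hinf => exact ((SearchInv.init h).run hr).1.delta_eq_bot hinf
  · rintro x ⟨n, S, hr, hs⟩
    exact ((SearchInv.init h).run hr).output_D21 hs
  · intro n S hr
    refine ⟨(h.run_le hr).trans (Nat.mul_le_mul_right _ (by omega)), ?_⟩
    obtain ⟨m, hP, hS⟩ := exists_stores P S
    exact (update_spec hP hS ((SearchInv.init h).run hr)).imp (fun ⟨S', h1, _⟩ => ⟨S', h1⟩)
      fun ⟨o, h1, _⟩ => ⟨o, h1⟩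
  · intro m hP hx
    obtain ⟨n, hn, hcar⟩ := carriesOut hP hx h
    refine ⟨_, hcar, ?_⟩
    have hk := h.size_lt
    have hmin : 1 ≤ min μ ν := by omega
    have hμν : 1 ≤ μ * ν := Nat.mul_pos (by omega) (by omega)
    have hcost : ∀ {D : ℕ} {p : Cmd}, (∀ (F : Type u) [Field F] (m : Mem F), 1 ≤ m.nat 0 0 0 →
        1 ≤ m.nat 0 0 1 → (p.run m).2 ≤ D * (m.nat 0 0 0 ^ 1 * m.nat 0 0 1 ^ 1)) →
        ∀ m' : Mem F, StoresMatrix m' P → (p.run m').2 ≤ D * (μ * ν) := by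
      intro D p hD m' hm'
      have := hD F m' (by rw [hm'.rows]; omega) (by rw [hm'.cols]; omega)
      rwa [hm'.rows, hm'.cols, pow_one, pow_one] at this
    refine (timeAfter_le hP hx h.optimal (hcost hB m hP) (C := (C + 1) * (μ * ν))
      (fun m' hm' => ?_) (n + 1)).trans ?_
    · have := hcost hC m' hm'
      rw [add_mul, one_mul]
      omega
    · calc B * (μ * ν) + (n + 1) * ((C + 1) * (μ * ν))
          ≤ B * (μ * ν * min μ ν) + (6 * min μ ν) * ((C + 1) * (μ * ν)) := by
            refine Nat.add_le_add (Nat.mul_le_mul_left _ (Nat.le_mul_of_pos_right _ hmin))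
              (Nat.mul_le_mul_right _ (by omega))
        _ = (B + 6 * (C + 1)) * (μ * ν * min μ ν) := by ring
        _ ≤ (5 + B + 6 * (C + 1)) * (μ * ν * min μ ν) := Nat.mul_le_mul_right _ (by omega)
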